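/- Let $M=\mathbb{A}^1(\mathbb{C})\setminus\{0,1\}$ and let $f_1:\mathcal{E}\to M$ be the Legendre family of elliptic curves, $\mathcal{E}_\lambda=V(y^2z=x(x-z)(x-\lambda z))\subset\mathbb{P}^2$. Let $\mathcal{H}^1=R^1(f_1)_*\mathbb{Q}$ with its Hodge filtration ($F^1=H^{1,0}(\mathcal{E}_\lambda)=\mathbb{C}\cdot[dx/y]$), and let $$\mathcal{V}=\mathrm{Sym}^3(\mathcal{H}^1)\subset(\mathcal{H}^1)^{\otimes 3}$$ be the local system of symmetric tensors with the filtration induced from $(\mathcal{H}^1)^{\otimes 3}$. (Under the identification $H^3=(H^1(\mathcal{E}_\lambda))^{\otimes3}$ for the Calabi-Yau threefold that C. Borcea's construction attaches to $\mathcal{E}_\lambda,\mathcal{E}_\lambda,\mathcal{E}_\lambda$, this is the sub-variation of the $H^3$ of Borcea's family over the diagonal whose underlying local system is $\mathrm{Sym}^3(\mathcal{H}^1)$.) **Definitions.** The Hodge group of a rational Hodge structure $(V,h)$ of weight $k$ is the smallest $\mathbb{Q}$-algebraic subgroup $G\subset\mathrm{GL}(V)$ with $h(S^1)\subset G_{\mathbb{R}}$,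 where $h(z)=z^p\bar z^q$ on $H^{p,q}$. The generic Hodge group of a variation of Hodge structures (VHS), as a subgroup of the general linear group of the fibre at a base point, is the maximum of the Hodge groups of all fibres, compared by parallel transport along paths. A VHS $\mathcal{W}$ with $h^{3,0}=h^{2,1}=h^{1,2}=h^{0,3}=1$ is Calabi-Yau like if it is a polarizable rational VHS of weight 3 such that $F^2$ is generated by the sections of $F^3$ and their derivatives and $F^1=(F^3)^\perp$. It is of third type if moreover the centre of its generic Hodge group $G$ is discrete and the associated Hermitian symmetric domain $G^{\mathrm{ad}}(\mathbb{R})^+/K^{\mathrm{ad}}$ ($K$ maximal compact in $G(\mathbb R)$) is the unit disc $\mathbb{B}_1$ (with $G^{\mathrm{ad}}(\mathbb{R})^+$ acting faithfully and transitively by holomorphic automorphisms). **Proposition.** The variation $\mathcal{V}$ is of third type: it is a Calabi-Yau like VHS with Hodge numbers $1,1,1,1$, its generic Hodge group $\mathrm{Hg}(\mathcal{V})$ exists at every base point and has discrete centre, and the associated Hermitian symmetric domain is $\mathbb{B}_1$. Consequently $\mathrm{Hg}(\mathcal{V})_{\mathbb{R}}$ is some $G_x$: for every polarization $Q$ of $\mathcal{V}$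 and every $\lambda\in M$ there are bases $(v_{3,0},v_{2,1},v_{1,2},v_{0,3})$ of $\mathcal{V}_{\lambda,\mathbb{C}}$ with $v_{p,q}\in H^{p,q}$, $\overline{v_{p,q}}=v_{q,p}$ and $Q(iv_{3,0},v_{0,3})=Q(-iv_{2,1},v_{1,2})=1$, and for each such basis there is $x\in\mathbb{C}$ with $|x|=\frac{2}{\sqrt3}$ such that $\mathrm{Hg}(\mathcal{V})_{\mathbb{R}}=G_x$. Here $G_x$ is the smallest $\mathbb{R}$-algebraic subgroup of $\mathrm{GL}(\mathcal V_{\lambda,\mathbb R})$ containing the exponentials of the elements of $$\mathfrak{g}_x=\mathrm{Span}_{\mathbb{R}}\left(\begin{pmatrix}3i&0&0&0\\0&i&0&0\\0&0&-i&0\\0&0&0&-3i\end{pmatrix},\begin{pmatrix}0&1&0&0\\1&0&x&0\\0&\bar x&0&1\\0&0&1&0\end{pmatrix},\begin{pmatrix}0&i&0&0\\-i&0&ix&0\\0&-i\bar x&0&i\\0&0&-i&0\end{pmatrix}\right)$$ (matrices with respect to that basis), and $\mathrm{Lie}(\mathrm{Hg}(\mathcal{V})_{\mathbb{R}})=\mathfrak{g}_x$.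 -/

import Mathlib

open scoped TensorProduct LinearAlgebra.Projectivization Topology

noncomputable section

/-! ### Complexified rational vector spaces and their automorphisms -/

/-- Complex conjugation on `ℂ ⊗ V` with respect to the real structure `ℝ ⊗ V`. -/
def complexConj (V : Type) [AddCommGroup V] [Module ℚ V] : (ℂ ⊗[ℚ] V) →ₗ[ℚ] (ℂ ⊗[ℚ] V) :=
  LinearMap.rTensor V (Complex.conjAe.toLinearMap.restrictScalars ℚ)

theorem complexConj_smul {V : Type} [AddCommGroup V] [Module ℚ V] (c : ℂ) (x : ℂ ⊗[ℚ] V) :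
    complexConj V (c • x) = (starRingEnd ℂ) c • complexConj V x := by
  induction x with
  | zero => simp
  | tmul z v => simp [complexConj, TensorProduct.smul_tmul']
  | add x y hx hy => simp only [smul_add, map_add, hx, hy]

/-- The complex conjugate of a complex subspace of `ℂ ⊗ V`. -/
def conjSubmodule {V : Type} [AddCommGroup V] [Module ℚ V] (S : Submodule ℂ (ℂ ⊗[ℚ] V)) :
    Submodule ℂ (ℂ ⊗[ℚ] V) where
  carrier := {x | complexConj V x ∈ S}
  add_mem' := by
    intro x y hx hy
    change complexConj V (x + y) ∈ S
    rw [map_add]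
    exact S.add_mem hx hy
  zero_mem' := by simp
  smul_mem' := by
    intro c x hx
    change complexConj V (c • x) ∈ S
    rw [complexConj_smul]
    exact S.smul_mem _ hx

/-- The group `GL(V)(ℂ)`. -/
abbrev GLC (V : Type) [AddCommGroup V] [Module ℚ V] : Type :=
  (ℂ ⊗[ℚ] V) ≃ₗ[ℂ] (ℂ ⊗[ℚ] V)

/-- The matrix coefficient `φ(g v)` of `g ∈ GL(V)(ℂ)`, for a rational vector `v` and a rational
linear form `φ`. -/
def matrixCoeff {V : Type} [AddCommGroup V] [Module ℚ V] (g : GLC V)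
    (i : V × Module.Dual ℚ V) : ℂ :=
  LinearMap.liftBaseChange ℂ ((Algebra.linearMap ℚ ℂ).comp i.2) (g ((1 : ℂ) ⊗ₜ[ℚ] i.1))

/-- The classical topology of `GL(V)(ℂ)` (`V` of finite dimension): the coarsest one for which all
matrix coefficients are continuous. -/
instance instTopologicalSpaceGLC (V : Type) [AddCommGroup V] [Module ℚ V] :
    TopologicalSpace (GLC V) :=
  TopologicalSpace.induced (fun g => matrixCoeff g) inferInstance

/-- `H` is (the group of complex points of) an algebraic subgroup of `GL(V)` defined over the
subfield `k` of `ℂ`: it is cut out in `GL(V)(ℂ)` by polynomials with coefficients in `k` in the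
matrix coefficients. -/
def IsAlgebraicSubgroup {V : Type} [AddCommGroup V] [Module ℚ V] (k : Type) [Field k] [Algebra k ℂ]
    (H : Subgroup (GLC V)) : Prop :=
  ∃ S : Set (MvPolynomial (V × Module.Dual ℚ V) k),
    ∀ g : GLC V, g ∈ H ↔ ∀ P ∈ S, MvPolynomial.aeval (matrixCoeff g) P = 0

/-- The group `G(ℝ)` of real points: the elements of `G(ℂ)` that commute with conjugation. -/
def realPoints {V : Type} [AddCommGroup V] [Module ℚ V] (G : Subgroup (GLC V)) :
    Subgroup (GLC V) where
  carrier := {g | g ∈ G ∧ ∀ x, g (complexConj V x) = complexConj V (g x)}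
  mul_mem' := by
    rintro a b ⟨ha, ha'⟩ ⟨hb, hb'⟩
    exact ⟨G.mul_mem ha hb, fun x => by simp [LinearEquiv.mul_apply, ha', hb']⟩
  one_mem' := ⟨G.one_mem, fun x => rfl⟩
  inv_mem' := by
    rintro a ⟨ha, ha'⟩
    refine ⟨G.inv_mem ha, fun x => ?_⟩
    have h : a (complexConj V (a⁻¹ x)) = complexConj V x := by
      rw [ha']
      congr 1
      exact a.apply_symm_apply x
    rw [← h]
    exact a.symm_apply_apply _

/-- The identity component `G(ℝ)⁺` of the Lie group `G(ℝ)`. -/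
def realIdentityComponent {V : Type} [AddCommGroup V] [Module ℚ V] (G : Subgroup (GLC V)) :
    Set (GLC V) :=
  connectedComponentIn (realPoints G : Set (GLC V)) 1

/-- The centre of `G`, as a subset of `GL(V)(ℂ)`. -/
def centerSet {V : Type} [AddCommGroup V] [Module ℚ V] (G : Subgroup (GLC V)) : Set (GLC V) :=
  {g | g ∈ G ∧ ∀ h ∈ G, g * h = h * g}

/-- `K` is a maximal compact subgroup of `G(ℝ)`. -/
def IsMaximalCompact {V : Type} [AddCommGroup V] [Module ℚ V] (G K : Subgroup (GLC V)) : Prop :=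
  K ≤ realPoints G ∧ IsCompact (K : Set (GLC V)) ∧
    ∀ K' : Subgroup (GLC V), K' ≤ realPoints G → IsCompact (K' : Set (GLC V)) → K ≤ K' → K' = K

/-- The Hermitian symmetric domain `G^ad(ℝ)⁺ / K^ad` associated with `G` is the unit disc `𝔹₁`.
Spelled out: `G(ℝ)⁺` acts by holomorphic automorphisms on the open unit disc, the elements acting
trivially are exactly those that are central in `G` (so that the acting group is the adjoint group
`G^ad(ℝ)⁺`), the stabiliser of the origin is `K ∩ G(ℝ)⁺` for a maximal compact subgroup `K` of
`G(ℝ)`, and the orbit map of the origin is surjective, continuous and open, i.e. it induces a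
homeomorphism of `G(ℝ)⁺ / (K ∩ G(ℝ)⁺) = G^ad(ℝ)⁺ / K^ad` with the disc. -/
def HasDomainUnitDisc {V : Type} [AddCommGroup V] [Module ℚ V] (G : Subgroup (GLC V)) : Prop :=
  ∃ K : Subgroup (GLC V), IsMaximalCompact G K ∧
  ∃ ρ : GLC V → ℂ → ℂ,
    (∀ g ∈ realIdentityComponent G,
      Set.MapsTo (ρ g) (Metric.ball 0 1) (Metric.ball 0 1) ∧
      DifferentiableOn ℂ (ρ g) (Metric.ball 0 1)) ∧
    Set.EqOn (ρ 1) id (Metric.ball 0 1) ∧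
    (∀ g ∈ realIdentityComponent G, ∀ h ∈ realIdentityComponent G,
      Set.EqOn (ρ (g * h)) (ρ g ∘ ρ h) (Metric.ball 0 1)) ∧
    (∀ g ∈ realIdentityComponent G, Set.EqOn (ρ g) id (Metric.ball 0 1) ↔ g ∈ centerSet G) ∧
    (∀ g ∈ realIdentityComponent G, ρ g 0 = 0 ↔ g ∈ K) ∧
    (∀ w ∈ Metric.ball (0 : ℂ) 1, ∃ g ∈ realIdentityComponent G, ρ g 0 = w) ∧
    ContinuousOn (fun g => ρ g 0) (realIdentityComponent G) ∧
    (∀ O : Set (GLC V), IsOpen O → IsOpen ((fun g => ρ g 0) '' (O ∩ realIdentityComponent G)))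

/-! ### Hodge structures and Hodge groups -/

/-- The component `H^{p,n-p} = F^p ∩ conj F^{n-p}` of a Hodge structure of weight `n`. -/
def hodgePiece {V : Type} [AddCommGroup V] [Module ℚ V] (n : ℕ)
    (F : ℤ → Submodule ℂ (ℂ ⊗[ℚ] V)) (p : ℤ) : Submodule ℂ (ℂ ⊗[ℚ] V) :=
  F p ⊓ conjSubmodule (F (n - p))

/-- `F` is the Hodge filtration of a rational Hodge structure of weight `n` on `V`. -/
structure IsHodgeStructure {V : Type} [AddCommGroup V] [Module ℚ V] (n : ℕ)
    (F : ℤ → Submodule ℂ (ℂ ⊗[ℚ] V)) : Prop where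
  finite : Module.Finite ℚ V
  antitone : Antitone F
  exists_top : ∃ p, F p = ⊤
  exists_bot : ∃ p, F p = ⊥
  isCompl : ∀ p : ℤ, IsCompl (F p) (conjSubmodule (F (n + 1 - p)))

/-- `g = h(z)` for the representation `h` of the circle group that describes the Hodge structure:
`h(z)` is multiplication by `z^p (conj z)^q = z^(p-q)` on `H^{p,q}`, `p + q = n`. -/
def IsCircleAction {V : Type} [AddCommGroup V] [Module ℚ V] (n : ℕ)
    (F : ℤ → Submodule ℂ (ℂ ⊗[ℚ] V)) (z : Circle) (g : GLC V) : Prop :=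
  ∀ p : ℤ, ∀ x ∈ hodgePiece n F p, g x = (z : ℂ) ^ (p - (n - p)) • x

/-- The Hodge group: the smallest algebraic subgroup of `GL(V)` over `ℚ` that contains `h(z)` for
all `z` in the circle group. -/
def hodgeGroup {V : Type} [AddCommGroup V] [Module ℚ V] (n : ℕ)
    (F : ℤ → Submodule ℂ (ℂ ⊗[ℚ] V)) : Subgroup (GLC V) :=
  sInf {H | IsAlgebraicSubgroup ℚ H ∧ ∀ (z : Circle) (g : GLC V), IsCircleAction n F z g → g ∈ H}

/-! ### Variations of Hodge structures over a plane domain -/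

/-- The data of a variation of rational Hodge structures over `M ⊆ ℂ`: the stalks of the rational
local system, its flat sections over subsets of `M`, and the Hodge filtration at each point.
The conditions on these data are in `IsVHS`. -/
structure VHSData (M : Set ℂ) where
  weight : ℕ
  Fiber : M → Type
  [addCommGroup : ∀ m, AddCommGroup (Fiber m)]
  [module : ∀ m, Module ℚ (Fiber m)]
  IsFlat : Set M → (∀ m, Fiber m) → Prop
  F : ∀ m, ℤ → Submodule ℂ (ℂ ⊗[ℚ] Fiber m)

attribute [instance] VHSData.addCommGroup VHSData.module

namespace VHSData

variable {M : Set ℂ}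

/-- The flat sections form a local system: near each point there is a frame such that the flat
sections are exactly those whose coordinates in this frame are locally constant. -/
def IsLocalSystem (W : VHSData M) : Prop :=
  ∀ m₀ : M, ∃ U : Set M, IsOpen U ∧ m₀ ∈ U ∧
    ∃ (r : ℕ) (e : ∀ m : M, m ∈ U → Module.Basis (Fin r) ℚ (W.Fiber m)),
      ∀ U' : Set M, IsOpen U' → U' ⊆ U → ∀ s : (∀ m, W.Fiber m),
        W.IsFlat U' s ↔
          ∀ m (hm : m ∈ U), m ∈ U' → ∀ᶠ m' in 𝓝 m, ∀ hm' : m' ∈ U,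
            (e m' hm').repr (s m') = (e m hm).repr (s m)

/-- `s` is a holomorphic section over `U` of `W ⊗ 𝓞`, and `s'` is its covariant derivative
`∇_{∂/∂λ} s` for the Gauss-Manin connection, `λ` being the coordinate of `M ⊆ ℂ`. -/
def HasCovariantDeriv (W : VHSData M) (U : Set M) (s s' : ∀ m, ℂ ⊗[ℚ] W.Fiber m) : Prop :=
  ∀ m₀ ∈ U, ∃ U' : Set M, IsOpen U' ∧ m₀ ∈ U' ∧
    ∃ (k : ℕ) (f : Fin k → ℂ → ℂ) (a : Fin k → ∀ m, W.Fiber m),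
      (∀ i, W.IsFlat U' (a i)) ∧
      ∀ m ∈ U', (∀ i, DifferentiableAt ℂ (f i) (m : ℂ)) ∧
        s m = ∑ i, f i (m : ℂ) ⊗ₜ[ℚ] a i m ∧
        s' m = ∑ i, deriv (f i) (m : ℂ) ⊗ₜ[ℚ] a i m

/-- The axioms of a variation of Hodge structures: a local system, with Hodge structures on its
stalks whose filtrations are holomorphic subbundles satisfying Griffiths transversality. -/
structure IsVHS (W : VHSData M) : Prop where
  isLocalSystem : W.IsLocalSystem
  isHodgeStructure : ∀ m, IsHodgeStructure W.weight (W.F m)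
  holomorphic : ∀ (p : ℤ) (m₀ : M), ∃ U : Set M, IsOpen U ∧ m₀ ∈ U ∧
    ∃ (k : ℕ) (s s' : Fin k → ∀ m, ℂ ⊗[ℚ] W.Fiber m),
      (∀ i, W.HasCovariantDeriv U (s i) (s' i)) ∧
      ∀ m ∈ U, LinearIndependent ℂ (fun i => s i m) ∧
        Submodule.span ℂ (Set.range (fun i => s i m)) = W.F m p
  transversal : ∀ (p : ℤ) (U : Set M) (s s' : ∀ m, ℂ ⊗[ℚ] W.Fiber m), IsOpen U →
    W.HasCovariantDeriv U s s' → (∀ m ∈ U, s m ∈ W.F m p) → ∀ m ∈ U, s' m ∈ W.F m (p - 1)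

/-- `Q` is a polarization of `W`: a flat rational bilinear form, symmetric or alternating according
to the parity of the weight, that satisfies the Hodge-Riemann bilinear relations. -/
structure IsPolarization (W : VHSData M) (Q : ∀ m, LinearMap.BilinForm ℚ (W.Fiber m)) : Prop where
  flat : ∀ (U : Set M) (a b : ∀ m, W.Fiber m), IsOpen U → W.IsFlat U a → W.IsFlat U b →
    ∀ m ∈ U, ∀ᶠ m' in 𝓝 m, Q m' (a m') (b m') = Q m (a m) (b m)
  parity : ∀ m x y, Q m x y = (-1) ^ W.weight * Q m y x
  orthogonal : ∀ m (p : ℤ), ∀ x ∈ W.F m p, ∀ y ∈ W.F m (W.weight + 1 - p),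
    (Q m).baseChange ℂ x y = 0
  positive : ∀ m (p : ℤ), ∀ x ∈ hodgePiece W.weight (W.F m) p, x ≠ 0 →
    ∃ r : ℝ, 0 < r ∧
      (-1) ^ (W.weight * (W.weight - 1) / 2) * Complex.I ^ (p - (W.weight - p)) *
        (Q m).baseChange ℂ x (complexConj _ x) = (r : ℂ)

/-- `T` is the parallel transport `W_{m₀} → W_{m₁}` along the path `γ`. -/
def IsTransport (W : VHSData M) {m₀ m₁ : M} (γ : Path m₀ m₁)
    (T : W.Fiber m₀ ≃ₗ[ℚ] W.Fiber m₁) : Prop :=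
  ∀ v, ∃ s : unitInterval → Σ m, W.Fiber m, s 0 = ⟨m₀, v⟩ ∧ s 1 = ⟨m₁, T v⟩ ∧
    ∀ t₀ : unitInterval, ∃ (U : Set M) (a : ∀ m, W.Fiber m), IsOpen U ∧ γ t₀ ∈ U ∧ W.IsFlat U a ∧
      ∀ᶠ t in 𝓝 t₀, s t = ⟨γ t, a (γ t)⟩

/-- `G ⊆ GL(W_{m₀})` is the generic Hodge group of `W`: the maximum of the Hodge groups of all
the Hodge structures `W_m`, regarded as subgroups of `GL(W_{m₀})` by parallel transport. -/
def IsGenericHodgeGroup (W : VHSData M) (m₀ : M) (G : Subgroup (GLC (W.Fiber m₀))) : Prop :=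
  (∀ (m : M) (γ : Path m₀ m) (T : W.Fiber m₀ ≃ₗ[ℚ] W.Fiber m), W.IsTransport γ T →
    ∀ g ∈ hodgeGroup W.weight (W.F m),
      ((T.baseChange ℚ ℂ _ _).trans g).trans (T.baseChange ℚ ℂ _ _).symm ∈ G) ∧
  ∃ (m : M) (γ : Path m₀ m) (T : W.Fiber m₀ ≃ₗ[ℚ] W.Fiber m), W.IsTransport γ T ∧
    ∀ g, g ∈ hodgeGroup W.weight (W.F m) ↔
      ((T.baseChange ℚ ℂ _ _).trans g).trans (T.baseChange ℚ ℂ _ _).symm ∈ G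

/-- A Calabi-Yau like variation of Hodge structures: a polarized rational variation of Hodge
structures of weight 3 and type `(3,0), (2,1), (1,2), (0,3)` such that `F²` is generated by the
sections of `F³` and their derivatives, and `F¹` is the orthogonal complement of `F³`. -/
def IsCalabiYauLike (W : VHSData M) : Prop :=
  W.weight = 3 ∧ W.IsVHS ∧ (∀ m, W.F m 0 = ⊤ ∧ W.F m 4 = ⊥) ∧
  (∀ m, W.F m 2 = Submodule.span ℂ {x | ∃ (U : Set M) (s s' : ∀ m, ℂ ⊗[ℚ] W.Fiber m),
    IsOpen U ∧ m ∈ U ∧ W.HasCovariantDeriv U s s' ∧ (∀ m' ∈ U, s m' ∈ W.F m' 3) ∧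
      (x = s m ∨ x = s' m)}) ∧
  ∃ Q : ∀ m, LinearMap.BilinForm ℚ (W.Fiber m), W.IsPolarization Q ∧
    ∀ m x, x ∈ W.F m 1 ↔ ∀ y ∈ W.F m 3, (Q m).baseChange ℂ y x = 0

/-- `W` is of third type: it is Calabi-Yau like with Hodge numbers `1, 1, 1, 1`, the centre of its
generic Hodge group is discrete, and the associated Hermitian symmetric domain is `𝔹₁`. -/
def IsThirdType (W : VHSData M) : Prop :=
  W.IsCalabiYauLike ∧
  (∀ m, ∀ p ∈ Finset.Icc (0 : ℤ) 3, Module.finrank ℂ (hodgePiece 3 (W.F m) p) = 1) ∧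
  ∀ m₀, ∃ G : Subgroup (GLC (W.Fiber m₀)), W.IsGenericHodgeGroup m₀ G ∧
    DiscreteTopology (centerSet G) ∧ HasDomainUnitDisc G

/-- The tensor power over `ℂ` of the complexification, as a target for the complexification of the
rational tensor power. -/
def tensorPowerComparison (n : ℕ) (V : Type) [AddCommGroup V] [Module ℚ V] :
    (ℂ ⊗[ℚ] (⨂[ℚ]^n V)) →ₗ[ℂ] (⨂[ℂ]^n (ℂ ⊗[ℚ] V)) :=
  LinearMap.liftBaseChange ℂ (PiTensorProduct.lift
    (((PiTensorProduct.tprod ℂ (s := fun _ : Fin n => ℂ ⊗[ℚ] V)).restrictScalars ℚ).compLinearMap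
      (fun _ => TensorProduct.mk ℚ ℂ V 1)))

/-- The symmetric tensors `Sym^n V ⊆ V^{⊗n}`. -/
def symTensors (n : ℕ) (V : Type) [AddCommGroup V] [Module ℚ V] : Submodule ℚ (⨂[ℚ]^n V) where
  carrier := {t | ∀ σ : Equiv.Perm (Fin n), PiTensorProduct.reindex ℚ (fun _ => V) σ t = t}
  add_mem' := by
    intro a b ha hb σ
    exact (map_add _ a b).trans (congrArg₂ (· + ·) (ha σ) (hb σ))
  zero_mem' := fun σ => map_zero _
  smul_mem' := by
    intro c a ha σ
    exact (map_smul _ c a).trans (congrArg (c • ·) (ha σ))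

/-- The `n`-th symmetric power of `W`, as a subobject of the tensor power `W^{⊗n}`. Flat sections
are those which, as sections of `W^{⊗n}`, are locally finite sums of tensors of flat sections, and
`F^p(Sym^n W)` is the intersection of `Sym^n W` with the filtration of the tensor power,
`F^p(W^{⊗n}) = ∑_{p₁+⋯+pₙ ≥ p} F^{p₁} ⊗ ⋯ ⊗ F^{pₙ}`. -/
def symPower (n : ℕ) (W : VHSData M) : VHSData M where
  weight := n * W.weight
  Fiber m := symTensors n (W.Fiber m)
  IsFlat U s := ∀ m₀ ∈ U, ∃ U' : Set M, IsOpen U' ∧ m₀ ∈ U' ∧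
    ∃ (k : ℕ) (a : Fin k → Fin n → ∀ m, W.Fiber m),
      (∀ i j, W.IsFlat U' (a i j)) ∧
      ∀ m ∈ U', (s m : ⨂[ℚ]^n (W.Fiber m)) =
        ∑ i, PiTensorProduct.tprod ℚ (fun j => a i j m)
  F m p := Submodule.comap
    (tensorPowerComparison n (W.Fiber m) ∘ₗ
      (symTensors n (W.Fiber m)).subtype.baseChange ℂ)
    (Submodule.span ℂ {t | ∃ (q : Fin n → ℤ) (u : Fin n → ℂ ⊗[ℚ] W.Fiber m),
      p ≤ ∑ j, q j ∧ (∀ j, u j ∈ W.F m (q j)) ∧ t = PiTensorProduct.tprod ℂ u})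

end VHSData

/-! ### First cohomology -/

/-- A 1-cocycle on the space `X` with values in `A`: a homotopy invariant function on paths that is
additive for concatenation, i.e. a functor from the fundamental groupoid of `X` to `A`. -/
structure PathCocycle (X : Type) [TopologicalSpace X] (A : Type) [AddCommGroup A] where
  toFun : ∀ {x y : X}, Path x y → A
  map_trans : ∀ {x y z : X} (p : Path x y) (q : Path y z), toFun (p.trans q) = toFun p + toFun q
  map_homotopic : ∀ {x y : X} (p q : Path x y), p.Homotopic q → toFun p = toFun q

/-- The cohomology `H¹(X, A) = Hom(π₁(X, x), A)` of a path connected space `X`. -/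
abbrev H1 (X : Type) [TopologicalSpace X] (x : X) (A : Type) [AddCommGroup A] : Type :=
  Additive (FundamentalGroup X x) →+ A

/-- The class in `H¹(X, A)` of the loop function `c`: `φ [γ] = c γ` for all loops `γ` at `x`. -/
def IsClassOf {X : Type} [TopologicalSpace X] {x : X} {A : Type} [AddCommGroup A] (φ : H1 X x A)
    (c : Path x x → A) : Prop :=
  ∀ γ : Path x x,
    φ (Additive.ofMul (FundamentalGroup.fromPath (Path.Homotopic.Quotient.mk γ))) = c γ

/-- The map `ℂ ⊗ H¹(X, ℚ) → H¹(X, ℂ)`. -/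
def complexifyH1 (X : Type) [TopologicalSpace X] (x : X) :
    (ℂ ⊗[ℚ] H1 X x ℚ) →ₗ[ℂ] H1 X x ℂ :=
  LinearMap.liftBaseChange ℂ
    { toFun := fun φ => (algebraMap ℚ ℂ).toAddMonoidHom.comp φ
      map_add' := fun φ ψ => by ext γ; simp
      map_smul' := fun c φ => by ext γ; simp [Algebra.smul_def] }

/-! ### The Legendre family of elliptic curves -/

/-- The quotient topology on the complex projective plane. -/
instance instTopologicalSpaceProjectivePlane : TopologicalSpace (ℙ ℂ (Fin 3 → ℂ)) :=
  TopologicalSpace.coinduced (Projectivization.mk' ℂ) inferInstance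

/-- The base `𝔸¹ ∖ {0, 1}`. -/
def legendreBase : Set ℂ := {l | l ≠ 0 ∧ l ≠ 1}

/-- The point `P = [x : y : z]` lies on the curve `y² z = x (x - z) (x - λ z)`. -/
def OnLegendre (l : ℂ) (P : ℙ ℂ (Fin 3 → ℂ)) : Prop :=
  P.rep 1 ^ 2 * P.rep 2 = P.rep 0 * (P.rep 0 - P.rep 2) * (P.rep 0 - l * P.rep 2)

/-- The elliptic curve `𝓔_λ`. -/
abbrev LegendreCurve (l : legendreBase) : Type := {P : ℙ ℂ (Fin 3 → ℂ) // OnLegendre l P}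

/-- The part `f₁⁻¹(U)` of the family `f₁ : 𝓔 → 𝔸¹ ∖ {0, 1}` over `U`. -/
abbrev LegendreTotal (U : Set legendreBase) : Type :=
  {q : legendreBase × ℙ ℂ (Fin 3 → ℂ) // q.1 ∈ U ∧ OnLegendre q.1 q.2}

/-- The inclusion `𝓔_λ → f₁⁻¹(U)` of a fibre, `λ ∈ U`. -/
def fiberInclusion (U : Set legendreBase) (l : legendreBase) (hl : l ∈ U) :
    C(LegendreCurve l, LegendreTotal U) where
  toFun P := ⟨(l, P.1), hl, P.2⟩
  continuous_toFun := by fun_prop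

/-- The zero section `O = [0 : 1 : 0]`. -/
def legendreOrigin (l : legendreBase) : LegendreCurve l :=
  ⟨Projectivization.mk ℂ ![0, 1, 0] (fun h => by simpa using congrFun h 1), by
    obtain ⟨a, ha⟩ := Projectivization.exists_smul_eq_mk_rep ℂ (![0, 1, 0] : Fin 3 → ℂ)
      (fun h => by simpa using congrFun h 1)
    simp [OnLegendre, ← ha]⟩

/-- The affine coordinate `x/z` (it has the value `0` at `O`). -/
def affineX {l : legendreBase} (P : LegendreCurve l) : ℂ := P.1.rep 0 / P.1.rep 2

/-- The affine coordinate `y/z` (it has the value `0` at `O`). -/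
def affineY {l : legendreBase} (P : LegendreCurve l) : ℂ := P.1.rep 1 / P.1.rep 2

/-- `f` is a primitive on `N` of the holomorphic differential `dx/y`. The points with `affineY ≠ 0`
are those where `x` is a local coordinate; at the four remaining points, continuity of `f` is
enough, by the removability of isolated singularities. -/
def IsPrimitiveOn {l : legendreBase} (f : LegendreCurve l → ℂ) (N : Set (LegendreCurve l)) : Prop :=
  ContinuousOn f N ∧ ∀ P ∈ N, affineY P ≠ 0 →
    Filter.Tendsto (fun R => (f R - f P) / (affineX R - affineX P)) (𝓝[≠] P) (𝓝 (1 / affineY P))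

/-- `φ ∈ H¹(𝓔_λ, ℂ)` is the class of `dx/y`: it is given on loops by integration of `dx/y` along
paths, i.e. by a cocycle that on paths inside small open sets is the difference of the values of a
primitive at the end points. -/
def IsClassOfDifferential {l : legendreBase} (φ : H1 (LegendreCurve l) (legendreOrigin l) ℂ) :
    Prop :=
  ∃ c : PathCocycle (LegendreCurve l) ℂ,
    (∀ P, ∃ N : Set (LegendreCurve l), IsOpen N ∧ P ∈ N ∧ ∃ f, IsPrimitiveOn f N ∧
      ∀ (R S : LegendreCurve l) (p : Path R S), (∀ t, p t ∈ N) → c.toFun p = f S - f R) ∧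
    IsClassOf φ c.toFun

/-- The variation of Hodge structures `R¹(f₁)_* ℚ` of the Legendre family. A section is flat if
locally on the base it is given by a class in `H¹(f₁⁻¹(U), ℚ)`, and `F¹ = H^{1,0}` is spanned by the
class of `dx/y`. -/
def legendreH1 : VHSData legendreBase where
  weight := 1
  Fiber l := H1 (LegendreCurve l) (legendreOrigin l) ℚ
  IsFlat U s := ∀ l₀ ∈ U, ∃ U' : Set legendreBase, IsOpen U' ∧ l₀ ∈ U' ∧
    ∃ c : PathCocycle (LegendreTotal U') ℚ,
      ∀ (l : legendreBase) (hl : l ∈ U'),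
        IsClassOf (s l) (fun γ => c.toFun (γ.map (fiberInclusion U' l hl).continuous))
  F l p := if p ≤ 0 then ⊤ else if p = 1 then
      Submodule.comap (complexifyH1 (LegendreCurve l) (legendreOrigin l))
        (Submodule.span ℂ {φ | IsClassOfDifferential φ})
    else ⊥

/-! ### The groups `G_x` -/

/-- `v = (v_{3,0}, v_{2,1}, v_{1,2}, v_{0,3})` is a normalized basis of `ℂ ⊗ V` for a polarized Hodge
structure of weight 3 with Hodge numbers `1, 1, 1, 1`: `v_{p,q} ∈ H^{p,q}`, `v_{q,p}` is the conjugate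
of `v_{p,q}`, and `Q(i v_{3,0}, v_{0,3}) = Q(-i v_{2,1}, v_{1,2}) = 1`. -/
def IsNormalizedBasis {V : Type} [AddCommGroup V] [Module ℚ V]
    (F : ℤ → Submodule ℂ (ℂ ⊗[ℚ] V)) (Q : LinearMap.BilinForm ℚ V)
    (v : Module.Basis (Fin 4) ℂ (ℂ ⊗[ℚ] V)) : Prop :=
  v 0 ∈ hodgePiece 3 F 3 ∧ v 1 ∈ hodgePiece 3 F 2 ∧
  complexConj V (v 0) = v 3 ∧ complexConj V (v 1) = v 2 ∧
  Q.baseChange ℂ (Complex.I • v 0) (v 3) = 1 ∧ Q.baseChange ℂ (-Complex.I • v 1) (v 2) = 1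

/-- The real Lie algebra of `G_x`, in matrices with respect to a normalized basis. -/
def lieGx (x : ℂ) : Submodule ℝ (Matrix (Fin 4) (Fin 4) ℂ) :=
  Submodule.span ℝ
    {!![3 * Complex.I, 0, 0, 0; 0, Complex.I, 0, 0; 0, 0, -Complex.I, 0; 0, 0, 0, -3 * Complex.I],
     !![0, 1, 0, 0; 1, 0, x, 0; 0, (starRingEnd ℂ) x, 0, 1; 0, 0, 1, 0],
     !![0, Complex.I, 0, 0; -Complex.I, 0, Complex.I * x, 0;
        0, -Complex.I * (starRingEnd ℂ) x, 0, Complex.I; 0, 0, -Complex.I, 0]}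

/-- The `ℝ`-algebraic group `G_x`: the smallest algebraic subgroup over `ℝ` that contains the
exponentials of the elements of its Lie algebra. -/
def groupGx {V : Type} [AddCommGroup V] [Module ℚ V] (v : Module.Basis (Fin 4) ℂ (ℂ ⊗[ℚ] V))
    (x : ℂ) : Subgroup (GLC V) :=
  sInf {H | IsAlgebraicSubgroup ℝ H ∧ ∀ A ∈ lieGx x, ∀ g : GLC V,
    LinearMap.toMatrix v v g.toLinearMap = NormedSpace.exp A → g ∈ H}

/-- The Lie algebra of the Lie group `G(ℝ)`, in matrices with respect to the basis `v`. -/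
def lieRealPoints {V : Type} [AddCommGroup V] [Module ℚ V]
    (v : Module.Basis (Fin 4) ℂ (ℂ ⊗[ℚ] V)) (G : Subgroup (GLC V)) :
    Set (Matrix (Fin 4) (Fin 4) ℂ) :=
  {A | ∀ t : ℝ, ∃ g ∈ realPoints G,
    LinearMap.toMatrix v v g.toLinearMap = NormedSpace.exp (t • A)}

end

/-! Locally on the base, `legendreH1` has a flat symplectic frame in which the Hodge line is spanned
by (1, τ), with Im τ > 0 and τ holomorphic with nonvanishing derivative
(`legendreH1EllipticStructure`). Everything else is formal. In such a frame the symmetric cube is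
the space of binary cubics, `SL₂` acts on it through `cubicRep`, and the Hodge filtration is the
coordinate filtration attached to the cube of (1, τ) (`isCubicFiltration_symPower`).

Hodge theory of the cube: the successive derivatives of the cube of (1, τ) generate the filtration.
This gives transversality and, because τ' ≠ 0, the Calabi-Yau condition on F². A negative multiple
of the invariant alternating form polarizes. Conversely, a polarization has a constant Gram matrix
in a flat frame, and the bilinear relation at all τ in an open set forces it to be a multiple of the
invariant form (`exists_isCubicForm`).

Generic Hodge group: the image `cubicGroup` of `SL₂` is the stabilizer of the alternating form and
of the cone over the twisted cubic. Hence it is defined over ℚ and contains the Hodge group of every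
fibre. If Re τ and Im τ are algebraically independent, the rational equations satisfied by the
circle action extend to all complex values of these parameters, and the resulting elements generate
the image of `SL₂` (`IsCubicFiltration.hodgeGroup_eq`). Such τ occur near every point since τ is an
open map. Parallel transport preserves symplectic frames, so `cubicGroup` is the maximum at each
base point (`isGenericHodgeGroup_iff`). Its real points are `SL₂(ℝ)`, connected with centre ±1,
acting on the disc through SU(1,1) (`hasDomainUnitDisc_cubicGroup`).

The groups `G_x`: with ω = (1, τ), a normalized basis is αω³, 3βω²ω̄ and their conjugates, where
|α|² = 3|β|². Writing the symmetric cube of su(1,1) in this basis yields `lieGx x` with x =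
2β̄α/(3β²), of absolute value 2/√3 (`IsCubicForm.exists_groupGx`).

The analytic input is uniformization. Every λ ≠ 0, 1 comes from a lattice, because a combination of
E₄³ and E₆² without zeros is excluded by dividing the discriminant by it
(`exists_mul_eisenstein_eq`). A lattice is determined by its invariants, so λ is locally injective
in the period ratio and has a holomorphic inverse (`exists_family`). Joint continuity of ℘ in
lattice and argument trivializes the family as a family of tori (`continuous_angle`), and winding
numbers give the flat frame. Finally dx/y = 2 dz identifies the Hodge line
(`isClassOfDifferential_iff`, `F_one`). -/

noncomputable section

/-! ### The third symmetric power of the standard representation -/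

section CubicRep

variable {A : Type*} [CommRing A]

/-- The matrix of the third symmetric power of a `2 × 2` matrix, in the basis of symmetrized
monomials. -/
def cubicRep (h : Matrix (Fin 2) (Fin 2) A) : Matrix (Fin 4) (Fin 4) A :=
  !![h 0 0 ^ 3, 3 * h 0 0 ^ 2 * h 0 1, 3 * h 0 0 * h 0 1 ^ 2, h 0 1 ^ 3;
     h 0 0 ^ 2 * h 1 0, h 0 0 ^ 2 * h 1 1 + 2 * h 0 0 * h 0 1 * h 1 0,
       h 0 1 ^ 2 * h 1 0 + 2 * h 0 0 * h 0 1 * h 1 1, h 0 1 ^ 2 * h 1 1;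
     h 0 0 * h 1 0 ^ 2, h 0 1 * h 1 0 ^ 2 + 2 * h 0 0 * h 1 0 * h 1 1,
       h 0 0 * h 1 1 ^ 2 + 2 * h 0 1 * h 1 0 * h 1 1, h 0 1 * h 1 1 ^ 2;
     h 1 0 ^ 3, 3 * h 1 0 ^ 2 * h 1 1, 3 * h 1 0 * h 1 1 ^ 2, h 1 1 ^ 3]

/-- The cubic Veronese map. -/
def veronese (p q : A) : Fin 4 → A := ![p ^ 3, p ^ 2 * q, p * q ^ 2, q ^ 3]

/-- The alternating form on binary cubics. -/
def cubicForm (x y : Fin 4 → A) : A := x 0 * y 3 - 3 * x 1 * y 2 + 3 * x 2 * y 1 - x 3 * y 0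

theorem cubicRep_mul (g h : Matrix (Fin 2) (Fin 2) A) :
    cubicRep (g * h) = cubicRep g * cubicRep h := by
  ext i j
  fin_cases i <;> fin_cases j <;>
    simp [cubicRep, Matrix.mul_apply, Fin.sum_univ_succ] <;> ring

@[simp]
theorem cubicRep_one : cubicRep (1 : Matrix (Fin 2) (Fin 2) A) = 1 := by
  ext i j
  fin_cases i <;> fin_cases j <;> simp [cubicRep]

theorem cubicRep_mulVec_veronese (h : Matrix (Fin 2) (Fin 2) A) (p q : A) :
    (cubicRep h).mulVec (veronese p q) =
      veronese (h 0 0 * p + h 0 1 * q) (h 1 0 * p + h 1 1 * q) := by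
  ext i
  fin_cases i <;>
    simp [cubicRep, veronese, Matrix.mulVec, dotProduct, Fin.sum_univ_succ] <;> ring

/-- The form is the third symmetric power of the determinant pairing on the plane, hence the cube of
the determinant. -/
theorem cubicForm_cubicRep (h : Matrix (Fin 2) (Fin 2) A) (x y : Fin 4 → A) :
    cubicForm ((cubicRep h).mulVec x) ((cubicRep h).mulVec y) = h.det ^ 3 * cubicForm x y := by
  simp [cubicRep, cubicForm, Matrix.mulVec, dotProduct, Fin.sum_univ_succ, Matrix.det_fin_two]
  ring

theorem cubicRep_smul (c : A) (h : Matrix (Fin 2) (Fin 2) A) :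
    cubicRep (c • h) = c ^ 3 • cubicRep h := by
  ext i j
  fin_cases i <;> fin_cases j <;> simp [cubicRep] <;> ring

theorem cubicRep_map {B : Type*} [CommRing B] (f : A →+* B) (h : Matrix (Fin 2) (Fin 2) A) :
    cubicRep (h.map f) = (cubicRep h).map f := by
  ext i j
  have h2 : f 2 = 2 := map_ofNat f 2
  have h3 : f 3 = 3 := map_ofNat f 3
  fin_cases i <;> fin_cases j <;> simp [cubicRep, h2, h3]

/-- The equations of the cone over the twisted cubic. -/
def IsOnCone (x : Fin 4 → A) : Prop :=
  x 0 * x 2 - x 1 ^ 2 = 0 ∧ x 1 * x 3 - x 2 ^ 2 = 0 ∧ x 0 * x 3 - x 1 * x 2 = 0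

theorem isOnCone_veronese (p q : A) : IsOnCone (veronese p q) := by
  refine ⟨?_, ?_, ?_⟩ <;> simp [veronese] <;> ring

end CubicRep

/-- If `x 0 ≠ 0`, a cube root p of it determines q = `x 1` / p². If `x 0 = 0`, the equations kill
the two middle coordinates and only a cube root of `x 3` is needed. -/
theorem IsOnCone.exists_veronese {x : Fin 4 → ℂ} (hx : IsOnCone x) : ∃ p q, x = veronese p q := by
  obtain ⟨h1, h2, h3⟩ := hx
  by_cases h0 : x 0 = 0
  · obtain ⟨q, hq⟩ := IsAlgClosed.exists_pow_nat_eq (x 3) (n := 3) (by norm_num)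
    have hx1 : x 1 = 0 := by simpa [h0] using h1
    have hx2 : x 2 = 0 := by simpa [hx1] using h2
    refine ⟨0, q, ?_⟩
    ext i
    fin_cases i <;> simp [veronese, h0, hx1, hx2, hq]
  · obtain ⟨p, hp⟩ := IsAlgClosed.exists_pow_nat_eq (x 0) (n := 3) (by norm_num)
    have hp0 : p ≠ 0 := by rintro rfl; exact h0 (by simpa using hp.symm)
    have hx2 : x 2 = x 1 ^ 2 / x 0 := by field_simp; linear_combination h1
    have hx3 : x 3 = x 1 * x 2 / x 0 := by field_simp; linear_combination h3
    refine ⟨p, x 1 / p ^ 2, ?_⟩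
    ext i
    fin_cases i
    · simp [veronese, hp]
    · simp [veronese]; field_simp
    · simp [veronese, hx2, ← hp]; field_simp
    · simp [veronese, hx3, hx2, ← hp]; field_simp

/-- Rational parameters suffice because a nonzero polynomial has finitely many roots. Testing only
rational points of the cone is what keeps its stabilizer defined over ℚ. -/
theorem coeff_eq_zero_of_forall_rat (c : Fin 7 → ℂ)
    (h : ∀ t : ℚ, ∑ i, c i * (t : ℂ) ^ (i : ℕ) = 0) : c = 0 := by
  let P : Polynomial ℂ := ∑ i : Fin 7, Polynomial.monomial (i : ℕ) (c i)
  have hP : P = 0 := by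
    refine Polynomial.eq_zero_of_infinite_isRoot P
      ((Set.infinite_range_of_injective (Rat.cast_injective (α := ℂ))).mono ?_)
    rintro _ ⟨t, rfl⟩
    simp only [Set.mem_ofPred_eq, Polynomial.IsRoot, P, Polynomial.eval_finsetSum,
      Polynomial.eval_monomial, h t]
  ext i
  have := congrArg (fun Q => Polynomial.coeff Q (i : ℕ)) hP
  simpa [P, Polynomial.finsetSum_coeff, Polynomial.coeff_monomial, Fin.val_inj] using this

theorem mulVec_fin_four (g : Matrix (Fin 4) (Fin 4) ℂ) (x : Fin 4 → ℂ) (i : Fin 4) :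
    g.mulVec x i = g i 0 * x 0 + g i 1 * x 1 + g i 2 * x 2 + g i 3 * x 3 := by
  simp [Matrix.mulVec, dotProduct, Fin.sum_univ_succ]
  ring

/-- The form pairs the outer basis vectors with each other and the middle ones with each other, so
fixing the outer ones makes `g` preserve the middle plane. Comparing coefficients of t in the cone
equations then leaves diag(1, u, u², 1) with u³ = 1, which is the symmetric cube of diag(u, u²). -/
theorem eq_cubicRep_of_fixes {g : Matrix (Fin 4) (Fin 4) ℂ}
    (hform : ∀ x y, cubicForm (g.mulVec x) (g.mulVec y) = cubicForm x y)
    (hcone : ∀ t : ℚ, IsOnCone (g.mulVec (veronese 1 (t : ℂ))))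
    (h0 : g.mulVec (Pi.single 0 1) = Pi.single 0 1) (h3 : g.mulVec (Pi.single 3 1) = Pi.single 3 1) :
    ∃ h : Matrix (Fin 2) (Fin 2) ℂ, h.det = 1 ∧ g = cubicRep h := by
  have e0 : ∀ i, g i 0 = (Pi.single 0 1 : Fin 4 → ℂ) i := fun i => by
    rw [← h0, Matrix.mulVec_single_one, Matrix.col_apply]
  have e3 : ∀ i, g i 3 = (Pi.single 3 1 : Fin 4 → ℂ) i := fun i => by
    rw [← h3, Matrix.mulVec_single_one, Matrix.col_apply]
  have f01 := hform (Pi.single 0 1) (Pi.single 1 1)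
  have f02 := hform (Pi.single 0 1) (Pi.single 2 1)
  have f31 := hform (Pi.single 3 1) (Pi.single 1 1)
  have f32 := hform (Pi.single 3 1) (Pi.single 2 1)
  simp only [Matrix.mulVec_single_one, cubicForm, Matrix.col_apply] at f01 f02 f31 f32
  simp [e0, e3] at f01 f02 f31 f32
  have key : ∀ t : ℚ, (t * g 2 1 + t ^ 2 * g 2 2 - (t * g 1 1 + t ^ 2 * g 1 2) ^ 2 : ℂ) = 0 ∧
      (t ^ 3 - (t * g 1 1 + t ^ 2 * g 1 2) * (t * g 2 1 + t ^ 2 * g 2 2) : ℂ) = 0 := by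
    intro t
    obtain ⟨c1, -, c3⟩ := hcone t
    simp only [mulVec_fin_four, veronese, e0, e3, f01, f02, f31, f32] at c1 c3
    simp at c1 c3
    exact ⟨by linear_combination c1, by linear_combination c3⟩
  have k1 := coeff_eq_zero_of_forall_rat
    ![0, g 2 1, g 2 2 - g 1 1 ^ 2, -2 * g 1 1 * g 1 2, - g 1 2 ^ 2, 0, 0] (fun t => by
      refine Eq.trans ?_ (key t).1; simp [Fin.sum_univ_seven]; ring)
  have k2 := coeff_eq_zero_of_forall_rat
    ![0, 0, - g 1 1 * g 2 1, 1 - g 1 1 * g 2 2 - g 1 2 * g 2 1, - g 1 2 * g 2 2, 0, 0] (fun t => by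
      refine Eq.trans ?_ (key t).2; simp [Fin.sum_univ_seven]; ring)
  have a21 : g 2 1 = 0 := by simpa using congrFun k1 1
  have a22 : g 2 2 - g 1 1 ^ 2 = 0 := by simpa using congrFun k1 2
  have a12 : g 1 2 = 0 := by simpa using congrFun k1 4
  have a3 : 1 - g 1 1 * g 2 2 - g 1 2 * g 2 1 = 0 := by simpa using congrFun k2 3
  have hu : g 1 1 ^ 3 = 1 := by
    rw [a21] at a3; linear_combination - a3 - g 1 1 * a22
  refine ⟨!![g 1 1, 0; 0, g 1 1 ^ 2], by simp [Matrix.det_fin_two]; linear_combination hu, ?_⟩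
  ext i j
  fin_cases i <;> fin_cases j <;> simp [cubicRep, e0, e3, f01, f02, f31, f32, a21, a12]
  · exact hu.symm
  · linear_combination - g 1 1 * hu
  · linear_combination a22 - g 1 1 ^ 2 * hu
  · linear_combination (- g 1 1 ^ 3 - 1) * hu

/-- A linear automorphism of the space of binary cubics that preserves the cone over the twisted
cubic and the alternating form is induced by an element of `SL₂`. -/
theorem eq_cubicRep_of_preserves {g : Matrix (Fin 4) (Fin 4) ℂ}
    (hform : ∀ x y, cubicForm (g.mulVec x) (g.mulVec y) = cubicForm x y)
    (hcone : ∀ s t : ℚ, IsOnCone (g.mulVec (veronese (s : ℂ) (t : ℂ)))) :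
    ∃ h : Matrix (Fin 2) (Fin 2) ℂ, h.det = 1 ∧ g = cubicRep h := by
  have v0 : veronese 1 0 = (Pi.single 0 1 : Fin 4 → ℂ) := by
    ext i; fin_cases i <;> simp [veronese]
  have v3 : veronese 0 1 = (Pi.single 3 1 : Fin 4 → ℂ) := by
    ext i; fin_cases i <;> simp [veronese]
  obtain ⟨a, c, hac⟩ := (hcone 1 0).exists_veronese
  obtain ⟨b, d, hbd⟩ := (hcone 0 1).exists_veronese
  simp only [Rat.cast_one, Rat.cast_zero] at hac hbd
  have hd : (a * d - b * c) ^ 3 = 1 := by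
    have := hform (veronese 1 0) (veronese 0 1)
    rw [hac, hbd] at this
    simp [cubicForm, veronese] at this
    linear_combination this
  set δ := a * d - b * c with hδ
  -- The determinant δ is only known to be a cube root of unity, so the adjugate is multiplied by δ
  -- to obtain determinant δ³ = 1. The result sends (a, c) to (δ², 0) and (b, d) to (0, δ²), whose
  -- cubes are the outer basis vectors since δ⁶ = 1.
  let k : Matrix (Fin 2) (Fin 2) ℂ := !![δ * d, -(δ * b); -(δ * c), δ * a]
  let k' : Matrix (Fin 2) (Fin 2) ℂ := !![δ * a, δ * b; δ * c, δ * d]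
  have hk : k.det = 1 := by
    simp [k, Matrix.det_fin_two]; rw [← hd]; ring
  have hk' : k'.det = 1 := by
    simp [k', Matrix.det_fin_two]; rw [← hd]; ring
  have hkk : k' * k = 1 := by
    have : δ * δ * δ = 1 := by rw [← hd]; ring
    ext i j
    fin_cases i <;> fin_cases j <;> simp [k, k', Matrix.mul_apply, Fin.sum_univ_succ]
    · linear_combination this - (δ * δ) * hδ
    · ring
    · ring
    · linear_combination this - (δ * δ) * hδ
  obtain ⟨h, hh, hg⟩ := eq_cubicRep_of_fixes (g := cubicRep k * g)
    (fun x y => by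
      rw [← Matrix.mulVec_mulVec, ← Matrix.mulVec_mulVec, cubicForm_cubicRep, hk, hform]; simp)
    (fun t => by
      obtain ⟨p, q, hpq⟩ := (hcone 1 t).exists_veronese
      rw [← Matrix.mulVec_mulVec]
      simp only [Rat.cast_one] at hpq
      rw [hpq, cubicRep_mulVec_veronese]
      exact isOnCone_veronese _ _)
    (by
      rw [← Matrix.mulVec_mulVec, ← v0, hac, cubicRep_mulVec_veronese]
      have : δ * d * a + -(δ * b) * c = δ ^ 2 := by rw [hδ]; ring
      have h2 : -(δ * c) * a + δ * a * c = 0 := by ring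
      simp only [k, Matrix.of_apply, Matrix.cons_val', Matrix.cons_val_zero, Matrix.cons_val_one,
        Matrix.cons_val_fin_one]
      rw [this, h2]
      ext i; fin_cases i <;> simp [veronese]
      calc (δ ^ 2) ^ 3 = (δ ^ 3) ^ 2 := by ring
        _ = 1 := by rw [hd]; simp)
    (by
      rw [← Matrix.mulVec_mulVec, ← v3, hbd, cubicRep_mulVec_veronese]
      have : -(δ * c) * b + (δ * a) * d = δ ^ 2 := by rw [hδ]; ring
      have h2 : δ * d * b + -(δ * b) * d = 0 := by ring
      simp only [k, Matrix.of_apply, Matrix.cons_val', Matrix.cons_val_zero, Matrix.cons_val_one,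
        Matrix.cons_val_fin_one]
      rw [this, h2]
      ext i; fin_cases i <;> simp [veronese]
      calc (δ ^ 2) ^ 3 = (δ ^ 3) ^ 2 := by ring
        _ = 1 := by rw [hd]; simp)
  refine ⟨k' * h, by rw [Matrix.det_mul, hk', hh, one_mul], ?_⟩
  rw [cubicRep_mul, ← hg, ← Matrix.mul_assoc, ← cubicRep_mul, hkk, cubicRep_one, one_mul]

/-- An element diag(a, d) of the kernel satisfies a²d = 1 and ad = 1, hence a = d = 1. The odd
exponent matters: −1 acts as −1. -/
theorem cubicRep_injective {h k : Matrix (Fin 2) (Fin 2) ℂ} (hh : h.det = 1) (hk : k.det = 1)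
    (e : cubicRep h = cubicRep k) : h = k := by
  obtain ⟨m, hm⟩ : ∃ m, m = h.adjugate * k := ⟨_, rfl⟩
  have hm1 : cubicRep m = 1 := by
    rw [hm, cubicRep_mul, ← e, ← cubicRep_mul, Matrix.adjugate_mul, hh, one_smul, cubicRep_one]
  have hmd : m.det = 1 := by
    rw [hm, Matrix.det_mul, Matrix.det_adjugate, hh, hk]; simp
  have m10 : m 1 0 = 0 := by
    have := congrFun (congrFun hm1 3) 0
    simpa [cubicRep] using this
  have m01 : m 0 1 = 0 := by
    have := congrFun (congrFun hm1 0) 3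
    simpa [cubicRep] using this
  have ha : m 0 0 ^ 3 = 1 := by
    have := congrFun (congrFun hm1 0) 0
    simpa [cubicRep] using this
  have hb : m 0 0 ^ 2 * m 1 1 = 1 := by
    have := congrFun (congrFun hm1 1) 1
    simpa [cubicRep, m10] using this
  have hc : m 0 0 * m 1 1 = 1 := by
    rw [Matrix.det_fin_two, m01] at hmd; linear_combination hmd
  have h00 : m 0 0 = 1 := by linear_combination hb - m 0 0 * hc
  have h11 : m 1 1 = 1 := by rw [h00] at hc; simpa using hc
  have : m = 1 := by
    ext i j
    fin_cases i <;> fin_cases j <;> simp [h00, h11, m10, m01]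
  have h2 : h * m = k := by
    rw [hm, ← Matrix.mul_assoc, Matrix.mul_adjugate, hh, one_smul, one_mul]
  rw [← h2, this, mul_one]
end

noncomputable section

/-! ### Coordinates on the complexification -/

section Coordinates

set_option linter.unusedSectionVars false

variable {V : Type} [AddCommGroup V] [Module ℚ V] {ι : Type} [Fintype ι] [DecidableEq ι]

/-- The basis of `ℂ ⊗ V` given by a rational basis. -/
abbrev complexBasis (b : Module.Basis ι ℚ V) : Module.Basis ι ℂ (ℂ ⊗[ℚ] V) :=
  Algebra.TensorProduct.basis ℂ b

/-- The coordinates on `ℂ ⊗ V` given by a rational basis. -/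
abbrev complexCoords (b : Module.Basis ι ℚ V) : (ℂ ⊗[ℚ] V) ≃ₗ[ℂ] (ι → ℂ) :=
  (complexBasis b).equivFun

theorem complexCoords_tmul (b : Module.Basis ι ℚ V) (z : ℂ) (v : V) (i : ι) :
    complexCoords b (z ⊗ₜ v) i = z * (b.repr v i : ℂ) := by
  simp [complexCoords, complexBasis]

theorem complexCoords_complexConj (b : Module.Basis ι ℚ V) (x : ℂ ⊗[ℚ] V) (i : ι) :
    complexCoords b (complexConj V x) i = (starRingEnd ℂ) (complexCoords b x i) := by
  induction x with
  | zero => simp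
  | tmul z v =>
    rw [complexCoords_tmul, map_mul]
    have : complexConj V (z ⊗ₜ v) = ((starRingEnd ℂ) z) ⊗ₜ v := by
      simp [complexConj]
    rw [this, complexCoords_tmul]
    simp
  | add x y hx hy => simp only [map_add, Pi.add_apply, hx, hy]

/-- The matrix of an automorphism of `ℂ ⊗ V` in a rational basis. -/
def glMatrix (b : Module.Basis ι ℚ V) (g : GLC V) : Matrix ι ι ℂ :=
  LinearMap.toMatrix (complexBasis b) (complexBasis b) g.toLinearMap

theorem complexCoords_apply (b : Module.Basis ι ℚ V) (g : GLC V) (x : ℂ ⊗[ℚ] V) :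
    complexCoords b (g x) = (glMatrix b g).mulVec (complexCoords b x) :=
  (LinearMap.toMatrix_mulVec_repr (complexBasis b) (complexBasis b) g.toLinearMap x).symm

theorem glMatrix_mul (b : Module.Basis ι ℚ V) (g h : GLC V) :
    glMatrix b (g * h) = glMatrix b g * glMatrix b h :=
  LinearMap.toMatrix_comp (complexBasis b) (complexBasis b) (complexBasis b) g.toLinearMap
    h.toLinearMap

@[simp]
theorem glMatrix_one (b : Module.Basis ι ℚ V) : glMatrix b (1 : GLC V) = 1 :=
  LinearMap.toMatrix_id _

theorem glMatrix_injective (b : Module.Basis ι ℚ V) : Function.Injective (glMatrix b) := by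
  intro g h e
  have := (LinearMap.toMatrix (complexBasis b) (complexBasis b)).injective e
  exact LinearEquiv.toLinearMap_injective this

theorem matrixCoeff_basis (b : Module.Basis ι ℚ V) (g : GLC V) (i j : ι) :
    matrixCoeff g (b j, b.coord i) = glMatrix b g i j := by
  have h : ∀ x : ℂ ⊗[ℚ] V,
      LinearMap.liftBaseChange ℂ ((Algebra.linearMap ℚ ℂ).comp (b.coord i)) x =
        complexCoords b x i := by
    intro x
    induction x with
    | zero => simp
    | tmul z v => rw [complexCoords_tmul]; simp
    | add x y hx hy => rw [map_add, hx, hy, map_add]; rfl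
  rw [matrixCoeff, h, glMatrix, LinearMap.toMatrix_apply]
  simp [complexCoords]

/-- All matrix coefficients are rational linear combinations of the entries in one rational basis.
The topology and polynomial equations over ℚ can therefore be tested on matrix entries. -/
theorem matrixCoeff_eq_sum (b : Module.Basis ι ℚ V) (g : GLC V) (v : V) (φ : Module.Dual ℚ V) :
    matrixCoeff g (v, φ) = ∑ i, ∑ j, (φ (b i) : ℂ) * (b.repr v j : ℂ) * glMatrix b g i j := by
  have h : ∀ x : ℂ ⊗[ℚ] V,
      LinearMap.liftBaseChange ℂ ((Algebra.linearMap ℚ ℂ).comp φ) x =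
        ∑ i, (φ (b i) : ℂ) * complexCoords b x i := by
    intro x
    induction x with
    | zero => simp
    | tmul z v =>
      have hv : φ v = ∑ i, b.repr v i * φ (b i) := by
        conv_lhs => rw [← b.sum_repr v, map_sum]
        simp only [map_smul, smul_eq_mul]
      simp only [complexCoords_tmul, LinearMap.liftBaseChange_tmul, LinearMap.comp_apply, hv,
        Algebra.linearMap_apply, map_sum, map_mul, smul_eq_mul, Finset.mul_sum, eq_ratCast]
      exact Finset.sum_congr rfl fun i _ => by ring
    | add x y hx hy => simp [hx, hy, mul_add, Finset.sum_add_distrib]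
  rw [matrixCoeff, h]
  refine Finset.sum_congr rfl fun i _ => ?_
  rw [complexCoords_apply, Matrix.mulVec, dotProduct, Finset.mul_sum]
  refine Finset.sum_congr rfl fun j _ => ?_
  rw [complexCoords_tmul]
  ring

theorem continuous_glMatrix (b : Module.Basis ι ℚ V) : Continuous (glMatrix b) := by
  refine continuous_matrix fun i j => ?_
  have : Continuous (fun g : GLC V => matrixCoeff g (b j, b.coord i)) :=
    continuous_pi_iff.1 (continuous_induced_dom (f := fun g : GLC V => matrixCoeff g)) _
  simpa only [matrixCoeff_basis] using this

theorem continuous_of_glMatrix (b : Module.Basis ι ℚ V) {X : Type*} [TopologicalSpace X]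
    {f : X → GLC V} (hf : Continuous fun x => glMatrix b (f x)) : Continuous f := by
  refine continuous_induced_rng.2 (continuous_pi fun p => ?_)
  have : (fun x => matrixCoeff (f x) p) = fun x =>
      ∑ i, ∑ j, (p.2 (b i) : ℂ) * (b.repr p.1 j : ℂ) * glMatrix b (f x) i j := by
    ext x; exact matrixCoeff_eq_sum b (f x) p.1 p.2
  change Continuous fun x => matrixCoeff (f x) p
  rw [this]
  exact continuous_finsetSum _ fun i _ => continuous_finsetSum _ fun j _ =>
    continuous_const.mul (hf.matrix_elem i j)

theorem t2Space_GLC (b : Module.Basis ι ℚ V) : T2Space (GLC V) :=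
  T2Space.of_injective_continuous (glMatrix_injective b) (continuous_glMatrix b)

theorem commutes_complexConj_iff (b : Module.Basis ι ℚ V) (g : GLC V) :
    (∀ x, g (complexConj V x) = complexConj V (g x)) ↔
      (glMatrix b g).map (starRingEnd ℂ) = glMatrix b g := by
  constructor
  · intro h
    ext i j
    have := congrFun (congrArg (complexCoords b) (h (complexBasis b j))) i
    rw [complexCoords_complexConj] at this
    have hb : complexConj V (complexBasis b j) = complexBasis b j := by
      simp [complexBasis, complexConj]
    rw [hb] at this
    simpa [glMatrix, LinearMap.toMatrix_apply, complexCoords] using this.symm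
  · intro h x
    apply (complexCoords b).injective
    ext i
    rw [complexCoords_apply, complexCoords_complexConj, complexCoords_apply]
    simp only [Matrix.mulVec, dotProduct, map_sum, map_mul, complexCoords_complexConj]
    refine Finset.sum_congr rfl fun j _ => ?_
    congr 1
    conv_lhs => rw [← h]
    rfl

/-- The automorphism of `ℂ ⊗ V` with a given invertible matrix. -/
def glOfMatrix (b : Module.Basis ι ℚ V) (A B : Matrix ι ι ℂ) (h : A * B = 1) (h' : B * A = 1) :
    GLC V :=
  LinearEquiv.ofLinearMap (Matrix.toLin (complexBasis b) (complexBasis b) A)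
    (Matrix.toLin (complexBasis b) (complexBasis b) B)
    (by rw [← Matrix.toLin_mul, h, Matrix.toLin_one])
    (by rw [← Matrix.toLin_mul, h', Matrix.toLin_one])

@[simp]
theorem glMatrix_glOfMatrix (b : Module.Basis ι ℚ V) (A B : Matrix ι ι ℂ) (h : A * B = 1)
    (h' : B * A = 1) : glMatrix b (glOfMatrix b A B h h') = A := by
  simp [glMatrix, glOfMatrix]

end Coordinates

theorem IsAlgebraicSubgroup.of_rat {V : Type} [AddCommGroup V] [Module ℚ V] {H : Subgroup (GLC V)}
    (hH : IsAlgebraicSubgroup ℚ H) : IsAlgebraicSubgroup ℝ H := by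
  obtain ⟨S, hS⟩ := hH
  refine ⟨MvPolynomial.map (algebraMap ℚ ℝ) '' S, fun g => ?_⟩
  rw [hS]
  simp only [Set.forall_mem_image, MvPolynomial.aeval_map_algebraMap]

/-! ### The group `Sym³ SL₂` -/

section CubicGroup

open Matrix

variable {V : Type} [AddCommGroup V] [Module ℚ V] (b : Module.Basis (Fin 4) ℚ V)

theorem cubicRep_mul_inv (h : SpecialLinearGroup (Fin 2) ℂ) :
    cubicRep (h : Matrix (Fin 2) (Fin 2) ℂ) * cubicRep (h⁻¹ : SpecialLinearGroup (Fin 2) ℂ) = 1 :=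
  (cubicRep_mul _ _).symm.trans
    ((congrArg cubicRep (congrArg Subtype.val (mul_inv_cancel h))).trans cubicRep_one)

theorem cubicRep_inv_mul (h : SpecialLinearGroup (Fin 2) ℂ) :
    cubicRep (h⁻¹ : SpecialLinearGroup (Fin 2) ℂ) * cubicRep (h : Matrix (Fin 2) (Fin 2) ℂ) = 1 :=
  (cubicRep_mul _ _).symm.trans
    ((congrArg cubicRep (congrArg Subtype.val (inv_mul_cancel h))).trans cubicRep_one)

/-- The action of `SL₂(ℂ)` on `ℂ ⊗ V` through the third symmetric power of the standard
representation. -/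
def cubicHom : SpecialLinearGroup (Fin 2) ℂ →* GLC V where
  toFun h := glOfMatrix b (cubicRep h) (cubicRep (h⁻¹ : SpecialLinearGroup (Fin 2) ℂ))
    (cubicRep_mul_inv h) (cubicRep_inv_mul h)
  map_one' := glMatrix_injective b (by simp)
  map_mul' g h := glMatrix_injective b (by simp [glMatrix_mul, cubicRep_mul])

@[simp]
theorem glMatrix_cubicHom (h : SpecialLinearGroup (Fin 2) ℂ) :
    glMatrix b (cubicHom b h) = cubicRep (h : Matrix (Fin 2) (Fin 2) ℂ) :=
  glMatrix_glOfMatrix b _ _ (cubicRep_mul_inv h) (cubicRep_inv_mul h)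

theorem cubicHom_injective : Function.Injective (cubicHom b) := by
  intro g h e
  have := congrArg (glMatrix b) e
  rw [glMatrix_cubicHom, glMatrix_cubicHom] at this
  exact Subtype.ext (cubicRep_injective g.2 h.2 this)

/-- The group of complex points of the image of `SL₂` in `GL(Sym³)`. -/
def cubicGroup : Subgroup (GLC V) := (cubicHom b).range

theorem mem_cubicGroup_iff {g : GLC V} :
    g ∈ cubicGroup b ↔ ∃ h : Matrix (Fin 2) (Fin 2) ℂ, h.det = 1 ∧ glMatrix b g = cubicRep h := by
  constructor
  · rintro ⟨h, rfl⟩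
    exact ⟨h, h.2, glMatrix_cubicHom b h⟩
  · rintro ⟨h, hd, e⟩
    exact ⟨⟨h, hd⟩, glMatrix_injective b ((glMatrix_cubicHom b _).trans e.symm)⟩

/-- The form is tested on basis vectors and the cone at rational points only, so that membership
becomes a set of polynomial equations with rational coefficients. -/
theorem mem_cubicGroup_iff_preserves {g : GLC V} :
    g ∈ cubicGroup b ↔
      (∀ i j, cubicForm ((glMatrix b g).col i) ((glMatrix b g).col j) =
        cubicForm (Pi.single i (1 : ℂ)) (Pi.single j 1)) ∧
      ∀ s t : ℚ, IsOnCone ((glMatrix b g).mulVec (veronese (s : ℂ) (t : ℂ))) := by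
  rw [mem_cubicGroup_iff]
  constructor
  · rintro ⟨h, hd, e⟩
    rw [e]
    refine ⟨fun i j => ?_, fun s t => ?_⟩
    · rw [← Matrix.mulVec_single_one, ← Matrix.mulVec_single_one, cubicForm_cubicRep, hd]
      simp
    · rw [cubicRep_mulVec_veronese]
      exact isOnCone_veronese _ _
  · rintro ⟨h1, h2⟩
    refine eq_cubicRep_of_preserves (fun x y => ?_) h2
    set g' := glMatrix b g
    have hs : ∀ z : Fin 4 → ℂ, g'.mulVec z = z 0 • g'.col 0 + z 1 • g'.col 1 + z 2 • g'.col 2 +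
        z 3 • g'.col 3 := by
      intro z
      ext i
      rw [mulVec_fin_four]
      simp [Matrix.col_apply]
      ring
    have key : ∀ i j, g' 0 i * g' 3 j - 3 * g' 1 i * g' 2 j + 3 * g' 2 i * g' 1 j - g' 3 i * g' 0 j
        = cubicForm (Pi.single i (1 : ℂ)) (Pi.single j 1) := by
      intro i j
      rw [← h1 i j]
      rfl
    have e : cubicForm (g'.mulVec x) (g'.mulVec y) = ∑ i, ∑ j, x i * y j *
        (g' 0 i * g' 3 j - 3 * g' 1 i * g' 2 j + 3 * g' 2 i * g' 1 j - g' 3 i * g' 0 j) := by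
      simp only [cubicForm, mulVec_fin_four, Fin.sum_univ_four]
      ring
    rw [e]
    simp only [key, Fin.sum_univ_four]
    simp [cubicForm]
    ring

theorem isAlgebraicSubgroup_cubicGroup : IsAlgebraicSubgroup ℚ (cubicGroup b) := by
  let X : Fin 4 → Fin 4 → MvPolynomial (V × Module.Dual ℚ V) ℚ :=
    fun i j => MvPolynomial.X (b j, b.coord i)
  have hX : ∀ (g : GLC V) i j, MvPolynomial.aeval (matrixCoeff g) (X i j) = glMatrix b g i j := by
    intro g i j
    rw [MvPolynomial.aeval_X, matrixCoeff_basis]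
  let Y : ℚ → ℚ → Fin 4 → MvPolynomial (V × Module.Dual ℚ V) ℚ := fun s t i =>
    MvPolynomial.C (s ^ 3) * X i 0 + MvPolynomial.C (s ^ 2 * t) * X i 1 +
      MvPolynomial.C (s * t ^ 2) * X i 2 + MvPolynomial.C (t ^ 3) * X i 3
  have hY : ∀ (g : GLC V) s t i, MvPolynomial.aeval (matrixCoeff g) (Y s t i) =
      (glMatrix b g).mulVec (veronese (s : ℂ) (t : ℂ)) i := by
    intro g s t i
    simp only [Y, map_add, map_mul, hX, mulVec_fin_four, veronese, MvPolynomial.aeval_C]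
    simp
    ring
  let S₁ : Set (MvPolynomial (V × Module.Dual ℚ V) ℚ) := Set.range fun p : Fin 4 × Fin 4 =>
    cubicForm (fun i => X i p.1) (fun i => X i p.2) -
      MvPolynomial.C (cubicForm (Pi.single p.1 1) (Pi.single p.2 1))
  let S₂ : Set (MvPolynomial (V × Module.Dual ℚ V) ℚ) := Set.range fun p : ℚ × ℚ =>
    Y p.1 p.2 0 * Y p.1 p.2 2 - Y p.1 p.2 1 ^ 2
  let S₃ : Set (MvPolynomial (V × Module.Dual ℚ V) ℚ) := Set.range fun p : ℚ × ℚ =>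
    Y p.1 p.2 1 * Y p.1 p.2 3 - Y p.1 p.2 2 ^ 2
  let S₄ : Set (MvPolynomial (V × Module.Dual ℚ V) ℚ) := Set.range fun p : ℚ × ℚ =>
    Y p.1 p.2 0 * Y p.1 p.2 3 - Y p.1 p.2 1 * Y p.1 p.2 2
  refine ⟨S₁ ∪ (S₂ ∪ (S₃ ∪ S₄)), fun g => ?_⟩
  rw [mem_cubicGroup_iff_preserves]
  simp only [Set.mem_union, or_imp, forall_and, S₁, S₂, S₃, S₄, Set.forall_mem_range, map_sub,
    map_mul, map_pow, hY, Prod.forall, IsOnCone]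
  refine and_congr (forall_congr' fun i => forall_congr' fun j => ?_) Iff.rfl
  have h1 : MvPolynomial.aeval (matrixCoeff g) (cubicForm (fun k => X k i) (fun k => X k j)) =
      cubicForm ((glMatrix b g).col i) ((glMatrix b g).col j) := by
    simp [cubicForm, hX, Matrix.col_apply]
  have h2 : MvPolynomial.aeval (matrixCoeff g) (MvPolynomial.C
      (cubicForm (Pi.single i 1) (Pi.single j 1)) : MvPolynomial (V × Module.Dual ℚ V) ℚ) =
      cubicForm (Pi.single i (1 : ℂ)) (Pi.single j 1) := by
    rw [MvPolynomial.aeval_C]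
    fin_cases i <;> fin_cases j <;> simp [cubicForm]
  rw [h1, h2, sub_eq_zero]

theorem continuous_cubicRep : Continuous (cubicRep : Matrix (Fin 2) (Fin 2) ℂ → _) := by
  refine continuous_matrix fun i j => ?_
  have h : ∀ k l : Fin 2, Continuous fun M : Matrix (Fin 2) (Fin 2) ℂ => M k l :=
    fun k l => continuous_id.matrix_elem k l
  have h00 := h 0 0
  have h01 := h 0 1
  have h10 := h 1 0
  have h11 := h 1 1
  fin_cases i <;> fin_cases j <;> simp [cubicRep] <;> fun_prop

/-- The inclusion `SL₂(ℝ) → SL₂(ℂ)`. -/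
abbrev slComplex : SpecialLinearGroup (Fin 2) ℝ →* SpecialLinearGroup (Fin 2) ℂ :=
  SpecialLinearGroup.map (algebraMap ℝ ℂ)

/-- Since `cubicRep` is injective on determinant one matrices and commutes with conjugation, a
conjugation-invariant image has a conjugation-invariant source. -/
theorem mem_realPoints_cubicGroup_iff {g : GLC V} :
    g ∈ realPoints (cubicGroup b) ↔ ∃ h, g = cubicHom b (slComplex h) := by
  change (g ∈ cubicGroup b ∧ ∀ x, g (complexConj V x) = complexConj V (g x)) ↔ _
  rw [commutes_complexConj_iff b]
  constructor
  · rintro ⟨⟨h, rfl⟩, h2⟩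
    rw [glMatrix_cubicHom, ← cubicRep_map] at h2
    have h3 := cubicRep_injective (by
      rw [← RingHom.mapMatrix_apply, ← RingHom.map_det, h.2, map_one]) h.2 h2
    have hr : ∀ i j, (((h.1 i j).re : ℝ) : ℂ) = h.1 i j := fun i j =>
      Complex.conj_eq_iff_re.1 (congrFun (congrFun h3 i) j)
    refine ⟨⟨Matrix.of fun i j => (h.1 i j).re, ?_⟩, ?_⟩
    · apply Complex.ofReal_injective
      have hd := h.2
      rw [Matrix.det_fin_two] at hd ⊢
      simp only [Matrix.of_apply, Complex.ofReal_sub, Complex.ofReal_mul, hr, hd, Complex.ofReal_one]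
    · congr 1
      ext i j
      exact (hr i j).symm
  · rintro ⟨h, rfl⟩
    refine ⟨⟨_, rfl⟩, ?_⟩
    rw [glMatrix_cubicHom, ← cubicRep_map]
    congr 1
    ext i j
    simp

end CubicGroup
end

noncomputable section

/-! ### `SL₂` and the unit disc -/

section SpecialLinear

open Matrix

variable {F : Type*} [Field F]

/-- Upper unipotent elements of `SL₂`. -/
def upperUnipotent (x : F) : SpecialLinearGroup (Fin 2) F := ⟨!![1, x; 0, 1], by simp⟩

/-- Lower unipotent elements of `SL₂`. -/
def lowerUnipotent (x : F) : SpecialLinearGroup (Fin 2) F := ⟨!![1, 0; x, 1], by simp⟩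

@[simp]
theorem coe_upperUnipotent (x : F) :
    (upperUnipotent x : Matrix (Fin 2) (Fin 2) F) = !![1, x; 0, 1] := rfl

@[simp]
theorem coe_lowerUnipotent (x : F) :
    (lowerUnipotent x : Matrix (Fin 2) (Fin 2) F) = !![1, 0; x, 1] := rfl

theorem SpecialLinearGroup.ext_fin_two {R : Type*} [CommRing R]
    {g h : SpecialLinearGroup (Fin 2) R}
    (h00 : g.1 0 0 = h.1 0 0) (h01 : g.1 0 1 = h.1 0 1) (h10 : g.1 1 0 = h.1 1 0)
    (h11 : g.1 1 1 = h.1 1 1) : g = h := by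
  ext i j
  fin_cases i <;> fin_cases j
  exacts [h00, h01, h10, h11]

theorem SpecialLinearGroup.mul_val_apply {R : Type*} [CommRing R]
    (g h : SpecialLinearGroup (Fin 2) R) (i j : Fin 2) :
    (g * h).1 i j = g.1 i 0 * h.1 0 j + g.1 i 1 * h.1 1 j := by
  rw [show (g * h).1 = g.1 * h.1 from rfl, Matrix.mul_apply, Fin.sum_univ_two]

theorem SpecialLinearGroup.det_eq {R : Type*} [CommRing R] (h : SpecialLinearGroup (Fin 2) R) :
    h.1 0 0 * h.1 1 1 - h.1 0 1 * h.1 1 0 = 1 := by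
  rw [← Matrix.det_fin_two, h.2]

/-- A matrix whose lower left entry c is nonzero is upper · lower · upper unipotent, with lower
parameter c. The last factor is there to make that entry nonzero. The decomposition gives both
connectedness and generation by unipotents. -/
theorem exists_eq_mul_unipotent (h : SpecialLinearGroup (Fin 2) F) :
    ∃ x y z w : F,
      h = upperUnipotent x * lowerUnipotent y * upperUnipotent z * lowerUnipotent w := by
  have hd := SpecialLinearGroup.det_eq h
  obtain ⟨w, hw⟩ : ∃ w, h.1 1 0 - w * h.1 1 1 ≠ 0 := by
    by_cases hc : h.1 1 0 = 0
    · have h11 : h.1 1 1 ≠ 0 := fun h11 => by simp [hc, h11] at hd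
      exact ⟨-(h.1 1 1)⁻¹, by simp [hc, h11]⟩
    · exact ⟨0, by simpa using hc⟩
  set c := h.1 1 0 - w * h.1 1 1 with hc
  refine ⟨(h.1 0 0 - w * h.1 0 1 - 1) / c, c, (h.1 1 1 - 1) / c, w, ?_⟩
  apply SpecialLinearGroup.ext_fin_two <;>
    simp only [SpecialLinearGroup.mul_val_apply, coe_upperUnipotent, coe_lowerUnipotent,
      Matrix.of_apply, Matrix.cons_val', Matrix.cons_val_zero, Matrix.cons_val_one,
      Matrix.cons_val_fin_one]
  · field_simp
    rw [hc]
    linear_combination (-w) * hd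
  · field_simp
    rw [hc]
    linear_combination (-1 : F) * hd
  · field_simp
    rw [hc]
    ring
  · field_simp
    ring

end SpecialLinear

section Disc

open Matrix

/-- The entry `α` of the element `(α, β; β̄, ᾱ)` of `SU(1,1)` that corresponds to `h ∈ SL₂(ℝ)`. -/
def discAlpha (h : SpecialLinearGroup (Fin 2) ℝ) : ℂ :=
  ⟨(h.1 0 0 + h.1 1 1) / 2, (h.1 0 1 - h.1 1 0) / 2⟩

/-- The entry `β` of the element `(α, β; β̄, ᾱ)` of `SU(1,1)` that corresponds to `h ∈ SL₂(ℝ)`. -/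
def discBeta (h : SpecialLinearGroup (Fin 2) ℝ) : ℂ :=
  ⟨(h.1 0 0 - h.1 1 1) / 2, -(h.1 0 1 + h.1 1 0) / 2⟩

theorem discAlpha_mul (g h : SpecialLinearGroup (Fin 2) ℝ) :
    discAlpha (g * h) = discAlpha g * discAlpha h + discBeta g * (starRingEnd ℂ) (discBeta h) := by
  apply Complex.ext <;>
    simp only [discAlpha, discBeta, SpecialLinearGroup.mul_val_apply, Complex.add_re,
      Complex.add_im, Complex.mul_re, Complex.mul_im, Complex.conj_re, Complex.conj_im] <;> ring

theorem discBeta_mul (g h : SpecialLinearGroup (Fin 2) ℝ) :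
    discBeta (g * h) = discAlpha g * discBeta h + discBeta g * (starRingEnd ℂ) (discAlpha h) := by
  apply Complex.ext <;>
    simp only [discAlpha, discBeta, SpecialLinearGroup.mul_val_apply, Complex.add_re,
      Complex.add_im, Complex.mul_re, Complex.mul_im, Complex.conj_re, Complex.conj_im] <;> ring

theorem normSq_discAlpha_sub (h : SpecialLinearGroup (Fin 2) ℝ) :
    Complex.normSq (discAlpha h) - Complex.normSq (discBeta h) = 1 := by
  have := SpecialLinearGroup.det_eq h
  simp only [Complex.normSq_apply, discAlpha, discBeta]
  linear_combination this

/-- The element of `SL₂(ℝ)` that corresponds to `(α, β; β̄, ᾱ)`. -/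
def ofDisc (α β : ℂ) (h : Complex.normSq α - Complex.normSq β = 1) :
    SpecialLinearGroup (Fin 2) ℝ :=
  ⟨!![α.re + β.re, α.im - β.im; -α.im - β.im, α.re - β.re], by
    rw [Matrix.det_fin_two]
    simp only [Complex.normSq_apply] at h
    simp
    linear_combination h⟩

@[simp]
theorem discAlpha_ofDisc (α β : ℂ) (h) : discAlpha (ofDisc α β h) = α := by
  apply Complex.ext <;> simp [discAlpha, ofDisc]

@[simp]
theorem discBeta_ofDisc (α β : ℂ) (h) : discBeta (ofDisc α β h) = β := by
  apply Complex.ext <;> simp [discBeta, ofDisc]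

theorem ext_disc {g h : SpecialLinearGroup (Fin 2) ℝ} (hα : discAlpha g = discAlpha h)
    (hβ : discBeta g = discBeta h) : g = h := by
  have h1 := congrArg Complex.re hα
  have h2 := congrArg Complex.im hα
  have h3 := congrArg Complex.re hβ
  have h4 := congrArg Complex.im hβ
  simp only [discAlpha, discBeta] at h1 h2 h3 h4
  apply SpecialLinearGroup.ext_fin_two <;> linarith

@[simp]
theorem discAlpha_one : discAlpha 1 = 1 := by
  apply Complex.ext <;> simp [discAlpha]

@[simp]
theorem discBeta_one : discBeta 1 = 0 := by
  apply Complex.ext <;> simp [discBeta]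

/-- The action of `SL₂(ℝ) ≅ SU(1,1)` on the unit disc. -/
def discAction (h : SpecialLinearGroup (Fin 2) ℝ) (w : ℂ) : ℂ :=
  (discAlpha h * w + discBeta h) /
    ((starRingEnd ℂ) (discBeta h) * w + (starRingEnd ℂ) (discAlpha h))

/-- This is the invariance of the Hermitian form |z₂|² − |z₁|² under SU(1,1), evaluated at (w, 1).
-/
theorem normSq_denom_sub (h : SpecialLinearGroup (Fin 2) ℝ) (w : ℂ) :
    Complex.normSq ((starRingEnd ℂ) (discBeta h) * w + (starRingEnd ℂ) (discAlpha h)) -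
      Complex.normSq (discAlpha h * w + discBeta h) = 1 - Complex.normSq w := by
  have := normSq_discAlpha_sub h
  simp only [Complex.normSq_apply, Complex.add_re, Complex.add_im, Complex.mul_re, Complex.mul_im,
    Complex.conj_re, Complex.conj_im] at this ⊢
  linear_combination (1 - w.re * w.re - w.im * w.im) * this

theorem mem_unitBall_iff {w : ℂ} : w ∈ Metric.ball (0 : ℂ) 1 ↔ Complex.normSq w < 1 := by
  rw [mem_ball_zero_iff, Complex.normSq_eq_norm_sq]
  constructor
  · intro h
    nlinarith [norm_nonneg w]
  · intro h
    nlinarith [norm_nonneg w]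

theorem denom_ne_zero (h : SpecialLinearGroup (Fin 2) ℝ) {w : ℂ} (hw : w ∈ Metric.ball (0 : ℂ) 1) :
    (starRingEnd ℂ) (discBeta h) * w + (starRingEnd ℂ) (discAlpha h) ≠ 0 := by
  intro h0
  have := normSq_denom_sub h w
  rw [h0, map_zero] at this
  have := Complex.normSq_nonneg (discAlpha h * w + discBeta h)
  have := mem_unitBall_iff.1 hw
  linarith

theorem discAction_mem_ball (h : SpecialLinearGroup (Fin 2) ℝ) {w : ℂ}
    (hw : w ∈ Metric.ball (0 : ℂ) 1) : discAction h w ∈ Metric.ball (0 : ℂ) 1 := by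
  rw [mem_unitBall_iff, discAction, map_div₀,
    div_lt_one (Complex.normSq_pos.2 (denom_ne_zero h hw))]
  have := normSq_denom_sub h w
  have := mem_unitBall_iff.1 hw
  linarith

theorem discAction_mul (g h : SpecialLinearGroup (Fin 2) ℝ) {w : ℂ}
    (hw : w ∈ Metric.ball (0 : ℂ) 1) : discAction (g * h) w = discAction g (discAction h w) := by
  have h1 := denom_ne_zero h hw
  have h2 := denom_ne_zero g (discAction_mem_ball h hw)
  have h3 := denom_ne_zero (g * h) hw
  rw [discAction] at h2
  rw [discAction, discAction, discAction, div_eq_div_iff h3 h2, discAlpha_mul, discBeta_mul]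
  simp only [map_add, map_mul, Complex.conj_conj]
  field_simp
  ring

theorem discAction_zero (h : SpecialLinearGroup (Fin 2) ℝ) :
    discAction h 0 = discBeta h / (starRingEnd ℂ) (discAlpha h) := by
  simp [discAction]

theorem discAlpha_ne_zero (h : SpecialLinearGroup (Fin 2) ℝ) : discAlpha h ≠ 0 := by
  intro h0
  have := normSq_discAlpha_sub h
  rw [h0, map_zero] at this
  linarith [Complex.normSq_nonneg (discBeta h)]

theorem discAction_zero_eq_zero_iff (h : SpecialLinearGroup (Fin 2) ℝ) :
    discAction h 0 = 0 ↔ discBeta h = 0 := by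
  rw [discAction_zero, div_eq_zero_iff]
  simp [discAlpha_ne_zero h]

/-- The value at 0 kills β and the value at 1/2 makes α real; then |α| = 1 leaves α = ±1. -/
theorem discAction_eqOn_id_iff (h : SpecialLinearGroup (Fin 2) ℝ) :
    Set.EqOn (discAction h) id (Metric.ball 0 1) ↔ h = 1 ∨ h = -1 := by
  have m1 : discAlpha (-1) = -1 := by apply Complex.ext <;> simp [discAlpha]
  have m2 : discBeta (-1) = 0 := by apply Complex.ext <;> simp [discBeta]
  constructor
  · intro he
    have hb : discBeta h = 0 := by
      rw [← discAction_zero_eq_zero_iff]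
      exact he (by simp)
    have ha : (starRingEnd ℂ) (discAlpha h) = discAlpha h := by
      have h1 := he (show (1 / 2 : ℂ) ∈ Metric.ball (0 : ℂ) 1 by simp; norm_num)
      have h0 : (starRingEnd ℂ) (discAlpha h) ≠ 0 := by simpa using discAlpha_ne_zero h
      simp only [discAction, hb, map_zero, zero_mul, zero_add, add_zero, id_eq] at h1
      rw [div_eq_iff h0] at h1
      linear_combination (-2) * h1
    have hn := normSq_discAlpha_sub h
    rw [hb, map_zero, sub_zero] at hn
    have hs : discAlpha h * discAlpha h = 1 := by
      conv_lhs => rw [← ha]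
      rw [mul_comm, ha]
      have := Complex.mul_conj (discAlpha h)
      rw [ha, hn] at this
      simpa using this
    rcases mul_self_eq_one_iff.1 hs with h1 | h1
    · left
      exact ext_disc (by rw [h1, discAlpha_one]) (by rw [hb, discBeta_one])
    · right
      exact ext_disc (by rw [h1, m1]) (by rw [hb, m2])
  · rintro (rfl | rfl) w -
    · simp [discAction]
    · simp [discAction, m1, m2]

theorem continuous_ofDisc {X : Type*} [TopologicalSpace X] {α β : X → ℂ}
    (hα : Continuous α) (hβ : Continuous β)
    (h : ∀ x, Complex.normSq (α x) - Complex.normSq (β x) = 1) (i j : Fin 2) :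
    Continuous fun x => (ofDisc (α x) (β x) (h x)).1 i j := by
  have h1 := Complex.continuous_re.comp hα
  have h2 := Complex.continuous_im.comp hα
  have h3 := Complex.continuous_re.comp hβ
  have h4 := Complex.continuous_im.comp hβ
  fin_cases i <;> fin_cases j
  · exact h1.add h3
  · exact h2.sub h4
  · exact h2.neg.sub h4
  · exact h1.sub h3

/-- The element of `SL₂(ℝ)` corresponding to the hyperbolic translation that maps `0` to `w`. -/
def boost (w : Metric.ball (0 : ℂ) 1) : SpecialLinearGroup (Fin 2) ℝ :=
  ofDisc ((1 / √(1 - Complex.normSq w) : ℝ) : ℂ) ((1 / √(1 - Complex.normSq w) : ℝ) * w) (by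
    have h1 : 0 < 1 - Complex.normSq (w : ℂ) := sub_pos.2 (mem_unitBall_iff.1 w.2)
    have h2 := Real.sq_sqrt h1.le
    have h3 : √(1 - Complex.normSq w) ≠ 0 := (Real.sqrt_pos.2 h1).ne'
    rw [map_mul, Complex.normSq_ofReal]
    field_simp
    linarith)

theorem discAction_boost (w : Metric.ball (0 : ℂ) 1) : discAction (boost w) 0 = w := by
  have h1 : 0 < 1 - Complex.normSq (w : ℂ) := sub_pos.2 (mem_unitBall_iff.1 w.2)
  have h3 : ((√(1 - Complex.normSq w) : ℝ) : ℂ) ≠ 0 :=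
    Complex.ofReal_ne_zero.2 (Real.sqrt_pos.2 h1).ne'
  rw [discAction_zero, boost, discAlpha_ofDisc, discBeta_ofDisc, Complex.conj_ofReal]
  push_cast
  field_simp

theorem continuous_boost (i j : Fin 2) : Continuous fun w => (boost w).1 i j := by
  have h : Continuous fun w : Metric.ball (0 : ℂ) 1 => 1 / √(1 - Complex.normSq (w : ℂ)) := by
    refine continuous_const.div ?_ fun w =>
      (Real.sqrt_pos.2 (sub_pos.2 (mem_unitBall_iff.1 w.2))).ne'
    have := Complex.continuous_normSq
    fun_prop
  exact continuous_ofDisc (Complex.continuous_ofReal.comp h)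
    ((Complex.continuous_ofReal.comp h).mul continuous_subtype_val) _ i j

end Disc
end

noncomputable section

/-! ### The domain of the group `Sym³ SL₂` -/

section CubicGroupDomain

open Matrix

variable {V : Type} [AddCommGroup V] [Module ℚ V] (b : Module.Basis (Fin 4) ℚ V)

/-- The action of `SL₂(ℝ)` on `ℂ ⊗ V`. -/
def realCubicHom : SpecialLinearGroup (Fin 2) ℝ →* GLC V := (cubicHom b).comp slComplex

theorem mem_realPoints_iff_realCubicHom {g : GLC V} :
    g ∈ realPoints (cubicGroup b) ↔ ∃ h, realCubicHom b h = g := by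
  rw [mem_realPoints_cubicGroup_iff]
  exact exists_congr fun h => eq_comm

theorem realCubicHom_injective : Function.Injective (realCubicHom b) := by
  intro g h e
  have := cubicHom_injective b e
  ext i j
  have h2 := congrFun (congrFun (congrArg Subtype.val this) i) j
  exact Complex.ofReal_injective h2

theorem glMatrix_realCubicHom (h : SpecialLinearGroup (Fin 2) ℝ) :
    glMatrix b (realCubicHom b h) = cubicRep (h.1.map (algebraMap ℝ ℂ)) :=
  glMatrix_cubicHom b (slComplex h)

theorem continuous_realCubicHom {X : Type*} [TopologicalSpace X]
    {f : X → SpecialLinearGroup (Fin 2) ℝ} (hf : ∀ i j, Continuous fun x => (f x).1 i j) :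
    Continuous fun x => realCubicHom b (f x) := by
  refine continuous_of_glMatrix b ?_
  simp only [glMatrix_realCubicHom]
  refine continuous_cubicRep.comp (continuous_matrix fun i j => ?_)
  exact Complex.continuous_ofReal.comp (hf i j)

/-- The real points are a continuous image of ℝ⁴, through products of four unipotents, hence
connected. -/
theorem realIdentityComponent_cubicGroup :
    realIdentityComponent (cubicGroup b) = (realPoints (cubicGroup b) : Set (GLC V)) := by
  let f : ℝ × ℝ × ℝ × ℝ → GLC V := fun p => realCubicHom b
    (upperUnipotent p.1 * lowerUnipotent p.2.1 * upperUnipotent p.2.2.1 * lowerUnipotent p.2.2.2)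
  have hf : Continuous f := by
    refine continuous_realCubicHom b fun i j => ?_
    fin_cases i <;> fin_cases j <;>
      simp [SpecialLinearGroup.mul_val_apply] <;> fun_prop
  have hr : Set.range f = (realPoints (cubicGroup b) : Set (GLC V)) := by
    ext g
    rw [SetLike.mem_coe, mem_realPoints_iff_realCubicHom]
    constructor
    · rintro ⟨p, rfl⟩
      exact ⟨_, rfl⟩
    · rintro ⟨h, rfl⟩
      obtain ⟨x, y, z, w, rfl⟩ := exists_eq_mul_unipotent h
      exact ⟨(x, y, z, w), rfl⟩
  have hp : IsPreconnected (realPoints (cubicGroup b) : Set (GLC V)) :=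
    hr ▸ isPreconnected_range hf
  exact hp.connectedComponentIn (realPoints (cubicGroup b)).one_mem

/-- Commuting with one upper and one lower unipotent already forces a scalar matrix, and determinant
one leaves ±1. -/
theorem mem_centerSet_cubicGroup_iff {g : GLC V} :
    g ∈ centerSet (cubicGroup b) ↔ g = 1 ∨ g = cubicHom b (-1) := by
  constructor
  · rintro ⟨⟨h, rfl⟩, hc⟩
    have comm : ∀ k, h * k = k * h := fun k => cubicHom_injective b (by
      rw [map_mul, map_mul]; exact hc _ ⟨k, rfl⟩)
    have hu := comm (upperUnipotent 1)
    have hl := comm (lowerUnipotent 1)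
    have u00 := congrFun (congrFun (congrArg Subtype.val hu) 0) 0
    have u01 := congrFun (congrFun (congrArg Subtype.val hu) 0) 1
    have l00 := congrFun (congrFun (congrArg Subtype.val hl) 0) 0
    simp only [SpecialLinearGroup.mul_val_apply, coe_upperUnipotent, coe_lowerUnipotent] at u00 u01 l00
    simp at u00 u01 l00
    have hd := SpecialLinearGroup.det_eq h
    rw [u00, l00] at hd
    have h00 : h.1 0 0 = h.1 1 1 := by linear_combination u01
    rw [h00] at hd
    have hs : h.1 1 1 * h.1 1 1 = 1 := by linear_combination hd
    rcases mul_self_eq_one_iff.1 hs with h1 | h1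
    · left
      rw [← map_one (cubicHom b)]
      congr 1
      apply SpecialLinearGroup.ext_fin_two <;> simp [h00, h1, u00, l00]
    · right
      congr 1
      apply SpecialLinearGroup.ext_fin_two <;> simp [h00, h1, u00, l00]
  · rintro (rfl | rfl)
    · exact ⟨Subgroup.one_mem _, fun h _ => by rw [one_mul, mul_one]⟩
    · refine ⟨⟨_, rfl⟩, ?_⟩
      rintro _ ⟨h, rfl⟩
      rw [← map_mul, ← map_mul]
      congr 1
      simp

theorem discreteTopology_centerSet_cubicGroup :
    DiscreteTopology (centerSet (cubicGroup b)) := by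
  have := t2Space_GLC b
  have hfin : (centerSet (cubicGroup b)).Finite :=
    (Set.toFinite {1, cubicHom b (-1)}).subset fun g hg => (mem_centerSet_cubicGroup_iff b).1 hg
  have := hfin.to_subtype
  infer_instance

/-- The matrix of `Sym³` of the base change from `SL₂(ℝ)` to `SU(1,1)`. -/
def discMatrix (g : GLC V) : Matrix (Fin 4) (Fin 4) ℂ :=
  (Complex.I / 8) • (cubicRep !![1, -Complex.I; 1, Complex.I] * glMatrix b g *
    cubicRep !![Complex.I, Complex.I; -1, 1])

/-- The two Cayley matrices are inverse to each other up to the scalar 2i, and `cubicRep` is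
homogeneous of degree three. The prefactor `Complex.I / 8` in `discMatrix` cancels (2i)³. -/
theorem discMatrix_realCubicHom (h : SpecialLinearGroup (Fin 2) ℝ) :
    discMatrix b (realCubicHom b h) = cubicRep !![discAlpha h, discBeta h;
      (starRingEnd ℂ) (discBeta h), (starRingEnd ℂ) (discAlpha h)] := by
  have e : (!![1, -Complex.I; 1, Complex.I] * h.1.map (algebraMap ℝ ℂ) *
      !![Complex.I, Complex.I; -1, 1] : Matrix (Fin 2) (Fin 2) ℂ) =
      (2 * Complex.I) • !![discAlpha h, discBeta h;
      (starRingEnd ℂ) (discBeta h), (starRingEnd ℂ) (discAlpha h)] := by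
    ext i j
    fin_cases i <;> fin_cases j <;>
      simp [Matrix.mul_apply, Matrix.vecMul, dotProduct, Fin.sum_univ_two] <;> apply Complex.ext <;>
        simp [discAlpha, discBeta] <;> ring
  rw [discMatrix, glMatrix_realCubicHom, ← cubicRep_mul, ← cubicRep_mul, e, cubicRep_smul, smul_smul]
  have : Complex.I / 8 * (2 * Complex.I) ^ 3 = 1 := by
    linear_combination (Complex.I ^ 2 - 1) * Complex.I_sq
  rw [this, one_smul]

theorem continuous_discMatrix : Continuous (discMatrix b) := by
  have := continuous_glMatrix b
  unfold discMatrix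
  fun_prop

open Classical in
/-- The element of `SL₂(ℝ)` that acts as `g`. -/
def realLift (g : GLC V) : SpecialLinearGroup (Fin 2) ℝ :=
  if h : ∃ h, realCubicHom b h = g then h.choose else 1

@[simp]
theorem realLift_realCubicHom (h : SpecialLinearGroup (Fin 2) ℝ) :
    realLift b (realCubicHom b h) = h := by
  have hex : ∃ k, realCubicHom b k = realCubicHom b h := ⟨h, rfl⟩
  rw [realLift, dif_pos hex]
  exact realCubicHom_injective b hex.choose_spec

/-- The subgroup of `SL₂(ℝ)` that fixes the origin of the disc. -/
def rotationSubgroup : Subgroup (SpecialLinearGroup (Fin 2) ℝ) where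
  carrier := {h | discBeta h = 0}
  mul_mem' := by
    intro g h hg hh
    rw [Set.mem_ofPred_eq] at *
    rw [discBeta_mul, hg, hh]; simp
  one_mem' := discBeta_one
  inv_mem' := by
    intro g hg
    rw [Set.mem_ofPred_eq] at *
    have := discBeta_mul g g⁻¹
    rw [mul_inv_cancel, discBeta_one, hg, zero_mul, add_zero] at this
    exact (mul_eq_zero.1 this.symm).resolve_left (discAlpha_ne_zero g)

theorem mem_rotationSubgroup {h : SpecialLinearGroup (Fin 2) ℝ} :
    h ∈ rotationSubgroup ↔ discBeta h = 0 := Iff.rfl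

theorem isCompact_map_rotationSubgroup :
    IsCompact ((rotationSubgroup.map (realCubicHom b) : Subgroup (GLC V)) : Set (GLC V)) := by
  let f : Circle → GLC V := fun z => realCubicHom b (ofDisc (z : ℂ) 0 (by simp))
  have hf : Continuous f := continuous_realCubicHom b fun i j =>
    continuous_ofDisc continuous_subtype_val continuous_const _ i j
  have hr : Set.range f = ((rotationSubgroup.map (realCubicHom b) : Subgroup (GLC V)) :
      Set (GLC V)) := by
    ext g
    constructor
    · rintro ⟨z, rfl⟩
      exact ⟨_, discBeta_ofDisc _ _ _, rfl⟩
    · rintro ⟨h, hh, rfl⟩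
      have hh : discBeta h = 0 := hh
      have hn := normSq_discAlpha_sub h
      rw [hh, map_zero, sub_zero] at hn
      refine ⟨⟨discAlpha h, ?_⟩, ?_⟩
      · rw [Submonoid.unitSphere, ← SetLike.mem_coe]
        simp only [Submonoid.coe_set_mk, Subsemigroup.coe_set_mk, mem_sphere_iff_norm, sub_zero]
        rw [Complex.normSq_eq_norm_sq] at hn
        nlinarith [norm_nonneg (discAlpha h)]
      · exact congrArg (realCubicHom b) (ext_disc (by simp) (by simp [hh]))
  rw [← hr]
  exact isCompact_range hf

/-- On a compact group K' containing the rotations, |α| attains its maximum at some h₀. With j the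
rotation having α = i, the parallelogram law gives |α(h₀h₀)|² + |α(h₀jh₀)|² = 2(|α|⁴ + |β|⁴). Both
summands are at most |α|², so |α|² ≤ 1 at the maximum, and β = 0 on all of K'. -/
theorem isMaximalCompact_cubicGroup :
    IsMaximalCompact (cubicGroup b) (rotationSubgroup.map (realCubicHom b)) := by
  refine ⟨?_, isCompact_map_rotationSubgroup b, ?_⟩
  · rintro _ ⟨h, -, rfl⟩
    exact (mem_realPoints_iff_realCubicHom b).2 ⟨h, rfl⟩
  intro K' hK' hc hle
  refine le_antisymm ?_ hle
  have hcont : Continuous fun g : GLC V => ‖discMatrix b g 0 0‖ :=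
    ((continuous_discMatrix b).matrix_elem 0 0).norm
  obtain ⟨g₀, hg₀, hmax⟩ := hc.exists_isMaxOn ⟨1, K'.one_mem⟩ hcont.continuousOn
  obtain ⟨h₀, rfl⟩ := (mem_realPoints_iff_realCubicHom b).1 (hK' hg₀)
  have hn : ∀ h, ‖discMatrix b (realCubicHom b h) 0 0‖ = ‖discAlpha h‖ ^ 3 := by
    intro h
    rw [discMatrix_realCubicHom]
    simp [cubicRep]
  have hle' : ∀ h, realCubicHom b h ∈ K' → ‖discAlpha h‖ ≤ ‖discAlpha h₀‖ := by
    intro h hh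
    have := hmax hh
    simp only [Set.mem_ofPred_eq, hn] at this
    exact le_of_pow_le_pow_left₀ (by norm_num) (norm_nonneg _) this
  let j : SpecialLinearGroup (Fin 2) ℝ := ofDisc Complex.I 0 (by simp)
  have hj : realCubicHom b j ∈ K' := hle ⟨j, discBeta_ofDisc _ _ _, rfl⟩
  have h1 := hle' (h₀ * h₀) (by rw [map_mul]; exact K'.mul_mem hg₀ hg₀)
  have h2 := hle' (h₀ * (j * h₀)) (by
    rw [map_mul, map_mul]; exact K'.mul_mem hg₀ (K'.mul_mem hj hg₀))
  have hα : ∀ h, ‖discAlpha h‖ ^ 2 - ‖discBeta h‖ ^ 2 = 1 := by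
    intro h
    rw [← Complex.normSq_eq_norm_sq, ← Complex.normSq_eq_norm_sq, normSq_discAlpha_sub]
  have key : ‖discAlpha h₀‖ ^ 2 ≤ 1 := by
    have e1 : ‖discAlpha (h₀ * h₀)‖ ^ 2 + ‖discAlpha (h₀ * (j * h₀))‖ ^ 2 =
        2 * (‖discAlpha h₀‖ ^ 4 + ‖discBeta h₀‖ ^ 4) := by
      simp only [discAlpha_mul, discBeta_mul, j, discAlpha_ofDisc, discBeta_ofDisc, zero_mul,
        add_zero, map_mul, Complex.conj_I]
      have e4 : ∀ z : ℂ, ‖z‖ ^ 4 = Complex.normSq z ^ 2 := fun z => by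
        rw [Complex.normSq_eq_norm_sq]; ring
      rw [e4, e4]
      simp only [← Complex.normSq_eq_norm_sq]
      simp only [Complex.normSq_apply, Complex.add_re,
        Complex.add_im, Complex.mul_re, Complex.mul_im, Complex.conj_re, Complex.conj_im,
        Complex.I_re, Complex.I_im, Complex.neg_re, Complex.neg_im]
      ring
    have a1 : ‖discAlpha (h₀ * h₀)‖ ^ 2 ≤ ‖discAlpha h₀‖ ^ 2 := by gcongr
    have a2 : ‖discAlpha (h₀ * (j * h₀))‖ ^ 2 ≤ ‖discAlpha h₀‖ ^ 2 := by gcongr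
    have a3 : 0 ≤ ‖discBeta h₀‖ ^ 4 := by positivity
    have a4 := hα h₀
    have a5 := sq_nonneg ‖discBeta h₀‖
    nlinarith
  intro g hg
  obtain ⟨h, rfl⟩ := (mem_realPoints_iff_realCubicHom b).1 (hK' hg)
  refine ⟨h, ?_, rfl⟩
  have a1 := hle' h hg
  have a2 : ‖discAlpha h‖ ^ 2 ≤ ‖discAlpha h₀‖ ^ 2 := by gcongr
  have a3 := hα h
  have a4 : ‖discBeta h‖ ^ 2 = 0 := le_antisymm (by linarith) (sq_nonneg _)
  exact norm_eq_zero.1 (pow_eq_zero_iff (by norm_num) |>.1 a4)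

theorem hasDomainUnitDisc_cubicGroup : HasDomainUnitDisc (cubicGroup b) := by
  have hmem : ∀ g, g ∈ realIdentityComponent (cubicGroup b) ↔ ∃ h, realCubicHom b h = g := by
    intro g
    rw [realIdentityComponent_cubicGroup, SetLike.mem_coe, mem_realPoints_iff_realCubicHom]
  refine ⟨_, isMaximalCompact_cubicGroup b, fun g => discAction (realLift b g), ?_, ?_, ?_, ?_, ?_,
    ?_, ?_, ?_⟩
  · intro g _
    refine ⟨fun w hw => discAction_mem_ball _ hw, ?_⟩
    refine DifferentiableOn.div (by fun_prop) (by fun_prop) fun w hw => denom_ne_zero _ hw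
  · have : realLift b 1 = 1 := by
      rw [← map_one (realCubicHom b), realLift_realCubicHom]
    beta_reduce
    rw [this]
    exact (discAction_eqOn_id_iff 1).2 (Or.inl rfl)
  · intro g hg k hk w hw
    obtain ⟨h, rfl⟩ := (hmem _).1 hg
    obtain ⟨k, rfl⟩ := (hmem _).1 hk
    simp only [← map_mul, realLift_realCubicHom, Function.comp_apply]
    exact discAction_mul _ _ hw
  · intro g hg
    obtain ⟨h, rfl⟩ := (hmem _).1 hg
    beta_reduce
    rw [realLift_realCubicHom, discAction_eqOn_id_iff, mem_centerSet_cubicGroup_iff]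
    refine or_congr ?_ ?_
    · rw [← (realCubicHom_injective b).eq_iff, map_one]
    · rw [← (realCubicHom_injective b).eq_iff]
      have : realCubicHom b (-1) = cubicHom b (-1) := by
        refine congrArg (cubicHom b) ?_
        apply SpecialLinearGroup.ext_fin_two <;> simp [slComplex]
      rw [this]
  · intro g hg
    obtain ⟨h, rfl⟩ := (hmem _).1 hg
    beta_reduce
    rw [realLift_realCubicHom, discAction_zero_eq_zero_iff, ← mem_rotationSubgroup]
    exact (Subgroup.mem_map_iff_mem (realCubicHom_injective b)).symm
  · intro w hw
    exact ⟨realCubicHom b (boost ⟨w, hw⟩), (hmem _).2 ⟨_, rfl⟩, by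
      beta_reduce
      rw [realLift_realCubicHom, discAction_boost]⟩
  -- The lift to `SL₂(ℝ)` is a choice, so continuity is read off matrix entries: these two are βᾱ²
  -- and ᾱ³, with quotient β/ᾱ, the image of the origin.
  · have hc : ContinuousOn (fun g : GLC V => discMatrix b g 2 3 / discMatrix b g 3 3)
        (realIdentityComponent (cubicGroup b)) := by
      refine ContinuousOn.div ((continuous_discMatrix b).matrix_elem 2 3).continuousOn
        ((continuous_discMatrix b).matrix_elem 3 3).continuousOn fun g hg => ?_
      obtain ⟨h, rfl⟩ := (hmem _).1 hg
      rw [discMatrix_realCubicHom]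
      simp [cubicRep, discAlpha_ne_zero]
    refine hc.congr fun g hg => ?_
    obtain ⟨h, rfl⟩ := (hmem _).1 hg
    have h0 : (starRingEnd ℂ) (discAlpha h) ≠ 0 := by simpa using discAlpha_ne_zero h
    change discAction (realLift b _) 0 = discMatrix b _ 2 3 / discMatrix b _ 3 3
    rw [realLift_realCubicHom, discAction_zero, discMatrix_realCubicHom]
    simp only [cubicRep, Matrix.of_apply, Matrix.cons_val', Matrix.cons_val, Matrix.cons_val_fin_one]
    field_simp
  · intro O hO
    rw [isOpen_iff_mem_nhds]
    rintro _ ⟨g, ⟨hgO, hg⟩, rfl⟩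
    obtain ⟨h, rfl⟩ := (hmem _).1 hg
    simp only [realLift_realCubicHom]
    have hw : discAction h 0 ∈ Metric.ball (0 : ℂ) 1 := discAction_mem_ball h (by simp)
    -- This element fixes the origin, so w ↦ `boost w * k` is a continuous section of the orbit map
    -- passing through h. Openness follows.
    let k := (boost ⟨_, hw⟩)⁻¹ * h
    have hk0 : discAction k 0 = 0 := by
      have e3 := discAction_mul (boost ⟨_, hw⟩)⁻¹ h (w := 0) (by simp)
      have e4 := discAction_mul (boost ⟨_, hw⟩)⁻¹ (boost ⟨_, hw⟩) (w := 0) (by simp)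
      rw [discAction_boost, inv_mul_cancel] at e4
      rw [show k = (boost ⟨_, hw⟩)⁻¹ * h from rfl, e3, ← e4]
      simp [discAction]
    let f : Metric.ball (0 : ℂ) 1 → GLC V := fun w => realCubicHom b (boost w * k)
    have hf : Continuous f := by
      refine continuous_realCubicHom b fun i j => ?_
      simp only [SpecialLinearGroup.mul_val_apply]
      exact ((continuous_boost i 0).mul continuous_const).add
        ((continuous_boost i 1).mul continuous_const)
    have hopen : IsOpen (Subtype.val '' (f ⁻¹' O)) :=
      Metric.isOpen_ball.isOpenMap_subtype_val _ (hO.preimage hf)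
    refine Filter.mem_of_superset (hopen.mem_nhds ⟨⟨_, hw⟩, ?_, rfl⟩) ?_
    · change realCubicHom b (boost ⟨_, hw⟩ * k) ∈ O
      have e2 : boost ⟨_, hw⟩ * k = h := by simp [k]
      rw [e2]
      exact hgO
    · rintro _ ⟨w, hwO, rfl⟩
      refine ⟨f w, ⟨hwO, (hmem _).2 ⟨_, rfl⟩⟩, ?_⟩
      change discAction (realLift b (realCubicHom b (boost w * k))) 0 = w
      rw [realLift_realCubicHom, discAction_mul _ _ (by simp), hk0, discAction_boost]

end CubicGroupDomain
end

noncomputable section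

/-! ### The Hodge structure on `Sym³` of an elliptic Hodge structure -/

section CubicFiltration

open Matrix ComplexConjugate

variable {V : Type} [AddCommGroup V] [Module ℚ V] (b : Module.Basis (Fin 4) ℚ V)

/-- Coordinates on binary cubics for which the filtration attached to the line spanned by
`(1, τ)` is the coordinate filtration. -/
def filtrationCoords (τ : ℂ) (x : Fin 4 → ℂ) : Fin 4 → ℂ := (cubicRep !![1, 0; -τ, 1]).mulVec x

/-- `F` is the filtration on `ℂ ⊗ V` that is induced on the third symmetric power by the line
spanned by `(1, τ)`. -/
def IsCubicFiltration (τ : ℂ) (F : ℤ → Submodule ℂ (ℂ ⊗[ℚ] V)) : Prop :=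
  ∀ p x, x ∈ F p ↔ ∀ k : Fin 4, 3 < p + (k : ℤ) → filtrationCoords τ (complexCoords b x) k = 0

/-- The matrix with columns `(1, τ)` and `(1, τ̄)`. -/
def periodMatrix (τ : ℂ) : Matrix (Fin 2) (Fin 2) ℂ := !![1, 1; τ, conj τ]

/-- The inverse of `periodMatrix`. -/
def periodMatrixInv (τ : ℂ) : Matrix (Fin 2) (Fin 2) ℂ :=
  (conj τ - τ)⁻¹ • !![conj τ, -1; -τ, 1]

variable {b} {τ : ℂ}

theorem conj_sub_ne_zero (hτ : 0 < τ.im) : conj τ - τ ≠ 0 := by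
  intro h
  have := congrArg Complex.im h
  simp at this
  linarith

theorem periodMatrix_mul_inv (hτ : 0 < τ.im) : periodMatrix τ * periodMatrixInv τ = 1 := by
  have := conj_sub_ne_zero hτ
  rw [periodMatrix, periodMatrixInv, Matrix.mul_smul]
  ext i j
  fin_cases i <;> fin_cases j <;> simp <;> field_simp <;> (try ring_nf) <;> simp

theorem periodMatrixInv_mul (hτ : 0 < τ.im) : periodMatrixInv τ * periodMatrix τ = 1 :=
  mul_eq_one_comm.1 (periodMatrix_mul_inv hτ)

variable (b)

/-- The basis of `ℂ ⊗ V` consisting of `ω³`, `3ω²ω̄`, `3ωω̄²`, `ω̄³`, where `ω = (1, τ)`. -/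
def hodgeBasis (hτ : 0 < τ.im) : Module.Basis (Fin 4) ℂ (ℂ ⊗[ℚ] V) :=
  Module.Basis.ofEquivFun ((complexCoords b).trans
    (Matrix.toLin'OfInv (M := cubicRep (periodMatrix τ)) (M' := cubicRep (periodMatrixInv τ))
      (by rw [← cubicRep_mul, periodMatrix_mul_inv hτ, cubicRep_one])
      (by rw [← cubicRep_mul, periodMatrixInv_mul hτ, cubicRep_one])))

theorem hodgeBasis_equivFun (hτ : 0 < τ.im) (x : ℂ ⊗[ℚ] V) :
    (hodgeBasis b hτ).equivFun x = (cubicRep (periodMatrixInv τ)).mulVec (complexCoords b x) := by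
  simp [hodgeBasis, Matrix.toLin'OfInv]

theorem complexCoords_eq (hτ : 0 < τ.im) (x : ℂ ⊗[ℚ] V) :
    complexCoords b x = (cubicRep (periodMatrix τ)).mulVec ((hodgeBasis b hτ).equivFun x) := by
  rw [hodgeBasis_equivFun, Matrix.mulVec_mulVec, ← cubicRep_mul, periodMatrix_mul_inv hτ,
    cubicRep_one, Matrix.one_mulVec]

theorem complexCoords_hodgeBasis (hτ : 0 < τ.im) (k i : Fin 4) :
    complexCoords b (hodgeBasis b hτ k) i = cubicRep (periodMatrix τ) i k := by
  rw [complexCoords_eq b hτ]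
  have : (hodgeBasis b hτ).equivFun (hodgeBasis b hτ k) = Pi.single k 1 := by
    ext j
    simp [Pi.single_apply, eq_comm]
  rw [this, Matrix.mulVec_single_one, Matrix.col_apply]

theorem complexConj_hodgeBasis (hτ : 0 < τ.im) (k : Fin 4) :
    complexConj V (hodgeBasis b hτ k) = hodgeBasis b hτ k.rev := by
  apply (complexCoords b).injective
  ext i
  rw [complexCoords_complexConj, complexCoords_hodgeBasis, complexCoords_hodgeBasis]
  have h2 : conj (2 : ℂ) = 2 := map_ofNat _ 2
  have h3 : conj (3 : ℂ) = 3 := map_ofNat _ 3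
  fin_cases k <;> fin_cases i <;> simp [cubicRep, periodMatrix, Fin.rev, h2, h3] <;> ring

theorem hodgeBasis_equivFun_complexConj (hτ : 0 < τ.im) (x : ℂ ⊗[ℚ] V) (k : Fin 4) :
    (hodgeBasis b hτ).equivFun (complexConj V x) k = conj ((hodgeBasis b hτ).equivFun x k.rev) := by
  have hx : x = ∑ i, (hodgeBasis b hτ).equivFun x i • hodgeBasis b hτ i :=
    ((hodgeBasis b hτ).sum_equivFun x).symm
  set y := (hodgeBasis b hτ).equivFun x with hy
  rw [hx, map_sum]
  simp only [complexConj_smul, complexConj_hodgeBasis, map_sum, map_smul, Finset.sum_apply,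
    Pi.smul_apply, smul_eq_mul, Module.Basis.equivFun_apply, Module.Basis.repr_self,
    Finsupp.single_apply]
  rw [Finset.sum_eq_single k.rev]
  · simp
  · intro j _ hj
    rw [if_neg, mul_zero]
    rintro rfl
    exact hj (Fin.rev_rev j).symm
  · simp

variable {b} {F : ℤ → Submodule ℂ (ℂ ⊗[ℚ] V)}

/-- The passage from the Hodge basis to the filtration coordinates is upper triangular, with powers
of τ̄ − τ ≠ 0 on the diagonal. Hence both describe the same flag. -/
theorem IsCubicFiltration.mem_iff (hF : IsCubicFiltration b τ F) (hτ : 0 < τ.im) (p : ℤ)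
    (x : ℂ ⊗[ℚ] V) :
    x ∈ F p ↔ ∀ k : Fin 4, 3 < p + (k : ℤ) → (hodgeBasis b hτ).equivFun x k = 0 := by
  rw [hF]
  have h0 := conj_sub_ne_zero hτ
  set z := (hodgeBasis b hτ).equivFun x with hz
  have hy : filtrationCoords τ (complexCoords b x) =
      (cubicRep !![1, 1; 0, conj τ - τ]).mulVec z := by
    rw [complexCoords_eq b hτ, filtrationCoords, Matrix.mulVec_mulVec, ← cubicRep_mul]
    congr 2
    ext i j
    fin_cases i <;> fin_cases j <;> simp [periodMatrix]
    ring
  have y0 : filtrationCoords τ (complexCoords b x) 0 = z 0 + 3 * z 1 + 3 * z 2 + z 3 := by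
    rw [hy, mulVec_fin_four]; simp [cubicRep]
  have y1 : filtrationCoords τ (complexCoords b x) 1 =
      (conj τ - τ) * (z 1 + 2 * z 2 + z 3) := by
    rw [hy, mulVec_fin_four]; simp [cubicRep]; ring
  have y2 : filtrationCoords τ (complexCoords b x) 2 = (conj τ - τ) ^ 2 * (z 2 + z 3) := by
    rw [hy, mulVec_fin_four]; simp [cubicRep]; ring
  have y3 : filtrationCoords τ (complexCoords b x) 3 = (conj τ - τ) ^ 3 * z 3 := by
    rw [hy, mulVec_fin_four]; simp [cubicRep]
  simp only [Fin.forall_fin_succ, Fin.succ_zero_eq_one, Fin.succ_one_eq_two, IsEmpty.forall_iff,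
    and_true, show Fin.succ (2 : Fin 3) = (3 : Fin 4) from rfl, y0, y1, y2, y3, mul_eq_zero,
    h0, false_or, Fin.val_zero, Fin.val_one, Fin.val_two,
    show ((3 : Fin 4) : ℕ) = 3 from rfl, pow_eq_zero_iff, ne_eq, OfNat.ofNat_ne_zero,
    not_false_eq_true, Nat.cast_zero, Nat.cast_one, Nat.cast_ofNat]
  constructor
  · rintro ⟨e0, e1, e2, e3⟩
    have f3 : 3 < p + 3 → z 3 = 0 := e3
    have f2 : 3 < p + 2 → z 2 = 0 := fun h => by
      have := e2 h; rwa [f3 (by linarith), add_zero] at this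
    have f1 : 3 < p + 1 → z 1 = 0 := fun h => by
      have := e1 h; rwa [f3 (by linarith), f2 (by linarith), mul_zero, add_zero, add_zero] at this
    refine ⟨fun h => ?_, f1, f2, f3⟩
    have := e0 h
    rwa [f3 (by linarith), f2 (by linarith), f1 (by linarith), mul_zero, add_zero, add_zero,
      add_zero] at this
  · rintro ⟨e0, e1, e2, e3⟩
    refine ⟨fun h => ?_, fun h => ?_, fun h => ?_, e3⟩
    · rw [e0 h, e1 (by linarith), e2 (by linarith), e3 (by linarith)]; simp
    · rw [e1 h, e2 (by linarith), e3 (by linarith)]; simp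
    · rw [e2 h, e3 (by linarith)]; simp

/-- Conjugation exchanges ω and ω̄, so it reverses the order of the Hodge basis. -/
theorem IsCubicFiltration.mem_conj_iff (hF : IsCubicFiltration b τ F) (hτ : 0 < τ.im) (p : ℤ)
    (x : ℂ ⊗[ℚ] V) :
    x ∈ conjSubmodule (F p) ↔ ∀ k : Fin 4, (k : ℤ) < p → (hodgeBasis b hτ).equivFun x k = 0 := by
  change complexConj V x ∈ F p ↔ _
  rw [hF.mem_iff hτ, ← Fin.revPerm.forall_congr_right]
  refine forall_congr' fun k => ?_
  rw [hodgeBasis_equivFun_complexConj, map_eq_zero, Fin.revPerm_apply, Fin.rev_rev, Fin.val_rev]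
  have : (3 < p + ((4 - (↑k + 1) : ℕ) : ℤ)) ↔ (k : ℤ) < p := by omega
  rw [this]

theorem IsCubicFiltration.mem_hodgePiece_iff (hF : IsCubicFiltration b τ F) (hτ : 0 < τ.im) (p : ℤ)
    (x : ℂ ⊗[ℚ] V) :
    x ∈ hodgePiece 3 F p ↔
      ∀ k : Fin 4, p + (k : ℤ) ≠ 3 → (hodgeBasis b hτ).equivFun x k = 0 := by
  rw [hodgePiece, Submodule.mem_inf, hF.mem_iff hτ, hF.mem_conj_iff hτ]
  constructor
  · rintro ⟨h1, h2⟩ k hk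
    rcases lt_or_gt_of_ne hk with h | h
    · exact h2 k (by push_cast; linarith)
    · exact h1 k h
  · intro h
    exact ⟨fun k hk => h k (by linarith), fun k hk => h k (by push_cast at hk; linarith)⟩

theorem IsCubicFiltration.hodgePiece_eq_span (hF : IsCubicFiltration b τ F) (hτ : 0 < τ.im)
    (k : Fin 4) : hodgePiece 3 F (3 - (k : ℤ)) = Submodule.span ℂ {hodgeBasis b hτ k} := by
  ext x
  rw [hF.mem_hodgePiece_iff hτ, Submodule.mem_span_singleton]
  constructor
  · intro h
    refine ⟨(hodgeBasis b hτ).equivFun x k, ?_⟩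
    conv_rhs => rw [← (hodgeBasis b hτ).sum_equivFun x]
    rw [Finset.sum_eq_single k]
    · intro j _ hj
      rw [h j, zero_smul]
      intro e
      apply hj
      ext
      linarith
    · simp
  · rintro ⟨c, rfl⟩ j hj
    have : k ≠ j := by rintro rfl; exact hj (by ring)
    simp [this]

theorem IsCubicFiltration.hodgePiece_eq_bot (hF : IsCubicFiltration b τ F) (hτ : 0 < τ.im)
    {p : ℤ} (hp : p < 0 ∨ 3 < p) : hodgePiece 3 F p = ⊥ := by
  rw [eq_bot_iff]
  intro x hx
  rw [hF.mem_hodgePiece_iff hτ] at hx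
  rw [Submodule.mem_bot, ← (hodgeBasis b hτ).equivFun.map_eq_zero_iff]
  ext k
  exact hx k (by omega)

theorem IsCubicFiltration.isHodgeStructure (hF : IsCubicFiltration b τ F) (hτ : 0 < τ.im) :
    IsHodgeStructure 3 F where
  finite := Module.Finite.of_basis b
  antitone := by
    intro p q hpq x hx
    rw [hF] at hx ⊢
    exact fun k hk => hx k (by linarith)
  exists_top := ⟨0, eq_top_iff.2 fun x _ => (hF 0 x).2 fun k hk => by omega⟩
  exists_bot := ⟨4, eq_bot_iff.2 fun x hx => by
    rw [hF.mem_iff hτ] at hx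
    rw [Submodule.mem_bot, ← (hodgeBasis b hτ).equivFun.map_eq_zero_iff]
    ext k
    exact hx k (by omega)⟩
  isCompl := by
    intro p
    rw [isCompl_iff, Submodule.disjoint_def, codisjoint_iff, eq_top_iff]
    constructor
    · intro x hx hx'
      rw [hF.mem_iff hτ] at hx
      rw [hF.mem_conj_iff hτ] at hx'
      rw [← (hodgeBasis b hτ).equivFun.map_eq_zero_iff]
      ext k
      by_cases h : 3 < p + (k : ℤ)
      · exact hx k h
      · exact hx' k (by push_cast; linarith)
    · intro x _
      rw [Submodule.mem_sup]
      let y := (hodgeBasis b hτ).equivFun x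
      refine ⟨(hodgeBasis b hτ).equivFun.symm fun k => if 3 < p + (k : ℤ) then 0 else y k, ?_,
        (hodgeBasis b hτ).equivFun.symm fun k => if 3 < p + (k : ℤ) then y k else 0, ?_, ?_⟩
      · rw [hF.mem_iff hτ]
        intro k hk
        rw [LinearEquiv.apply_symm_apply, if_pos hk]
      · rw [hF.mem_conj_iff hτ]
        intro k hk
        rw [LinearEquiv.apply_symm_apply, if_neg]
        push_cast at hk
        linarith
      · rw [← map_add, LinearEquiv.symm_apply_eq]
        ext k
        rw [Pi.add_apply]
        split_ifs <;> simp [y]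

/-- The element of `SL₂(ℂ)` that acts as `z` on `(1, τ)` and as `z⁻¹` on `(1, τ̄)`. -/
def hodgeRotation (hτ : 0 < τ.im) (z : Circle) : SpecialLinearGroup (Fin 2) ℂ :=
  ⟨periodMatrix τ * !![(z : ℂ), 0; 0, (z : ℂ)⁻¹] * periodMatrixInv τ, by
    rw [mul_assoc, Matrix.det_mul_comm, mul_assoc, periodMatrixInv_mul hτ, mul_one]
    simp [Matrix.det_fin_two]⟩

theorem cubicHom_hodgeRotation_apply (hτ : 0 < τ.im) (z : Circle) (k : Fin 4) :
    cubicHom b (hodgeRotation hτ z) (hodgeBasis b hτ k) =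
      (z : ℂ) ^ (3 - (k : ℤ) - (k : ℤ)) • hodgeBasis b hτ k := by
  apply (hodgeBasis b hτ).equivFun.injective
  rw [hodgeBasis_equivFun, complexCoords_apply, complexCoords_eq b hτ, glMatrix_cubicHom]
  have hz : (z : ℂ) ≠ 0 := Circle.coe_ne_zero z
  rw [Matrix.mulVec_mulVec, Matrix.mulVec_mulVec, ← cubicRep_mul, ← cubicRep_mul]
  have : periodMatrixInv τ * (hodgeRotation hτ z).1 * periodMatrix τ =
      !![(z : ℂ), 0; 0, (z : ℂ)⁻¹] := by
    rw [hodgeRotation, mul_assoc, mul_assoc, mul_assoc, periodMatrixInv_mul hτ, mul_one,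
      ← mul_assoc, periodMatrixInv_mul hτ, one_mul]
  rw [this]
  ext i
  rw [mulVec_fin_four]
  fin_cases k <;> fin_cases i <;> simp [cubicRep] <;> field_simp

/-- The symmetric cube of diag(z, z⁻¹) has weights 3, 1, −1, −3 on the Hodge basis, which are the
exponents p − q. An automorphism is determined by its values on a basis. -/
theorem IsCubicFiltration.isCircleAction_iff (hF : IsCubicFiltration b τ F) (hτ : 0 < τ.im)
    (z : Circle) (g : GLC V) : IsCircleAction 3 F z g ↔ g = cubicHom b (hodgeRotation hτ z) := by
  constructor
  · intro h
    apply LinearEquiv.toLinearMap_injective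
    refine (hodgeBasis b hτ).ext fun k => ?_
    have hk : hodgeBasis b hτ k ∈ hodgePiece 3 F (3 - (k : ℤ)) := by
      rw [hF.hodgePiece_eq_span hτ]
      exact Submodule.mem_span_singleton_self _
    have h1 := h _ _ hk
    refine h1.trans ?_
    refine Eq.trans ?_ (cubicHom_hodgeRotation_apply hτ z k).symm
    congr 2
    push_cast
    ring
  · rintro rfl p x hx
    by_cases hp : p < 0 ∨ 3 < p
    · rw [hF.hodgePiece_eq_bot hτ hp, Submodule.mem_bot] at hx
      rw [hx, map_zero, smul_zero]
    · obtain ⟨k, rfl⟩ : ∃ k : Fin 4, p = 3 - (k : ℤ) :=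
        ⟨⟨(3 - p).toNat, by omega⟩, by simp only []; omega⟩
      rw [hF.hodgePiece_eq_span hτ, Submodule.mem_span_singleton] at hx
      obtain ⟨c, rfl⟩ := hx
      rw [map_smul, cubicHom_hodgeRotation_apply hτ, smul_comm]
      congr 3
      push_cast
      ring

theorem IsCubicFiltration.hodgeGroup_le (hF : IsCubicFiltration b τ F) (hτ : 0 < τ.im) :
    hodgeGroup 3 F ≤ cubicGroup b := by
  refine sInf_le ⟨isAlgebraicSubgroup_cubicGroup b, fun z g hg => ?_⟩
  rw [(hF.isCircleAction_iff hτ z g).1 hg]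
  exact ⟨_, rfl⟩

end CubicFiltration
end

noncomputable section

/-! ### Hodge structures with the maximal Hodge group -/

/-- The algebra of functions of the form `Q(x, y) / y ^ N` with a rational polynomial `Q`. -/
def laurentFunctions : Subalgebra ℚ (ℂ × ℂ → ℂ) where
  carrier := {f | ∃ (N : ℕ) (Q : MvPolynomial (Fin 2) ℚ), ∀ p : ℂ × ℂ, p.2 ≠ 0 →
    p.2 ^ N * f p = MvPolynomial.aeval ![p.1, p.2] Q}
  add_mem' := by
    rintro f g ⟨N, Q, h⟩ ⟨N', Q', h'⟩
    refine ⟨N + N', MvPolynomial.X 1 ^ N' * Q + MvPolynomial.X 1 ^ N * Q', fun p hp => ?_⟩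
    simp only [map_add, map_mul, map_pow, MvPolynomial.aeval_X, ← h p hp, ← h' p hp, Pi.add_apply]
    simp
    ring
  mul_mem' := by
    rintro f g ⟨N, Q, h⟩ ⟨N', Q', h'⟩
    refine ⟨N + N', Q * Q', fun p hp => ?_⟩
    simp only [map_mul, ← h p hp, ← h' p hp, Pi.mul_apply]
    ring
  algebraMap_mem' := fun q => ⟨0, MvPolynomial.C q, fun p _ => by
    simp⟩

theorem fst_mem_laurentFunctions : (fun p : ℂ × ℂ => p.1) ∈ laurentFunctions :=
  ⟨0, MvPolynomial.X 0, fun p _ => by simp⟩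

theorem snd_mem_laurentFunctions : (fun p : ℂ × ℂ => p.2) ∈ laurentFunctions :=
  ⟨0, MvPolynomial.X 1, fun p _ => by simp⟩

theorem inv_snd_mem_laurentFunctions : (fun p : ℂ × ℂ => p.2⁻¹) ∈ laurentFunctions :=
  ⟨1, 1, fun p hp => by simp [hp]⟩

/-- Evaluation of functions at a point. -/
def laurentEval (p : ℂ × ℂ) : laurentFunctions →ₐ[ℚ] ℂ :=
  (Pi.evalAlgHom ℚ (fun _ : ℂ × ℂ => ℂ) p).comp laurentFunctions.val

/-- An algebraically independent pair is a generic point over ℚ: a relation with rational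
coefficients that holds there is an identity. -/
theorem laurentEval_eq_zero {a c : ℂ} (h : AlgebraicIndependent ℚ ![a, c]) {f : laurentFunctions}
    (hf : laurentEval (a, c) f = 0) {p : ℂ × ℂ} (hp : p.2 ≠ 0) : laurentEval p f = 0 := by
  obtain ⟨f, N, Q, hQ⟩ := f
  have hc : c ≠ 0 := by simpa using h.ne_zero 1
  have h1 := hQ (a, c) hc
  have h2 : f (a, c) = 0 := hf
  rw [h2, mul_zero] at h1
  have h3 : Q = 0 := h.eq_zero_of_aeval_eq_zero Q h1.symm
  have h4 := hQ p hp
  rw [h3, map_zero] at h4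
  exact (mul_eq_zero.1 h4).resolve_left (pow_ne_zero _ hp)

section Rotations

open Matrix ComplexConjugate

variable {V : Type} [AddCommGroup V] [Module ℚ V] (b : Module.Basis (Fin 4) ℚ V)

/-- The matrix `c + s J` for the complex structure `J` with eigenvector `(1, x + i y)`. -/
def rotationMatrix {A : Type*} [CommRing A] (c s x y y' : A) : Matrix (Fin 2) (Fin 2) A :=
  !![c - s * x * y', s * y'; -s * (x ^ 2 + y ^ 2) * y', c + s * x * y']

/-- For z with rational real and imaginary part, the circle action thereby has entries in ℚ[x, y,
y⁻¹], evaluated at x = Re τ and y = Im τ. -/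
theorem hodgeRotation_eq {τ : ℂ} (hτ : 0 < τ.im) (z : Circle) :
    (hodgeRotation hτ z).1 = rotationMatrix ((z : ℂ).re : ℂ) ((z : ℂ).im : ℂ) (τ.re : ℂ)
      (τ.im : ℂ) (τ.im : ℂ)⁻¹ := by
  set R := rotationMatrix ((z : ℂ).re : ℂ) ((z : ℂ).im : ℂ) (τ.re : ℂ) (τ.im : ℂ) (τ.im : ℂ)⁻¹
    with hR
  have hb : (τ.im : ℂ) ≠ 0 := Complex.ofReal_ne_zero.2 hτ.ne'
  have e : periodMatrix τ * !![(z : ℂ), 0; 0, (z : ℂ)⁻¹] = R * periodMatrix τ := by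
    have h1 : ((z : ℂ)⁻¹ : ℂ) = (z : ℂ).re - (z : ℂ).im * Complex.I := by
      rw [← Circle.coe_inv, Circle.coe_inv_eq_conj]
      apply Complex.ext <;> simp
    have h2 : (z : ℂ) = (z : ℂ).re + (z : ℂ).im * Complex.I := (Complex.re_add_im _).symm
    have h3 : conj τ = τ.re - τ.im * Complex.I := by apply Complex.ext <;> simp
    have h4 : τ = τ.re + τ.im * Complex.I := (Complex.re_add_im τ).symm
    have hI := Complex.I_sq
    rw [periodMatrix, h3, h1, hR, rotationMatrix]
    set c := ((z : ℂ).re : ℂ)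
    set s := ((z : ℂ).im : ℂ)
    set x := (τ.re : ℂ)
    set y := (τ.im : ℂ)
    rw [h2, h4]
    ext i j
    fin_cases i <;> fin_cases j <;> simp <;> field_simp
    · ring
    · ring
    · linear_combination y ^ 2 * s * hI
    · linear_combination y ^ 2 * s * hI
  calc (hodgeRotation hτ z).1 =
      periodMatrix τ * !![(z : ℂ), 0; 0, (z : ℂ)⁻¹] * periodMatrixInv τ := rfl
    _ = R := by rw [e, mul_assoc, periodMatrix_mul_inv hτ, mul_one]

/-- Turns an equation of a ℚ-subgroup, restricted to the rotations with fixed rational (c, s), into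
one rational Laurent function of the parameters (x, y). -/
theorem aeval_matrixCoeff_cubicHom (P : MvPolynomial (V × Module.Dual ℚ V) ℚ) (c s : ℚ) :
    ∃ f : laurentFunctions, ∀ (p : ℂ × ℂ) (h : SpecialLinearGroup (Fin 2) ℂ),
      h.1 = rotationMatrix (c : ℂ) (s : ℂ) p.1 p.2 p.2⁻¹ →
      MvPolynomial.aeval (matrixCoeff (cubicHom b h)) P = laurentEval p f := by
  let M : Matrix (Fin 2) (Fin 2) laurentFunctions :=
    rotationMatrix (algebraMap ℚ _ c) (algebraMap ℚ _ s) ⟨_, fst_mem_laurentFunctions⟩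
      ⟨_, snd_mem_laurentFunctions⟩ ⟨_, inv_snd_mem_laurentFunctions⟩
  let C : V × Module.Dual ℚ V → laurentFunctions := fun i =>
    ∑ k, ∑ l, algebraMap ℚ _ (i.2 (b k)) * algebraMap ℚ _ (b.repr i.1 l) * cubicRep M k l
  refine ⟨MvPolynomial.aeval C P, fun p h hh => ?_⟩
  have hM : cubicRep h.1 = (cubicRep M).map (laurentEval p : laurentFunctions →+* ℂ) := by
    rw [← cubicRep_map, hh]
    congr 1
    ext i j
    fin_cases i <;> fin_cases j <;> simp [M, rotationMatrix] <;> simp [laurentEval]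
  rw [← AlgHom.comp_apply, MvPolynomial.comp_aeval]
  congr 2
  ext ⟨v, φ⟩
  rw [matrixCoeff_eq_sum b, glMatrix_cubicHom, hM]
  simp [C]

variable {b}

/-- The upper right entry s/y determines y and the upper left entry determines x; trace and
determinant give the rest. With complex (x, y) the rotations thus fill a dense part of a conjugacy
class. -/
theorem exists_eq_rotationMatrix {c s : ℂ} (hcs : c ^ 2 + s ^ 2 = 1) (hs : s ≠ 0)
    (k : SpecialLinearGroup (Fin 2) ℂ) (htr : k.1 0 0 + k.1 1 1 = 2 * c) (h01 : k.1 0 1 ≠ 0) :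
    ∃ p : ℂ × ℂ, p.2 ≠ 0 ∧ k.1 = rotationMatrix c s p.1 p.2 p.2⁻¹ := by
  have hd := SpecialLinearGroup.det_eq k
  refine ⟨((c - k.1 0 0) / k.1 0 1, s / k.1 0 1), div_ne_zero hs h01, ?_⟩
  have h11 : k.1 1 1 = 2 * c - k.1 0 0 := by linear_combination htr
  ext i j
  fin_cases i <;> fin_cases j <;> simp [rotationMatrix] <;> field_simp
  · ring
  · rw [h11] at hd
    linear_combination (-1 : ℂ) * hd + hcs
  · rw [h11]; ring

/-- A unipotent is a quotient of two allowed elements: an antidiagonal g has trace 0, and its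
entries are chosen so that the product of the unipotent of parameter x with g has trace x · 6/(5x) =
6/5. Unipotents generate `SL₂`. -/
theorem eq_top_of_forall_trace_mem {H : Subgroup (SpecialLinearGroup (Fin 2) ℂ)}
    (h0 : ∀ k : SpecialLinearGroup (Fin 2) ℂ, k.1 0 0 + k.1 1 1 = 2 * (0 : ℚ) → k.1 0 1 ≠ 0 → k ∈ H)
    (h1 : ∀ k : SpecialLinearGroup (Fin 2) ℂ, k.1 0 0 + k.1 1 1 = 2 * (3 / 5 : ℚ) → k.1 0 1 ≠ 0 →
      k ∈ H) : H = ⊤ := by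
  have hU : ∀ x : ℂ, upperUnipotent x ∈ H := by
    intro x
    by_cases hx : x = 0
    · have : upperUnipotent x = 1 := by
        apply SpecialLinearGroup.ext_fin_two <;> simp [hx]
      rw [this]; exact H.one_mem
    let g : SpecialLinearGroup (Fin 2) ℂ :=
      ⟨!![0, -(5 * x / 6); 6 / (5 * x), 0], by
        have : (x : ℂ) ≠ 0 := hx
        rw [Matrix.det_fin_two]; simp; field_simp⟩
    have g0 : g ∈ H := h0 g (by simp [g]) (by simp [g, hx])
    have g1 : upperUnipotent x * g ∈ H := by
      refine h1 _ ?_ ?_ <;> simp only [SpecialLinearGroup.mul_val_apply] <;> simp [g, hx]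
      field_simp; norm_num
    simpa using H.mul_mem g1 (H.inv_mem g0)
  have hL : ∀ x : ℂ, lowerUnipotent x ∈ H := by
    intro x
    by_cases hx : x = 0
    · have : lowerUnipotent x = 1 := by
        apply SpecialLinearGroup.ext_fin_two <;> simp [hx]
      rw [this]; exact H.one_mem
    let g : SpecialLinearGroup (Fin 2) ℂ :=
      ⟨!![0, 6 / (5 * x); -(5 * x / 6), 0], by
        rw [Matrix.det_fin_two_of]; field_simp; ring⟩
    have g0 : g ∈ H := h0 g (by simp [g]) (by simp [g, hx])
    have g1 : lowerUnipotent x * g ∈ H := by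
      refine h1 _ ?_ ?_ <;> simp only [SpecialLinearGroup.mul_val_apply] <;> simp [g, hx]
      field_simp; norm_num
    simpa using H.mul_mem g1 (H.inv_mem g0)
  rw [eq_top_iff]
  intro h _
  obtain ⟨x, y, z, w, rfl⟩ := exists_eq_mul_unipotent h
  exact H.mul_mem (H.mul_mem (H.mul_mem (hU x) (hL y)) (hU z)) (hL w)

/-- If the real and imaginary parts of `τ` are algebraically independent, then the Hodge group of
the third symmetric power is the full image of `SL₂`. -/
theorem IsCubicFiltration.hodgeGroup_eq {τ : ℂ} {F : ℤ → Submodule ℂ (ℂ ⊗[ℚ] V)}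
    (hF : IsCubicFiltration b τ F) (hτ : 0 < τ.im)
    (hai : AlgebraicIndependent ℚ ![(τ.re : ℂ), (τ.im : ℂ)]) : hodgeGroup 3 F = cubicGroup b := by
  refine le_antisymm (hF.hodgeGroup_le hτ) (le_sInf ?_)
  rintro H ⟨⟨S, hS⟩, hrot⟩
  -- The circle element c + is lies in H, at the generic parameters (Re τ, Im τ). Each equation of H
  -- then holds for every complex pair (x, y) with y ≠ 0.
  have key : ∀ c s : ℚ, c ^ 2 + s ^ 2 = 1 → s ≠ 0 → ∀ k : SpecialLinearGroup (Fin 2) ℂ,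
      k.1 0 0 + k.1 1 1 = 2 * c → k.1 0 1 ≠ 0 → cubicHom b k ∈ H := by
    intro c s hcs hs k htr h01
    obtain ⟨p, hp, hk⟩ := exists_eq_rotationMatrix (c := c) (s := s) (by exact_mod_cast hcs)
      (by exact_mod_cast hs) k htr h01
    let z : Circle := ⟨⟨c, s⟩, by
      rw [Submonoid.unitSphere, ← SetLike.mem_coe]
      simp only [Submonoid.coe_set_mk, Subsemigroup.coe_set_mk, mem_sphere_iff_norm, sub_zero]
      rw [← sq_eq_sq₀ (norm_nonneg _) zero_le_one]
      rw [show (1 : ℝ) ^ 2 = 1 by norm_num, ← Complex.normSq_eq_norm_sq, Complex.normSq_mk]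
      have : ((c ^ 2 + s ^ 2 : ℚ) : ℝ) = 1 := by rw [hcs]; simp
      push_cast at this
      linarith [this, sq ((c : ℚ) : ℝ), sq ((s : ℚ) : ℝ)]⟩
    have hz := hrot z _ ((hF.isCircleAction_iff hτ z _).2 rfl)
    rw [hS] at hz ⊢
    intro P hP
    obtain ⟨f, hf⟩ := aeval_matrixCoeff_cubicHom b P c s
    rw [hf p k hk]
    refine laurentEval_eq_zero hai ?_ hp
    rw [← hz P hP]
    refine (hf _ _ ?_).symm
    rw [hodgeRotation_eq]
    simp [z]
  -- Two rational points of the circle with nonzero imaginary part suffice: (0, 1) and (3/5, 4/5).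
  have htop : H.comap (cubicHom b) = ⊤ :=
    eq_top_of_forall_trace_mem (key 0 1 (by norm_num) (by norm_num))
      (key (3 / 5) (4 / 5) (by norm_num) (by norm_num))
  rintro _ ⟨h, rfl⟩
  have : h ∈ H.comap (cubicHom b) := htop ▸ Subgroup.mem_top h
  exact this

end Rotations

/-- Every nonempty open set of complex numbers contains a number with algebraically independent
real and imaginary parts. -/
theorem exists_algebraicIndependent_re_im {U : Set ℂ} (hU : IsOpen U) (hne : U.Nonempty) :
    ∃ τ ∈ U, AlgebraicIndependent ℚ ![(τ.re : ℂ), (τ.im : ℂ)] := by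
  obtain ⟨z, hz⟩ := hne
  obtain ⟨ε, hε, hball⟩ := Metric.isOpen_iff.1 hU z hz
  -- Only countably many numbers are algebraic over a countable ring, while an interval is
  -- uncountable. This is applied to ℚ for the real part and then to ℚ[x] for the imaginary part.
  have hbad : ∀ (A : Type) [CommRing A] [IsDomain A] [Algebra A ℂ] [Module.IsTorsionFree A ℂ]
      [Countable A] (t : ℝ),
      ∃ x ∈ Set.Ioo (t - ε / 2) (t + ε / 2), Transcendental A ((x : ℝ) : ℂ) := by
    intro A _ _ _ _ _ t
    by_contra! hcon
    have hc : {x : ℂ | IsAlgebraic A x}.Countable := Algebraic.countable A ℂ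
    have h2 : (Set.Ioo (t - ε / 2) (t + ε / 2)).Countable :=
      (hc.preimage Complex.ofReal_injective).mono fun x hx => by
        simpa [Transcendental] using hcon x hx
    rw [← Cardinal.le_aleph0_iff_set_countable, Cardinal.mk_Ioo_real (by linarith)] at h2
    exact absurd h2 (not_le.2 Cardinal.aleph0_lt_continuum)
  obtain ⟨x, hx, hxt⟩ := hbad ℚ z.re
  have hcp : Countable (Polynomial ℚ) :=
    Cardinal.mk_le_aleph0_iff.1 (Polynomial.cardinalMk_le_max.trans (by simp))
  have hcount : Countable (Algebra.adjoin ℚ {(x : ℂ)}) := by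
    rw [Algebra.adjoin_singleton_eq_range_aeval]
    exact (Set.countable_range (Polynomial.aeval (R := ℚ) (x : ℂ))).to_subtype
  obtain ⟨y, hy, hyt⟩ := hbad (Algebra.adjoin ℚ {(x : ℂ)}) z.im
  refine ⟨⟨x, y⟩, hball ?_, ?_⟩
  · rw [Metric.mem_ball, Complex.dist_eq]
    refine (Complex.norm_le_abs_re_add_abs_im _).trans_lt ?_
    have h1 : |x - z.re| < ε / 2 := abs_lt.2 ⟨by linarith [hx.1], by linarith [hx.2]⟩
    have h2 : |y - z.im| < ε / 2 := abs_lt.2 ⟨by linarith [hy.1], by linarith [hy.2]⟩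
    simp only [Complex.sub_re, Complex.sub_im]
    linarith
  · rw [AlgebraicIndependent.iff_transcendental_adjoin_image 1]
    have himg : (![(x : ℂ), (y : ℂ)] : Fin 2 → ℂ) '' {1}ᶜ = {(x : ℂ)} := by
      have : ({1}ᶜ : Set (Fin 2)) = {0} := by
        ext i; fin_cases i <;> simp
      rw [this]; simp
    refine ⟨?_, ?_⟩
    · letI : Unique {j : Fin 2 // j ≠ 1} :=
        { default := ⟨0, by decide⟩
          uniq := by
            rintro ⟨i, hi⟩
            apply Subtype.ext
            apply Fin.ext
            have : (i : ℕ) ≠ 1 := fun h => hi (Fin.ext h)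
            have := i.2
            change (i : ℕ) = 0
            omega }
      rw [algebraicIndependent_unique_type_iff]
      change Transcendental ℚ (x : ℂ)
      exact hxt
    · change Transcendental (Algebra.adjoin ℚ ((![(x : ℂ), (y : ℂ)] : Fin 2 → ℂ) '' {1}ᶜ)) (y : ℂ)
      rw [himg]
      exact hyt
end

noncomputable section

/-! ### The Weierstrass function of a lattice -/

open Filter

/-- Uniqueness for the differential equation `f'' = 6 f² - c`. -/
theorem eventuallyEq_of_deriv_deriv_eq {f g : ℂ → ℂ} {c z₀ : ℂ} (hf : AnalyticAt ℂ f z₀)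
    (hg : AnalyticAt ℂ g z₀) (hf2 : ∀ᶠ z in 𝓝 z₀, deriv (deriv f) z = 6 * f z ^ 2 - c)
    (hg2 : ∀ᶠ z in 𝓝 z₀, deriv (deriv g) z = 6 * g z ^ 2 - c) (h0 : f z₀ = g z₀)
    (h1 : deriv f z₀ = deriv g z₀) : f =ᶠ[𝓝 z₀] g := by
  set d := f - g with hd
  have had : AnalyticAt ℂ d z₀ := hf.sub hg
  have hd1 : deriv d =ᶠ[𝓝 z₀] deriv f - deriv g := by
    filter_upwards [hf.eventually_analyticAt, hg.eventually_analyticAt] with z h h'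
    exact deriv_sub h.differentiableAt h'.differentiableAt
  have hd2 : deriv (deriv d) =ᶠ[𝓝 z₀] fun z => (6 * (f z + g z)) * d z := by
    have := hd1.deriv
    filter_upwards [this, hf.deriv.eventually_analyticAt, hg.deriv.eventually_analyticAt, hf2, hg2]
      with z hz h h' h2 h3
    rw [hz, deriv_sub h.differentiableAt h'.differentiableAt, h2, h3, hd, Pi.sub_apply]
    ring
  have h00 : d z₀ = 0 := by simp [hd, h0]
  have h01 : deriv d z₀ = 0 := by rw [hd1.self_of_nhds]; simp [h1]
  have o1 := had.analyticOrderAt_deriv_add_one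
  have o2 := had.deriv.analyticOrderAt_deriv_add_one
  simp only [h00, h01, sub_zero] at o1 o2
  -- Since d'' = 6(f + g)d, the order of d'' is at least that of d. As d and d' vanish at the point,
  -- a finite order would drop by two, so the order is infinite.
  have o3 : analyticOrderAt d z₀ ≤ analyticOrderAt (deriv (deriv d)) z₀ := by
    rw [analyticOrderAt_congr hd2]
    have : (fun z => 6 * (f z + g z) * d z) = (fun z => 6 * (f z + g z)) * d := rfl
    rw [this, analyticOrderAt_mul (by fun_prop) had]
    exact le_add_self
  have htop : analyticOrderAt d z₀ = ⊤ := by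
    change analyticOrderAt (deriv (deriv d)) z₀ + 1 = analyticOrderAt (deriv d) z₀ at o2
    change analyticOrderAt (deriv d) z₀ + 1 = analyticOrderAt d z₀ at o1
    rw [← o2] at o1
    by_contra hne
    obtain ⟨n, hn⟩ := ENat.ne_top_iff_exists.1 hne
    rw [← hn] at o1 o3
    generalize analyticOrderAt (deriv (deriv d)) z₀ = m at o1 o3
    cases m with
    | top => simp at o1
    | coe m =>
      norm_cast at o1 o3
      omega
  filter_upwards [analyticOrderAt_eq_top.1 htop] with z hz
  exact sub_eq_zero.1 hz

namespace PeriodPair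

variable (L : PeriodPair)

theorem countable_lattice : (L.lattice : Set ℂ).Countable := by
  have : Countable L.lattice := L.latticeEquivProd.injective.countable
  exact Set.to_countable _

theorem isPreconnected_compl_lattice : IsPreconnected (L.lattice : Set ℂ)ᶜ :=
  (L.countable_lattice.isConnected_compl_of_one_lt_rank (by simp)).isPreconnected

theorem hasDerivAt_weierstrassP {z : ℂ} (hz : z ∉ L.lattice) :
    HasDerivAt L.weierstrassP (L.derivWeierstrassP z) z := by
  rw [← L.deriv_weierstrassP]
  exact (L.analyticOnNhd_weierstrassP z hz).differentiableAt.hasDerivAt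

theorem isOpen_compl_lattice : IsOpen (L.lattice : Set ℂ)ᶜ := L.isClosed_lattice.isOpen_compl

/-- Otherwise the regular part of ℘' at 0 would have to cancel the principal part −2/z³, which is
impossible for a function continuous at 0. -/
theorem exists_derivWeierstrassP_ne_zero : ∃ z ∉ L.lattice, L.derivWeierstrassP z ≠ 0 := by
  by_contra! hcon
  have h1 : ∀ᶠ z in 𝓝[≠] (0 : ℂ), L.derivWeierstrassPExcept 0 z * z ^ 3 = 2 := by
    filter_upwards [self_mem_nhdsWithin, mem_nhdsWithin_of_mem_nhds
      (L.compl_lattice_sdiff_singleton_mem_nhds 0)] with z hz hz'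
    have hz0 : z ≠ 0 := hz
    have hzL : z ∉ L.lattice := by simp_all
    have := L.derivWeierstrassPExcept_def 0 z
    simp only [ZeroMemClass.coe_zero, sub_zero, hcon z hzL, zero_add] at this
    rw [this]
    field_simp
  have h2 : Tendsto (fun z => L.derivWeierstrassPExcept 0 z * z ^ 3) (𝓝[≠] (0 : ℂ)) (𝓝 0) := by
    have : ContinuousAt (fun z => L.derivWeierstrassPExcept 0 z * z ^ 3) 0 :=
      (L.analyticAt_derivWeierstrassPExcept 0).continuousAt.mul (by fun_prop)
    have := this.tendsto.mono_left (nhdsWithin_le_nhds (s := {0}ᶜ))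
    simpa using this
  have h3 := h2.congr' h1
  exact two_ne_zero (tendsto_nhds_unique tendsto_const_nhds h3)

/-- Differentiating the equation for ℘'² gives ℘'(2℘'' − 12℘² + g₂) = 0. On the connected complement
of the lattice the factor ℘', which is not identically zero, can be cancelled. -/
theorem deriv_derivWeierstrassP {z : ℂ} (hz : z ∉ L.lattice) :
    deriv L.derivWeierstrassP z = 6 * L.weierstrassP z ^ 2 - L.g₂ / 2 := by
  have ha := L.analyticOnNhd_weierstrassP
  have hb := L.analyticOnNhd_derivWeierstrassP
  have key : ∀ w ∈ (L.lattice : Set ℂ)ᶜ, L.derivWeierstrassP w *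
      (2 * deriv L.derivWeierstrassP w - 12 * L.weierstrassP w ^ 2 + L.g₂) = 0 := by
    intro w hw
    have e : (fun z => L.derivWeierstrassP z ^ 2) =ᶠ[𝓝 w]
        fun z => 4 * L.weierstrassP z ^ 3 - L.g₂ * L.weierstrassP z - L.g₃ := by
      filter_upwards [L.isOpen_compl_lattice.mem_nhds hw] with z hz
      exact L.derivWeierstrassP_sq z hz
    have d1 := ((hb w hw).differentiableAt.hasDerivAt.pow 2)
    have d2 := ((((L.hasDerivAt_weierstrassP hw).pow 3).const_mul 4).sub
      ((L.hasDerivAt_weierstrassP hw).const_mul L.g₂)).sub_const L.g₃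
    have d3 := d1.unique (d2.congr_of_eventuallyEq e)
    simp at d3
    linear_combination d3
  rcases AnalyticOnNhd.eq_zero_or_eq_zero_of_mul_eq_zero hb
    (g := fun w => 2 * deriv L.derivWeierstrassP w - 12 * L.weierstrassP w ^ 2 + L.g₂)
    (fun w hw => by
      have h1 := (hb w hw).deriv
      have h2 := ha w hw
      fun_prop) key L.isPreconnected_compl_lattice with h | h
  · obtain ⟨w, hw, hw'⟩ := L.exists_derivWeierstrassP_ne_zero
    exact absurd (h w hw) hw'
  · have := h z hz
    linear_combination this / 2

theorem tendsto_weierstrassP_cobounded {l : ℂ} (hl : l ∈ L.lattice) :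
    Tendsto L.weierstrassP (𝓝[≠] l) (Bornology.cobounded ℂ) := by
  apply tendsto_cobounded_of_meromorphicOrderAt_neg
  rw [L.order_weierstrassP l hl]
  decide

/-- The local identity spreads over the complement of the countable set of poles, which is
connected; a pole of one function cannot then be a regular point of the other. -/
theorem mem_lattice_of_eventuallyEq {L₁ L₂ : PeriodPair} {u₁ u₂ : ℂ} (h₁ : u₁ ∉ L₁.lattice)
    (h₂ : u₂ ∉ L₂.lattice)
    (h : (fun z => L₁.weierstrassP (z + u₁)) =ᶠ[𝓝 0] fun z => L₂.weierstrassP (z + u₂))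
    {p : ℂ} (hp : p + u₁ ∈ L₁.lattice) : p + u₂ ∈ L₂.lattice := by
  by_contra hp2
  set S : Set ℂ := (fun z => z + u₁) ⁻¹' (L₁.lattice : Set ℂ) ∪
    (fun z => z + u₂) ⁻¹' (L₂.lattice : Set ℂ) with hS
  have hSc : S.Countable := (L₁.countable_lattice.preimage (add_left_injective u₁)).union
    (L₂.countable_lattice.preimage (add_left_injective u₂))
  have hpre : IsPreconnected Sᶜ :=
    (hSc.isConnected_compl_of_one_lt_rank (by simp)).isPreconnected
  have han : ∀ (L : PeriodPair) (u z : ℂ), z + u ∉ L.lattice →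
      AnalyticAt ℂ (fun z => L.weierstrassP (z + u)) z := fun L u z hz =>
    AnalyticAt.fun_comp (g := L.weierstrassP) (L.analyticOnNhd_weierstrassP _ hz) (by fun_prop)
  have heq := AnalyticOnNhd.eqOn_of_preconnected_of_eventuallyEq
    (f := fun z => L₁.weierstrassP (z + u₁)) (g := fun z => L₂.weierstrassP (z + u₂)) (U := Sᶜ)
    (fun z hz => han _ _ _ fun h => hz (Or.inl h)) (fun z hz => han _ _ _ fun h => hz (Or.inr h))
    hpre (z₀ := 0) (by simp [hS, h₁, h₂]) h
  have t1 : Tendsto (fun z => L₁.weierstrassP (z + u₁)) (𝓝[≠] p) (Bornology.cobounded ℂ) := by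
    refine (L₁.tendsto_weierstrassP_cobounded hp).comp ?_
    refine tendsto_nhdsWithin_iff.2 ⟨?_, ?_⟩
    · exact ((continuous_add_const u₁).tendsto p).mono_left nhdsWithin_le_nhds
    · filter_upwards [self_mem_nhdsWithin] with z hz h
      exact hz (add_right_cancel (b := u₁) h)
  have t2 : Tendsto (fun z => L₂.weierstrassP (z + u₂)) (𝓝[≠] p) (𝓝 (L₂.weierstrassP (p + u₂))) :=
    (han _ _ _ hp2).continuousAt.tendsto.mono_left nhdsWithin_le_nhds
  have hev : ∀ᶠ z in 𝓝[≠] p, L₁.weierstrassP (z + u₁) = L₂.weierstrassP (z + u₂) := by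
    have c1 : ∀ᶠ z in 𝓝[≠] p, z + u₁ ∉ L₁.lattice := by
      have : ∀ᶠ z in 𝓝 p, z + u₁ ∈ ((L₁.lattice : Set ℂ) \ {p + u₁})ᶜ :=
        (continuous_add_const u₁).tendsto p
          (L₁.compl_lattice_sdiff_singleton_mem_nhds (p + u₁))
      filter_upwards [mem_nhdsWithin_of_mem_nhds this, self_mem_nhdsWithin] with z hz hz' hzL
      exact hz ⟨hzL, fun h => hz' (add_right_cancel (b := u₁) h)⟩
    have c2 : ∀ᶠ z in 𝓝[≠] p, z + u₂ ∉ L₂.lattice :=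
      mem_nhdsWithin_of_mem_nhds ((continuous_add_const u₂).tendsto p
        (L₂.isOpen_compl_lattice.mem_nhds hp2))
    filter_upwards [c1, c2] with z hz1 hz2
    exact heq fun h => h.elim hz1 hz2
  have t3 := t1.congr' hev
  exact t3.not_tendsto (Metric.disjoint_cobounded_nhds _) t2

/-- Both translates solve ℘'' = 6℘² − g₂/2 with the same initial values. Equality of g₃ is not
needed, since the first-order equation recovers it from those values. -/
theorem eventuallyEq_weierstrassP {L₁ L₂ : PeriodPair} {u₁ u₂ : ℂ} (h₁ : u₁ ∉ L₁.lattice)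
    (h₂ : u₂ ∉ L₂.lattice) (hg : L₁.g₂ = L₂.g₂) (h : L₁.weierstrassP u₁ = L₂.weierstrassP u₂)
    (h' : L₁.derivWeierstrassP u₁ = L₂.derivWeierstrassP u₂) :
    (fun z => L₁.weierstrassP (z + u₁)) =ᶠ[𝓝 0] fun z => L₂.weierstrassP (z + u₂) := by
  have han : ∀ (L : PeriodPair) (u : ℂ), u ∉ L.lattice →
      AnalyticAt ℂ (fun z => L.weierstrassP (z + u)) 0 := fun L u hz =>
    AnalyticAt.fun_comp (g := L.weierstrassP) (L.analyticOnNhd_weierstrassP _ (by simpa using hz))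
      (by fun_prop)
  have hd : ∀ (L : PeriodPair) (u : ℂ), deriv (fun z => L.weierstrassP (z + u)) =
      fun z => L.derivWeierstrassP (z + u) := by
    intro L u
    ext z
    rw [deriv_comp_add_const, L.deriv_weierstrassP]
  have h2 : ∀ (L : PeriodPair) (u : ℂ), u ∉ L.lattice → ∀ᶠ z in 𝓝 (0 : ℂ),
      deriv (deriv fun z => L.weierstrassP (z + u)) z = 6 * L.weierstrassP (z + u) ^ 2 - L.g₂ / 2 := by
    intro L u hu
    have : ∀ᶠ z in 𝓝 (0 : ℂ), z + u ∈ (L.lattice : Set ℂ)ᶜ :=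
      (continuous_add_const u).tendsto 0 (L.isOpen_compl_lattice.mem_nhds (by simpa using hu))
    filter_upwards [this] with z hz
    rw [hd, deriv_comp_add_const, L.deriv_derivWeierstrassP hz]
  refine eventuallyEq_of_deriv_deriv_eq (c := L₁.g₂ / 2) (han _ _ h₁) (han _ _ h₂) (h2 _ _ h₁)
    ?_ (by simpa using h) (by simpa [hd] using h')
  rw [hg]
  exact h2 _ _ h₂

/-- The translates of ℘ by u and v agree near 0, so the pole at −v of one is a pole of the other. -/
theorem sub_mem_lattice_of_eq {u v : ℂ} (hu : u ∉ L.lattice) (hv : v ∉ L.lattice)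
    (h : L.weierstrassP u = L.weierstrassP v) (h' : L.derivWeierstrassP u = L.derivWeierstrassP v) :
    u - v ∈ L.lattice := by
  have := mem_lattice_of_eventuallyEq hv hu (eventuallyEq_weierstrassP hv hu rfl h.symm h'.symm)
    (p := -v) (by simp)
  rwa [neg_add_eq_sub] at this

/-- If x is omitted, 1/(℘ − x), extended by 0 at the lattice points, is entire and doubly periodic.
By Liouville it is constant, hence 0, which is absurd off the lattice. -/
theorem exists_weierstrassP_eq (x : ℂ) : ∃ u ∉ L.lattice, L.weierstrassP u = x := by
  classical
  by_contra! hcon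
  set f : ℂ → ℂ := fun z => if z ∈ L.lattice then 0 else (L.weierstrassP z - x)⁻¹ with hf
  have hdiff1 : ∀ z ∉ L.lattice, DifferentiableAt ℂ f z := by
    intro z hz
    have : f =ᶠ[𝓝 z] fun w => (L.weierstrassP w - x)⁻¹ := by
      filter_upwards [L.isOpen_compl_lattice.mem_nhds hz] with w hw
      exact if_neg hw
    refine DifferentiableAt.congr_of_eventuallyEq ?_ this
    exact ((L.analyticOnNhd_weierstrassP z hz).differentiableAt.sub_const x).inv
      (sub_ne_zero.2 (hcon z hz))
  have hcont : ∀ l ∈ L.lattice, ContinuousAt f l := by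
    intro l hl
    rw [continuousAt_iff_punctured_nhds]
    have h0 : f l = 0 := if_pos hl
    rw [h0]
    have t : Tendsto (fun z => (L.weierstrassP z - x)⁻¹) (𝓝[≠] l) (𝓝 0) := by
      refine tendsto_inv₀_cobounded.comp ?_
      have := L.tendsto_weierstrassP_cobounded hl
      rw [← tendsto_norm_atTop_iff_cobounded] at this ⊢
      refine tendsto_atTop_mono (fun z => ?_) (tendsto_atTop_add_const_right _ (-‖x‖) this)
      have := norm_sub_norm_le (L.weierstrassP z) x
      linarith
    refine t.congr' ?_
    filter_upwards [mem_nhdsWithin_of_mem_nhds (L.compl_lattice_sdiff_singleton_mem_nhds l),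
      self_mem_nhdsWithin] with z hz hz'
    exact (if_neg fun h => hz ⟨h, hz'⟩).symm
  have hdiff : Differentiable ℂ f := by
    intro z
    by_cases hz : z ∈ L.lattice
    · refine (Complex.analyticAt_of_differentiable_on_punctured_nhds_of_continuousAt ?_
        (hcont z hz)).differentiableAt
      filter_upwards [mem_nhdsWithin_of_mem_nhds (L.compl_lattice_sdiff_singleton_mem_nhds z),
        self_mem_nhdsWithin] with w hw hw'
      exact hdiff1 w fun h => hw ⟨h, hw'⟩
    · exact hdiff1 z hz
  have hper : ∀ z w, w ∈ L.lattice → f (z + w) = f z := by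
    intro z w hw
    have h1 : z + w ∈ L.lattice ↔ z ∈ L.lattice :=
      L.lattice.toAddSubgroup.add_mem_cancel_right (y := z) hw
    simp only [hf, h1]
    rw [show L.weierstrassP (z + w) = L.weierstrassP z from L.weierstrassP_add_coe z ⟨w, hw⟩]
  have hconst := hdiff.apply_eq_apply_of_bounded (IsZLattice.isCompact_range_of_periodic L.lattice _
    hdiff.continuous hper).isBounded (L.ω₁ / 2) 0
  have h0 : f 0 = 0 := if_pos L.lattice.zero_mem
  rw [h0] at hconst
  have h1 : f (L.ω₁ / 2) = (L.weierstrassP (L.ω₁ / 2) - x)⁻¹ := if_neg L.ω₁_div_two_notMem_lattice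
  rw [h1, inv_eq_zero, sub_eq_zero] at hconst
  exact hcon _ L.ω₁_div_two_notMem_lattice hconst

theorem exists_weierstrassP_eq_and_deriv_eq {x y : ℂ} (h : y ^ 2 = 4 * x ^ 3 - L.g₂ * x - L.g₃) :
    ∃ u ∉ L.lattice, L.weierstrassP u = x ∧ L.derivWeierstrassP u = y := by
  obtain ⟨u, hu, rfl⟩ := L.exists_weierstrassP_eq x
  rw [← L.derivWeierstrassP_sq u hu] at h
  rcases sq_eq_sq_iff_eq_or_eq_neg.1 h with h | h
  · exact ⟨u, hu, rfl, h.symm⟩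
  · exact ⟨-u, by simpa using hu, L.weierstrassP_neg u, by rw [L.derivWeierstrassP_neg, h]⟩

/-- A lattice is determined by its invariants. -/
theorem mem_lattice_iff_of_g_eq {L₁ L₂ : PeriodPair} (h₂ : L₁.g₂ = L₂.g₂) (h₃ : L₁.g₃ = L₂.g₃)
    {l : ℂ} (hl : l ∈ L₁.lattice) : l ∈ L₂.lattice := by
  -- The invariants agree, so the initial values at a half period of the first lattice are attained
  -- by the second ℘ at some u. The poles of the two translates then correspond, and l is a
  -- difference of two poles.
  obtain ⟨u, hu, h, h'⟩ := L₂.exists_weierstrassP_eq_and_deriv_eq (x := L₁.weierstrassP (L₁.ω₁ / 2))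
    (y := L₁.derivWeierstrassP (L₁.ω₁ / 2))
    (by rw [L₁.derivWeierstrassP_sq _ L₁.ω₁_div_two_notMem_lattice, h₂, h₃])
  have key := fun p => mem_lattice_of_eventuallyEq (p := p) L₁.ω₁_div_two_notMem_lattice hu
    (eventuallyEq_weierstrassP L₁.ω₁_div_two_notMem_lattice hu h₂ h.symm h'.symm)
  have h1 := key (l - L₁.ω₁ / 2) (by simpa using hl)
  have h2 := key (-(L₁.ω₁ / 2)) (by simp)
  have := L₂.lattice.sub_mem h1 h2
  ring_nf at this
  exact this

theorem derivWeierstrassP_half {w : ℂ} (hw : 2 * w ∈ L.lattice) : L.derivWeierstrassP w = 0 := by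
  have h := L.derivWeierstrassP_add_coe (-w) ⟨2 * w, hw⟩
  rw [L.derivWeierstrassP_neg] at h
  rw [show -w + (2 * w) = w by ring] at h
  exact self_eq_neg.1 h

theorem two_mul_mem_lattice {w : ℂ} (hw : w ∉ L.lattice) (h : L.derivWeierstrassP w = 0) :
    2 * w ∈ L.lattice := by
  have := L.sub_mem_lattice_of_eq (u := w) (v := -w) hw (by simpa using hw)
    (L.weierstrassP_neg w).symm (by rw [L.derivWeierstrassP_neg, h, neg_zero])
  rwa [sub_neg_eq_add, ← two_mul] at this

/-- Three half periods, which represent the three nonzero classes. -/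
structure IsHalfPeriods (w₁ w₂ w₃ : ℂ) : Prop where
  two_mul_mem₁ : 2 * w₁ ∈ L.lattice
  two_mul_mem₂ : 2 * w₂ ∈ L.lattice
  two_mul_mem₃ : 2 * w₃ ∈ L.lattice
  notMem₁ : w₁ ∉ L.lattice
  notMem₂ : w₂ ∉ L.lattice
  notMem₃ : w₃ ∉ L.lattice
  sub_notMem₁ : w₂ - w₃ ∉ L.lattice
  sub_notMem₂ : w₁ - w₃ ∉ L.lattice
  sub_notMem₃ : w₁ - w₂ ∉ L.lattice

variable {L}

theorem weierstrassP_half_ne {u v : ℂ} (hu2 : 2 * u ∈ L.lattice) (hv2 : 2 * v ∈ L.lattice)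
    (hu : u ∉ L.lattice) (hv : v ∉ L.lattice) (huv : u - v ∉ L.lattice) :
    L.weierstrassP u ≠ L.weierstrassP v := fun h =>
  huv (L.sub_mem_lattice_of_eq hu hv h
    (by rw [L.derivWeierstrassP_half hu2, L.derivWeierstrassP_half hv2]))

theorem cubic_half {w : ℂ} (hw2 : 2 * w ∈ L.lattice) (hw : w ∉ L.lattice) :
    4 * L.weierstrassP w ^ 3 - L.g₂ * L.weierstrassP w - L.g₃ = 0 := by
  rw [← L.derivWeierstrassP_sq w hw, L.derivWeierstrassP_half hw2]
  ring

namespace IsHalfPeriods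

variable {w₁ w₂ w₃ : ℂ} (h : L.IsHalfPeriods w₁ w₂ w₃)

include h

theorem ne₁ : L.weierstrassP w₂ ≠ L.weierstrassP w₃ :=
  weierstrassP_half_ne h.two_mul_mem₂ h.two_mul_mem₃ h.notMem₂ h.notMem₃ h.sub_notMem₁

theorem ne₂ : L.weierstrassP w₁ ≠ L.weierstrassP w₃ :=
  weierstrassP_half_ne h.two_mul_mem₁ h.two_mul_mem₃ h.notMem₁ h.notMem₃ h.sub_notMem₂

theorem ne₃ : L.weierstrassP w₁ ≠ L.weierstrassP w₂ :=
  weierstrassP_half_ne h.two_mul_mem₁ h.two_mul_mem₂ h.notMem₁ h.notMem₂ h.sub_notMem₃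

theorem sum_eq_zero : L.weierstrassP w₁ + L.weierstrassP w₂ + L.weierstrassP w₃ = 0 := by
  have c₁ := cubic_half h.two_mul_mem₁ h.notMem₁
  have c₂ := cubic_half h.two_mul_mem₂ h.notMem₂
  have c₃ := cubic_half h.two_mul_mem₃ h.notMem₃
  have n₁ := sub_ne_zero.2 h.ne₁
  have n₂ := sub_ne_zero.2 h.ne₂
  have n₃ := sub_ne_zero.2 h.ne₃
  generalize L.weierstrassP w₁ = a at *
  generalize L.weierstrassP w₂ = b at *
  generalize L.weierstrassP w₃ = c at *
  have d₃ : 4 * (a ^ 2 + a * b + b ^ 2) - L.g₂ = 0 :=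
    (mul_eq_zero.1 (show (a - b) * (4 * (a ^ 2 + a * b + b ^ 2) - L.g₂) = 0 by
      linear_combination c₁ - c₂)).resolve_left n₃
  have d₂ : 4 * (a ^ 2 + a * c + c ^ 2) - L.g₂ = 0 :=
    (mul_eq_zero.1 (show (a - c) * (4 * (a ^ 2 + a * c + c ^ 2) - L.g₂) = 0 by
      linear_combination c₁ - c₃)).resolve_left n₂
  exact (mul_eq_zero.1 (show (b - c) * (a + b + c) = 0 by
    linear_combination (d₃ - d₂) / 4)).resolve_left n₁

theorem g₂_eq : L.g₂ = -4 * (L.weierstrassP w₁ * L.weierstrassP w₂ +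
    L.weierstrassP w₁ * L.weierstrassP w₃ + L.weierstrassP w₂ * L.weierstrassP w₃) := by
  have c₁ := cubic_half h.two_mul_mem₁ h.notMem₁
  have c₂ := cubic_half h.two_mul_mem₂ h.notMem₂
  have n₃ := sub_ne_zero.2 h.ne₃
  have hs := h.sum_eq_zero
  generalize L.weierstrassP w₁ = a at *
  generalize L.weierstrassP w₂ = b at *
  generalize L.weierstrassP w₃ = c at *
  have d₃ : 4 * (a ^ 2 + a * b + b ^ 2) - L.g₂ = 0 :=
    (mul_eq_zero.1 (show (a - b) * (4 * (a ^ 2 + a * b + b ^ 2) - L.g₂) = 0 by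
      linear_combination c₁ - c₂)).resolve_left n₃
  linear_combination -d₃ + 4 * (a + b) * hs

theorem g₃_eq : L.g₃ = 4 * (L.weierstrassP w₁ * L.weierstrassP w₂ * L.weierstrassP w₃) := by
  have c₁ := cubic_half h.two_mul_mem₁ h.notMem₁
  rw [h.g₂_eq] at c₁
  linear_combination -c₁ + 4 * L.weierstrassP w₁ ^ 2 * h.sum_eq_zero

theorem derivWeierstrassP_sq {z : ℂ} (hz : z ∉ L.lattice) :
    L.derivWeierstrassP z ^ 2 = 4 * (L.weierstrassP z - L.weierstrassP w₁) *
      (L.weierstrassP z - L.weierstrassP w₂) * (L.weierstrassP z - L.weierstrassP w₃) := by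
  rw [L.derivWeierstrassP_sq z hz, h.g₂_eq, h.g₃_eq]
  linear_combination 4 * L.weierstrassP z ^ 2 * h.sum_eq_zero

end IsHalfPeriods

end PeriodPair
end

noncomputable section

/-! ### Existence of lattices with given invariants -/

section Eisenstein

open UpperHalfPlane ModularForm ModularFormClass MatrixGroups EisensteinSeries Filter

theorem tendsto_eisenstein_atImInfty {k : ℕ} (hk : 3 ≤ k) (hk2 : Even k) :
    Tendsto (E hk) atImInfty (𝓝 1) := by
  have hc := E_qExpansion_coeff_zero hk hk2
  have hv : valueAtInfty (E hk) = 1 := by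
    rw [← hc, UpperHalfPlane.qExpansion_coeff_zero one_pos
      (ModularFormClass.analyticAt_cuspFunction_zero _ one_pos one_mem_strictPeriods_SL)
      (SlashInvariantFormClass.periodic_comp_ofComplex _ one_mem_strictPeriods_SL)]
  obtain ⟨c, hcpos, h⟩ := ModularFormClass.exp_decay_sub_atImInfty' (E hk)
  rw [hv] at h
  have h1 : Tendsto (fun τ : ℍ => Real.exp (-c * τ.im)) atImInfty (𝓝 0) := by
    refine Real.tendsto_exp_atBot.comp ?_
    have : Tendsto (fun τ : ℍ => τ.im) atImInfty atTop := tendsto_comap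
    exact this.const_mul_atTop_of_neg (by linarith)
  simpa using (h.trans_tendsto h1).add_const 1

/-- If f = αE₄³ − βE₆² had no zero, Δ/f would be a modular form of level one and weight 0, hence
constant. At the cusp f tends to α − β ≠ 0 and Δ to 0, so the constant is 0, although Δ has no
zeros. -/
theorem exists_mul_eisenstein_eq {α β : ℂ} (h : α ≠ β) :
    ∃ z : ℍ, α * E₄ z ^ 3 = β * E₆ z ^ 2 := by
  by_contra! hcon
  let f : ModularForm 𝒮ℒ 12 := α • ModularForm.mcast (by decide) (E₄.pow 3) -
    β • ModularForm.mcast (by decide) (E₆.pow 2)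
  have hf : ∀ z, f z = α * E₄ z ^ 3 - β * E₆ z ^ 2 := fun z =>
    congrArg₂ (fun x y => α * x - β * y) (congrFun (ModularForm.coe_pow E₄ 3) z)
      (congrFun (ModularForm.coe_pow E₆ 2) z)
  have hf0 : ∀ z, f z ≠ 0 := fun z => by
    rw [hf, sub_ne_zero]
    exact hcon z
  have hlim : Tendsto f atImInfty (𝓝 (α - β)) := by
    have := (((tendsto_eisenstein_atImInfty (k := 4) (by norm_num) (by decide)).pow 3).const_mul
      α).sub (((tendsto_eisenstein_atImInfty (k := 6) (by norm_num) (by decide)).pow 2).const_mul β)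
    simp only [one_pow, mul_one] at this
    exact this.congr fun z => (hf z).symm
  have hslash : ∀ γ : SL(2, ℤ), (⇑CuspForm.discriminant / ⇑f) ∣[(12 - 12 : ℤ)] γ =
      ⇑CuspForm.discriminant / ⇑f := by
    intro γ
    have hγ : (γ : GL (Fin 2) ℝ) ∈ 𝒮ℒ := ⟨γ, rfl⟩
    simp_rw [div_slash_SL2, SL_slash, SlashInvariantFormClass.slash_action_eq _ _ hγ]
  have hzero : Tendsto (⇑CuspForm.discriminant / ⇑f) atImInfty (𝓝 0) := by
    have h1 : Tendsto CuspForm.discriminant atImInfty (𝓝 0) := discriminant_isZeroAtImInfty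
    simpa using h1.div hlim (sub_ne_zero.2 h)
  let g : ModularForm 𝒮ℒ (12 - 12) :=
    { toFun := ⇑CuspForm.discriminant / ⇑f
      slash_action_eq' := fun _ ⟨γ, hγ⟩ => hγ ▸ hslash γ
      holo' := CuspForm.discriminant.holo'.div f.holo' hf0
      bdd_at_cusps' := by
        intro c hc
        rw [Subgroup.IsArithmetic.isCusp_iff_isCusp_SL2Z] at hc
        rw [OnePoint.isBoundedAt_iff_forall_SL2Z hc]
        intro γ _
        rw [hslash γ]
        exact hzero.isBigO_one ℝ }
  obtain ⟨c, hc⟩ := levelOne_weight_zero_const (F := ModularForm 𝒮ℒ 0) g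
  have hgc : (⇑CuspForm.discriminant / ⇑f : ℍ → ℂ) = Function.const ℍ c := hc
  have hc0 : c = 0 := by
    rw [hgc] at hzero
    exact tendsto_nhds_unique tendsto_const_nhds hzero
  have := congrFun hgc I
  rw [hc0] at this
  exact div_ne_zero (discriminant_ne_zero I) (hf0 I) this

end Eisenstein

namespace PeriodPair

/-- The lattice with basis `s, s τ`. -/
def ofRatio (s τ : ℂ) (hs : s ≠ 0) (hτ : 0 < τ.im) : PeriodPair where
  ω₁ := s
  ω₂ := s * τ
  indep := by
    rw [LinearIndependent.pair_iff]
    intro x y h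
    have h1 : s * (x + y * τ) = 0 := by
      rw [← h, Complex.real_smul, Complex.real_smul]; ring
    have h2 := (mul_eq_zero.1 h1).resolve_left hs
    have h3 := congrArg Complex.im h2
    have h4 := congrArg Complex.re h2
    simp at h3 h4
    have hy : y = 0 := h3.resolve_right hτ.ne'
    simp [hy] at h4
    exact ⟨h4, hy⟩

theorem ofRatio_mem_lattice {s τ : ℂ} (hs : s ≠ 0) (hτ : 0 < τ.im) {z : ℂ} :
    s * z ∈ (ofRatio s τ hs hτ).lattice ↔ ∃ m n : ℤ, m + n * τ = z := by
  rw [mem_lattice]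
  refine exists_congr fun m => exists_congr fun n => ?_
  change (m * s + n * (s * τ) = s * z) ↔ _
  rw [← mul_right_inj' hs (b := m + n * τ)]
  constructor <;> intro h <;> linear_combination h

theorem weierstrassP_eq_tsum (L : PeriodPair) (z : ℂ) : L.weierstrassP z = ∑' x : ℤ × ℤ,
    (1 / (z - (x.1 * L.ω₁ + x.2 * L.ω₂)) ^ 2 - 1 / (x.1 * L.ω₁ + x.2 * L.ω₂) ^ 2) := by
  rw [weierstrassP, ← L.latticeEquivProd.symm.toEquiv.tsum_eq]
  refine tsum_congr fun x => ?_
  simp only [LinearEquiv.coe_toEquiv, L.latticeEquiv_symm_apply]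

theorem G_eq_tsum (L : PeriodPair) (n : ℕ) : L.G n = ∑' x : ℤ × ℤ,
    ((x.1 * L.ω₁ + x.2 * L.ω₂) ^ n)⁻¹ := by
  rw [G, ← L.latticeEquivProd.symm.toEquiv.tsum_eq]
  refine tsum_congr fun x => ?_
  simp only [LinearEquiv.coe_toEquiv, L.latticeEquiv_symm_apply]

theorem weierstrassP_ofRatio {s τ : ℂ} (hs : s ≠ 0) (hτ : 0 < τ.im) (z : ℂ) :
    (ofRatio s τ hs hτ).weierstrassP (s * z) =
      (s ^ 2)⁻¹ * (ofRatio 1 τ one_ne_zero hτ).weierstrassP z := by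
  rw [weierstrassP_eq_tsum, weierstrassP_eq_tsum, ← tsum_mul_left]
  refine tsum_congr fun x => ?_
  change 1 / (s * z - (x.1 * s + x.2 * (s * τ))) ^ 2 - 1 / (x.1 * s + x.2 * (s * τ)) ^ 2 =
    (s ^ 2)⁻¹ * (1 / (z - (x.1 * 1 + x.2 * (1 * τ))) ^ 2 - 1 / (x.1 * 1 + x.2 * (1 * τ)) ^ 2)
  rw [show s * z - (x.1 * s + x.2 * (s * τ)) = s * (z - (x.1 * 1 + x.2 * (1 * τ))) by ring,
    show (x.1 * s + x.2 * (s * τ)) = s * (x.1 * 1 + x.2 * (1 * τ)) by ring, mul_pow, mul_pow,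
    one_div, one_div, one_div, one_div, mul_inv, mul_inv]
  ring

open UpperHalfPlane ModularForm EisensteinSeries in
theorem G_ofRatio {k : ℕ} (hk : 3 ≤ k) (z : ℍ) :
    (ofRatio 1 z one_ne_zero z.2).G k = 2 * riemannZeta k * E hk z := by
  have h1 := tsum_eisSummand_eq_riemannZeta_mul_eisensteinSeries hk z
  have h2 : E hk z = (1 / 2 : ℂ) * eisensteinSeries (N := 1) 0 k z := rfl
  rw [h2, G_eq_tsum]
  calc _ = ∑' v : Fin 2 → ℤ, eisSummand k v z := by
        rw [← ((finTwoArrowEquiv ℤ).symm.trans (Equiv.arrowCongr (Equiv.swap 0 1)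
          (Equiv.refl ℤ))).tsum_eq]
        refine tsum_congr fun x => ?_
        change ((x.1 * 1 + x.2 * (1 * (z : ℂ))) ^ k)⁻¹ = ((x.2 : ℂ) * z + x.1) ^ (-(k : ℤ))
        rw [zpow_neg, zpow_natCast]
        ring_nf
    _ = _ := by rw [h1]; ring

theorem riemannZeta_six : riemannZeta 6 = (Real.pi : ℂ) ^ 6 / 945 := by
  have h := riemannZeta_two_mul_nat (k := 3) (by norm_num)
  have hb : bernoulli 6 = 1 / 42 := by
    rw [bernoulli_eq_bernoulli'_of_ne_one (by norm_num)]
    have h2 : Nat.choose 6 2 = 15 := by decide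
    have h4 : Nat.choose 6 4 = 15 := by decide
    rw [bernoulli'_def]
    norm_num [Finset.sum_range_succ, bernoulli'_eq_zero_of_odd (n := 5) (by decide), h2, h4]
  norm_num [hb, Nat.factorial] at h
  rw [h]
  ring

/-- Here g₂ = (4π⁴/3)E₄ and g₃ = (8π⁶/27)E₆, so the claim is a zero of 27b²E₄³ − a³E₆². The
hypothesis says exactly that the two coefficients differ. -/
theorem exists_invariants_proportional {a b : ℂ} (h : a ^ 3 ≠ 27 * b ^ 2) :
    ∃ (τ : ℂ) (hτ : 0 < τ.im), b ^ 2 * (ofRatio 1 τ one_ne_zero hτ).g₂ ^ 3 =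
      a ^ 3 * (ofRatio 1 τ one_ne_zero hτ).g₃ ^ 2 := by
  obtain ⟨z, hz⟩ := exists_mul_eisenstein_eq h.symm
  refine ⟨z, z.2, ?_⟩
  rw [g₂, g₃, G_ofRatio (k := 4) (by norm_num), G_ofRatio (k := 6) (by norm_num)]
  have e4 : riemannZeta ((4 : ℕ) : ℂ) = (Real.pi : ℂ) ^ 4 / 90 := by exact_mod_cast riemannZeta_four
  have e6 : riemannZeta ((6 : ℕ) : ℂ) = (Real.pi : ℂ) ^ 6 / 945 := by
    exact_mod_cast riemannZeta_six
  rw [e4, e6]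
  linear_combination (64 * Real.pi ^ 12 / 27 ^ 2 : ℂ) * hz

/-- When both invariants are nonzero, u² must be bg₂/(ag₃), and this value works by proportionality.
If one invariant vanishes, a sixth or a fourth root is taken instead; the discriminant conditions
keep u nonzero. -/
theorem exists_scaling {a b g₂ g₃ : ℂ} (h : a ^ 3 ≠ 27 * b ^ 2) (hg : g₂ ^ 3 ≠ 27 * g₃ ^ 2)
    (hab : b ^ 2 * g₂ ^ 3 = a ^ 3 * g₃ ^ 2) : ∃ u : ℂ, u ≠ 0 ∧ a = u ^ 4 * g₂ ∧ b = u ^ 6 * g₃ := by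
  by_cases h2 : g₂ = 0
  · have h3 : g₃ ≠ 0 := by rintro rfl; simp [h2] at hg
    have ha : a = 0 := by simpa [h2, h3] using hab.symm
    have hb : b ≠ 0 := by rintro rfl; simp [ha] at h
    obtain ⟨u, hu⟩ := IsAlgClosed.exists_pow_nat_eq (b / g₃) (n := 6) (by norm_num)
    refine ⟨u, ?_, by simp [ha, h2], by rw [hu]; field_simp⟩
    rintro rfl
    exact div_ne_zero hb h3 (by simpa using hu.symm)
  by_cases h3 : g₃ = 0
  · have hb : b = 0 := by simpa [h2, h3] using hab
    have ha : a ≠ 0 := by rintro rfl; simp [hb] at h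
    obtain ⟨u, hu⟩ := IsAlgClosed.exists_pow_nat_eq (a / g₂) (n := 4) (by norm_num)
    refine ⟨u, ?_, by rw [hu]; field_simp, by simp [hb, h3]⟩
    rintro rfl
    exact div_ne_zero ha h2 (by simpa using hu.symm)
  have ha : a ≠ 0 := by
    rintro rfl
    have : b = 0 := by simpa [h2] using hab
    simp [this] at h
  have hb : b ≠ 0 := by
    rintro rfl
    simp [ha, h3] at hab
  set w := (b * g₂) / (a * g₃) with hw
  have hw2 : w ^ 2 = a / g₂ := by
    rw [hw]; field_simp; linear_combination hab
  obtain ⟨u, hu⟩ := IsAlgClosed.exists_pow_nat_eq w (n := 2) (by norm_num)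
  refine ⟨u, ?_, ?_, ?_⟩
  · rintro rfl
    rw [← hu] at hw2
    exact div_ne_zero ha h2 (by simpa using hw2.symm)
  · rw [show u ^ 4 = (u ^ 2) ^ 2 by ring, hu, hw2]; field_simp
  · rw [show u ^ 6 = (u ^ 2) ^ 2 * u ^ 2 by ring, hu, hw2, hw]; field_simp

/-- The coordinates of the three half periods. -/
def halfCoords : Fin 3 → ℝ × ℝ := ![(1 / 2, 0), (0, 1 / 2), (1 / 2, 1 / 2)]

/-- The half periods of the lattice with basis `s, s τ`. -/
def halfPeriod (τ : ℂ) (i : Fin 3) : ℂ := (halfCoords i).1 + (halfCoords i).2 * τ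

theorem coords_mem_lattice {s τ : ℂ} (hs : s ≠ 0) (hτ : 0 < τ.im) {a b : ℝ} :
    s * (a + b * τ) ∈ (ofRatio s τ hs hτ).lattice ↔ (∃ m : ℤ, m = a) ∧ ∃ n : ℤ, n = b := by
  rw [ofRatio_mem_lattice]
  constructor
  · rintro ⟨m, n, h⟩
    have h1 := congrArg Complex.im h
    have h2 := congrArg Complex.re h
    simp at h1 h2
    rw [h1.resolve_right hτ.ne'] at h2
    exact ⟨⟨m, by linarith⟩, n, h1.resolve_right hτ.ne'⟩
  · rintro ⟨⟨m, rfl⟩, n, rfl⟩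
    exact ⟨m, n, by simp⟩

theorem not_exists_int_eq_half {x : ℝ} (hx : x = 1 / 2 ∨ x = -(1 / 2)) : ¬ ∃ m : ℤ, (m : ℝ) = x := by
  rintro ⟨m, hm⟩
  have h2 : (2 * m : ℝ) = 1 ∨ (2 * m : ℝ) = -1 := by
    rcases hx with h | h
    · left; rw [hm, h]; norm_num
    · right; rw [hm, h]; norm_num
  norm_cast at h2
  omega

theorem isHalfPeriods_ofRatio {s τ : ℂ} (hs : s ≠ 0) (hτ : 0 < τ.im) (σ : Equiv.Perm (Fin 3)) :
    (ofRatio s τ hs hτ).IsHalfPeriods (s * halfPeriod τ (σ 0)) (s * halfPeriod τ (σ 1))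
      (s * halfPeriod τ (σ 2)) := by
  have h2 : ∀ i, 2 * (s * halfPeriod τ i) ∈ (ofRatio s τ hs hτ).lattice := by
    intro i
    have : 2 * (s * halfPeriod τ i) =
        s * (((2 * (halfCoords i).1 : ℝ) : ℂ) + ((2 * (halfCoords i).2 : ℝ) : ℂ) * τ) := by
      rw [halfPeriod]; push_cast; ring
    rw [this, coords_mem_lattice]
    fin_cases i
    · exact ⟨⟨1, by simp [halfCoords]⟩, 0, by simp [halfCoords]⟩
    · exact ⟨⟨0, by simp [halfCoords]⟩, 1, by simp [halfCoords]⟩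
    · exact ⟨⟨1, by simp [halfCoords]⟩, 1, by simp [halfCoords]⟩
  have h1 : ∀ i, s * halfPeriod τ i ∉ (ofRatio s τ hs hτ).lattice := by
    intro i
    rw [halfPeriod, coords_mem_lattice]
    rintro ⟨ha, hb⟩
    fin_cases i
    · exact not_exists_int_eq_half (by simp [halfCoords]) ha
    · exact not_exists_int_eq_half (by simp [halfCoords]) hb
    · exact not_exists_int_eq_half (by simp [halfCoords]) hb
  have h3 : ∀ i j, i ≠ j → s * halfPeriod τ i - s * halfPeriod τ j ∉ (ofRatio s τ hs hτ).lattice := by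
    intro i j hij
    have : s * halfPeriod τ i - s * halfPeriod τ j =
        s * ((((halfCoords i).1 - (halfCoords j).1 : ℝ) : ℂ) +
          (((halfCoords i).2 - (halfCoords j).2 : ℝ) : ℂ) * τ) := by
      rw [halfPeriod, halfPeriod]; push_cast; ring
    rw [this, coords_mem_lattice]
    rintro ⟨ha, hb⟩
    fin_cases i <;> fin_cases j <;> first
      | exact hij rfl
      | (refine not_exists_int_eq_half ?_ ha; norm_num [halfCoords]; done)
      | (refine not_exists_int_eq_half ?_ hb; norm_num [halfCoords])
  exact ⟨h2 _, h2 _, h2 _, h1 _, h1 _, h1 _, h3 _ _ (by simp), h3 _ _ (by simp), h3 _ _ (by simp)⟩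

theorem cubic_eq_zero {A x y z w : ℂ} (hA : A ≠ 0) (h : A * ((w - x) * (w - y) * (w - z)) = 0) :
    w = x ∨ w = y ∨ w = z := by
  rcases mul_eq_zero.1 ((mul_eq_zero.1 h).resolve_left hA) with h | h
  · rcases mul_eq_zero.1 h with h | h
    · exact Or.inl (sub_eq_zero.1 h)
    · exact Or.inr (Or.inl (sub_eq_zero.1 h))
  · exact Or.inr (Or.inr (sub_eq_zero.1 h))

/-- Every `l ≠ 0, 1` is the modular invariant `λ` of a lattice, normalized so that the first two
values of `℘` at the half periods have difference `1`. -/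
theorem exists_ofRatio_eq {l : ℂ} (h0 : l ≠ 0) (h1 : l ≠ 1) :
    ∃ (s τ : ℂ) (hs : s ≠ 0) (hτ : 0 < τ.im) (σ : Equiv.Perm (Fin 3)),
      (ofRatio s τ hs hτ).weierstrassP (s * halfPeriod τ (σ 1)) -
        (ofRatio s τ hs hτ).weierstrassP (s * halfPeriod τ (σ 0)) = 1 ∧
      (ofRatio s τ hs hτ).weierstrassP (s * halfPeriod τ (σ 2)) -
        (ofRatio s τ hs hτ).weierstrassP (s * halfPeriod τ (σ 0)) = l := by
  -- The roots 0, 1, l of the Legendre cubic, translated to have sum zero; a and b are the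
  -- corresponding Weierstrass invariants, with discriminant 16(l(l − 1))².
  set r : Fin 3 → ℂ := ![-(1 + l) / 3, 1 - (1 + l) / 3, l - (1 + l) / 3] with hr
  set a : ℂ := -4 * (r 0 * r 1 + r 0 * r 2 + r 1 * r 2) with ha
  set b : ℂ := 4 * (r 0 * r 1 * r 2) with hb
  have hsum : r 0 + r 1 + r 2 = 0 := by simp [hr]; ring
  have hdisc : a ^ 3 - 27 * b ^ 2 = 16 * (l * (l - 1)) ^ 2 := by
    simp [ha, hb, hr]; ring
  have hne : a ^ 3 ≠ 27 * b ^ 2 := by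
    rw [← sub_ne_zero, hdisc]
    exact mul_ne_zero (by norm_num) (pow_ne_zero _ (mul_ne_zero h0 (sub_ne_zero.2 h1)))
  obtain ⟨τ, hτ, hab⟩ := exists_invariants_proportional hne
  set L := ofRatio 1 τ one_ne_zero hτ with hL
  have H := isHalfPeriods_ofRatio one_ne_zero hτ (Equiv.refl _)
  simp only [one_mul, Equiv.refl_apply] at H
  rw [← hL] at H
  set e : Fin 3 → ℂ := fun i => L.weierstrassP (halfPeriod τ i) with he
  have hg : L.g₂ ^ 3 ≠ 27 * L.g₃ ^ 2 := by
    rw [← sub_ne_zero, H.g₂_eq, H.g₃_eq]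
    have := mul_ne_zero (mul_ne_zero (sub_ne_zero.2 H.ne₁) (sub_ne_zero.2 H.ne₂))
      (sub_ne_zero.2 H.ne₃)
    have hs := H.sum_eq_zero
    intro h
    apply this
    have h3 : L.weierstrassP (halfPeriod τ 2) =
        -L.weierstrassP (halfPeriod τ 0) - L.weierstrassP (halfPeriod τ 1) := by
      linear_combination hs
    rw [h3] at h ⊢
    apply pow_eq_zero_iff (two_ne_zero) |>.1
    linear_combination h / 16
  obtain ⟨u, hu, h2, h3⟩ := exists_scaling hne hg hab
  have hroot : ∀ i, ∃ j, r i = u ^ 2 * e j := by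
    intro i
    have hri : 4 * r i ^ 3 - a * r i - b = 0 := by
      rw [ha, hb]
      fin_cases i
      · change 4 * r 0 ^ 3 - _ * r 0 - _ = 0
        linear_combination 4 * r 0 ^ 2 * hsum
      · change 4 * r 1 ^ 3 - _ * r 1 - _ = 0
        linear_combination 4 * r 1 ^ 2 * hsum
      · change 4 * r 2 ^ 3 - _ * r 2 - _ = 0
        linear_combination 4 * r 2 ^ 2 * hsum
    rw [h2, h3, H.g₂_eq, H.g₃_eq] at hri
    rcases cubic_eq_zero (A := 4) (x := u ^ 2 * e 0) (y := u ^ 2 * e 1) (z := u ^ 2 * e 2)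
      (w := r i) (by norm_num) (by
        simp only [he]
        linear_combination hri - 4 * r i ^ 2 * u ^ 2 * H.sum_eq_zero) with h | h | h
    exacts [⟨0, h⟩, ⟨1, h⟩, ⟨2, h⟩]
  -- The cubic with invariants u⁴g₂ and u⁶g₃ has as roots u² times the half-period values. As the
  -- numbers `r i` are distinct, the matching is a permutation of the half periods.
  choose σ hσ using hroot
  have hrinj : Function.Injective r := by
    have d01 : r 1 - r 0 = 1 := by simp [hr]; ring
    have d02 : r 2 - r 0 = l := by simp [hr]; ring
    have n01 : r 0 ≠ r 1 := fun h => by simp [h] at d01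
    have n02 : r 0 ≠ r 2 := fun h => h0 (by rw [← d02, h, sub_self])
    have n12 : r 1 ≠ r 2 := fun h => h1 (by rw [← d02, ← d01, h])
    intro i j hij
    fin_cases i <;> fin_cases j <;> first
      | rfl
      | exact absurd hij n01
      | exact absurd hij n02
      | exact absurd hij n12
      | exact absurd hij.symm n01
      | exact absurd hij.symm n02
      | exact absurd hij.symm n12
  have hσinj : Function.Injective σ := fun i j hij => hrinj (by rw [hσ i, hσ j, hij])
  let σ' : Equiv.Perm (Fin 3) := Equiv.ofBijective σ (Finite.injective_iff_bijective.1 hσinj)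
  refine ⟨u⁻¹, τ, inv_ne_zero hu, hτ, σ', ?_⟩
  have hval : ∀ i, (ofRatio u⁻¹ τ (inv_ne_zero hu) hτ).weierstrassP (u⁻¹ * halfPeriod τ (σ' i)) =
      r i := by
    intro i
    rw [weierstrassP_ofRatio, hσ i]
    simp [he, σ', hL]
  simp only [hval]
  constructor <;> simp [hr] <;> ring

end PeriodPair
end

noncomputable section

/-! ### Dependence of the Weierstrass function on the lattice -/

open Filter

namespace PeriodPair

/-- The norms |x + yτ| on ℝ² are equivalent to the maximum norm with constants that can be kept
fixed while Im τ stays bounded below and |τ| bounded above. -/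
theorem exists_mul_max_le_norm {τ₀ : ℂ} (h : 0 < τ₀.im) : ∃ ε > 0, ∃ c > 0, ∃ C ≥ 1,
    ∀ τ ∈ Metric.ball τ₀ ε, 0 < τ.im ∧ (∀ x y : ℝ, c * max |x| |y| ≤ ‖(x : ℂ) + y * τ‖) ∧
      ∀ x y : ℝ, ‖(x : ℂ) + y * τ‖ ≤ C * max |x| |y| := by
  set δ := τ₀.im / 2 with hδ
  have hδ0 : 0 < δ := by positivity
  set B := ‖τ₀‖ + δ with hB
  have hB0 : 0 < B := by positivity
  refine ⟨δ, hδ0, (1 + B / δ + 1 / δ)⁻¹, by positivity, 1 + B, by linarith, fun τ hτ => ?_⟩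
  rw [Metric.mem_ball, Complex.dist_eq] at hτ
  have him : δ ≤ τ.im := by
    have h1 := Complex.abs_im_le_norm (τ - τ₀)
    rw [Complex.sub_im] at h1
    have := abs_le.1 (h1.trans hτ.le)
    linarith [this.1]
  have hnorm : ‖τ‖ ≤ B := by
    have := norm_le_norm_add_norm_sub' τ τ₀
    linarith
  refine ⟨hδ0.trans_le him, fun x y => ?_, fun x y => ?_⟩
  · set n := ‖(x : ℂ) + y * τ‖ with hn
    have hy : |y| ≤ n / δ := by
      rw [le_div_iff₀ hδ0]
      have h1 := Complex.abs_im_le_norm ((x : ℂ) + y * τ)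
      simp [abs_mul] at h1
      refine le_trans ?_ h1
      exact mul_le_mul_of_nonneg_left (him.trans (le_abs_self _)) (abs_nonneg y)
    have hx : |x| ≤ n + n / δ * B := by
      have h1 : (x : ℂ) = ((x : ℂ) + y * τ) - y * τ := by ring
      have h2 := norm_sub_le ((x : ℂ) + y * τ) (y * τ)
      rw [← h1, norm_mul, Complex.norm_real, Complex.norm_real, Real.norm_eq_abs,
        Real.norm_eq_abs] at h2
      have := mul_le_mul hy hnorm (norm_nonneg _) (by positivity)
      linarith
    rw [inv_mul_le_iff₀ (by positivity)]
    have hn0 : 0 ≤ n := norm_nonneg _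
    have e : (1 + B / δ + 1 / δ) * n = n + n / δ * B + n / δ := by field_simp
    rw [e]
    have : 0 ≤ n / δ := by positivity
    have : 0 ≤ n / δ * B := by positivity
    exact max_le (by linarith) (by linarith)
  · refine (norm_add_le _ _).trans ?_
    rw [norm_mul, Complex.norm_real, Complex.norm_real, Real.norm_eq_abs, Real.norm_eq_abs, add_mul,
      one_mul, mul_comm B]
    exact add_le_add (le_max_left _ _)
      (mul_le_mul (le_max_right _ _) hnorm (norm_nonneg _) ((abs_nonneg x).trans (le_max_left _ _)))

theorem summable_norm_rpow_prod : Summable fun x : ℤ × ℤ => ‖x‖ ^ (-3 : ℝ) := by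
  have h := EisensteinSeries.summable_one_div_norm_rpow (k := 3) (by norm_num)
  rw [← (finTwoArrowEquiv ℤ).symm.summable_iff] at h
  refine h.congr fun x => ?_
  change ‖![x.1, x.2]‖ ^ (-3 : ℝ) = ‖x‖ ^ (-3 : ℝ)
  rw [EisensteinSeries.norm_eq_max_natAbs, Prod.norm_def]
  simp [Int.norm_eq_abs, Nat.cast_natAbs]

/-- A term of the series of the regular part of `℘`. -/
def regularTerm (x : ℤ × ℤ) (p : ℂ × ℝ × ℝ) : ℂ :=
  if x = 0 then 0 else 1 / (((p.2.1 - x.1 : ℝ) : ℂ) + ((p.2.2 - x.2 : ℝ) : ℂ) * p.1) ^ 2 -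
    1 / (((x.1 : ℝ) : ℂ) + ((x.2 : ℝ) : ℂ) * p.1) ^ 2

/-- A term of the series of the regular part of `℘'`. -/
def derivRegularTerm (x : ℤ × ℤ) (p : ℂ × ℝ × ℝ) : ℂ :=
  if x = 0 then 0 else -2 / (((p.2.1 - x.1 : ℝ) : ℂ) + ((p.2.2 - x.2 : ℝ) : ℂ) * p.1) ^ 3

/-- The regular part of `℘`, for the lattice with basis `1, τ`, at `a + b τ`. -/
def regularPart (p : ℂ × ℝ × ℝ) : ℂ := ∑' x, regularTerm x p

/-- The regular part of `℘'`, for the lattice with basis `1, τ`, at `a + b τ`. -/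
def derivRegularPart (p : ℂ × ℝ × ℝ) : ℂ := ∑' x, derivRegularTerm x p

/-- The parameters for which only the pole at the origin can be met. -/
def polarRegion : Set (ℂ × ℝ × ℝ) := {p | 0 < p.1.im ∧ |p.2.1| < 1 ∧ |p.2.2| < 1}

theorem mul_abs_le_abs_sub {ρ a : ℝ} (ha : |a| ≤ ρ) (m : ℤ) : (1 - ρ) * |(m : ℝ)| ≤ |a - m| := by
  by_cases hm : m = 0
  · simp [hm]
  have h1 : (1 : ℝ) ≤ |(m : ℝ)| := by exact_mod_cast Int.one_le_abs hm
  have h2 := abs_sub_abs_le_abs_sub (m : ℝ) a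
  rw [abs_sub_comm] at h2
  have : 0 ≤ ρ := (abs_nonneg a).trans ha
  nlinarith

/-- With z = a + bτ and a lattice point w ≠ 0, the difference of inverse squares is z(2w − z)/(w²(z
− w)²), of size |w|⁻³, locally uniformly in all parameters. Keeping |a| and |b| below some ρ < 1
bounds |z − w| below by a multiple of |w|. -/
theorem exists_summable_bound {p₀ : ℂ × ℝ × ℝ} (h : p₀ ∈ polarRegion) :
    ∃ U ∈ 𝓝 p₀, U ⊆ polarRegion ∧ ∃ u : ℤ × ℤ → ℝ, Summable u ∧ ∀ x, ∀ p ∈ U,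
      (x ≠ 0 → ((x.1 : ℝ) : ℂ) + ((x.2 : ℝ) : ℂ) * p.1 ≠ 0) ∧
      (x ≠ 0 → ((p.2.1 - x.1 : ℝ) : ℂ) + ((p.2.2 - x.2 : ℝ) : ℂ) * p.1 ≠ 0) ∧
      ‖regularTerm x p‖ ≤ u x ∧ ‖derivRegularTerm x p‖ ≤ u x := by
  obtain ⟨hτ, ha, hb⟩ := h
  obtain ⟨ε, hε, c, hc, C, hC, hbound⟩ := exists_mul_max_le_norm hτ
  obtain ⟨ρ, hρ1, hρ2⟩ := exists_between (max_lt ha hb)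
  have hρ0 : 0 < ρ := (abs_nonneg _).trans_lt ((le_max_left _ _).trans_lt hρ1)
  set d := c * (1 - ρ) with hd
  have hd0 : 0 < d := mul_pos hc (by linarith)
  refine ⟨{p | p.1 ∈ Metric.ball p₀.1 ε ∧ |p.2.1| < ρ ∧ |p.2.2| < ρ}, ?_, ?_,
    fun x => (3 * C ^ 2 / (c ^ 2 * d ^ 2) + 2 / d ^ 3) * ‖x‖ ^ (-3 : ℝ),
    summable_norm_rpow_prod.mul_left _, ?_⟩
  · refine IsOpen.mem_nhds ?_ ⟨Metric.mem_ball_self hε, (le_max_left _ _).trans_lt hρ1,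
      (le_max_right _ _).trans_lt hρ1⟩
    refine IsOpen.inter (Metric.isOpen_ball.preimage continuous_fst) (IsOpen.inter ?_ ?_)
    · exact isOpen_lt (f := fun p : ℂ × ℝ × ℝ => |p.2.1|) (g := fun _ => ρ)
        (by fun_prop) (by fun_prop)
    · exact isOpen_lt (f := fun p : ℂ × ℝ × ℝ => |p.2.2|) (g := fun _ => ρ)
        (by fun_prop) (by fun_prop)
  · rintro p ⟨h1, h2, h3⟩
    exact ⟨(hbound _ h1).1, h2.trans hρ2, h3.trans hρ2⟩
  rintro ⟨m, n⟩ ⟨τ, a, b⟩ ⟨h1, h2, h3⟩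
  obtain ⟨-, hlow, hup⟩ := hbound τ h1
  simp only at h2 h3
  by_cases hx : ((m, n) : ℤ × ℤ) = 0
  · rw [hx]
    simp [regularTerm, derivRegularTerm]
  set N : ℝ := ‖((m, n) : ℤ × ℤ)‖ with hN
  have hNmax : N = max |(m : ℝ)| |(n : ℝ)| := by
    simp [hN, Prod.norm_def, Int.norm_eq_abs]
  have hN1 : 1 ≤ N := by
    rw [hNmax]
    by_cases hm : m = 0
    · have hn : n ≠ 0 := by rintro rfl; exact hx (by rw [hm]; rfl)
      exact le_max_of_le_right (by exact_mod_cast Int.one_le_abs hn)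
    · exact le_max_of_le_left (by exact_mod_cast Int.one_le_abs hm)
  have hN0 : 0 < N := by linarith
  set w : ℂ := ((m : ℝ) : ℂ) + ((n : ℝ) : ℂ) * τ with hw
  set z : ℂ := (a : ℂ) + (b : ℂ) * τ with hz
  have hzw : ((a - m : ℝ) : ℂ) + ((b - n : ℝ) : ℂ) * τ = z - w := by
    rw [hz, hw]; push_cast; ring
  have lw : c * N ≤ ‖w‖ := by rw [hNmax]; exact hlow m n
  have uw : ‖w‖ ≤ C * N := by rw [hNmax]; exact hup m n
  have uz : ‖z‖ ≤ C := by
    refine (hup a b).trans ?_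
    have : max |a| |b| ≤ 1 := max_le (by linarith) (by linarith)
    nlinarith
  have lzw : d * N ≤ ‖z - w‖ := by
    rw [← hzw]
    refine le_trans ?_ (hlow _ _)
    rw [hd, mul_assoc]
    refine mul_le_mul_of_nonneg_left ?_ hc.le
    rw [hNmax, mul_max_of_nonneg _ _ (by linarith)]
    exact max_le_max (mul_abs_le_abs_sub h2.le m) (mul_abs_le_abs_sub h3.le n)
  have w0 : w ≠ 0 := norm_pos_iff.1 ((by positivity : 0 < c * N).trans_le lw)
  have zw0 : z - w ≠ 0 := norm_pos_iff.1 ((by positivity : 0 < d * N).trans_le lzw)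
  have hrpow : N ^ (-3 : ℝ) = (N ^ 3)⁻¹ := by
    rw [Real.rpow_neg hN0.le]; norm_cast
  refine ⟨fun _ => w0, fun _ => by simpa only [hzw] using zw0, ?_, ?_⟩
  · rw [regularTerm, if_neg hx]
    simp only [hzw]
    change ‖1 / (z - w) ^ 2 - 1 / w ^ 2‖ ≤ _
    have e : 1 / (z - w) ^ 2 - 1 / w ^ 2 = z * (2 * w - z) / (w ^ 2 * (z - w) ^ 2) := by
      field_simp; ring
    rw [e, norm_div, norm_mul, norm_mul, norm_pow, norm_pow, hrpow, add_mul]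
    have hnum : ‖z‖ * ‖2 * w - z‖ ≤ 3 * C ^ 2 * N := by
      have h4 : ‖2 * w - z‖ ≤ 3 * C * N := by
        refine (norm_sub_le _ _).trans ?_
        rw [norm_mul, Complex.norm_two]
        nlinarith
      calc ‖z‖ * ‖2 * w - z‖ ≤ C * (3 * C * N) := mul_le_mul uz h4 (norm_nonneg _) (by linarith)
        _ = _ := by ring
    have hden : c ^ 2 * d ^ 2 * N ^ 4 ≤ ‖w‖ ^ 2 * ‖z - w‖ ^ 2 := by
      calc c ^ 2 * d ^ 2 * N ^ 4 = (c * N) ^ 2 * (d * N) ^ 2 := by ring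
        _ ≤ _ := by gcongr
    have : ‖z‖ * ‖2 * w - z‖ / (‖w‖ ^ 2 * ‖z - w‖ ^ 2) ≤
        3 * C ^ 2 * N / (c ^ 2 * d ^ 2 * N ^ 4) :=
      div_le_div₀ (by positivity) hnum (by positivity) hden
    refine this.trans ?_
    have e2 : 3 * C ^ 2 * N / (c ^ 2 * d ^ 2 * N ^ 4) = 3 * C ^ 2 / (c ^ 2 * d ^ 2) * (N ^ 3)⁻¹ := by
      field_simp
    rw [e2]
    exact le_add_of_nonneg_right (by positivity)
  · rw [derivRegularTerm, if_neg hx]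
    simp only [hzw]
    change ‖-2 / (z - w) ^ 3‖ ≤ _
    rw [norm_div, norm_neg, Complex.norm_two, norm_pow, hrpow, add_mul]
    have h5 : 2 / ‖z - w‖ ^ 3 ≤ 2 / d ^ 3 * (N ^ 3)⁻¹ := by
      have : 2 / d ^ 3 * (N ^ 3)⁻¹ = 2 / (d * N) ^ 3 := by field_simp
      rw [this]
      gcongr
    exact h5.trans (le_add_of_nonneg_left (by positivity))

theorem continuousOn_regularPart : ContinuousOn regularPart polarRegion := by
  intro p hp
  obtain ⟨U, hU, hsub, u, hu, hbound⟩ := exists_summable_bound hp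
  have h : ContinuousOn regularPart U := by
    refine continuousOn_tsum (fun x => ?_) hu fun x p hp => (hbound x p hp).2.2.1
    change ContinuousOn (fun p => regularTerm x p) U
    by_cases hx : x = 0
    · simp only [regularTerm, hx, if_true]
      exact continuousOn_const
    · simp only [regularTerm, hx, if_false]
      refine ContinuousOn.sub ?_ ?_
      · exact ContinuousOn.div continuousOn_const (by fun_prop)
          fun p hp => pow_ne_zero _ ((hbound x p hp).2.1 hx)
      · exact ContinuousOn.div continuousOn_const (by fun_prop)
          fun p hp => pow_ne_zero _ ((hbound x p hp).1 hx)
  exact (h.continuousAt hU).continuousWithinAt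

theorem continuousOn_derivRegularPart : ContinuousOn derivRegularPart polarRegion := by
  intro p hp
  obtain ⟨U, hU, hsub, u, hu, hbound⟩ := exists_summable_bound hp
  have h : ContinuousOn derivRegularPart U := by
    refine continuousOn_tsum (fun x => ?_) hu fun x p hp => (hbound x p hp).2.2.2
    change ContinuousOn (fun p => derivRegularTerm x p) U
    by_cases hx : x = 0
    · simp only [derivRegularTerm, hx, if_true]
      exact continuousOn_const
    · simp only [derivRegularTerm, hx, if_false]
      exact ContinuousOn.div continuousOn_const (by fun_prop)
        fun p hp => pow_ne_zero _ ((hbound x p hp).2.1 hx)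
  exact (h.continuousAt hU).continuousWithinAt

/-- Holomorphy in the lattice parameter at fixed real coordinates (a, b); half-period values are of
this kind. -/
theorem differentiableAt_regularPart {τ : ℂ} {a b : ℝ} (h : (τ, a, b) ∈ polarRegion) :
    DifferentiableAt ℂ (fun t => regularPart (t, a, b)) τ := by
  obtain ⟨U, hU, hsub, u, hu, hbound⟩ := exists_summable_bound h
  have hc : ContinuousAt (fun t : ℂ => ((t, a, b) : ℂ × ℝ × ℝ)) τ := by fun_prop
  obtain ⟨W, hWU, hWo, hτW⟩ := mem_nhds_iff.1 (hc.preimage_mem_nhds hU)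
  have := Complex.differentiableOn_tsum_of_summable_norm (U := W) (F := fun x t =>
    regularTerm x (t, a, b)) hu (fun x => ?_) hWo fun x t ht => (hbound x _ (hWU ht)).2.2.1
  · exact this.differentiableAt (hWo.mem_nhds hτW)
  · by_cases hx : x = 0
    · simp only [regularTerm, hx, if_true]
      exact differentiableOn_const _
    · simp only [regularTerm, hx, if_false]
      refine DifferentiableOn.sub ?_ ?_
      · exact DifferentiableOn.div (differentiableOn_const _) (by fun_prop)
          fun p hp => pow_ne_zero _ ((hbound x _ (hWU hp)).2.1 hx)
      · exact DifferentiableOn.div (differentiableOn_const _) (by fun_prop)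
          fun p hp => pow_ne_zero _ ((hbound x _ (hWU hp)).1 hx)

theorem latticeEquivProd_symm_ofRatio {τ : ℂ} (hτ : 0 < τ.im) (x : ℤ × ℤ) :
    (((ofRatio 1 τ one_ne_zero hτ).latticeEquivProd.symm x : (ofRatio 1 τ one_ne_zero hτ).lattice) :
      ℂ) = x.1 + x.2 * τ := by
  rw [latticeEquiv_symm_apply]
  change (x.1 : ℂ) * 1 + x.2 * (1 * τ) = _
  ring

theorem latticeEquivProd_symm_eq_zero {τ : ℂ} (hτ : 0 < τ.im) (x : ℤ × ℤ) :
    (((ofRatio 1 τ one_ne_zero hτ).latticeEquivProd.symm x : (ofRatio 1 τ one_ne_zero hτ).lattice) :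
      ℂ) = 0 ↔ x = 0 := by
  rw [ZeroMemClass.coe_eq_zero, LinearEquiv.map_eq_zero_iff]

theorem weierstrassPExcept_eq_regularPart {τ : ℂ} (hτ : 0 < τ.im) (a b : ℝ) :
    (ofRatio 1 τ one_ne_zero hτ).weierstrassPExcept 0 (a + b * τ) = regularPart (τ, a, b) := by
  rw [weierstrassPExcept, ← (ofRatio 1 τ one_ne_zero hτ).latticeEquivProd.symm.toEquiv.tsum_eq,
    regularPart]
  refine tsum_congr fun x => ?_
  simp only [LinearEquiv.coe_toEquiv, regularTerm, latticeEquivProd_symm_eq_zero]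
  simp only [latticeEquivProd_symm_ofRatio]
  split_ifs
  · rfl
  · push_cast
    ring_nf

theorem derivWeierstrassPExcept_eq_derivRegularPart {τ : ℂ} (hτ : 0 < τ.im) (a b : ℝ) :
    (ofRatio 1 τ one_ne_zero hτ).derivWeierstrassPExcept 0 (a + b * τ) =
      derivRegularPart (τ, a, b) := by
  rw [derivWeierstrassPExcept,
    ← (ofRatio 1 τ one_ne_zero hτ).latticeEquivProd.symm.toEquiv.tsum_eq, derivRegularPart]
  refine tsum_congr fun x => ?_
  simp only [LinearEquiv.coe_toEquiv, derivRegularTerm, latticeEquivProd_symm_eq_zero]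
  simp only [latticeEquivProd_symm_ofRatio]
  split_ifs
  · rfl
  · push_cast
    ring_nf

theorem weierstrassP_eq_regularPart {τ : ℂ} (hτ : 0 < τ.im) (a b : ℝ) :
    (ofRatio 1 τ one_ne_zero hτ).weierstrassP (a + b * τ) =
      regularPart (τ, a, b) + 1 / (a + b * τ) ^ 2 := by
  have := (ofRatio 1 τ one_ne_zero hτ).weierstrassPExcept_add 0 (a + b * τ)
  rw [← this, ZeroMemClass.coe_zero, weierstrassPExcept_eq_regularPart]
  simp

theorem derivWeierstrassP_eq_derivRegularPart {τ : ℂ} (hτ : 0 < τ.im) (a b : ℝ) :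
    (ofRatio 1 τ one_ne_zero hτ).derivWeierstrassP (a + b * τ) =
      derivRegularPart (τ, a, b) - 2 / (a + b * τ) ^ 3 := by
  have := (ofRatio 1 τ one_ne_zero hτ).derivWeierstrassPExcept_sub 0 (a + b * τ)
  rw [← this, ZeroMemClass.coe_zero, derivWeierstrassPExcept_eq_derivRegularPart]
  simp

end PeriodPair
end

noncomputable section

/-! ### The inverse of the modular function -/

open Filter

/-- Injectivity makes f nowhere locally constant, hence open, so the inverse is continuous. It is
differentiable where f' ≠ 0; the zeros of f' are isolated, so the remaining singularities are
removable. The chain rule for f ∘ g then excludes g' = 0. -/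
theorem exists_holomorphic_inverse {f : ℂ → ℂ} {z₀ : ℂ} {r : ℝ}
    (hf : DifferentiableOn ℂ f (Metric.ball z₀ r)) (hinj : Set.InjOn f (Metric.ball z₀ r)) :
    IsOpen (f '' Metric.ball z₀ r) ∧ ∃ g : ℂ → ℂ, ∀ y ∈ f '' Metric.ball z₀ r,
      g y ∈ Metric.ball z₀ r ∧ f (g y) = y ∧ DifferentiableAt ℂ g y ∧ deriv g y ≠ 0 := by
  set B := Metric.ball z₀ r with hB
  have hBo : IsOpen B := Metric.isOpen_ball
  have han : AnalyticOnNhd ℂ f B := hf.analyticOnNhd hBo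
  have hnc : ∀ z ∈ B, ¬ ∀ᶠ w in 𝓝 z, f w = f z := by
    intro z hz h
    have h1 : ∀ᶠ w in 𝓝 z, w = z := by
      filter_upwards [h, hBo.mem_nhds hz] with w hw hwB
      exact hinj hwB hz hw
    have h2 : ∀ᶠ w in 𝓝[≠] z, w = z := mem_nhdsWithin_of_mem_nhds h1
    have h3 : ∀ᶠ w in 𝓝[≠] z, False := by
      filter_upwards [h2, self_mem_nhdsWithin] with w h h'
      exact h' h
    rw [eventually_false_iff_eq_bot] at h3
    exact (inferInstance : (𝓝[≠] z).NeBot).ne h3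
  have hmap : ∀ z ∈ B, 𝓝 (f z) ≤ map f (𝓝 z) := fun z hz =>
    (han z hz).eventually_constant_or_nhds_le_map_nhds.resolve_left (hnc z hz)
  have hopen : ∀ O : Set ℂ, IsOpen O → IsOpen (f '' (B ∩ O)) := by
    intro O hO
    rw [isOpen_iff_mem_nhds]
    rintro _ ⟨z, ⟨hzB, hzO⟩, rfl⟩
    exact hmap z hzB (image_mem_map ((hBo.inter hO).mem_nhds ⟨hzB, hzO⟩))
  have hV : IsOpen (f '' B) := by simpa using hopen Set.univ isOpen_univ
  refine ⟨hV, Function.invFunOn f B, ?_⟩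
  set g := Function.invFunOn f B with hg
  have hgB : ∀ y ∈ f '' B, g y ∈ B := fun y hy => Function.invFunOn_mem hy
  have hfg : ∀ y ∈ f '' B, f (g y) = y := fun y hy => Function.invFunOn_eq hy
  have hgf : ∀ z ∈ B, g (f z) = z := fun z hz =>
    hinj (hgB _ ⟨z, hz, rfl⟩) hz (hfg _ ⟨z, hz, rfl⟩)
  have hgc : ∀ y ∈ f '' B, ContinuousAt g y := by
    rintro y hy
    rw [ContinuousAt, tendsto_def]
    intro N hN
    obtain ⟨O, hON, hO, hyO⟩ := mem_nhds_iff.1 hN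
    refine mem_of_superset ((hopen O hO).mem_nhds ⟨g y, ⟨hgB y hy, hyO⟩, hfg y hy⟩) ?_
    rintro _ ⟨z, ⟨hzB, hzO⟩, rfl⟩
    exact hON (by rw [hgf z hzB]; exact hzO)
  have hreg : ∀ y ∈ f '' B, deriv f (g y) ≠ 0 → DifferentiableAt ℂ g y := by
    intro y hy hd
    refine (HasDerivAt.of_local_left_inverse (hgc y hy)
      ((han _ (hgB y hy)).differentiableAt.hasDerivAt) hd ?_).differentiableAt
    filter_upwards [hV.mem_nhds hy] with w hw using hfg w hw
  have hdiff : ∀ y ∈ f '' B, DifferentiableAt ℂ g y := by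
    intro y hy
    refine (Complex.analyticAt_of_differentiable_on_punctured_nhds_of_continuousAt ?_
      (hgc y hy)).differentiableAt
    have hz := hgB y hy
    have h1 : ∀ᶠ w in 𝓝[≠] (g y), deriv f w ≠ 0 := by
      refine (han _ hz).deriv.eventually_eq_zero_or_eventually_ne_zero.resolve_left fun h => ?_
      obtain ⟨ε, hε, hball⟩ := Metric.eventually_nhds_iff_ball.1
        (h.and (hBo.mem_nhds hz))
      refine hnc _ hz (Metric.eventually_nhds_iff_ball.2 ⟨ε, hε, fun w hw => ?_⟩)
      exact (convex_ball (g y) ε).is_const_of_fderivWithin_eq_zero (𝕜 := ℂ) (f := f)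
        (fun u hu => (hf.differentiableAt (hBo.mem_nhds (hball u hu).2)).differentiableWithinAt)
        (fun u hu => by
          rw [fderivWithin_of_isOpen Metric.isOpen_ball hu]
          ext
          simpa using (hball u hu).1) hw (Metric.mem_ball_self hε)
    have h2 : Tendsto g (𝓝[≠] y) (𝓝[≠] (g y)) := by
      refine tendsto_nhdsWithin_iff.2 ⟨(hgc y hy).tendsto.mono_left nhdsWithin_le_nhds, ?_⟩
      filter_upwards [mem_nhdsWithin_of_mem_nhds (hV.mem_nhds hy), self_mem_nhdsWithin]
        with w hw hw' h
      exact hw' (by rw [Set.mem_singleton_iff, ← hfg w hw, ← hfg y hy, h])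
    filter_upwards [h2.eventually h1, mem_nhdsWithin_of_mem_nhds (hV.mem_nhds hy)] with w hw hwV
    exact hreg w hwV hw
  intro y hy
  refine ⟨hgB y hy, hfg y hy, hdiff y hy, fun h0 => ?_⟩
  have h1 : HasDerivAt (f ∘ g) (deriv f (g y) * deriv g y) y :=
    (han _ (hgB y hy)).differentiableAt.hasDerivAt.comp y (hdiff y hy).hasDerivAt
  have h2 : f ∘ g =ᶠ[𝓝 y] id := by
    filter_upwards [hV.mem_nhds hy] with w hw using hfg w hw
  have h3 := h1.unique ((hasDerivAt_id y).congr_of_eventuallyEq h2)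
  rw [h0, mul_zero] at h3
  exact zero_ne_one h3

namespace PeriodPair

/-- The value of `℘` at a half period, for the lattice with basis `1, τ`. -/
def halfValue (i : Fin 3) (τ : ℂ) : ℂ :=
  regularPart (τ, halfCoords i) + 1 / halfPeriod τ i ^ 2

theorem weierstrassP_halfPeriod {s τ : ℂ} (hs : s ≠ 0) (hτ : 0 < τ.im) (i : Fin 3) :
    (ofRatio s τ hs hτ).weierstrassP (s * halfPeriod τ i) = (s ^ 2)⁻¹ * halfValue i τ := by
  rw [weierstrassP_ofRatio, halfPeriod, weierstrassP_eq_regularPart]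
  rfl

theorem halfPeriod_ne_zero {τ : ℂ} (hτ : 0 < τ.im) (i : Fin 3) : halfPeriod τ i ≠ 0 := by
  have h := isHalfPeriods_ofRatio one_ne_zero hτ (Equiv.swap 0 i)
  intro h0
  refine h.notMem₁ ?_
  simp [h0]

theorem halfCoords_mem_polarRegion {τ : ℂ} (hτ : 0 < τ.im) (i : Fin 3) :
    (τ, halfCoords i) ∈ polarRegion := by
  refine ⟨hτ, ?_, ?_⟩ <;> fin_cases i <;> norm_num [halfCoords, abs_of_pos]

theorem differentiableAt_halfValue {τ : ℂ} (hτ : 0 < τ.im) (i : Fin 3) :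
    DifferentiableAt ℂ (halfValue i) τ := by
  refine DifferentiableAt.add (differentiableAt_regularPart (halfCoords_mem_polarRegion hτ i)) ?_
  refine DifferentiableAt.div (differentiableAt_const _) ?_ (pow_ne_zero _ (halfPeriod_ne_zero hτ i))
  unfold halfPeriod
  fun_prop

theorem halfValue_injective {τ : ℂ} (hτ : 0 < τ.im) : Function.Injective fun i => halfValue i τ := by
  have h := isHalfPeriods_ofRatio one_ne_zero hτ (Equiv.refl _)
  have e : ∀ i, (ofRatio 1 τ one_ne_zero hτ).weierstrassP (1 * halfPeriod τ i) = halfValue i τ :=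
    fun i => by rw [weierstrassP_halfPeriod, one_pow, inv_one, one_mul]
  have n₁ := h.ne₁
  have n₂ := h.ne₂
  have n₃ := h.ne₃
  simp only [Equiv.refl_apply, e] at n₁ n₂ n₃
  intro i j hij
  fin_cases i <;> fin_cases j <;> first
    | rfl
    | exact absurd hij n₁
    | exact absurd hij n₂
    | exact absurd hij n₃
    | exact absurd hij.symm n₁
    | exact absurd hij.symm n₂
    | exact absurd hij.symm n₃

/-- The lattice is normalized, so that the cubic polynomial is that of the Legendre curve. -/
def IsNormalizedFor (L : PeriodPair) (w₀ w₁ w₂ l : ℂ) : Prop :=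
  L.IsHalfPeriods w₀ w₁ w₂ ∧ L.weierstrassP w₁ - L.weierstrassP w₀ = 1 ∧
    L.weierstrassP w₂ - L.weierstrassP w₀ = l

theorem IsNormalizedFor.weierstrassP_eq {L : PeriodPair} {w₀ w₁ w₂ l : ℂ}
    (h : L.IsNormalizedFor w₀ w₁ w₂ l) : L.weierstrassP w₀ = -(1 + l) / 3 := by
  obtain ⟨h1, h2, h3⟩ := h
  linear_combination (h1.sum_eq_zero - h2 - h3) / 3

/-- The three half-period values have sum zero and prescribed differences, so l determines them,
then g₂ and g₃, and finally the lattice. -/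
theorem IsNormalizedFor.mem_lattice_iff {L L' : PeriodPair} {w₀ w₁ w₂ w₀' w₁' w₂' l : ℂ}
    (h : L.IsNormalizedFor w₀ w₁ w₂ l) (h' : L'.IsNormalizedFor w₀' w₁' w₂' l) {x : ℂ}
    (hx : x ∈ L.lattice) : x ∈ L'.lattice := by
  have e0 : L.weierstrassP w₀ = L'.weierstrassP w₀' := by
    rw [h.weierstrassP_eq, h'.weierstrassP_eq]
  have e1 : L.weierstrassP w₁ = L'.weierstrassP w₁' := by linear_combination h.2.1 - h'.2.1 + e0
  have e2 : L.weierstrassP w₂ = L'.weierstrassP w₂' := by linear_combination h.2.2 - h'.2.2 + e0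
  refine mem_lattice_iff_of_g_eq ?_ ?_ hx
  · rw [h.1.g₂_eq, h'.1.g₂_eq, e0, e1, e2]
  · rw [h.1.g₃_eq, h'.1.g₃_eq, e0, e1, e2]

theorem isNormalizedFor_iff {s τ l : ℂ} (hs : s ≠ 0) (hτ : 0 < τ.im) (σ : Equiv.Perm (Fin 3)) :
    (ofRatio s τ hs hτ).IsNormalizedFor (s * halfPeriod τ (σ 0)) (s * halfPeriod τ (σ 1))
      (s * halfPeriod τ (σ 2)) l ↔ halfValue (σ 1) τ - halfValue (σ 0) τ = s ^ 2 ∧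
        halfValue (σ 2) τ - halfValue (σ 0) τ = s ^ 2 * l := by
  have hs2 : s ^ 2 ≠ 0 := pow_ne_zero _ hs
  simp only [IsNormalizedFor, isHalfPeriods_ofRatio hs hτ σ, true_and, weierstrassP_halfPeriod]
  rw [← mul_sub, ← mul_sub, inv_mul_eq_iff_eq_mul₀ hs2, inv_mul_eq_iff_eq_mul₀ hs2, mul_one]

theorem eq_of_mem_lattice {c : ℝ} {τ : ℂ}
    (hc : ∀ x y : ℝ, c * max |x| |y| ≤ ‖(x : ℂ) + y * τ‖) {m n a b : ℤ} {z : ℂ}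
    (hz : (m : ℂ) + n * τ = z) (h : ‖z - (a + b * τ)‖ < c) : m = a ∧ n = b := by
  have h1 := hc ((m - a : ℤ) : ℝ) ((n - b : ℤ) : ℝ)
  rw [← hz] at h
  have e : (m : ℂ) + n * τ - (a + b * τ) =
      (((m - a : ℤ) : ℝ) : ℂ) + (((n - b : ℤ) : ℝ) : ℂ) * τ := by push_cast; ring
  rw [e] at h
  have h2 := h1.trans_lt h
  have hc0 : 0 < c := (norm_nonneg _).trans_lt h
  have h3 : max |((m - a : ℤ) : ℝ)| |((n - b : ℤ) : ℝ)| < 1 := by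
    by_contra hcon
    push Not at hcon
    nlinarith
  have h4 : |m - a| < 1 := by exact_mod_cast (le_max_left _ _).trans_lt h3
  have h5 : |n - b| < 1 := by exact_mod_cast (le_max_right _ _).trans_lt h3
  rw [Int.abs_lt_one_iff] at h4 h5
  omega

/-- Near each point of the base, the Legendre curves are uniformized by lattices whose period ratio
is a local coordinate. -/
theorem exists_family {l₀ : ℂ} (h0 : l₀ ≠ 0) (h1 : l₀ ≠ 1) :
    ∃ (σ : Equiv.Perm (Fin 3)) (U : Set ℂ) (s τ : ℂ → ℂ), IsOpen U ∧ l₀ ∈ U ∧ ContinuousOn s U ∧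
      ∀ l ∈ U, DifferentiableAt ℂ τ l ∧ deriv τ l ≠ 0 ∧ ∃ (hs : s l ≠ 0) (hτ : 0 < (τ l).im),
        (ofRatio (s l) (τ l) hs hτ).IsNormalizedFor (s l * halfPeriod (τ l) (σ 0))
          (s l * halfPeriod (τ l) (σ 1)) (s l * halfPeriod (τ l) (σ 2)) l := by
  obtain ⟨s₀, τ₀, hs₀, hτ₀, σ, hn1, hn2⟩ := exists_ofRatio_eq h0 h1
  have hn := (isNormalizedFor_iff (l := l₀) hs₀ hτ₀ σ).1 ⟨isHalfPeriods_ofRatio hs₀ hτ₀ σ, hn1, hn2⟩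
  set D : ℂ → ℂ := fun t => halfValue (σ 1) t - halfValue (σ 0) t with hD
  set f : ℂ → ℂ := fun t => (halfValue (σ 2) t - halfValue (σ 0) t) / D t with hf
  have hD0 : ∀ t : ℂ, 0 < t.im → D t ≠ 0 := fun t ht => sub_ne_zero.2 fun h => by
    simpa using halfValue_injective ht h
  have hDd : ∀ t : ℂ, 0 < t.im → DifferentiableAt ℂ D t := fun t ht =>
    (differentiableAt_halfValue ht _).sub (differentiableAt_halfValue ht _)
  have hfd : ∀ t : ℂ, 0 < t.im → DifferentiableAt ℂ f t := fun t ht =>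
    ((differentiableAt_halfValue ht _).sub (differentiableAt_halfValue ht _)).div (hDd t ht)
      (hD0 t ht)
  have hs2 : s₀ ^ 2 ≠ 0 := pow_ne_zero _ hs₀
  have hDτ : D τ₀ = s₀ ^ 2 := hn.1
  have hfτ : f τ₀ = l₀ := by
    simp only [hf]
    rw [hDτ, hn.2]
    field_simp
  -- The normalization requires a square root of D. Dividing by s₀² moves the base value to 1, where
  -- the principal branch is continuous.
  set s : ℂ → ℂ := fun t => s₀ * (D t / s₀ ^ 2) ^ (1 / 2 : ℂ) with hs
  have hslit : ∀ᶠ t in 𝓝 τ₀, D t / s₀ ^ 2 ∈ Complex.slitPlane := by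
    have hc : ContinuousAt (fun t => D t / s₀ ^ 2) τ₀ := (hDd _ hτ₀).continuousAt.div_const _
    refine hc.eventually_mem (Complex.isOpen_slitPlane.mem_nhds ?_)
    rw [hDτ, div_self hs2]
    exact Complex.one_mem_slitPlane
  have hsq : ∀ t, s t ^ 2 = D t := by
    intro t
    simp only [hs, mul_pow]
    rw [← Complex.cpow_nat_mul]
    norm_num
    field_simp
  have hs0 : ∀ t : ℂ, 0 < t.im → s t ≠ 0 := fun t ht h => hD0 t ht (by rw [← hsq, h]; simp)
  have hsc : ∀ t : ℂ, 0 < t.im → D t / s₀ ^ 2 ∈ Complex.slitPlane → ContinuousAt s t :=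
    fun t ht h => continuousAt_const.mul
      (((hDd t ht).continuousAt.div_const _).cpow continuousAt_const h)
  have hnorm : ∀ t (ht : 0 < t.im), (ofRatio (s t) t (hs0 t ht) ht).IsNormalizedFor
      (s t * halfPeriod t (σ 0)) (s t * halfPeriod t (σ 1)) (s t * halfPeriod t (σ 2)) (f t) := by
    intro t ht
    rw [isNormalizedFor_iff, hsq]
    refine ⟨rfl, ?_⟩
    simp only [hf]
    rw [mul_div_cancel₀ _ (hD0 t ht)]
  obtain ⟨ε, hε, c, hc, C, hC, hbound⟩ := exists_mul_max_le_norm hτ₀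
  have hsτ : ContinuousAt s τ₀ := hsc _ hτ₀ hslit.self_of_nhds
  have hA : ContinuousAt (fun p : ℂ × ℂ => s p.2) (τ₀, τ₀) :=
    ContinuousAt.comp (f := Prod.snd) (g := s) hsτ continuousAt_snd
  have hB : ContinuousAt (fun p : ℂ × ℂ => s p.1) (τ₀, τ₀) :=
    ContinuousAt.comp (f := Prod.fst) (g := s) hsτ continuousAt_fst
  have hclose1 : ∀ᶠ p : ℂ × ℂ in 𝓝 (τ₀, τ₀), ‖s p.2 / s p.1 - 1‖ < c := by
    have hcont : ContinuousAt (fun p : ℂ × ℂ => ‖s p.2 / s p.1 - 1‖) (τ₀, τ₀) :=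
      ((hA.div hB (hs0 _ hτ₀)).sub continuousAt_const).norm
    refine hcont.eventually_lt continuousAt_const ?_
    simp [div_self (hs0 _ hτ₀), hc]
  have hclose2 : ∀ᶠ p : ℂ × ℂ in 𝓝 (τ₀, τ₀), ‖s p.2 * p.2 / s p.1 - p.1‖ < c := by
    have hcont : ContinuousAt (fun p : ℂ × ℂ => ‖s p.2 * p.2 / s p.1 - p.1‖) (τ₀, τ₀) :=
      (((hA.mul continuousAt_snd).div hB (hs0 _ hτ₀)).sub continuousAt_fst).norm
    refine hcont.eventually_lt continuousAt_const ?_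
    simp [mul_div_right_comm, div_self (hs0 _ hτ₀), hc]
  obtain ⟨W₁, hW₁, W₂, hW₂, hW⟩ := mem_nhds_prod_iff.1 (hclose1.and hclose2)
  obtain ⟨r, hr, hball⟩ := Metric.mem_nhds_iff.1
    (inter_mem (inter_mem (inter_mem hW₁ hW₂) hslit) (Metric.ball_mem_nhds τ₀ hε))
  have him : ∀ t ∈ Metric.ball τ₀ r, 0 < t.im := fun t ht => (hbound t (hball ht).2).1
  -- Equal values of λ give the same lattice, so the basis at t' is an integral combination of the
  -- one at t. The ball is so small that the bases differ by less than the spacing of lattice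
  -- points, which forces the identity combination and t = t'.
  have hinj : Set.InjOn f (Metric.ball τ₀ r) := by
    intro t ht t' ht' hff
    have N := hnorm t (him t ht)
    have N' := hnorm t' (him t' ht')
    rw [← hff] at N'
    have h1 := IsNormalizedFor.mem_lattice_iff N' N (ω₁_mem_lattice _)
    have h2 := IsNormalizedFor.mem_lattice_iff N' N (ω₂_mem_lattice _)
    change s t' ∈ _ at h1
    change s t' * t' ∈ _ at h2
    have st0 := hs0 t (him t ht)
    rw [← mul_div_cancel₀ (s t') st0, ofRatio_mem_lattice] at h1
    rw [← mul_div_cancel₀ (s t' * t') st0, ofRatio_mem_lattice] at h2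
    obtain ⟨m, n, hmn⟩ := h1
    obtain ⟨m', n', hmn'⟩ := h2
    have hb := (hbound t (hball ht).2).2.1
    obtain ⟨c1, c2⟩ := hW (Set.mk_mem_prod (hball ht).1.1.1 (hball ht').1.1.2)
    obtain ⟨rfl, rfl⟩ := eq_of_mem_lattice (a := 1) (b := 0) hb hmn (by simpa using c1)
    obtain ⟨rfl, rfl⟩ := eq_of_mem_lattice (a := 0) (b := 1) hb hmn' (by simpa using c2)
    have e1 : s t' = s t := by
      have : s t' / s t = 1 := by rw [← hmn]; simp
      exact (div_eq_one_iff_eq st0).1 this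
    rw [e1, mul_div_cancel_left₀ _ st0] at hmn'
    simpa using hmn'
  obtain ⟨hVo, g, hg⟩ := exists_holomorphic_inverse
    (fun t ht => (hfd t (him t ht)).differentiableWithinAt) hinj
  refine ⟨σ, f '' Metric.ball τ₀ r, fun l => s (g l), g, hVo,
    ⟨τ₀, Metric.mem_ball_self hr, hfτ⟩, ?_, ?_⟩
  · intro l hl
    obtain ⟨hl1, hl2, hl3, -⟩ := hg l hl
    exact (ContinuousAt.comp (f := g) (g := s) (hsc _ (him _ hl1) (hball hl1).1.2)
      hl3.continuousAt).continuousWithinAt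
  · intro l hl
    obtain ⟨hl1, hl2, hl3, hl4⟩ := hg l hl
    refine ⟨hl3, hl4, hs0 _ (him _ hl1), him _ hl1, ?_⟩
    have := hnorm _ (him _ hl1)
    rwa [hl2] at this

end PeriodPair
end

/-! ### Path cocycles, cohomology classes and the first cohomology of a torus. -/

noncomputable section

namespace PathCocycle

variable {X Y A B : Type} [TopologicalSpace X] [TopologicalSpace Y] [AddCommGroup A]
  [AddCommGroup B]

theorem congr_path (c : PathCocycle X A) {x y x' y' : X} (p : Path x y) (q : Path x' y')
    (h : ∀ t, p t = q t) : c.toFun p = c.toFun q := by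
  obtain rfl : x = x' := by simpa using h 0
  obtain rfl : y = y' := by simpa using h 1
  exact congrArg _ (Path.ext (funext h))

theorem map_refl (c : PathCocycle X A) (x : X) : c.toFun (Path.refl x) = 0 := by
  have h := c.map_trans (Path.refl x) (Path.refl x)
  rw [Path.refl_trans_refl] at h
  simpa using h

/-- The pullback of a cocycle under a continuous map. -/
def comap (c : PathCocycle Y A) (f : C(X, Y)) : PathCocycle X A where
  toFun p := c.toFun (p.map f.continuous)
  map_trans p q := by rw [Path.map_trans, c.map_trans]
  map_homotopic p q h := c.map_homotopic _ _ (h.map f)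

/-- The image of a cocycle under a homomorphism of coefficients. -/
def mapCoeff (φ : A →+ B) (c : PathCocycle X A) : PathCocycle X B where
  toFun p := φ (c.toFun p)
  map_trans p q := by rw [c.map_trans, map_add]
  map_homotopic p q h := by rw [c.map_homotopic p q h]

/-- The sum of two cocycles. -/
def add (c d : PathCocycle X A) : PathCocycle X A where
  toFun p := c.toFun p + d.toFun p
  map_trans p q := by rw [c.map_trans, d.map_trans]; abel
  map_homotopic p q h := by rw [c.map_homotopic p q h, d.map_homotopic p q h]

/-- The cohomology class of a cocycle. -/
def toH1 (c : PathCocycle X A) (x : X) : H1 X x A :=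
  MonoidHom.toAdditiveLeft
    { toFun := fun g => Multiplicative.ofAdd (Quotient.lift (fun p : Path x x => c.toFun p)
        (fun p q h => c.map_homotopic p q h) (FundamentalGroup.toPath g))
      map_one' := congrArg Multiplicative.ofAdd (c.map_refl x)
      map_mul' := by
        intro a b
        induction a using Quotient.inductionOn with | _ p => ?_
        induction b using Quotient.inductionOn with | _ q => ?_
        refine congrArg Multiplicative.ofAdd ?_
        -- Multiplication in the fundamental group concatenates in the opposite order; commutativity
        -- of the coefficients absorbs this.
        change c.toFun (q.trans p) = c.toFun p + c.toFun q
        rw [c.map_trans, add_comm] }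

theorem isClassOf_toH1 (c : PathCocycle X A) (x : X) :
    IsClassOf (c.toH1 x) c.toFun := fun _ => rfl

theorem eq_of_simplyConnected [SimplyConnectedSpace X] (c : PathCocycle X A) {x y : X}
    (p q : Path x y) : c.toFun p = c.toFun q :=
  c.map_homotopic p q (SimplyConnectedSpace.paths_homotopic p q)

end PathCocycle

namespace H1

variable {X A : Type} [TopologicalSpace X] [AddCommGroup A] {x : X}

/-- The value of a cohomology class on a loop. -/
def eval (φ : H1 X x A) (γ : Path x x) : A :=
  φ (Additive.ofMul (FundamentalGroup.fromPath (Path.Homotopic.Quotient.mk γ)))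

theorem eval_add (φ ψ : H1 X x A) (γ : Path x x) : (φ + ψ).eval γ = φ.eval γ + ψ.eval γ := rfl

theorem eval_trans (φ : H1 X x A) (γ δ : Path x x) :
    φ.eval (γ.trans δ) = φ.eval γ + φ.eval δ := by
  rw [add_comm]
  exact φ.map_add (Additive.ofMul (FundamentalGroup.fromPath (Path.Homotopic.Quotient.mk δ)))
    (Additive.ofMul (FundamentalGroup.fromPath (Path.Homotopic.Quotient.mk γ)))

theorem eval_homotopic (φ : H1 X x A) {γ δ : Path x x} (h : γ.Homotopic δ) :
    φ.eval γ = φ.eval δ :=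
  congrArg (fun a => φ (Additive.ofMul (FundamentalGroup.fromPath a)))
    (Path.Homotopic.Quotient.eq.mpr h)

theorem ext_eval {φ ψ : H1 X x A} (h : ∀ γ, φ.eval γ = ψ.eval γ) : φ = ψ := by
  refine AddMonoidHom.ext fun a => ?_
  induction a using Quotient.inductionOn with | _ p => exact h p

end H1

/-! ### Angular displacement -/

/-- The displacement of the angle along a path in the circle. -/
def circleDisplacement {x y : AddCircle (1 : ℝ)} (p : Path x y) : ℝ :=
  (AddCircle.isCoveringMap_coe (1 : ℝ)).liftPath p.toContinuousMap (AddCircle.equivIco 1 0 x)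
    (by rw [AddCircle.coe_equivIco]; exact p.source) 1 - AddCircle.equivIco 1 0 x

/-- Translating a lift by the difference of the starting values gives the standard lift, by
uniqueness of path lifting; displacements do not see the translation. -/
theorem circleDisplacement_eq {x y : AddCircle (1 : ℝ)} (p : Path x y) (L : C(unitInterval, ℝ))
    (hL : ∀ t, (L t : AddCircle (1 : ℝ)) = p t) : circleDisplacement p = L 1 - L 0 := by
  have h0 : ((L 0 : ℝ) : AddCircle (1 : ℝ)) = x := by rw [hL, p.source]
  let L' : C(unitInterval, ℝ) := ⟨fun t => L t + (AddCircle.equivIco 1 0 x - L 0), by fun_prop⟩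
  have h : L' = (AddCircle.isCoveringMap_coe (1 : ℝ)).liftPath p.toContinuousMap
      (AddCircle.equivIco 1 0 x) (by rw [AddCircle.coe_equivIco]; exact p.source) := by
    rw [IsCoveringMap.eq_liftPath_iff']
    refine ⟨?_, ?_⟩
    · funext t
      change ((L t + (AddCircle.equivIco 1 0 x - L 0) : ℝ) : AddCircle (1 : ℝ)) = p t
      rw [AddCircle.coe_add, AddCircle.coe_sub, AddCircle.coe_equivIco, h0, sub_self, add_zero, hL]
    · change L 0 + (_ - L 0) = _
      ring
  rw [circleDisplacement, ← h]
  change L 1 + (_ - L 0) - _ = _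
  ring

theorem exists_circle_lift {x y : AddCircle (1 : ℝ)} (p : Path x y) (a : ℝ)
    (ha : (a : AddCircle (1 : ℝ)) = x) :
    ∃ L : C(unitInterval, ℝ), L 0 = a ∧ ∀ t, (L t : AddCircle (1 : ℝ)) = p t := by
  obtain ⟨L, hL, h0⟩ := (AddCircle.isCoveringMap_coe (1 : ℝ)).exists_path_lifts p.toContinuousMap a
    (by rw [ha]; exact p.source)
  exact ⟨L, h0, fun t => congrFun hL t⟩

/-- The displacement of the angle as a cocycle on the circle. -/
def circleCocycle : PathCocycle (AddCircle (1 : ℝ)) ℝ where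
  toFun p := circleDisplacement p
  map_trans {x y z} p q := by
    obtain ⟨L, -, hL⟩ := exists_circle_lift (p.trans q) (AddCircle.equivIco 1 0 x)
      AddCircle.coe_equivIco
    have e : ∀ t : unitInterval, (t : ℝ) / 2 ∈ unitInterval ∧ (1 + t : ℝ) / 2 ∈ unitInterval :=
      fun t => ⟨⟨by linarith [t.2.1], by linarith [t.2.2]⟩, ⟨by linarith [t.2.1], by linarith [t.2.2]⟩⟩
    rw [circleDisplacement_eq _ L hL,
      circleDisplacement_eq p (L.comp ⟨fun t => ⟨t / 2, (e t).1⟩, by fun_prop⟩) ?_,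
      circleDisplacement_eq q (L.comp ⟨fun t => ⟨(1 + t) / 2, (e t).2⟩, by fun_prop⟩) ?_]
    · have h1 : (⟨((0 : unitInterval) : ℝ) / 2, (e 0).1⟩ : unitInterval) = 0 :=
        Subtype.ext (by simp)
      have h2 : (⟨(1 + (1 : unitInterval) : ℝ) / 2, (e 1).2⟩ : unitInterval) = 1 :=
        Subtype.ext (by norm_num)
      have h3 : (⟨(1 + (0 : unitInterval) : ℝ) / 2, (e 0).2⟩ : unitInterval) =
          ⟨((1 : unitInterval) : ℝ) / 2, (e 1).1⟩ := Subtype.ext (by norm_num)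
      change _ = L ⟨((1 : unitInterval) : ℝ) / 2, (e 1).1⟩ - L ⟨((0 : unitInterval) : ℝ) / 2, (e 0).1⟩
        + (L ⟨(1 + (1 : unitInterval) : ℝ) / 2, (e 1).2⟩ -
          L ⟨(1 + (0 : unitInterval) : ℝ) / 2, (e 0).2⟩)
      rw [h1, h2, h3]
      ring
    · intro t
      change ((L _ : ℝ) : AddCircle (1 : ℝ)) = _
      rw [hL, Path.trans_apply]
      split_ifs with h
      · have : t = 0 := Subtype.ext (le_antisymm (by change (1 + (t : ℝ)) / 2 ≤ 1 / 2 at h; change (t : ℝ) ≤ 0; linarith) t.2.1)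
        subst this
        rw [q.source]
        convert p.target using 2
        exact Subtype.ext (by norm_num)
      · congr 1
        exact Subtype.ext (by change 2 * ((1 + (t : ℝ)) / 2) - 1 = t; ring)
    · intro t
      change ((L _ : ℝ) : AddCircle (1 : ℝ)) = _
      rw [hL, Path.trans_apply, dif_pos (by change (t : ℝ) / 2 ≤ 1 / 2; linarith [t.2.2])]
      congr 1
      exact Subtype.ext (by change 2 * ((t : ℝ) / 2) = t; ring)
  map_homotopic p q h := by
    unfold circleDisplacement
    congr 1
    exact IsCoveringMap.liftPath_apply_one_eq_of_homotopicRel _ h _ _ _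

theorem exists_int_circleDisplacement {x y : AddCircle (1 : ℝ)} (p : Path x y) :
    ∃ n : ℤ, (n : ℝ) = circleCocycle.toFun p -
      ((AddCircle.equivIco 1 0 y : ℝ) - (AddCircle.equivIco 1 0 x : ℝ)) := by
  obtain ⟨L, h0, hL⟩ := exists_circle_lift p (AddCircle.equivIco 1 0 x)
    AddCircle.coe_equivIco
  have h : ((L 1 : ℝ) : AddCircle (1 : ℝ)) = ((AddCircle.equivIco 1 0 y : ℝ) : AddCircle (1 : ℝ)) := by
    rw [AddCircle.coe_equivIco, hL, p.target]
  rw [← sub_eq_zero, ← AddCircle.coe_sub, AddCircle.coe_eq_zero_iff] at h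
  obtain ⟨n, hn⟩ := h
  refine ⟨n, ?_⟩
  change _ = circleDisplacement p - _
  rw [circleDisplacement_eq p L hL, h0]
  simp only [zsmul_eq_mul, mul_one] at hn
  linarith

/-- The winding number, made into an integral cocycle by means of the standard section of
`ℝ → ℝ / ℤ`. -/
def windingCocycle : PathCocycle (AddCircle (1 : ℝ)) ℤ where
  toFun p := (exists_int_circleDisplacement p).choose
  map_trans p q := by
    have h := (exists_int_circleDisplacement (p.trans q)).choose_spec
    have h1 := (exists_int_circleDisplacement p).choose_spec
    have h2 := (exists_int_circleDisplacement q).choose_spec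
    have h0 := circleCocycle.map_trans p q
    have : (((exists_int_circleDisplacement (p.trans q)).choose : ℤ) : ℝ) =
      ((exists_int_circleDisplacement p).choose : ℝ) +
      ((exists_int_circleDisplacement q).choose : ℝ) := by linarith
    exact_mod_cast this
  map_homotopic p q hpq := by
    have h1 := (exists_int_circleDisplacement p).choose_spec
    have h2 := (exists_int_circleDisplacement q).choose_spec
    have h0 := circleCocycle.map_homotopic p q hpq
    have : ((exists_int_circleDisplacement p).choose : ℝ) =
      ((exists_int_circleDisplacement q).choose : ℝ) := by linarith
    exact_mod_cast this

/-- The correction by the discontinuous section is a coboundary, so it cancels on loops. It is what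
makes an integral cocycle available on all paths. -/
theorem windingCocycle_loop {x : AddCircle (1 : ℝ)} (p : Path x x) :
    (windingCocycle.toFun p : ℝ) = circleCocycle.toFun p := by
  have h := (exists_int_circleDisplacement p).choose_spec
  exact h.trans (by ring)

/-! ### Spaces uniformized by the plane modulo the integral lattice -/

/-- A uniformization of `X` by `ℝ² / ℤ²`. -/
structure TorusParam (X : Type) [TopologicalSpace X] where
  param : C(ℝ × ℝ, X)
  angle₁ : C(X, AddCircle (1 : ℝ))
  angle₂ : C(X, AddCircle (1 : ℝ))
  angle₁_param : ∀ v, angle₁ (param v) = (v.1 : AddCircle (1 : ℝ))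
  angle₂_param : ∀ v, angle₂ (param v) = (v.2 : AddCircle (1 : ℝ))
  param_eq : ∀ v x, (v.1 : AddCircle (1 : ℝ)) = angle₁ x → (v.2 : AddCircle (1 : ℝ)) = angle₂ x →
    param v = x

namespace TorusParam

variable {X A : Type} [TopologicalSpace X] [AddCommGroup A] {x : X} (T : TorusParam X)

theorem param_add_int (v : ℝ × ℝ) (m n : ℤ) : T.param (v + ((m : ℝ), (n : ℝ))) = T.param v := by
  refine T.param_eq _ _ ?_ ?_
  · rw [T.angle₁_param]
    simp
  · rw [T.angle₂_param]
    simp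

/-- The loop in `X` that is the image of a path in the plane. -/
def loopOf {u v : ℝ × ℝ} (p : Path u v) (hu : T.param u = x) (hv : T.param v = x) : Path x x :=
  (p.map T.param.continuous).cast hu.symm hv.symm

theorem loopOf_trans {u v w : ℝ × ℝ} (p : Path u v) (q : Path v w) (hu : T.param u = x)
    (hv : T.param v = x) (hw : T.param w = x) :
    T.loopOf (p.trans q) hu hw = (T.loopOf p hu hv).trans (T.loopOf q hv hw) := by
  subst hu
  unfold loopOf
  rw [Path.map_trans]
  ext t
  simp only [Path.cast_coe, Path.trans_apply]

/-- The straight path from the origin. -/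
def ray (v : ℝ × ℝ) : Path (0 : ℝ × ℝ) v where
  toFun t := (t : ℝ) • v
  continuous_toFun := by fun_prop
  source' := by simp
  target' := by simp

/-- The loop that corresponds to a lattice vector. -/
def loop (hx : T.param 0 = x) (m n : ℤ) : Path x x :=
  T.loopOf (ray ((m : ℝ), (n : ℝ))) hx (by
    rw [← hx, ← T.param_add_int 0 m n, zero_add])

theorem eval_loopOf_eq (φ : H1 X x A) {u v : ℝ × ℝ} (p q : Path u v) (hu : T.param u = x)
    (hv : T.param v = x) : φ.eval (T.loopOf p hu hv) = φ.eval (T.loopOf q hu hv) := by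
  subst hu
  refine φ.eval_homotopic ?_
  obtain ⟨h⟩ := (SimplyConnectedSpace.paths_homotopic p q).map T.param
  exact ⟨⟨h.toHomotopy, h.prop'⟩⟩

theorem eval_loop_add (φ : H1 X x A) (hx : T.param 0 = x) (m n m' n' : ℤ) :
    φ.eval (T.loop hx (m + m') (n + n')) = φ.eval (T.loop hx m n) + φ.eval (T.loop hx m' n') := by
  have h1 : T.param ((m : ℝ), (n : ℝ)) = x := by rw [← hx, ← T.param_add_int 0 m n, zero_add]
  have h2 : T.param (((m + m' : ℤ) : ℝ), ((n + n' : ℤ) : ℝ)) = x := by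
    rw [← hx, ← T.param_add_int 0 _ _, zero_add]
  let q : Path ((m : ℝ), (n : ℝ)) (((m + m' : ℤ) : ℝ), ((n + n' : ℤ) : ℝ)) :=
    { toFun := fun t => (t : ℝ) • ((m' : ℝ), (n' : ℝ)) + ((m : ℝ), (n : ℝ))
      continuous_toFun := by fun_prop
      source' := by simp
      target' := by simp [add_comm] }
  have h3 : T.loopOf q h1 h2 = T.loop hx m' n' := by
    ext t
    exact T.param_add_int _ m n
  rw [loop, T.eval_loopOf_eq φ _ ((ray ((m : ℝ), (n : ℝ))).trans q), T.loopOf_trans _ _ _ h1,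
    φ.eval_trans, h3]
  rfl

theorem eval_loop (φ : H1 X x A) (hx : T.param 0 = x) (m n : ℤ) :
    φ.eval (T.loop hx m n) = m • φ.eval (T.loop hx 1 0) + n • φ.eval (T.loop hx 0 1) := by
  let ψ : ℤ × ℤ →+ A := AddMonoidHom.mk' (fun k => φ.eval (T.loop hx k.1 k.2))
    (fun a b => T.eval_loop_add φ hx a.1 a.2 b.1 b.2)
  have h : ((m, n) : ℤ × ℤ) = m • ((1, 0) : ℤ × ℤ) + n • ((0, 1) : ℤ × ℤ) := by simp
  change ψ (m, n) = m • ψ (1, 0) + n • ψ (0, 1)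
  rw [h, map_add, map_zsmul, map_zsmul]

/-- The displacement of the first angle. -/
def displacement₁ : PathCocycle X ℝ := circleCocycle.comap T.angle₁

/-- The displacement of the second angle. -/
def displacement₂ : PathCocycle X ℝ := circleCocycle.comap T.angle₂

theorem displacement₁_eq {y z : X} (p : Path y z) (L : C(unitInterval, ℝ))
    (hL : ∀ t, (L t : AddCircle (1 : ℝ)) = T.angle₁ (p t)) :
    T.displacement₁.toFun p = L 1 - L 0 :=
  circleDisplacement_eq _ L hL

theorem displacement₂_eq {y z : X} (p : Path y z) (L : C(unitInterval, ℝ))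
    (hL : ∀ t, (L t : AddCircle (1 : ℝ)) = T.angle₂ (p t)) :
    T.displacement₂.toFun p = L 1 - L 0 :=
  circleDisplacement_eq _ L hL

theorem displacement₁_loop (hx : T.param 0 = x) (m n : ℤ) :
    T.displacement₁.toFun (T.loop hx m n) = m := by
  rw [T.displacement₁_eq _ ⟨fun t => t * m, by fun_prop⟩ fun t => ?_]
  · simp
  · exact (T.angle₁_param ((t : ℝ) • ((m : ℝ), (n : ℝ)))).symm

theorem displacement₂_loop (hx : T.param 0 = x) (m n : ℤ) :
    T.displacement₂.toFun (T.loop hx m n) = n := by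
  rw [T.displacement₂_eq _ ⟨fun t => t * n, by fun_prop⟩ fun t => ?_]
  · simp
  · exact (T.angle₂_param ((t : ℝ) • ((m : ℝ), (n : ℝ)))).symm

/-- Lifting both angles to ℝ yields a path in the plane from 0 to a lattice vector, whose image is
the given loop. In the simply connected plane it is homotopic to the straight path. -/
theorem exists_eval_eq (hx : T.param 0 = x) (γ : Path x x) :
    ∃ m n : ℤ, ∀ {A : Type} [AddCommGroup A] (φ : H1 X x A),
      φ.eval γ = φ.eval (T.loop hx m n) := by
  obtain ⟨L₁, h₁, hL₁⟩ := exists_circle_lift (γ.map T.angle₁.continuous) 0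
    (by rw [← hx, T.angle₁_param]; rfl)
  obtain ⟨L₂, h₂, hL₂⟩ := exists_circle_lift (γ.map T.angle₂.continuous) 0
    (by rw [← hx, T.angle₂_param]; rfl)
  have e₁ : ((L₁ 1 : ℝ) : AddCircle (1 : ℝ)) = 0 := by
    rw [hL₁]
    change T.angle₁ (γ 1) = _
    rw [γ.target, ← hx, T.angle₁_param]
    rfl
  have e₂ : ((L₂ 1 : ℝ) : AddCircle (1 : ℝ)) = 0 := by
    rw [hL₂]
    change T.angle₂ (γ 1) = _
    rw [γ.target, ← hx, T.angle₂_param]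
    rfl
  obtain ⟨m, hm⟩ := (AddCircle.coe_eq_zero_iff 1).mp e₁
  obtain ⟨n, hn⟩ := (AddCircle.coe_eq_zero_iff 1).mp e₂
  simp only [zsmul_eq_mul, mul_one] at hm hn
  refine ⟨m, n, fun {A} _ φ => ?_⟩
  let q : Path (0 : ℝ × ℝ) ((m : ℝ), (n : ℝ)) :=
    { toFun := fun t => (L₁ t, L₂ t)
      continuous_toFun := by fun_prop
      source' := by rw [h₁, h₂]; rfl
      target' := by rw [← hm, ← hn] }
  rw [loop, T.eval_loopOf_eq φ (ray _) q]
  congr 1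
  ext t
  exact (T.param_eq _ _ (hL₁ t) (hL₂ t)).symm

theorem ext_loop (hx : T.param 0 = x) {φ ψ : H1 X x A}
    (h₁ : φ.eval (T.loop hx 1 0) = ψ.eval (T.loop hx 1 0))
    (h₂ : φ.eval (T.loop hx 0 1) = ψ.eval (T.loop hx 0 1)) : φ = ψ := by
  refine H1.ext_eval fun γ => ?_
  obtain ⟨m, n, h⟩ := T.exists_eval_eq hx γ
  rw [h φ, h ψ, T.eval_loop φ, T.eval_loop ψ, h₁, h₂]

end TorusParam

end

noncomputable section

/-! ### The projective plane -/

theorem continuous_projectivization_mk {α : Type*} [TopologicalSpace α] {f : α → Fin 3 → ℂ}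
    (hf : Continuous f) (h : ∀ x, f x ≠ 0) :
    Continuous fun x => Projectivization.mk ℂ (f x) (h x) := by
  have h1 : Continuous (Projectivization.mk' ℂ : {v : Fin 3 → ℂ // v ≠ 0} → _) :=
    continuous_coinduced_rng
  exact h1.comp (hf.subtype_mk h)

/-- The entries of the orthogonal projection onto a line. -/
def lineProjection (P : ℙ ℂ (Fin 3 → ℂ)) (i j : Fin 3) : ℂ :=
  P.rep i * (starRingEnd ℂ) (P.rep j) / ∑ k, P.rep k * (starRingEnd ℂ) (P.rep k)

theorem sum_mul_conj_ne_zero {v : Fin 3 → ℂ} (hv : v ≠ 0) :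
    ∑ k, v k * (starRingEnd ℂ) (v k) ≠ 0 := by
  simp only [Complex.mul_conj]
  rw [← Complex.ofReal_sum, Complex.ofReal_ne_zero]
  intro h
  rw [Finset.sum_eq_zero_iff_of_nonneg fun i _ => Complex.normSq_nonneg _] at h
  exact hv (funext fun i => Complex.normSq_eq_zero.1 (h i (Finset.mem_univ i)))

theorem lineProjection_mk {v : Fin 3 → ℂ} (hv : v ≠ 0) (i j : Fin 3) :
    lineProjection (Projectivization.mk ℂ v hv) i j =
      v i * (starRingEnd ℂ) (v j) / ∑ k, v k * (starRingEnd ℂ) (v k) := by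
  obtain ⟨a, ha⟩ := Projectivization.exists_smul_eq_mk_rep ℂ v hv
  have ha0 : (a : ℂ) * (starRingEnd ℂ) a ≠ 0 :=
    mul_ne_zero a.ne_zero ((map_ne_zero _).2 a.ne_zero)
  unfold lineProjection
  rw [← ha]
  simp only [Pi.smul_apply, Units.smul_def, smul_eq_mul, map_mul]
  rw [← mul_div_mul_left (v i * _) _ ha0, Finset.mul_sum]
  congr 1
  · ring
  · exact Finset.sum_congr rfl fun k _ => by ring

theorem continuous_lineProjection : Continuous lineProjection := by
  refine continuous_coinduced_dom.2 (continuous_pi fun i => continuous_pi fun j => ?_)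
  have : (fun v : {v : Fin 3 → ℂ // v ≠ 0} => lineProjection (Projectivization.mk' ℂ v) i j) =
      fun v => v.1 i * (starRingEnd ℂ) (v.1 j) / ∑ k, v.1 k * (starRingEnd ℂ) (v.1 k) :=
    funext fun v => lineProjection_mk v.2 i j
  change Continuous fun v : {v : Fin 3 → ℂ // v ≠ 0} => lineProjection (Projectivization.mk' ℂ v) i j
  rw [this]
  have hc : ∀ i, Continuous fun v : {v : Fin 3 → ℂ // v ≠ 0} => v.1 i :=
    fun i => (continuous_apply i).comp continuous_subtype_val
  refine Continuous.div ?_ ?_ fun v => sum_mul_conj_ne_zero v.2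
  · exact (hc i).mul (Complex.continuous_conj.comp (hc j))
  · exact continuous_finsetSum _ fun k _ => (hc k).mul (Complex.continuous_conj.comp (hc k))

/-- A line is recovered from a nonzero column of its orthogonal projection. Together with continuity
this makes the projective plane Hausdorff, as needed for the properness argument in
`continuous_angle`. -/
theorem lineProjection_injective : Function.Injective lineProjection := by
  intro P Q h
  have hQ := sum_mul_conj_ne_zero Q.rep_nonzero
  have hP := sum_mul_conj_ne_zero P.rep_nonzero
  obtain ⟨j, hj⟩ : ∃ j, P.rep j ≠ 0 := Function.ne_iff.1 P.rep_nonzero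
  have e : ∀ i, P.rep i * (starRingEnd ℂ) (P.rep j) * ∑ k, Q.rep k * (starRingEnd ℂ) (Q.rep k) =
      Q.rep i * (starRingEnd ℂ) (Q.rep j) * ∑ k, P.rep k * (starRingEnd ℂ) (P.rep k) := fun i => by
    have := congrFun (congrFun h i) j
    rwa [lineProjection, lineProjection, div_eq_div_iff hP hQ] at this
  have hj' : (starRingEnd ℂ) (P.rep j) * ∑ k, Q.rep k * (starRingEnd ℂ) (Q.rep k) ≠ 0 :=
    mul_ne_zero ((map_ne_zero _).2 hj) hQ
  rw [← P.mk_rep, ← Q.mk_rep, Projectivization.mk_eq_mk_iff']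
  refine ⟨(starRingEnd ℂ) (Q.rep j) * (∑ k, P.rep k * (starRingEnd ℂ) (P.rep k)) /
    ((starRingEnd ℂ) (P.rep j) * ∑ k, Q.rep k * (starRingEnd ℂ) (Q.rep k)), funext fun i => ?_⟩
  rw [Pi.smul_apply, smul_eq_mul, div_mul_eq_mul_div, div_eq_iff hj']
  linear_combination -e i

instance : T2Space (ℙ ℂ (Fin 3 → ℂ)) :=
  T2Space.of_injective_continuous lineProjection_injective continuous_lineProjection

theorem onLegendre_mk {l : ℂ} {v : Fin 3 → ℂ} (hv : v ≠ 0) :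
    OnLegendre l (Projectivization.mk ℂ v hv) ↔
      v 1 ^ 2 * v 2 = v 0 * (v 0 - v 2) * (v 0 - l * v 2) := by
  obtain ⟨a, ha⟩ := Projectivization.exists_smul_eq_mk_rep ℂ v hv
  have ha0 : (a : ℂ) ^ 3 ≠ 0 := pow_ne_zero _ a.ne_zero
  unfold OnLegendre
  rw [← ha]
  simp only [Pi.smul_apply, Units.smul_def, smul_eq_mul]
  rw [← mul_right_inj' ha0 (b := v 1 ^ 2 * v 2)]
  constructor <;> intro h <;> linear_combination h

theorem mk_rep_div {v : Fin 3 → ℂ} (hv : v ≠ 0) (i j : Fin 3) :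
    (Projectivization.mk ℂ v hv).rep i / (Projectivization.mk ℂ v hv).rep j = v i / v j := by
  obtain ⟨a, ha⟩ := Projectivization.exists_smul_eq_mk_rep ℂ v hv
  rw [← ha]
  exact mul_div_mul_left _ _ a.ne_zero

/-! ### The uniformization of a Legendre curve by the Weierstrass function -/

theorem vec_one_ne_zero (x z : ℂ) : (![x, 1, z] : Fin 3 → ℂ) ≠ 0 :=
  fun h => by simpa using congrFun h 1

theorem vec_two_ne_zero (x y : ℂ) : (![x, y, 1] : Fin 3 → ℂ) ≠ 0 :=
  fun h => by simpa using congrFun h 2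

open Classical in
/-- The point of the Legendre curve with parameter `l` that corresponds to `z ∈ ℂ`. -/
def legendrePoint (L : PeriodPair) (l z : ℂ) : ℙ ℂ (Fin 3 → ℂ) :=
  if z ∈ L.lattice then Projectivization.mk ℂ ![0, 1, 0] (vec_one_ne_zero 0 0)
  else Projectivization.mk ℂ ![L.weierstrassP z + (1 + l) / 3, L.derivWeierstrassP z / 2, 1]
    (vec_two_ne_zero _ _)

variable {L : PeriodPair} {w₀ w₁ w₂ l z z' : ℂ}

theorem legendrePoint_of_mem (h : z ∈ L.lattice) :
    legendrePoint L l z = Projectivization.mk ℂ ![0, 1, 0] (vec_one_ne_zero 0 0) := if_pos h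

theorem legendrePoint_of_notMem (h : z ∉ L.lattice) : legendrePoint L l z =
    Projectivization.mk ℂ ![L.weierstrassP z + (1 + l) / 3, L.derivWeierstrassP z / 2, 1]
      (vec_two_ne_zero _ _) := if_neg h

theorem legendrePoint_add (h : z' ∈ L.lattice) : legendrePoint L l (z + z') = legendrePoint L l z := by
  have e : z + z' ∈ L.lattice ↔ z ∈ L.lattice := L.lattice.add_mem_iff_left h
  by_cases hz : z ∈ L.lattice
  · rw [legendrePoint_of_mem hz, legendrePoint_of_mem (e.2 hz)]
  · rw [legendrePoint_of_notMem hz, legendrePoint_of_notMem (fun h' => hz (e.1 h'))]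
    have h1 := L.weierstrassP_add_coe z ⟨z', h⟩
    have h2 := L.derivWeierstrassP_add_coe z ⟨z', h⟩
    simp only at h1 h2
    simp only [h1, h2]

theorem sub_mem_of_legendrePoint_eq (h : legendrePoint L l z = legendrePoint L l z') :
    z - z' ∈ L.lattice := by
  by_cases hz : z ∈ L.lattice <;> by_cases hz' : z' ∈ L.lattice
  · exact L.lattice.sub_mem hz hz'
  · rw [legendrePoint_of_mem hz, legendrePoint_of_notMem hz', Projectivization.mk_eq_mk_iff'] at h
    obtain ⟨a, ha⟩ := h
    have h2 := congrFun ha 2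
    have h1 := congrFun ha 1
    simp at h1 h2
    simp [h2] at h1
  · rw [legendrePoint_of_notMem hz, legendrePoint_of_mem hz', Projectivization.mk_eq_mk_iff'] at h
    obtain ⟨a, ha⟩ := h
    have h2 := congrFun ha 2
    simp at h2
  · rw [legendrePoint_of_notMem hz, legendrePoint_of_notMem hz', Projectivization.mk_eq_mk_iff'] at h
    obtain ⟨a, ha⟩ := h
    have h2 := congrFun ha 2
    have h1 := congrFun ha 1
    have h0 := congrFun ha 0
    simp at h0 h1 h2
    subst h2
    simp at h0 h1
    refine L.sub_mem_lattice_of_eq hz hz' h0.symm h1.symm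

/-- The substitution x = ℘ + (1 + l)/3, y = ℘'/2 moves the half-period values to 0, 1, l and absorbs
the factor 4 of the Weierstrass equation. -/
theorem PeriodPair.IsNormalizedFor.onLegendre (h : L.IsNormalizedFor w₀ w₁ w₂ l) (z : ℂ) :
    OnLegendre l (legendrePoint L l z) := by
  by_cases hz : z ∈ L.lattice
  · rw [legendrePoint_of_mem hz, onLegendre_mk]
    simp
  · rw [legendrePoint_of_notMem hz, onLegendre_mk]
    have h0 := h.weierstrassP_eq
    have h1 : L.weierstrassP w₁ = 1 - (1 + l) / 3 := by linear_combination h.2.1 + h0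
    have h2 : L.weierstrassP w₂ = l - (1 + l) / 3 := by linear_combination h.2.2 + h0
    have := h.1.derivWeierstrassP_sq hz
    rw [h0, h1, h2] at this
    simp
    linear_combination this / 4

/-- The only point at infinity is the origin of the curve; affine points are reached because the
pair (℘, ℘') attains every solution of the Weierstrass equation. -/
theorem PeriodPair.IsNormalizedFor.exists_legendrePoint_eq (h : L.IsNormalizedFor w₀ w₁ w₂ l)
    {P : ℙ ℂ (Fin 3 → ℂ)} (hP : OnLegendre l P) : ∃ z, legendrePoint L l z = P := by
  induction P with | h v hv =>
  rw [onLegendre_mk] at hP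
  by_cases h2 : v 2 = 0
  · have h0 : v 0 = 0 := by simpa [h2] using hP
    refine ⟨0, ?_⟩
    rw [legendrePoint_of_mem L.lattice.zero_mem, Projectivization.mk_eq_mk_iff']
    have h1 : v 1 ≠ 0 := fun h1 => hv (by ext i; fin_cases i <;> assumption)
    refine ⟨(v 1)⁻¹, ?_⟩
    ext i
    fin_cases i <;> simp [h0, h1, h2]
  · have e0 := h.weierstrassP_eq
    have e1 : L.weierstrassP w₁ = 1 - (1 + l) / 3 := by linear_combination h.2.1 + e0
    have e2 : L.weierstrassP w₂ = l - (1 + l) / 3 := by linear_combination h.2.2 + e0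
    have hP' : (v 1 / v 2) ^ 2 = v 0 / v 2 * (v 0 / v 2 - 1) * (v 0 / v 2 - l) := by
      field_simp
      linear_combination hP
    obtain ⟨u, hu, hx, hy⟩ := L.exists_weierstrassP_eq_and_deriv_eq (x := v 0 / v 2 - (1 + l) / 3)
      (y := 2 * (v 1 / v 2)) (by
        rw [h.1.g₂_eq, h.1.g₃_eq, e0, e1, e2]
        linear_combination 4 * hP')
    refine ⟨u, ?_⟩
    rw [legendrePoint_of_notMem hu, Projectivization.mk_eq_mk_iff']
    refine ⟨(v 2)⁻¹, ?_⟩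
    ext i
    fin_cases i
    · simp [hx]; ring
    · simp [hy]; ring
    · simp [h2]

/-! ### Local uniformization of the Legendre family -/

theorem PeriodPair.derivWeierstrassP_ofRatio {s τ : ℂ} (hs : s ≠ 0) (hτ : 0 < τ.im) (z : ℂ) :
    (ofRatio s τ hs hτ).derivWeierstrassP (s * z) =
      (s ^ 3)⁻¹ * (ofRatio 1 τ one_ne_zero hτ).derivWeierstrassP z := by
  have h : (ofRatio s τ hs hτ).weierstrassP =
      fun u => (s ^ 2)⁻¹ * (ofRatio 1 τ one_ne_zero hτ).weierstrassP (s⁻¹ * u) := funext fun u => by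
    rw [← weierstrassP_ofRatio hs hτ, mul_inv_cancel_left₀ hs]
  rw [← deriv_weierstrassP, ← deriv_weierstrassP, h, deriv_const_mul_field,
    deriv_comp_mul_left s⁻¹ (ofRatio 1 τ one_ne_zero hτ).weierstrassP, inv_mul_cancel_left₀ hs,
    smul_eq_mul, ← mul_assoc, ← mul_inv, ← pow_succ]

/-- Normalized periods for the Legendre curves over `U`. -/
structure LegendreFrame (U : Set legendreBase) where
  perm : Equiv.Perm (Fin 3)
  scale : ℂ → ℂ
  ratio : ℂ → ℂ
  scale_ne_zero : ∀ l ∈ U, scale (l : legendreBase) ≠ 0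
  im_pos : ∀ l ∈ U, 0 < (ratio (l : legendreBase)).im
  continuous_scale : Continuous fun l : U => scale l
  differentiableAt_ratio : ∀ l ∈ U, DifferentiableAt ℂ ratio (l : legendreBase)
  deriv_ratio_ne_zero : ∀ l ∈ U, deriv ratio (l : legendreBase) ≠ 0
  isNormalized : ∀ l (hl : l ∈ U),
    (PeriodPair.ofRatio (scale l) (ratio l) (scale_ne_zero l hl) (im_pos l hl)).IsNormalizedFor
      (scale l * PeriodPair.halfPeriod (ratio l) (perm 0))
      (scale l * PeriodPair.halfPeriod (ratio l) (perm 1))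
      (scale l * PeriodPair.halfPeriod (ratio l) (perm 2)) l

theorem exists_legendreFrame (l₀ : legendreBase) :
    ∃ U : Set legendreBase, IsOpen U ∧ l₀ ∈ U ∧ Nonempty (LegendreFrame U) := by
  obtain ⟨σ, U, s, τ, hU, hl₀, hs, h⟩ := PeriodPair.exists_family l₀.2.1 l₀.2.2
  exact ⟨Subtype.val ⁻¹' U, hU.preimage continuous_subtype_val, hl₀,
    ⟨{ perm := σ
       scale := s
       ratio := τ
       scale_ne_zero := fun l hl => (h l hl).2.2.1
       im_pos := fun l hl => (h l hl).2.2.2.1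
       continuous_scale := hs.comp_continuous (by fun_prop) fun l => l.2
       differentiableAt_ratio := fun l hl => (h l hl).1
       deriv_ratio_ne_zero := fun l hl => (h l hl).2.1
       isNormalized := fun l hl => (h l hl).2.2.2.2 }⟩⟩

namespace LegendreFrame

variable {U : Set legendreBase} (D : LegendreFrame U)

/-- The lattice of the Legendre curve over a point of `U`. -/
def lattice (l : U) : PeriodPair :=
  PeriodPair.ofRatio (D.scale l) (D.ratio l) (D.scale_ne_zero l l.2) (D.im_pos l l.2)

/-- The complex number with given coordinates with respect to the normalized periods. -/
def coord (l : U) (v : ℝ × ℝ) : ℂ := D.scale l * (v.1 + v.2 * D.ratio l)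

/-- The point with given coordinates with respect to the normalized periods. -/
def point (l : U) (v : ℝ × ℝ) : ℙ ℂ (Fin 3 → ℂ) :=
  legendrePoint (D.lattice l) (l : legendreBase) (D.coord l v)

theorem coord_mem_lattice (l : U) (v : ℝ × ℝ) :
    D.coord l v ∈ (D.lattice l).lattice ↔ (∃ m : ℤ, m = v.1) ∧ ∃ n : ℤ, n = v.2 :=
  PeriodPair.coords_mem_lattice _ _

theorem coord_sub (l : U) (v w : ℝ × ℝ) : D.coord l (v - w) = D.coord l v - D.coord l w := by
  simp only [coord, Prod.fst_sub, Prod.snd_sub]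
  push_cast
  ring

theorem coord_add (l : U) (v w : ℝ × ℝ) : D.coord l (v + w) = D.coord l v + D.coord l w := by
  simp only [coord, Prod.fst_add, Prod.snd_add]
  push_cast
  ring

theorem onLegendre_point (l : U) (v : ℝ × ℝ) : OnLegendre (l : legendreBase) (D.point l v) :=
  (D.isNormalized l l.2).onLegendre _

theorem point_add_int (l : U) (v : ℝ × ℝ) (m n : ℤ) :
    D.point l (v + ((m : ℝ), (n : ℝ))) = D.point l v := by
  rw [point, coord_add]
  exact legendrePoint_add ((D.coord_mem_lattice l _).2 ⟨⟨m, rfl⟩, n, rfl⟩)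

theorem angle_eq_of_point_eq {l : U} {v w : ℝ × ℝ} (h : D.point l v = D.point l w) :
    (v.1 : AddCircle (1 : ℝ)) = w.1 ∧ (v.2 : AddCircle (1 : ℝ)) = w.2 := by
  have := sub_mem_of_legendrePoint_eq h
  rw [← coord_sub, coord_mem_lattice] at this
  obtain ⟨⟨m, hm⟩, n, hn⟩ := this
  constructor <;> rw [← sub_eq_zero, ← AddCircle.coe_sub, AddCircle.coe_eq_zero_iff]
  exacts [⟨m, by simpa using hm⟩, ⟨n, by simpa using hn⟩]

theorem point_eq_of_angle_eq (l : U) {v w : ℝ × ℝ} (h₁ : (v.1 : AddCircle (1 : ℝ)) = w.1)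
    (h₂ : (v.2 : AddCircle (1 : ℝ)) = w.2) : D.point l v = D.point l w := by
  rw [← sub_eq_zero, ← AddCircle.coe_sub, AddCircle.coe_eq_zero_iff] at h₁ h₂
  obtain ⟨m, hm⟩ := h₁
  obtain ⟨n, hn⟩ := h₂
  simp only [zsmul_eq_mul, mul_one] at hm hn
  rw [← D.point_add_int l w m n]
  congr 1
  ext
  · simp [hm]
  · simp [hn]

theorem exists_point_eq (l : U) {P : ℙ ℂ (Fin 3 → ℂ)} (hP : OnLegendre (l : legendreBase) P) :
    ∃ v : ℝ × ℝ, v ∈ Set.Icc (0 : ℝ) 1 ×ˢ Set.Icc (0 : ℝ) 1 ∧ D.point l v = P := by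
  obtain ⟨z, rfl⟩ := (D.isNormalized l l.2).exists_legendrePoint_eq hP
  have hs := D.scale_ne_zero l l.2
  have hτ := D.im_pos l l.2
  set b : ℝ := (z / D.scale l).im / (D.ratio l).im with hb
  set a : ℝ := (z / D.scale l).re - b * (D.ratio l).re with ha
  have e : D.coord l (a, b) = z := by
    have : (a : ℂ) + b * D.ratio l = z / D.scale l := by
      apply Complex.ext
      · simp [ha]
      · simp [hb, hτ.ne']
    simp only [coord]
    rw [this, mul_div_cancel₀ _ hs]
  refine ⟨(Int.fract a, Int.fract b), ⟨⟨Int.fract_nonneg _, (Int.fract_lt_one _).le⟩,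
    Int.fract_nonneg _, (Int.fract_lt_one _).le⟩, ?_⟩
  rw [← D.point_add_int l _ ⌊a⌋ ⌊b⌋]
  simp only [Prod.mk_add_mk, Int.fract_add_floor]
  rw [point, e]
  rfl

/-- Homogeneous coordinates of `point`, near the zero section. -/
def polarVec (p : U × ℝ × ℝ) : Fin 3 → ℂ :=
  let s := D.scale p.1
  let τ := D.ratio p.1
  let z : ℂ := p.2.1 + p.2.2 * τ
  ![(s ^ 2)⁻¹ * (z ^ 3 * PeriodPair.regularPart (τ, p.2) + z) + z ^ 3 * (1 + (p.1 : legendreBase)) / 3,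
    (s ^ 3)⁻¹ * (z ^ 3 * PeriodPair.derivRegularPart (τ, p.2) - 2) / 2, z ^ 3]

end LegendreFrame

end

/-! ### Continuity of the uniformization and angular coordinates on the family. -/

noncomputable section

namespace LegendreFrame

variable {U : Set legendreBase} (D : LegendreFrame U)

theorem eq_zero_of_add_mul_eq_zero {τ : ℂ} (hτ : 0 < τ.im) {a b : ℝ} (h : (a : ℂ) + b * τ = 0) :
    a = 0 ∧ b = 0 := by
  have h1 := congrArg Complex.im h
  have h2 := congrArg Complex.re h
  simp at h1 h2
  have hb : b = 0 := h1.resolve_right hτ.ne'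
  subst hb
  exact ⟨by simpa using h2, rfl⟩

theorem polarVec_ne_zero (p : U × ℝ × ℝ) : D.polarVec p ≠ 0 := by
  intro h
  have h2 : ((p.2.1 : ℂ) + p.2.2 * D.ratio p.1) ^ 3 = 0 := congrFun h 2
  have hz := pow_eq_zero_iff (three_ne_zero) |>.1 h2
  have h1 := congrFun h 1
  simp only [polarVec, hz] at h1
  simp [D.scale_ne_zero p.1 p.1.2] at h1

/-- Scaling the affine coordinates by z³, with z = a + bτ, clears the poles of ℘ and ℘'. One
continuous formula then also covers the zero section, where the middle coordinate is nonzero. -/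
theorem mk_polarVec {p : U × ℝ × ℝ} (h₁ : |p.2.1| < 1) (h₂ : |p.2.2| < 1) :
    Projectivization.mk ℂ (D.polarVec p) (D.polarVec_ne_zero p) = D.point p.1 p.2 := by
  obtain ⟨l, a, b⟩ := p
  have hτ := D.im_pos l l.2
  have hs := D.scale_ne_zero l l.2
  by_cases hz : (a : ℂ) + b * D.ratio l = 0
  · have hv : D.coord l (a, b) ∈ (D.lattice l).lattice := by
      simp only [coord, hz, mul_zero]
      exact Submodule.zero_mem _
    rw [point, legendrePoint_of_mem hv, Projectivization.mk_eq_mk_iff']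
    refine ⟨-(D.scale l ^ 3)⁻¹, ?_⟩
    ext i
    fin_cases i <;> simp [polarVec, hz]
    ring
  · have hv : D.coord l (a, b) ∉ (D.lattice l).lattice := by
      rw [coord_mem_lattice]
      rintro ⟨⟨m, hm⟩, n, hn⟩
      simp only at hm hn h₁ h₂
      rw [← hm] at h₁
      rw [← hn] at h₂
      have hm0 : m = 0 := Int.abs_lt_one_iff.1 (by exact_mod_cast h₁)
      have hn0 : n = 0 := Int.abs_lt_one_iff.1 (by exact_mod_cast h₂)
      simp [← hm, ← hn, hm0, hn0] at hz
    rw [point, legendrePoint_of_notMem hv, Projectivization.mk_eq_mk_iff']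
    refine ⟨((a : ℂ) + b * D.ratio l) ^ 3, ?_⟩
    have e1 : (D.lattice l).weierstrassP (D.coord l (a, b)) = _ :=
      PeriodPair.weierstrassP_ofRatio hs hτ _
    have e2 : (D.lattice l).derivWeierstrassP (D.coord l (a, b)) = _ :=
      PeriodPair.derivWeierstrassP_ofRatio hs hτ _
    simp only at e1 e2
    rw [PeriodPair.weierstrassP_eq_regularPart hτ] at e1
    rw [PeriodPair.derivWeierstrassP_eq_derivRegularPart hτ] at e2
    rw [e1, e2]
    ext i
    fin_cases i
    · simp only [polarVec, Pi.smul_apply, smul_eq_mul]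
      simp
      field_simp
    · simp only [polarVec, Pi.smul_apply, smul_eq_mul]
      simp
      field_simp
    · simp [polarVec]

theorem continuous_coe_base : Continuous fun l : U => ((l : legendreBase) : ℂ) := by fun_prop

theorem continuous_ratio : Continuous fun l : U => D.ratio l :=
  continuous_iff_continuousAt.2 fun l => ContinuousAt.comp (g := D.ratio)
    (D.differentiableAt_ratio l l.2).continuousAt continuous_coe_base.continuousAt

theorem continuousOn_polarVec :
    ContinuousOn D.polarVec {p : U × ℝ × ℝ | |p.2.1| < 1 ∧ |p.2.2| < 1} := by
  have hs : Continuous fun p : U × ℝ × ℝ => D.scale p.1 := D.continuous_scale.comp continuous_fst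
  have hτ : Continuous fun p : U × ℝ × ℝ => D.ratio p.1 := D.continuous_ratio.comp continuous_fst
  have hl : Continuous fun p : U × ℝ × ℝ => ((p.1 : legendreBase) : ℂ) :=
    continuous_coe_base.comp continuous_fst
  have hz : Continuous fun p : U × ℝ × ℝ => (p.2.1 : ℂ) + p.2.2 * D.ratio p.1 := by fun_prop
  have hmap : Set.MapsTo (fun p : U × ℝ × ℝ => (D.ratio p.1, p.2))
      {p : U × ℝ × ℝ | |p.2.1| < 1 ∧ |p.2.2| < 1} PeriodPair.polarRegion :=
    fun p hp => ⟨D.im_pos p.1 p.1.2, hp⟩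
  have hc : Continuous fun p : U × ℝ × ℝ => (D.ratio p.1, p.2) := by fun_prop
  have hR := PeriodPair.continuousOn_regularPart.comp hc.continuousOn hmap
  have hR' := PeriodPair.continuousOn_derivRegularPart.comp hc.continuousOn hmap
  have hs2 : Continuous fun p : U × ℝ × ℝ => (D.scale p.1 ^ 2)⁻¹ :=
    (hs.pow 2).inv₀ fun p => pow_ne_zero _ (D.scale_ne_zero p.1 p.1.2)
  have hs3 : Continuous fun p : U × ℝ × ℝ => (D.scale p.1 ^ 3)⁻¹ :=
    (hs.pow 3).inv₀ fun p => pow_ne_zero _ (D.scale_ne_zero p.1 p.1.2)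
  refine continuousOn_pi.2 fun i => ?_
  fin_cases i
  · exact (hs2.continuousOn.mul (((hz.pow 3).continuousOn.mul hR).add hz.continuousOn)).add
      (((hz.pow 3).mul (continuous_const.add hl)).div_const 3).continuousOn
  · exact (hs3.continuousOn.mul (((hz.pow 3).continuousOn.mul hR').sub continuousOn_const)).div_const 2
  · exact (hz.pow 3).continuousOn

theorem continuous_point : Continuous fun p : U × ℝ × ℝ => D.point p.1 p.2 := by
  set W : Set (U × ℝ × ℝ) := {p | |p.2.1| < 1 ∧ |p.2.2| < 1} with hW
  have hWo : IsOpen W :=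
    (isOpen_lt (f := fun p : U × ℝ × ℝ => |p.2.1|) (g := fun _ => 1) (by fun_prop) (by fun_prop)).inter
      (isOpen_lt (f := fun p : U × ℝ × ℝ => |p.2.2|) (g := fun _ => 1) (by fun_prop) (by fun_prop))
  have h : ContinuousOn (fun p : U × ℝ × ℝ => D.point p.1 p.2) W := by
    rw [continuousOn_iff_continuous_domRestrict]
    have : W.domRestrict (fun p : U × ℝ × ℝ => D.point p.1 p.2) = fun p : W =>
        Projectivization.mk ℂ (D.polarVec p) (D.polarVec_ne_zero p) :=
      funext fun p => (D.mk_polarVec p.2.1 p.2.2).symm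
    rw [this]
    exact continuous_projectivization_mk
      (continuousOn_iff_continuous_domRestrict.1 D.continuousOn_polarVec) _
  refine continuous_iff_continuousAt.2 fun p => ?_
  -- Subtracting the rounded coordinates of p, kept fixed, moves a neighbourhood of p into the polar
  -- region without changing the point of the curve.
  set f : U × ℝ × ℝ → U × ℝ × ℝ :=
    fun q => (q.1, q.2 - ((round p.2.1 : ℝ), (round p.2.2 : ℝ))) with hf
  have hfp : f p ∈ W := by
    constructor
    · exact (abs_sub_round _).trans_lt (by norm_num)
    · exact (abs_sub_round _).trans_lt (by norm_num)
  have e : (fun p : U × ℝ × ℝ => D.point p.1 p.2) = (fun p : U × ℝ × ℝ => D.point p.1 p.2) ∘ f :=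
    funext fun q => by
      simp only [hf, Function.comp_apply]
      rw [← D.point_add_int q.1 (q.2 - _) (round p.2.1) (round p.2.2), sub_add_cancel]
  rw [e]
  exact ContinuousAt.comp (h.continuousAt (hWo.mem_nhds hfp)) (by fun_prop)

/-- The uniformization of the family over `U`. -/
def totalPoint (l : U) (v : ℝ × ℝ) : LegendreTotal U :=
  ⟨((l : legendreBase), D.point l v), l.2, D.onLegendre_point l v⟩

theorem continuous_totalPoint : Continuous fun p : U × ℝ × ℝ => D.totalPoint p.1 p.2 :=
  Continuous.subtype_mk ((continuous_subtype_val.comp continuous_fst).prodMk D.continuous_point) _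

/-- The projection of the family. -/
def projection (q : LegendreTotal U) : U := ⟨q.1.1, q.2.1⟩

theorem exists_totalPoint_eq (q : LegendreTotal U) :
    ∃ v : ℝ × ℝ, v ∈ Set.Icc (0 : ℝ) 1 ×ˢ Set.Icc (0 : ℝ) 1 ∧ D.totalPoint (projection q) v = q := by
  obtain ⟨v, hv, h⟩ := D.exists_point_eq (projection q) q.2.2
  exact ⟨v, hv, Subtype.ext (Prod.ext rfl h)⟩

/-- The angular coordinates on the family. -/
def angle (q : LegendreTotal U) : AddCircle (1 : ℝ) × AddCircle (1 : ℝ) :=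
  ((D.exists_totalPoint_eq q).choose.1, (D.exists_totalPoint_eq q).choose.2)

theorem angle_totalPoint (l : U) (v : ℝ × ℝ) : D.angle (D.totalPoint l v) = (↑v.1, ↑v.2) := by
  have h := (D.exists_totalPoint_eq (D.totalPoint l v)).choose_spec.2
  obtain ⟨h1, h2⟩ := D.angle_eq_of_point_eq (l := l) (congrArg (fun q => q.1.2) h)
  exact Prod.ext h1 h2

/-- The map from U × (closed unit square) to the family is proper, because its composite with the
projection to U is. Being surjective and closed, it is a quotient map, and on the square the angles
are visibly continuous although `angle` itself is defined by choice. -/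
theorem continuous_angle : Continuous D.angle := by
  set I : Set (ℝ × ℝ) := Set.Icc (0 : ℝ) 1 ×ˢ Set.Icc (0 : ℝ) 1
  have : CompactSpace I := isCompact_iff_compactSpace.1 (isCompact_Icc.prod isCompact_Icc)
  set Ψ : U × I → LegendreTotal U := fun p => D.totalPoint p.1 p.2
  have hΨ : Continuous Ψ := D.continuous_totalPoint.comp (f := fun p : U × I => (p.1, (p.2 : ℝ × ℝ)))
    (by fun_prop)
  have hp : Continuous (projection (U := U)) := by unfold projection; fun_prop
  have hproper : IsProperMap Ψ := isProperMap_of_comp_of_t2 hΨ hp (isProperMap_fst_of_compactSpace)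
  have hq : Topology.IsQuotientMap Ψ := hproper.isClosedMap.isQuotientMap hΨ fun q => by
    obtain ⟨v, hv, h⟩ := D.exists_totalPoint_eq q
    exact ⟨(projection q, ⟨v, hv⟩), h⟩
  rw [hq.continuous_iff]
  have : D.angle ∘ Ψ = fun p => (((p.2 : ℝ × ℝ).1 : AddCircle (1 : ℝ)), ((p.2 : ℝ × ℝ).2 : AddCircle (1 : ℝ))) :=
    funext fun p => D.angle_totalPoint _ _
  rw [this]
  have hc : Continuous ((↑) : ℝ → AddCircle (1 : ℝ)) := AddCircle.continuous_mk' 1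
  fun_prop

/-- The uniformization of a Legendre curve. -/
def torusParam (l : U) : TorusParam (LegendreCurve l) where
  param := ⟨fun v => ⟨D.point l v, D.onLegendre_point l v⟩,
    (D.continuous_point.comp (by fun_prop : Continuous fun v : ℝ × ℝ => (l, v))).subtype_mk _⟩
  angle₁ := ⟨fun P => (D.angle (fiberInclusion U l l.2 P)).1,
    (continuous_fst.comp D.continuous_angle).comp (fiberInclusion U l l.2).continuous⟩
  angle₂ := ⟨fun P => (D.angle (fiberInclusion U l l.2 P)).2,
    (continuous_snd.comp D.continuous_angle).comp (fiberInclusion U l l.2).continuous⟩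
  angle₁_param v := congrArg Prod.fst (D.angle_totalPoint l v)
  angle₂_param v := congrArg Prod.snd (D.angle_totalPoint l v)
  param_eq v P h₁ h₂ := by
    obtain ⟨w, -, hw⟩ := D.exists_totalPoint_eq (fiberInclusion U l l.2 P)
    have hw' : D.totalPoint l w = fiberInclusion U l l.2 P := hw
    have hP : D.point l w = P.1 := congrArg (fun q => q.1.2) hw'
    refine Subtype.ext ?_
    change D.point l v = P.1
    rw [← hP]
    change _ = (D.angle (fiberInclusion U l l.2 P)).1 at h₁
    change _ = (D.angle (fiberInclusion U l l.2 P)).2 at h₂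
    rw [← hw', D.angle_totalPoint] at h₁ h₂
    exact D.point_eq_of_angle_eq l h₁ h₂

theorem torusParam_zero (l : U) : (D.torusParam l).param 0 = legendreOrigin l := by
  refine Subtype.ext ?_
  change D.point l 0 = _
  refine legendrePoint_of_mem ?_
  rw [coord_mem_lattice]
  exact ⟨⟨0, by simp⟩, 0, by simp⟩

end LegendreFrame

end

noncomputable section

/-! ### The periods of the holomorphic differential -/

/-- The choice of the angle in the interval around `a`. -/
def angleNear (a : ℝ) (x : AddCircle (1 : ℝ)) : ℝ := AddCircle.equivIco 1 (a - 1 / 2) x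

theorem coe_angleNear (a : ℝ) (x : AddCircle (1 : ℝ)) : (angleNear a x : AddCircle (1 : ℝ)) = x :=
  AddCircle.coe_equivIco

theorem continuousAt_angleNear {a : ℝ} {x : AddCircle (1 : ℝ)}
    (h : x ≠ ((a - 1 / 2 : ℝ) : AddCircle (1 : ℝ))) : ContinuousAt (angleNear a) x :=
  continuous_subtype_val.continuousAt.comp (AddCircle.continuousAt_equivIco 1 (a - 1 / 2) h)

theorem coe_ne_sub_half (a : ℝ) :
    (a : AddCircle (1 : ℝ)) ≠ ((a - 1 / 2 : ℝ) : AddCircle (1 : ℝ)) := by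
  intro h
  rw [← sub_eq_zero, ← AddCircle.coe_sub, AddCircle.coe_eq_zero_iff] at h
  obtain ⟨n, hn⟩ := h
  refine PeriodPair.not_exists_int_eq_half (Or.inl rfl) ⟨n, ?_⟩
  simp only [zsmul_eq_mul, mul_one] at hn
  linarith

namespace LegendreFrame

variable {U : Set legendreBase} (D : LegendreFrame U) {l : U}

theorem affineX_param {v : ℝ × ℝ} (hv : D.coord l v ∉ (D.lattice l).lattice) :
    affineX ((D.torusParam l).param v) =
      (D.lattice l).weierstrassP (D.coord l v) + (1 + (l : legendreBase)) / 3 := by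
  have h : D.point l v = _ := legendrePoint_of_notMem hv
  change (D.point l v).rep 0 / (D.point l v).rep 2 = _
  rw [h, mk_rep_div]
  simp

theorem affineY_param {v : ℝ × ℝ} (hv : D.coord l v ∉ (D.lattice l).lattice) :
    affineY ((D.torusParam l).param v) = (D.lattice l).derivWeierstrassP (D.coord l v) / 2 := by
  have h : D.point l v = _ := legendrePoint_of_notMem hv
  change (D.point l v).rep 1 / (D.point l v).rep 2 = _
  rw [h, mk_rep_div]
  simp

theorem notMem_of_affineY_ne_zero {v : ℝ × ℝ} (h : affineY ((D.torusParam l).param v) ≠ 0) :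
    D.coord l v ∉ (D.lattice l).lattice := by
  intro hv
  have e : D.point l v = _ := legendrePoint_of_mem hv
  change (D.point l v).rep 1 / (D.point l v).rep 2 ≠ 0 at h
  rw [e, mk_rep_div] at h
  simp at h

theorem two_mul_mem_of_affineY_eq_zero {v : ℝ × ℝ} (h : affineY ((D.torusParam l).param v) = 0) :
    2 * D.coord l v ∈ (D.lattice l).lattice := by
  by_cases hv : D.coord l v ∈ (D.lattice l).lattice
  · rw [two_mul]
    exact Submodule.add_mem _ hv hv
  · rw [D.affineY_param hv] at h
    exact (D.lattice l).two_mul_mem_lattice hv (by simpa using h)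

theorem continuous_coord : Continuous (D.coord l) := by
  unfold coord
  fun_prop

/-- The cocycle that integrates `dx/y`. -/
def integralCocycle (l : U) : PathCocycle (LegendreCurve l) ℂ :=
  ((D.torusParam l).displacement₁.mapCoeff
    ((AddMonoidHom.mulLeft (2 * D.scale l)).comp Complex.ofRealHom.toAddMonoidHom)).add
  ((D.torusParam l).displacement₂.mapCoeff
    ((AddMonoidHom.mulLeft (2 * D.scale l * D.ratio l)).comp Complex.ofRealHom.toAddMonoidHom))

theorem integralCocycle_eq {R S : LegendreCurve l} (p : Path R S) :
    (D.integralCocycle l).toFun p = 2 * D.coord l ((D.torusParam l).displacement₁.toFun p,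
      (D.torusParam l).displacement₂.toFun p) := by
  change 2 * D.scale l * (((D.torusParam l).displacement₁.toFun p : ℝ) : ℂ) +
    2 * D.scale l * D.ratio l * (((D.torusParam l).displacement₂.toFun p : ℝ) : ℂ) = _
  rw [coord]
  ring

/-- Since x = ℘(z) + const and y = ℘'(z)/2, the differential dx/y equals 2 dz. Near a point,
branches of the two angles give a branch ζ of z, and 2ζ is the primitive. -/
theorem isClassOfDifferential_integralCocycle (l : U) :
    IsClassOfDifferential ((D.integralCocycle l).toH1 (legendreOrigin l)) := by
  refine ⟨D.integralCocycle l, fun P => ?_, PathCocycle.isClassOf_toH1 _ _⟩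
  set T := D.torusParam l with hT
  obtain ⟨v₀, -, hv₀⟩ := D.exists_point_eq l P.2
  obtain rfl : T.param v₀ = P := Subtype.ext hv₀
  set a : LegendreCurve l → ℝ := fun R => angleNear v₀.1 (T.angle₁ R) with ha
  set b : LegendreCurve l → ℝ := fun R => angleNear v₀.2 (T.angle₂ R) with hb
  set N : Set (LegendreCurve l) := {R | T.angle₁ R ≠ ((v₀.1 - 1 / 2 : ℝ) : AddCircle (1 : ℝ))} ∩
    {R | T.angle₂ R ≠ ((v₀.2 - 1 / 2 : ℝ) : AddCircle (1 : ℝ))} with hN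
  have hpar : ∀ R, T.param (a R, b R) = R := fun R =>
    T.param_eq (a R, b R) R (coe_angleNear v₀.1 (T.angle₁ R)) (coe_angleNear v₀.2 (T.angle₂ R))
  have hac : ∀ R ∈ N, ContinuousAt a R := fun R hR =>
    (continuousAt_angleNear hR.1).comp T.angle₁.continuous.continuousAt
  have hbc : ∀ R ∈ N, ContinuousAt b R := fun R hR =>
    (continuousAt_angleNear hR.2).comp T.angle₂.continuous.continuousAt
  set ζ : LegendreCurve l → ℂ := fun R => D.coord l (a R, b R) with hζ
  have hζc : ∀ R ∈ N, ContinuousAt ζ R := fun R hR =>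
    D.continuous_coord.continuousAt.comp ((hac R hR).prodMk (hbc R hR))
  have hζinj : ∀ {R S}, ζ R = ζ S → R = S := fun {R S} h => by
    rw [← hpar R, ← hpar S]
    exact Subtype.ext (congrArg (legendrePoint (D.lattice l) (l : legendreBase)) h)
  refine ⟨N, ?_, ⟨?_, ?_⟩, fun R => 2 * ζ R, ⟨?_, ?_⟩, ?_⟩
  · exact (isOpen_ne.preimage T.angle₁.continuous).inter (isOpen_ne.preimage T.angle₂.continuous)
  · change T.angle₁ (T.param v₀) ≠ _
    rw [T.angle₁_param]
    exact coe_ne_sub_half _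
  · change T.angle₂ (T.param v₀) ≠ _
    rw [T.angle₂_param]
    exact coe_ne_sub_half _
  · exact fun R hR => (continuousAt_const.mul (hζc R hR)).continuousWithinAt
  · intro Q hQ hY
    have hY' : affineY (T.param (a Q, b Q)) ≠ 0 := by rwa [hpar]
    have hmem : ζ Q ∉ (D.lattice l).lattice := D.notMem_of_affineY_ne_zero hY'
    have eY : affineY Q = (D.lattice l).derivWeierstrassP (ζ Q) / 2 := by
      rw [← D.affineY_param hmem, hpar]
    have eX : ∀ R, ζ R ∉ (D.lattice l).lattice → affineX R =
        (D.lattice l).weierstrassP (ζ R) + (1 + (l : legendreBase)) / 3 := fun R hR => by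
      rw [← D.affineX_param hR, hpar]
    have hd0 : (D.lattice l).derivWeierstrassP (ζ Q) ≠ 0 := fun h => hY (by rw [eY, h, zero_div])
    have hslope := ((D.lattice l).hasDerivAt_weierstrassP hmem).tendsto_slope
    have hto : Filter.Tendsto ζ (𝓝[≠] Q) (𝓝[≠] (ζ Q)) :=
      tendsto_nhdsWithin_of_tendsto_nhds_of_eventually_within _
        ((hζc Q hQ).tendsto.mono_left nhdsWithin_le_nhds)
        (Filter.eventually_of_mem self_mem_nhdsWithin fun R hR h => hR (hζinj h))
    have hlim := ((hslope.comp hto).inv₀ hd0).const_mul 2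
    rw [eY, one_div_div, div_eq_mul_inv]
    refine hlim.congr' ?_
    have hev : ∀ᶠ R in 𝓝[≠] Q, ζ R ∉ (D.lattice l).lattice :=
      ((hζc Q hQ).tendsto.mono_left nhdsWithin_le_nhds).eventually
        ((D.lattice l).isOpen_compl_lattice.mem_nhds hmem)
    filter_upwards [hev] with R hR
    rw [Function.comp_apply, slope_def_field, inv_div, eX R hR, eX Q hmem, add_sub_add_right_eq_sub,
      ← mul_sub, mul_div_assoc]
  · intro R S p hp
    have hac' : Continuous fun t => a (p t) :=
      continuous_iff_continuousAt.2 fun t => (hac _ (hp t)).comp p.continuous.continuousAt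
    have hbc' : Continuous fun t => b (p t) :=
      continuous_iff_continuousAt.2 fun t => (hbc _ (hp t)).comp p.continuous.continuousAt
    rw [integralCocycle_eq, T.displacement₁_eq p ⟨_, hac'⟩ fun t => coe_angleNear v₀.1 (T.angle₁ (p t)),
      T.displacement₂_eq p ⟨_, hbc'⟩ fun t => coe_angleNear v₀.2 (T.angle₂ (p t))]
    change 2 * D.coord l ((a (p 1), b (p 1)) - (a (p 0), b (p 0))) = _
    rw [coord_sub, p.source, p.target, mul_sub]

theorem coord_smul (l : U) (t : ℝ) (v : ℝ × ℝ) : D.coord l (t • v) = t * D.coord l v := by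
  simp only [coord, Prod.smul_fst, Prod.smul_snd, smul_eq_mul]
  push_cast
  ring

theorem coord_ne_zero {v : ℝ × ℝ} (hv : v ≠ 0) : D.coord l v ≠ 0 := by
  intro h
  obtain ⟨h1, h2⟩ := eq_zero_of_add_mul_eq_zero (D.im_pos l l.2)
    ((mul_eq_zero.1 h).resolve_left (D.scale_ne_zero l l.2))
  exact hv (Prod.ext h1 h2)

/-- Uniqueness of the periods. Along the ray to a lattice vector w, any cocycle that integrates dx/y
gives a continuous function of t with derivative 2 · `D.coord l w`, except at the countably many t
where 2z is a lattice point. The fundamental theorem of calculus tolerates a countable exceptional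
set. -/
theorem eval_loop_of_isClassOfDifferential
    {φ : H1 (LegendreCurve l) (legendreOrigin l) ℂ} (h : IsClassOfDifferential φ) {m n : ℤ}
    (hw : ((m : ℝ), (n : ℝ)) ≠ 0) :
    φ.eval ((D.torusParam l).loop (D.torusParam_zero l) m n) = 2 * D.coord l (m, n) := by
  obtain ⟨c, hc, hφ⟩ := h
  set T := D.torusParam l with hT
  set w : ℝ × ℝ := (m, n) with hwd
  set c' : PathCocycle (ℝ × ℝ) ℂ := c.comap T.param with hc'
  set g : ℝ → ℂ := fun t => c'.toFun (TorusParam.ray (t • w)) with hg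
  have key : ∀ t₀ : ℝ, ∃ (N : Set (LegendreCurve l)) (f : LegendreCurve l → ℂ), IsOpen N ∧
      T.param (t₀ • w) ∈ N ∧ IsPrimitiveOn f N ∧
      ∀ᶠ t in 𝓝 t₀, g t = g t₀ + (f (T.param (t • w)) - f (T.param (t₀ • w))) := by
    intro t₀
    obtain ⟨N, hNo, hN, f, hf, hcf⟩ := hc (T.param (t₀ • w))
    refine ⟨N, f, hNo, hN, hf, ?_⟩
    have hcont : Continuous fun t : ℝ => T.param (t • w) := T.param.continuous.comp (by fun_prop)
    obtain ⟨ε, hε, hball⟩ := Metric.mem_nhds_iff.1 ((hNo.preimage hcont).mem_nhds hN)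
    filter_upwards [Metric.ball_mem_nhds t₀ hε] with t ht
    let q : Path (t₀ • w) (t • w) :=
      { toFun := fun x => (t₀ + x * (t - t₀)) • w
        continuous_toFun := by fun_prop
        source' := by simp
        target' := by simp }
    have h1 : c'.toFun q = f (T.param (t • w)) - f (T.param (t₀ • w)) := by
      refine hcf _ _ _ fun x => ?_
      refine hball (?_ : t₀ + x * (t - t₀) ∈ _)
      rw [Metric.mem_ball, Real.dist_eq] at ht ⊢
      rw [add_sub_cancel_left, abs_mul, abs_of_nonneg x.2.1]
      exact (mul_le_of_le_one_left (abs_nonneg _) x.2.2).trans_lt ht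
    change c'.toFun _ = c'.toFun _ + _
    rw [c'.eq_of_simplyConnected _ ((TorusParam.ray (t₀ • w)).trans q), c'.map_trans, h1]
  have hcont : ∀ t₀, ContinuousAt (fun t : ℝ => T.param (t • w)) t₀ := fun t₀ =>
    (T.param.continuous.comp (by fun_prop)).continuousAt
  have hgc : Continuous g := by
    refine continuous_iff_continuousAt.2 fun t₀ => ?_
    obtain ⟨N, f, hNo, hN, hf, hev⟩ := key t₀
    refine ContinuousAt.congr ?_ (hev.mono fun t h => h.symm)
    exact continuousAt_const.add ((ContinuousAt.comp
      (f := fun t : ℝ => T.param (t • w)) (hf.1.continuousAt (hNo.mem_nhds hN)) (hcont t₀)).sub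
      continuousAt_const)
  have hgd : ∀ t₀, affineY (T.param (t₀ • w)) ≠ 0 → HasDerivAt g (2 * D.coord l w) t₀ := by
    intro t₀ hY
    obtain ⟨N, f, hNo, hN, hf, hev⟩ := key t₀
    have hmem := D.notMem_of_affineY_ne_zero hY
    have eY := D.affineY_param hmem
    have hd0 : (D.lattice l).derivWeierstrassP (D.coord l (t₀ • w)) ≠ 0 :=
      fun h => hY (by rw [hT, eY, h, zero_div])
    have hz : HasDerivAt (fun t : ℝ => D.coord l (t • w)) (D.coord l w) t₀ := by
      simp only [coord_smul]
      simpa using (Complex.ofRealCLM.hasDerivAt (x := t₀)).mul_const (D.coord l w)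
    have hX : HasDerivAt (fun t : ℝ => affineX (T.param (t • w)))
        ((D.lattice l).derivWeierstrassP (D.coord l (t₀ • w)) * D.coord l w) t₀ := by
      have h1 := (((D.lattice l).hasDerivAt_weierstrassP hmem).comp t₀ hz).add_const
        ((1 + ((l : legendreBase) : ℂ)) / 3)
      refine h1.congr_of_eventuallyEq ?_
      filter_upwards [hz.continuousAt.eventually
        ((D.lattice l).isOpen_compl_lattice.mem_nhds hmem)] with t ht
      exact D.affineX_param ht
    have hX0 : ∀ᶠ t in 𝓝[≠] t₀, affineX (T.param (t • w)) ≠ affineX (T.param (t₀ • w)) :=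
      hX.eventually_ne (mul_ne_zero hd0 (D.coord_ne_zero hw))
    have hto : Filter.Tendsto (fun t : ℝ => T.param (t • w)) (𝓝[≠] t₀)
        (𝓝[≠] (T.param (t₀ • w))) :=
      tendsto_nhdsWithin_of_tendsto_nhds_of_eventually_within _
        ((hcont t₀).tendsto.mono_left nhdsWithin_le_nhds)
        (hX0.mono fun t ht h => ht (congrArg affineX h))
    have hlim := ((hf.2 _ hN hY).comp hto).mul hX.tendsto_slope
    rw [hasDerivAt_iff_tendsto_slope]
    have e : 1 / affineY (T.param (t₀ • w)) *
        ((D.lattice l).derivWeierstrassP (D.coord l (t₀ • w)) * D.coord l w) = 2 * D.coord l w := by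
      rw [hT, eY]
      field_simp
    rw [e] at hlim
    refine hlim.congr' ?_
    filter_upwards [hX0, nhdsWithin_le_nhds hev] with t ht h
    have ht' := sub_ne_zero.2 ht
    rw [slope_def_module, slope_def_module, h, Function.comp_apply, add_sub_cancel_left,
      mul_smul_comm, div_mul_cancel₀ _ ht']
  have hs : {t : ℝ | affineY (T.param (t • w)) = 0}.Countable := by
    refine Set.Countable.mono (s₂ := (fun t : ℝ => 2 * D.coord l (t • w)) ⁻¹'
      ((D.lattice l).lattice : Set ℂ)) (fun t ht => D.two_mul_mem_of_affineY_eq_zero ht) ?_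
    refine (D.lattice l).countable_lattice.preimage_of_injOn fun s _ t _ hst => ?_
    simp only [coord_smul] at hst
    simpa [D.coord_ne_zero hw] using hst
  have hint := MeasureTheory.integral_eq_of_hasDerivAt_off_countable (a := 0) (b := 1) g
    (fun _ => 2 * D.coord l w) hs hgc.continuousOn (fun t ht => hgd t ht.2) (by simp)
  have h0 : g 0 = 0 := by
    change c.toFun _ = 0
    rw [c.congr_path _ (Path.refl (T.param 0)), c.map_refl]
    intro t
    change T.param ((t : ℝ) • (0 : ℝ) • w) = T.param 0
    simp
  have h1 : g 1 = φ.eval (T.loop (D.torusParam_zero l) m n) := by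
    refine Eq.trans ?_ (hφ _).symm
    refine c.congr_path _ _ fun t => ?_
    change T.param ((t : ℝ) • (1 : ℝ) • w) = T.param ((t : ℝ) • w)
    rw [one_smul]
  rw [h0, h1] at hint
  simpa using hint.symm

theorem isClassOfDifferential_iff {φ : H1 (LegendreCurve l) (legendreOrigin l) ℂ} :
    IsClassOfDifferential φ ↔ φ = (D.integralCocycle l).toH1 (legendreOrigin l) := by
  constructor
  · intro h
    have h' := D.isClassOfDifferential_integralCocycle l
    refine (D.torusParam l).ext_loop (D.torusParam_zero l) ?_ ?_
    · rw [D.eval_loop_of_isClassOfDifferential h (by simp),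
        D.eval_loop_of_isClassOfDifferential h' (by simp)]
    · rw [D.eval_loop_of_isClassOfDifferential h (by simp),
        D.eval_loop_of_isClassOfDifferential h' (by simp)]
  · rintro rfl
    exact D.isClassOfDifferential_integralCocycle l

end LegendreFrame

end

noncomputable section

/-! ### Variations of Hodge structures of elliptic type -/

/-- A frame over `U` such that the flat sections are those with locally constant coordinates. -/
def VHSData.IsFlatFrame {M : Set ℂ} (W : VHSData M) {r : ℕ} (U : Set M)
    (e : ∀ m : M, m ∈ U → Module.Basis (Fin r) ℚ (W.Fiber m)) : Prop :=
  ∀ U' : Set M, IsOpen U' → U' ⊆ U → ∀ s : (∀ m, W.Fiber m), W.IsFlat U' s ↔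
    ∀ m (hm : m ∈ U), m ∈ U' → ∀ᶠ m' in 𝓝 m, ∀ hm' : m' ∈ U,
      (e m' hm').repr (s m') = (e m hm).repr (s m)

/-- The structure of a variation of Hodge structures of the type of the first cohomology of a
family of elliptic curves with nowhere vanishing Kodaira-Spencer map: a symplectic form, and local
symplectic frames with a period function. -/
structure VHSData.EllipticStructure {M : Set ℂ} (W : VHSData M) where
  weight_eq : W.weight = 1
  isFlat_mono : ∀ {U V : Set M} {s : ∀ m, W.Fiber m}, V ⊆ U → W.IsFlat U s → W.IsFlat V s
  form : ∀ m, LinearMap.BilinForm ℚ (W.Fiber m)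
  form_self : ∀ m x, form m x x = 0
  F_nonpos : ∀ m p, p ≤ 0 → W.F m p = ⊤
  F_two_le : ∀ m p, 2 ≤ p → W.F m p = ⊥
  exists_frame : ∀ m₀ : M, ∃ U : Set M, IsOpen U ∧ m₀ ∈ U ∧
    ∃ (e : ∀ m, m ∈ U → Module.Basis (Fin 2) ℚ (W.Fiber m)) (τ : ℂ → ℂ),
      (∀ m (hm : m ∈ U), form m (e m hm 0) (e m hm 1) = 1 ∧ DifferentiableAt ℂ τ m ∧
        deriv τ m ≠ 0 ∧ 0 < (τ m).im ∧
        W.F m 1 = Submodule.span ℂ {(1 : ℂ) ⊗ₜ[ℚ] e m hm 0 + τ m ⊗ₜ[ℚ] e m hm 1}) ∧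
      W.IsFlatFrame U e

/-! ### The rational frame of the first cohomology given by winding numbers. -/

namespace LegendreFrame

variable {U : Set legendreBase} (D : LegendreFrame U)

/-- The winding number of the first angle as a rational cocycle on the family. -/
def windingCocycle₁ : PathCocycle (LegendreTotal U) ℚ :=
  (windingCocycle.mapCoeff (Int.castAddHom ℚ)).comap
    ⟨fun q => (D.angle q).1, continuous_fst.comp D.continuous_angle⟩

/-- The winding number of the second angle as a rational cocycle on the family. -/
def windingCocycle₂ : PathCocycle (LegendreTotal U) ℚ :=
  (windingCocycle.mapCoeff (Int.castAddHom ℚ)).comap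
    ⟨fun q => (D.angle q).2, continuous_snd.comp D.continuous_angle⟩

/-- The first class of the frame. -/
def class₁ (l : U) : H1 (LegendreCurve l) (legendreOrigin l) ℚ :=
  (D.windingCocycle₁.comap (fiberInclusion U l l.2)).toH1 _

/-- The second class of the frame. -/
def class₂ (l : U) : H1 (LegendreCurve l) (legendreOrigin l) ℚ :=
  (D.windingCocycle₂.comap (fiberInclusion U l l.2)).toH1 _

theorem exists_int_eval_class₁ (l : U) (γ : Path (legendreOrigin l) (legendreOrigin l)) :
    ∃ n : ℤ, (D.class₁ l).eval γ = n ∧ (D.torusParam l).displacement₁.toFun γ = n :=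
  ⟨windingCocycle.toFun (γ.map (D.torusParam l).angle₁.continuous), rfl,
    (windingCocycle_loop (γ.map (D.torusParam l).angle₁.continuous)).symm⟩

theorem exists_int_eval_class₂ (l : U) (γ : Path (legendreOrigin l) (legendreOrigin l)) :
    ∃ n : ℤ, (D.class₂ l).eval γ = n ∧ (D.torusParam l).displacement₂.toFun γ = n :=
  ⟨windingCocycle.toFun (γ.map (D.torusParam l).angle₂.continuous), rfl,
    (windingCocycle_loop (γ.map (D.torusParam l).angle₂.continuous)).symm⟩

/-- The loop that corresponds to a lattice vector. -/
def loop (l : U) (m n : ℤ) : Path (legendreOrigin l) (legendreOrigin l) :=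
  (D.torusParam l).loop (D.torusParam_zero l) m n

theorem eval_class₁_loop (l : U) (m n : ℤ) : (D.class₁ l).eval (D.loop l m n) = m := by
  obtain ⟨k, h1, h2⟩ := D.exists_int_eval_class₁ l (D.loop l m n)
  rw [loop, TorusParam.displacement₁_loop] at h2
  rw [h1]
  exact_mod_cast h2.symm

theorem eval_class₂_loop (l : U) (m n : ℤ) : (D.class₂ l).eval (D.loop l m n) = n := by
  obtain ⟨k, h1, h2⟩ := D.exists_int_eval_class₂ l (D.loop l m n)
  rw [loop, TorusParam.displacement₂_loop] at h2
  rw [h1]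
  exact_mod_cast h2.symm

theorem eq_classes (l : U) (φ : H1 (LegendreCurve l) (legendreOrigin l) ℚ) :
    φ = φ.eval (D.loop l 1 0) • D.class₁ l + φ.eval (D.loop l 0 1) • D.class₂ l := by
  refine (D.torusParam l).ext_loop (D.torusParam_zero l) ?_ ?_
  · change H1.eval _ (D.loop l 1 0) = H1.eval _ (D.loop l 1 0)
    rw [H1.eval_add]
    change _ = _ * (D.class₁ l).eval _ + _ * (D.class₂ l).eval _
    rw [eval_class₁_loop, eval_class₂_loop]
    simp
  · change H1.eval _ (D.loop l 0 1) = H1.eval _ (D.loop l 0 1)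
    rw [H1.eval_add]
    change _ = _ * (D.class₁ l).eval _ + _ * (D.class₂ l).eval _
    rw [eval_class₁_loop, eval_class₂_loop]
    simp

/-- The coordinates of a rational class. -/
def coordEquiv (l : U) : H1 (LegendreCurve l) (legendreOrigin l) ℚ ≃ₗ[ℚ] (Fin 2 → ℚ) where
  toFun φ := ![φ.eval (D.loop l 1 0), φ.eval (D.loop l 0 1)]
  map_add' φ ψ := by
    ext i
    fin_cases i <;> rfl
  map_smul' c φ := by
    ext i
    fin_cases i <;> rfl
  invFun a := a 0 • D.class₁ l + a 1 • D.class₂ l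
  left_inv φ := (D.eq_classes l φ).symm
  right_inv a := by
    ext i
    fin_cases i
    · change a 0 * (D.class₁ l).eval _ + a 1 * (D.class₂ l).eval _ = _
      rw [eval_class₁_loop, eval_class₂_loop]
      simp
    · change a 0 * (D.class₁ l).eval _ + a 1 * (D.class₂ l).eval _ = _
      rw [eval_class₁_loop, eval_class₂_loop]
      simp

/-- The frame of the first cohomology. -/
def basis (l : U) : Module.Basis (Fin 2) ℚ (H1 (LegendreCurve l) (legendreOrigin l) ℚ) :=
  Module.Basis.ofEquivFun (D.coordEquiv l)

theorem basis_zero (l : U) : D.basis l 0 = D.class₁ l := by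
  rw [basis, Module.Basis.coe_ofEquivFun]
  change (Function.update 0 0 1 : Fin 2 → ℚ) 0 • D.class₁ l +
    (Function.update 0 0 1 : Fin 2 → ℚ) 1 • D.class₂ l = _
  simp

theorem basis_one (l : U) : D.basis l 1 = D.class₂ l := by
  rw [basis, Module.Basis.coe_ofEquivFun]
  change (Function.update 0 1 1 : Fin 2 → ℚ) 0 • D.class₁ l +
    (Function.update 0 1 1 : Fin 2 → ℚ) 1 • D.class₂ l = _
  simp

theorem coe_basis_repr (l : U) (φ : H1 (LegendreCurve l) (legendreOrigin l) ℚ) :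
    ⇑((D.basis l).repr φ) = ![φ.eval (D.loop l 1 0), φ.eval (D.loop l 0 1)] := by
  rw [← Module.Basis.equivFun_apply, basis, Module.Basis.equivFun_ofEquivFun]
  rfl

theorem basis_repr_eq_iff {l l' : U} {φ : H1 (LegendreCurve l) (legendreOrigin l) ℚ}
    {φ' : H1 (LegendreCurve l') (legendreOrigin l') ℚ} :
    (D.basis l).repr φ = (D.basis l').repr φ' ↔
      φ.eval (D.loop l 1 0) = φ'.eval (D.loop l' 1 0) ∧
      φ.eval (D.loop l 0 1) = φ'.eval (D.loop l' 0 1) := by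
  rw [← DFunLike.coe_fn_eq, coe_basis_repr, coe_basis_repr]
  constructor
  · intro h
    exact ⟨congrFun h 0, congrFun h 1⟩
  · rintro ⟨h1, h2⟩
    rw [h1, h2]

end LegendreFrame

end

/-! ### The Hodge line in the frame and the comparison of two frames. -/

noncomputable section

namespace LegendreFrame

variable {U : Set legendreBase} (D : LegendreFrame U)

theorem eval_integralCocycle (l : U) (γ : Path (legendreOrigin l) (legendreOrigin l)) :
    ((D.integralCocycle l).toH1 (legendreOrigin l)).eval γ =
      2 * D.scale l * ((D.class₁ l).eval γ + (D.class₂ l).eval γ * D.ratio l) := by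
  obtain ⟨m, h1, h1'⟩ := D.exists_int_eval_class₁ l γ
  obtain ⟨n, h2, h2'⟩ := D.exists_int_eval_class₂ l γ
  change (D.integralCocycle l).toFun γ = _
  rw [integralCocycle_eq, h1, h2, h1', h2', coord]
  push_cast
  ring

theorem eval_complexifyH1 {X : Type} [TopologicalSpace X] {x : X} (z : ℂ) (φ : H1 X x ℚ)
    (γ : Path x x) : (complexifyH1 X x (z ⊗ₜ[ℚ] φ)).eval γ = z * (φ.eval γ : ℂ) := by
  rw [complexifyH1, LinearMap.liftBaseChange_tmul]
  rfl

/-- The class of dx/y has periods 2s and 2sτ, so it is 2s times the first class plus τ times the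
second. Evaluation on the two basic loops identifies coefficients. -/
theorem F_one (l : U) : legendreH1.F l 1 = Submodule.span ℂ
    {(1 : ℂ) ⊗ₜ[ℚ] D.basis l 0 + D.ratio l ⊗ₜ[ℚ] D.basis l 1} := by
  have e : {φ | IsClassOfDifferential φ} =
      {(D.integralCocycle l).toH1 (legendreOrigin l)} :=
    Set.ext fun φ => D.isClassOfDifferential_iff
  have hs : 2 * D.scale l ≠ 0 := mul_ne_zero two_ne_zero (D.scale_ne_zero l l.2)
  have key : ∀ γ, (complexifyH1 (LegendreCurve l) (legendreOrigin l)
      ((1 : ℂ) ⊗ₜ[ℚ] D.basis l 0 + D.ratio l ⊗ₜ[ℚ] D.basis l 1)).eval γ =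
      (D.class₁ l).eval γ + (D.class₂ l).eval γ * D.ratio l := fun γ => by
    rw [map_add, H1.eval_add, eval_complexifyH1, eval_complexifyH1, basis_zero, basis_one]
    ring
  change Submodule.comap (complexifyH1 (LegendreCurve l) (legendreOrigin l))
    (Submodule.span ℂ {φ | IsClassOfDifferential φ}) = _
  rw [e]
  ext x
  rw [Submodule.mem_comap, Submodule.mem_span_singleton, Submodule.mem_span_singleton]
  constructor
  · rintro ⟨a, ha⟩
    refine ⟨a * (2 * D.scale l), ?_⟩
    have hx : ∃ z w : ℂ, x = z ⊗ₜ[ℚ] D.basis l 0 + w ⊗ₜ[ℚ] D.basis l 1 := by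
      have := ((D.basis l).baseChange ℂ).sum_repr x
      rw [Fin.sum_univ_two] at this
      refine ⟨((D.basis l).baseChange ℂ).repr x 0, ((D.basis l).baseChange ℂ).repr x 1, ?_⟩
      conv_lhs => rw [← this]
      simp [TensorProduct.smul_tmul']
    obtain ⟨z, w, rfl⟩ := hx
    have h : ∀ γ, a * (2 * D.scale l * ((D.class₁ l).eval γ + (D.class₂ l).eval γ * D.ratio l)) =
        z * ((D.class₁ l).eval γ : ℂ) + w * ((D.class₂ l).eval γ : ℂ) := fun γ => by
      have h1 := congrArg (fun φ => H1.eval φ γ) ha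
      simp only [map_add, H1.eval_add, eval_complexifyH1, basis_zero, basis_one] at h1
      rw [← h1, ← eval_integralCocycle]
      rfl
    have h1 := h (D.loop l 1 0)
    have h2 := h (D.loop l 0 1)
    simp only [eval_class₁_loop, eval_class₂_loop] at h1 h2
    push_cast at h1 h2
    have hz : z = a * (2 * D.scale l) := by linear_combination -h1
    have hw : w = a * (2 * D.scale l) * D.ratio l := by linear_combination -h2
    rw [hz, hw, smul_add, TensorProduct.smul_tmul', TensorProduct.smul_tmul', smul_eq_mul,
      smul_eq_mul, mul_one]
  · rintro ⟨a, rfl⟩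
    refine ⟨a * (2 * D.scale l)⁻¹, H1.ext_eval fun γ => ?_⟩
    rw [map_smul]
    change a * (2 * D.scale l)⁻¹ * _ = a * H1.eval _ γ
    rw [key]
    change a * (2 * D.scale l)⁻¹ * H1.eval _ γ = _
    rw [eval_integralCocycle]
    have := D.scale_ne_zero l l.2
    field_simp

/-- The two frames are related by integral matrices inverse to each other, so the determinant is ±1.
Both express the same class of dx/y, so the period ratios are related by a Möbius transformation;
since both have positive imaginary part, the sign is +. -/
theorem det_classes {U' : Set legendreBase} (D' : LegendreFrame U') {l : legendreBase} (hl : l ∈ U)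
    (hl' : l ∈ U') :
    (D'.class₁ ⟨l, hl'⟩).eval (D.loop ⟨l, hl⟩ 1 0) * (D'.class₂ ⟨l, hl'⟩).eval (D.loop ⟨l, hl⟩ 0 1) -
    (D'.class₁ ⟨l, hl'⟩).eval (D.loop ⟨l, hl⟩ 0 1) * (D'.class₂ ⟨l, hl'⟩).eval (D.loop ⟨l, hl⟩ 1 0)
      = 1 := by
  set γ₁ := D.loop ⟨l, hl⟩ 1 0
  set γ₂ := D.loop ⟨l, hl⟩ 0 1
  set γ₁' := D'.loop ⟨l, hl'⟩ 1 0
  set γ₂' := D'.loop ⟨l, hl'⟩ 0 1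
  obtain ⟨a, ha, -⟩ := D'.exists_int_eval_class₁ ⟨l, hl'⟩ γ₁
  obtain ⟨b, hb, -⟩ := D'.exists_int_eval_class₁ ⟨l, hl'⟩ γ₂
  obtain ⟨c, hc, -⟩ := D'.exists_int_eval_class₂ ⟨l, hl'⟩ γ₁
  obtain ⟨d, hd, -⟩ := D'.exists_int_eval_class₂ ⟨l, hl'⟩ γ₂
  obtain ⟨a', ha', -⟩ := D.exists_int_eval_class₁ ⟨l, hl⟩ γ₁'
  obtain ⟨b', hb', -⟩ := D.exists_int_eval_class₁ ⟨l, hl⟩ γ₂'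
  obtain ⟨c', hc', -⟩ := D.exists_int_eval_class₂ ⟨l, hl⟩ γ₁'
  obtain ⟨d', hd', -⟩ := D.exists_int_eval_class₂ ⟨l, hl⟩ γ₂'
  have e : ∀ (φ : H1 (LegendreCurve l) (legendreOrigin l) ℚ) γ, φ.eval γ =
      φ.eval γ₁ * (D.class₁ ⟨l, hl⟩).eval γ + φ.eval γ₂ * (D.class₂ ⟨l, hl⟩).eval γ := fun φ γ =>
    congrArg (fun φ => H1.eval φ γ) (D.eq_classes ⟨l, hl⟩ φ)
  have h1 := e (D'.class₁ ⟨l, hl'⟩) γ₁'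
  have h2 := e (D'.class₁ ⟨l, hl'⟩) γ₂'
  have h3 := e (D'.class₂ ⟨l, hl'⟩) γ₁'
  have h4 := e (D'.class₂ ⟨l, hl'⟩) γ₂'
  rw [ha, hb, ha', hc', D'.eval_class₁_loop] at h1
  rw [ha, hb, hb', hd', D'.eval_class₁_loop] at h2
  rw [hc, hd, ha', hc', D'.eval_class₂_loop] at h3
  rw [hc, hd, hb', hd', D'.eval_class₂_loop] at h4
  norm_cast at h1 h2 h3 h4
  have hdet : (a * d - b * c) * (a' * d' - b' * c') = 1 := by
    linear_combination (-1 : ℤ) * h1 * (c * b' + d * d') - h4 + (c * a' + d * c') * h2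
  have hφ : (D.integralCocycle ⟨l, hl⟩).toH1 (legendreOrigin l) =
      (D'.integralCocycle ⟨l, hl'⟩).toH1 (legendreOrigin l) :=
    (D'.isClassOfDifferential_iff (l := ⟨l, hl'⟩)).1
      (D.isClassOfDifferential_integralCocycle ⟨l, hl⟩)
  have p1 := congrArg (fun φ => H1.eval φ γ₁) hφ
  have p2 := congrArg (fun φ => H1.eval φ γ₂) hφ
  have q1 := D.eval_integralCocycle ⟨l, hl⟩ γ₁
  have q2 := D.eval_integralCocycle ⟨l, hl⟩ γ₂
  have q1' := D'.eval_integralCocycle ⟨l, hl'⟩ γ₁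
  have q2' := D'.eval_integralCocycle ⟨l, hl'⟩ γ₂
  rw [D.eval_class₁_loop, D.eval_class₂_loop] at q1 q2
  rw [ha, hc] at q1'
  rw [hb, hd] at q2'
  have r1 := q1.symm.trans (p1.trans q1')
  have r2 := q2.symm.trans (p2.trans q2')
  simp only at r1 r2
  push_cast at r1 r2
  have hs := D.scale_ne_zero l hl
  have hs' := D'.scale_ne_zero l hl'
  have hτ := D.im_pos l hl
  have hτ' := D'.im_pos l hl'
  set τ := D.ratio l
  set τ' := D'.ratio l
  set s := D.scale l
  set s' := D'.scale l
  have r3 : τ * (a + c * τ') = b + d * τ' := by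
    have : (2 * s') * (τ * (a + c * τ')) = (2 * s') * (b + d * τ') := by
      linear_combination r2 - τ * r1
    exact mul_left_cancel₀ (mul_ne_zero two_ne_zero hs') this
  have hne : (a : ℂ) + c * τ' ≠ 0 := by
    intro h
    rw [h] at r1
    simp [hs] at r1
  have him := congrArg Complex.im (congrArg (· * (starRingEnd ℂ) ((a : ℂ) + c * τ')) r3)
  rw [mul_assoc, Complex.mul_conj] at him
  have hn := Complex.normSq_pos.2 hne
  have him2 : τ.im * Complex.normSq (a + c * τ') = ((a * d - b * c : ℤ) : ℝ) * τ'.im := by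
    simp at him
    push_cast
    linear_combination him
  have hpos : (0 : ℝ) < ((a * d - b * c : ℤ) : ℝ) := by
    have : 0 < ((a * d - b * c : ℤ) : ℝ) * τ'.im := him2 ▸ mul_pos hτ hn
    exact pos_of_mul_pos_left this hτ'.le
  rw [Int.cast_pos] at hpos
  have h1 : a * d - b * c = 1 := by
    rcases Int.mul_eq_one_iff_eq_one_or_neg_one.1 hdet with h | h
    · exact h.1
    · omega
  rw [ha, hb, hc, hd]
  exact_mod_cast h1

end LegendreFrame

end

/-! ### Flat sections of the first cohomology and its elliptic structure. -/

noncomputable section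

/-- The inclusion of the part of the family over a smaller set. -/
def totalInclusion {V U : Set legendreBase} (h : V ⊆ U) : C(LegendreTotal V, LegendreTotal U) where
  toFun q := ⟨q.1, h q.2.1, q.2.2⟩
  continuous_toFun := by fun_prop

namespace LegendreFrame

variable {U : Set legendreBase} (D : LegendreFrame U)

/-- The winding cocycles live on the total space over U, so a section with constant coordinates is
the restriction of a fixed rational combination of them. -/
theorem isFlat_of_eventually {U' : Set legendreBase} (hU' : U' ⊆ U)
    {s : ∀ l : legendreBase, legendreH1.Fiber l}
    (h : ∀ l (hl : l ∈ U), l ∈ U' → ∀ᶠ l' in 𝓝 l, ∀ hl' : l' ∈ U,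
      (D.basis ⟨l', hl'⟩).repr (s l') = (D.basis ⟨l, hl⟩).repr (s l)) (hUo : IsOpen U) :
    legendreH1.IsFlat U' s := by
  intro l₀ hl₀
  have hlU := hU' hl₀
  obtain ⟨V, hV, hVo, hl₀V⟩ := mem_nhds_iff.1 ((h l₀ hlU hl₀).and (hUo.mem_nhds hlU))
  have hVU : V ⊆ U := fun l hl => (hV hl).2
  refine ⟨V, hVo, hl₀V, ?_⟩
  set r₁ := H1.eval (s l₀) (D.loop ⟨l₀, hlU⟩ 1 0)
  set r₂ := H1.eval (s l₀) (D.loop ⟨l₀, hlU⟩ 0 1)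
  refine ⟨((D.windingCocycle₁.mapCoeff (AddMonoidHom.mulLeft r₁)).add
    (D.windingCocycle₂.mapCoeff (AddMonoidHom.mulLeft r₂))).comap (totalInclusion hVU), ?_⟩
  intro l hl γ
  obtain ⟨h1, h2⟩ := D.basis_repr_eq_iff.1 ((hV hl).1 (hVU hl))
  have e := congrArg (fun φ => H1.eval φ γ) (D.eq_classes ⟨l, hVU hl⟩ (s l))
  simp only [h1, h2] at e
  exact e

/-- A path in the base, straight in the coordinate. -/
theorem exists_straight_path {V : Set legendreBase} (hV : IsOpen V) {l₀ : legendreBase}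
    (hl₀ : l₀ ∈ V) : ∀ᶠ l in 𝓝 l₀, ∃ δ : C(ℝ, V), (δ 0 : legendreBase) = l₀ ∧
      (δ 1 : legendreBase) = l := by
  have ho : IsOpen (Subtype.val '' V : Set ℂ) := by
    refine IsOpen.isOpenMap_subtype_val ?_ V hV
    have : legendreBase = ({0}ᶜ : Set ℂ) ∩ {1}ᶜ := rfl
    rw [this]
    exact isOpen_compl_singleton.inter isOpen_compl_singleton
  obtain ⟨ε, hε, hball⟩ := Metric.isOpen_iff.1 ho l₀ ⟨l₀, hl₀, rfl⟩
  have hmem : ∀ᶠ l : legendreBase in 𝓝 l₀, (l : ℂ) ∈ Metric.ball (l₀ : ℂ) ε :=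
    continuous_subtype_val.continuousAt.eventually (Metric.ball_mem_nhds _ hε)
  filter_upwards [hmem] with l hl
  set f : ℝ → ℂ := fun t => l₀ + ((Set.projIcc (0 : ℝ) 1 zero_le_one t : ℝ) : ℂ) * (l - l₀) with hf
  have hfc : Continuous f := by
    have := continuous_subtype_val.comp (continuous_projIcc (a := (0 : ℝ)) (b := 1)
      (h := zero_le_one))
    fun_prop
  have hfm : ∀ t, f t ∈ Subtype.val '' V := fun t => hball (by
    have h := (Set.projIcc (0 : ℝ) 1 zero_le_one t).2
    rw [Metric.mem_ball, dist_eq_norm] at hl ⊢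
    simp only [hf]
    rw [add_sub_cancel_left, norm_mul, Complex.norm_real, Real.norm_of_nonneg h.1]
    exact (mul_le_of_le_one_left (norm_nonneg _) h.2).trans_lt hl)
  have hfb : ∀ t, f t ∈ legendreBase := fun t => by
    obtain ⟨x, -, hx⟩ := hfm t
    rw [← hx]
    exact x.2
  have hfV : ∀ t, (⟨f t, hfb t⟩ : legendreBase) ∈ V := fun t => by
    obtain ⟨x, hxV, hx⟩ := hfm t
    rwa [show (⟨f t, hfb t⟩ : legendreBase) = x from Subtype.ext hx.symm]
  refine ⟨⟨fun t => ⟨⟨f t, hfb t⟩, hfV t⟩, by fun_prop⟩, Subtype.ext ?_, Subtype.ext ?_⟩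
  · simp [hf]
  · simp [hf]

/-- Moving the loop along δ sweeps out a square, over which the cocycle is path independent. Two
opposite sides both trace the zero section, so their contributions cancel and the loops at the two
ends have the same value. -/
theorem eval_loop_eq_of_cocycle {V : Set legendreBase} (hVU : V ⊆ U) (c : PathCocycle (LegendreTotal V) ℚ)
    (δ : C(ℝ, V)) (m n : ℤ) :
    c.toFun ((D.loop ⟨δ 0, hVU (δ 0).2⟩ m n).map (fiberInclusion V (δ 0) (δ 0).2).continuous) =
    c.toFun ((D.loop ⟨δ 1, hVU (δ 1).2⟩ m n).map (fiberInclusion V (δ 1) (δ 1).2).continuous) := by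
  set w : ℝ × ℝ := (m, n) with hw
  have hc : Continuous fun p : ℝ × ℝ =>
      D.point ⟨δ p.1, hVU (δ p.1).2⟩ (p.2 • w) :=
    D.continuous_point.comp (f := fun p : ℝ × ℝ =>
      ((⟨δ p.1, hVU (δ p.1).2⟩, p.2 • w) : U × ℝ × ℝ)) (by fun_prop)
  let G : C(ℝ × ℝ, LegendreTotal V) :=
    ⟨fun p => ⟨((δ p.1 : legendreBase), D.point ⟨δ p.1, hVU (δ p.1).2⟩ (p.2 • w)), (δ p.1).2,
      D.onLegendre_point _ _⟩, by
        refine Continuous.subtype_mk (Continuous.prodMk ?_ hc) _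
        fun_prop⟩
  let hor : ∀ t : ℝ, Path ((0, t) : ℝ × ℝ) (1, t) := fun t =>
    { toFun := fun x => (x, t)
      continuous_toFun := by fun_prop
      source' := by simp
      target' := by simp }
  let ver : ∀ r : ℝ, Path ((r, 0) : ℝ × ℝ) (r, 1) := fun r =>
    { toFun := fun x => (r, x)
      continuous_toFun := by fun_prop
      source' := by simp
      target' := by simp }
  have h1 : (c.comap G).toFun (hor 0) = (c.comap G).toFun (hor 1) := by
    refine c.congr_path _ _ fun t => Subtype.ext (Prod.ext rfl ?_)
    change D.point _ ((0 : ℝ) • w) = D.point _ ((1 : ℝ) • w)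
    rw [zero_smul, one_smul, ← D.point_add_int _ 0 m n, zero_add]
    rfl
  have h2 := (c.comap G).eq_of_simplyConnected ((hor 0).trans (ver 1)) ((ver 0).trans (hor 1))
  rw [PathCocycle.map_trans, PathCocycle.map_trans, h1, add_comm] at h2
  refine Eq.trans (c.congr_path _ ((ver 0).map G.continuous) ?_)
    ((add_right_cancel h2).symm.trans (c.congr_path ((ver 1).map G.continuous) _ ?_))
  all_goals
    intro t
    rfl

theorem eventually_of_isFlat (hUo : IsOpen U) {U' : Set legendreBase}
    {s : ∀ l : legendreBase, legendreH1.Fiber l} (hs : legendreH1.IsFlat U' s) (l : legendreBase)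
    (hl : l ∈ U) (hlU' : l ∈ U') : ∀ᶠ l' in 𝓝 l, ∀ hl' : l' ∈ U,
      (D.basis ⟨l', hl'⟩).repr (s l') = (D.basis ⟨l, hl⟩).repr (s l) := by
  obtain ⟨V, hVo, hlV, c, hc⟩ := hs l hlU'
  have hVU : V ∩ U ⊆ V := Set.inter_subset_left
  filter_upwards [exists_straight_path (hVo.inter hUo) ⟨hlV, hl⟩] with l' hδ hl'
  obtain ⟨δ, h0, h1⟩ := hδ
  subst h0 h1
  have key : ∀ m n, H1.eval (s (δ 0)) (D.loop ⟨δ 0, hl⟩ m n) =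
      H1.eval (s (δ 1)) (D.loop ⟨δ 1, hl'⟩ m n) := fun m n => by
    have e0 := hc (δ 0) (δ 0).2.1 (D.loop ⟨δ 0, hl⟩ m n)
    have e1 := hc (δ 1) (δ 1).2.1 (D.loop ⟨δ 1, hl'⟩ m n)
    refine e0.trans (Eq.trans ?_ e1.symm)
    exact D.eval_loop_eq_of_cocycle (V := V ∩ U) Set.inter_subset_right
      (c.comap (totalInclusion hVU)) δ m n
  exact D.basis_repr_eq_iff.2 ⟨(key 1 0).symm, (key 0 1).symm⟩

end LegendreFrame

/-- The bilinear form with value `1` on the vectors of a basis. -/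
def areaForm {V : Type} [AddCommGroup V] [Module ℚ V] (b : Module.Basis (Fin 2) ℚ V) :
    LinearMap.BilinForm ℚ V :=
  LinearMap.mk₂ ℚ (fun x y => b.repr x 0 * b.repr y 1 - b.repr x 1 * b.repr y 0)
    (by intros; simp; ring) (by intros; simp; ring) (by intros; simp; ring) (by intros; simp; ring)

theorem areaForm_self {V : Type} [AddCommGroup V] [Module ℚ V] (b : Module.Basis (Fin 2) ℚ V)
    (x : V) : areaForm b x x = 0 := by
  rw [areaForm, LinearMap.mk₂_apply]
  ring

/-- A neighbourhood of `l` with a frame. -/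
theorem exists_frame_at (l : legendreBase) :
    ∃ U : Set legendreBase, l ∈ U ∧ Nonempty (LegendreFrame U) :=
  let ⟨U, _, hl, h⟩ := exists_legendreFrame l
  ⟨U, hl, h⟩

/-- The symplectic basis of the first cohomology given by some frame. -/
def legendreBasis (l : legendreBase) :
    Module.Basis (Fin 2) ℚ (H1 (LegendreCurve l) (legendreOrigin l) ℚ) :=
  (exists_frame_at l).choose_spec.2.some.basis ⟨l, (exists_frame_at l).choose_spec.1⟩

/-- The elliptic structure of the first cohomology of the Legendre family. -/
def legendreH1EllipticStructure : legendreH1.EllipticStructure where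
  weight_eq := rfl
  isFlat_mono hVU h l hl := h l (hVU hl)
  form l := areaForm (legendreBasis l)
  form_self l x := areaForm_self (legendreBasis l) x
  F_nonpos l p hp := if_pos hp
  F_two_le l p hp := (if_neg (by omega)).trans (if_neg (by omega))
  exists_frame l₀ := by
    obtain ⟨U, hUo, hl₀, ⟨D⟩⟩ := exists_legendreFrame l₀
    refine ⟨U, hUo, hl₀, fun l hl => D.basis ⟨l, hl⟩, D.ratio, fun l hl => ⟨?_,
      D.differentiableAt_ratio l hl, D.deriv_ratio_ne_zero l hl, D.im_pos l hl,
      D.F_one ⟨l, hl⟩⟩, fun U' _ hU' s => ⟨fun h l hl hl' => D.eventually_of_isFlat hUo h l hl hl',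
      fun h => D.isFlat_of_eventually hU' h hUo⟩⟩
    -- The form at each point comes from an arbitrarily chosen frame there. Any other frame differs
    -- from it by determinant one, so the pointwise choices fit together.
    have h := LegendreFrame.det_classes (exists_frame_at l).choose_spec.2.some D
      (exists_frame_at l).choose_spec.1 hl
    rw [← D.basis_zero, ← D.basis_one] at h
    refine Eq.trans ?_ h
    exact congrArg₂ (· - ·)
      (congrArg₂ (· * ·) (congrFun (LegendreFrame.coe_basis_repr _ _ _) 0)
        (congrFun (LegendreFrame.coe_basis_repr _ _ _) 1))
      (congrArg₂ (· * ·) (congrFun (LegendreFrame.coe_basis_repr _ _ _) 1)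
        (congrFun (LegendreFrame.coe_basis_repr _ _ _) 0))

end

noncomputable section

open VHSData

/-! ### Symmetric cubic tensors in two variables -/

/-- The number of ones in a word of length three. -/
def wordWeight (w : Fin 3 → Fin 2) : Fin 4 := ⟨∑ i, (w i : ℕ), by
  refine Nat.lt_succ_of_le ((Finset.sum_le_card_nsmul _ _ 1 fun i _ => by omega).trans ?_)
  simp⟩

/-- The word of length three that starts with `k` ones and ends with zeros. -/
def standardWord (k : Fin 4) : Fin 3 → Fin 2 := fun i => if (i : ℕ) < k then 1 else 0

theorem wordWeight_standardWord : ∀ k, wordWeight (standardWord k) = k := by decide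

theorem exists_perm_standardWord : ∀ w : Fin 3 → Fin 2,
    ∃ σ : Equiv.Perm (Fin 3), w ∘ σ = standardWord (wordWeight w) := by decide

theorem wordWeight_comp : ∀ (w : Fin 3 → Fin 2) (σ : Equiv.Perm (Fin 3)),
    wordWeight (w ∘ σ) = wordWeight w := by
  intro w σ
  apply Fin.ext
  exact Equiv.sum_comp σ fun i => (w i : ℕ)

theorem univ_words : (Finset.univ : Finset (Fin 3 → Fin 2)) =
    {![0, 0, 0], ![0, 0, 1], ![0, 1, 0], ![0, 1, 1],
      ![1, 0, 0], ![1, 0, 1], ![1, 1, 0], ![1, 1, 1]} := by decide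

/-- Explains the integers 2 and 3 in `cubicRep`: each of its entries sums the products of entries of
A over all words of one weight. -/
theorem sum_word_eq {R : Type} [CommRing R] (A : Matrix (Fin 2) (Fin 2) R) (a : Fin 4 → R)
    (w : Fin 3 → Fin 2) :
    ∑ v, a (wordWeight v) * ∏ j, A (w j) (v j) = (cubicRep A).mulVec a (wordWeight w) := by
  have hw : w ∈ (Finset.univ : Finset (Fin 3 → Fin 2)) := Finset.mem_univ w
  rw [univ_words] at hw ⊢
  simp only [Finset.mem_insert, Finset.mem_singleton] at hw
  rw [Finset.sum_insert (by decide), Finset.sum_insert (by decide), Finset.sum_insert (by decide),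
    Finset.sum_insert (by decide), Finset.sum_insert (by decide), Finset.sum_insert (by decide),
    Finset.sum_insert (by decide), Finset.sum_singleton]
  have h0 : wordWeight ![0, 0, 0] = 0 := by decide
  have h1 : wordWeight ![0, 0, 1] = 1 := by decide
  have h2 : wordWeight ![0, 1, 0] = 1 := by decide
  have h3 : wordWeight ![0, 1, 1] = 2 := by decide
  have h4 : wordWeight ![1, 0, 0] = 1 := by decide
  have h5 : wordWeight ![1, 0, 1] = 2 := by decide
  have h6 : wordWeight ![1, 1, 0] = 2 := by decide
  have h7 : wordWeight ![1, 1, 1] = 3 := by decide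
  simp only [h0, h1, h2, h3, h4, h5, h6, h7, Fin.prod_univ_three]
  rcases hw with rfl | rfl | rfl | rfl | rfl | rfl | rfl | rfl <;>
    simp [h0, h1, h2, h3, h4, h5, h6, h7, cubicRep, Matrix.mulVec, dotProduct,
      Fin.sum_univ_succ] <;> ring

section

variable {R V : Type} [CommRing R] [AddCommGroup V] [Module R V]

/-- The tensor basis of the third tensor power. -/
def cubeBasis (e : Module.Basis (Fin 2) R V) : Module.Basis (Fin 3 → Fin 2) R (⨂[R]^3 V) :=
  Basis.piTensorProduct fun _ => e

theorem cubeBasis_repr_tprod (e : Module.Basis (Fin 2) R V) (v : Fin 3 → V) (w : Fin 3 → Fin 2) :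
    (cubeBasis e).repr (PiTensorProduct.tprod R v) w = ∏ j, e.repr (v j) (w j) :=
  Basis.piTensorProduct_repr_tprod_apply _ _ _

theorem cubeBasis_apply (e : Module.Basis (Fin 2) R V) (w : Fin 3 → Fin 2) :
    cubeBasis e w = PiTensorProduct.tprod R fun j => e (w j) :=
  Basis.piTensorProduct_apply _ _

theorem cubeBasis_repr_reindex (e : Module.Basis (Fin 2) R V) (σ : Equiv.Perm (Fin 3))
    (t : ⨂[R]^3 V) (w : Fin 3 → Fin 2) :
    (cubeBasis e).repr (PiTensorProduct.reindex R (fun _ => V) σ t) w =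
      (cubeBasis e).repr t (w ∘ σ) := by
  induction t using PiTensorProduct.induction_on with
  | smul_tprod r v =>
    rw [map_smul, map_smul, map_smul, Finsupp.smul_apply, Finsupp.smul_apply,
      PiTensorProduct.reindex_tprod]
    congr 1
    erw [cubeBasis_repr_tprod, cubeBasis_repr_tprod]
    rw [← Equiv.prod_comp σ]
    exact Finset.prod_congr rfl fun i _ => by rw [Equiv.symm_apply_apply]; rfl
  | add x y hx hy => simp only [map_add, Finsupp.add_apply, hx, hy]

end

variable {V : Type} [AddCommGroup V] [Module ℚ V] (e : Module.Basis (Fin 2) ℚ V)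

/-- Permutations act transitively on the words of given weight, so symmetry means that coordinates
depend only on the weight. -/
theorem mem_symTensors_iff {t : ⨂[ℚ]^3 V} : t ∈ symTensors 3 V ↔
    ∀ w, (cubeBasis e).repr t w = (cubeBasis e).repr t (standardWord (wordWeight w)) := by
  constructor
  · intro h w
    obtain ⟨σ, hσ⟩ := exists_perm_standardWord w
    rw [← hσ, ← cubeBasis_repr_reindex, h σ]
  · intro h σ
    refine (cubeBasis e).repr.injective (Finsupp.ext fun w => ?_)
    rw [cubeBasis_repr_reindex, h, h w, wordWeight_comp]

/-- The symmetric tensor with given coordinates. -/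
def symTensorOf (a : Fin 4 → ℚ) : ⨂[ℚ]^3 V := ∑ w, a (wordWeight w) • cubeBasis e w

theorem repr_symTensorOf (a : Fin 4 → ℚ) (w : Fin 3 → Fin 2) :
    (cubeBasis e).repr (symTensorOf e a) w = a (wordWeight w) := by
  rw [symTensorOf, Module.Basis.repr_sum_self]

/-- The coordinates of symmetric tensors. -/
def symCoordEquiv : symTensors 3 V ≃ₗ[ℚ] (Fin 4 → ℚ) where
  toFun t k := (cubeBasis e).repr t.1 (standardWord k)
  map_add' s t := by
    ext k
    simp
  map_smul' c t := by
    ext k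
    simp
  invFun a := ⟨symTensorOf e a, (mem_symTensors_iff e).2 fun w => by
    rw [repr_symTensorOf, repr_symTensorOf, wordWeight_standardWord]⟩
  left_inv t := by
    refine Subtype.ext ((cubeBasis e).repr.injective (Finsupp.ext fun w => ?_))
    rw [repr_symTensorOf]
    exact ((mem_symTensors_iff e).1 t.2 w).symm
  right_inv a := by
    ext k
    change (cubeBasis e).repr (symTensorOf e a) (standardWord k) = a k
    rw [repr_symTensorOf, wordWeight_standardWord]

/-- The basis of the symmetric tensors. -/
def symBasis : Module.Basis (Fin 4) ℚ (symTensors 3 V) :=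
  Module.Basis.ofEquivFun (symCoordEquiv e)

theorem symBasis_repr (t : symTensors 3 V) (w : Fin 3 → Fin 2) :
    (symBasis e).repr t (wordWeight w) = (cubeBasis e).repr t.1 w := by
  rw [(mem_symTensors_iff e).1 t.2 w, ← Module.Basis.equivFun_apply, symBasis,
    Module.Basis.equivFun_ofEquivFun]
  rfl

theorem coe_eq_sum (t : symTensors 3 V) :
    (t : ⨂[ℚ]^3 V) = ∑ w, (symBasis e).repr t (wordWeight w) • cubeBasis e w := by
  conv_lhs => rw [← (cubeBasis e).sum_repr t.1]
  exact Finset.sum_congr rfl fun w _ => by rw [symBasis_repr]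

theorem symBasis_repr_change (e' : Module.Basis (Fin 2) ℚ V) (t : symTensors 3 V) :
    ⇑((symBasis e').repr t) = (cubicRep (e'.toMatrix e)).mulVec ((symBasis e).repr t) := by
  ext k
  rw [← wordWeight_standardWord k, symBasis_repr, coe_eq_sum e t, map_sum, Finset.sum_apply',
    ← sum_word_eq]
  refine Finset.sum_congr rfl fun v _ => ?_
  rw [map_smul, Finsupp.smul_apply, smul_eq_mul, cubeBasis_apply, cubeBasis_repr_tprod]
  rfl

/-- The basis `1 ⊗ e₀ + τ ⊗ e₁`, `1 ⊗ e₁` of the complexification. -/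
def periodBasis (τ : ℂ) : Module.Basis (Fin 2) ℂ (ℂ ⊗[ℚ] V) :=
  Module.Basis.ofEquivFun (((e.baseChange ℂ).equivFun).trans
    (Matrix.toLin'OfInv (M := !![1, 0; τ, 1]) (M' := !![1, 0; -τ, 1])
      (by ext i j; fin_cases i <;> fin_cases j <;> simp)
      (by ext i j; fin_cases i <;> fin_cases j <;> simp)))

theorem periodBasis_repr_tmul (τ z : ℂ) (v : V) :
    ⇑((periodBasis e τ).repr (z ⊗ₜ v)) = ![z * e.repr v 0, -τ * (z * e.repr v 0) + z * e.repr v 1] := by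
  rw [← Module.Basis.equivFun_apply, periodBasis, Module.Basis.equivFun_ofEquivFun]
  ext i
  fin_cases i <;> simp [Matrix.toLin'OfInv, Matrix.mulVec, dotProduct, Fin.sum_univ_two,
    Module.Basis.baseChange_repr_tmul, Algebra.smul_def] <;> ring

theorem periodBasis_zero (τ : ℂ) : periodBasis e τ 0 = 1 ⊗ₜ e 0 + τ ⊗ₜ e 1 := by
  refine (periodBasis e τ).repr.injective (DFunLike.coe_injective ?_)
  rw [map_add, Finsupp.coe_add, periodBasis_repr_tmul, periodBasis_repr_tmul]
  ext i
  fin_cases i <;> simp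

/-- Passing to the basis e₀ + τe₁, e₁ changes plane coordinates by the lower unipotent matrix with
entry −τ, and symmetric tensors by its `cubicRep`. -/
theorem cubeBasis_repr_comparison (τ : ℂ) (x : ℂ ⊗[ℚ] symTensors 3 V) (w : Fin 3 → Fin 2) :
    (cubeBasis (periodBasis e τ)).repr ((tensorPowerComparison 3 V ∘ₗ
      (symTensors 3 V).subtype.baseChange ℂ) x) w =
    filtrationCoords τ (complexCoords (symBasis e) x) (wordWeight w) := by
  have hword : ∀ v w : Fin 3 → Fin 2, (cubeBasis (periodBasis e τ)).repr
      (tensorPowerComparison 3 V ((1 : ℂ) ⊗ₜ cubeBasis e v)) w =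
      ∏ j, (!![1, 0; -τ, 1] : Matrix (Fin 2) (Fin 2) ℂ) (w j) (v j) := fun v w => by
    rw [tensorPowerComparison, LinearMap.liftBaseChange_tmul, one_smul, cubeBasis_apply,
      PiTensorProduct.lift.tprod]
    change (cubeBasis (periodBasis e τ)).repr (PiTensorProduct.tprod ℂ fun j => 1 ⊗ₜ e (v j)) w = _
    rw [cubeBasis_repr_tprod]
    refine Finset.prod_congr rfl fun j _ => ?_
    rw [periodBasis_repr_tmul]
    generalize v j = a
    generalize w j = b
    fin_cases a <;> fin_cases b <;> simp
  induction x with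
  | zero => simp [filtrationCoords]
  | add x y hx hy =>
    rw [map_add, map_add, Finsupp.add_apply, hx, hy, map_add, filtrationCoords, filtrationCoords,
      filtrationCoords, Matrix.mulVec_add, Pi.add_apply]
  | tmul z t =>
    set a := (symBasis e).repr t with ha
    have h1 : complexCoords (symBasis e) (z ⊗ₜ t) = fun k => z * (a k : ℂ) :=
      funext fun k => complexCoords_tmul _ _ _ _
    have h2 : (tensorPowerComparison 3 V ∘ₗ (symTensors 3 V).subtype.baseChange ℂ) (z ⊗ₜ t) =
        ∑ v, (z * (a (wordWeight v) : ℂ)) •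
          tensorPowerComparison 3 V ((1 : ℂ) ⊗ₜ cubeBasis e v) := by
      rw [LinearMap.comp_apply, LinearMap.baseChange_tmul, Submodule.subtype_apply, coe_eq_sum e t,
        TensorProduct.tmul_sum, map_sum]
      refine Finset.sum_congr rfl fun v _ => ?_
      rw [← map_smul (tensorPowerComparison 3 V), TensorProduct.smul_tmul', smul_eq_mul, mul_one, TensorProduct.tmul_smul,
        TensorProduct.smul_tmul', Algebra.smul_def, mul_comm]
      rfl
    rw [h1, h2, map_sum, Finset.sum_apply']
    simp only [map_smul, Finsupp.smul_apply, hword, smul_eq_mul]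
    exact sum_word_eq (!![1, 0; -τ, 1] : Matrix (Fin 2) (Fin 2) ℂ) (fun k => z * (a k : ℂ)) w

/-- If the degrees q sum to at least p and the word has weight above 3 − p, some factor has q j + w
j > 1. Then q j ≥ 2 and the factor vanishes, or q j = 1 and the second coordinate of a vector of F¹
is taken. Conversely, a basis tensor is admissible with degrees 1 − w j. -/
theorem mem_span_tprod_iff {F : ℤ → Submodule ℂ (ℂ ⊗[ℚ] V)} {τ : ℂ}
    (h1 : F 1 = Submodule.span ℂ {1 ⊗ₜ e 0 + τ ⊗ₜ e 1}) (h0 : ∀ p ≤ 0, F p = ⊤)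
    (h2 : ∀ p, 2 ≤ p → F p = ⊥) (p : ℤ) (y : ⨂[ℂ]^3 (ℂ ⊗[ℚ] V)) :
    y ∈ Submodule.span ℂ {t | ∃ (q : Fin 3 → ℤ) (u : Fin 3 → ℂ ⊗[ℚ] V),
      p ≤ ∑ j, q j ∧ (∀ j, u j ∈ F (q j)) ∧ t = PiTensorProduct.tprod ℂ u} ↔
    ∀ w, 3 < p + (wordWeight w : ℤ) → (cubeBasis (periodBasis e τ)).repr y w = 0 := by
  have hsum : ∀ w : Fin 3 → Fin 2, ((wordWeight w : ℕ) : ℤ) = ∑ j, ((w j : ℕ) : ℤ) := fun w =>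
    Nat.cast_sum Finset.univ fun j => ((w j : Fin 2) : ℕ)
  constructor
  · intro hy w hw
    induction hy using Submodule.span_induction with
    | mem t ht =>
      obtain ⟨q, u, hq, hu, rfl⟩ := ht
      rw [cubeBasis_repr_tprod]
      obtain ⟨j, hj⟩ : ∃ j, 1 < q j + ((w j : ℕ) : ℤ) := by
        by_contra! hcon
        have := Finset.sum_le_sum fun j (_ : j ∈ Finset.univ) => hcon j
        rw [Finset.sum_add_distrib, ← hsum] at this
        simp at this
        linarith
      refine Finset.prod_eq_zero (Finset.mem_univ j) ?_
      have hwj := (w j).2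
      by_cases hq2 : 2 ≤ q j
      · have := hu j
        rw [h2 _ hq2, Submodule.mem_bot] at this
        rw [this, map_zero, Finsupp.zero_apply]
      · have hq1 : q j = 1 := by omega
        have hw1 : w j = 1 := by apply Fin.ext; rw [Fin.val_one]; omega
        have := hu j
        rw [hq1, h1, Submodule.mem_span_singleton, ← periodBasis_zero] at this
        obtain ⟨c, hc⟩ := this
        rw [← hc, hw1]
        simp
    | zero => simp
    | add x y _ _ hx hy => rw [map_add, Finsupp.add_apply, hx, hy, add_zero]
    | smul c x _ hx => rw [map_smul, Finsupp.smul_apply, hx, smul_zero]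
  · intro h
    rw [← (cubeBasis (periodBasis e τ)).sum_repr y]
    refine Submodule.sum_mem _ fun w _ => ?_
    by_cases hw : 3 < p + (wordWeight w : ℤ)
    · rw [h w hw, zero_smul]
      exact Submodule.zero_mem _
    · refine Submodule.smul_mem _ _ (Submodule.subset_span ⟨fun j => 1 - ((w j : ℕ) : ℤ),
        fun j => periodBasis e τ (w j), ?_, fun j => ?_, cubeBasis_apply _ _⟩)
      · rw [Finset.sum_sub_distrib, ← hsum]
        simp
        linarith
      · change periodBasis e τ (w j) ∈ F (1 - ((w j : ℕ) : ℤ))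
        generalize w j = a
        fin_cases a
        · change periodBasis e τ 0 ∈ F (1 - 0)
          rw [sub_zero, h1, periodBasis_zero]
          exact Submodule.mem_span_singleton_self _
        · change periodBasis e τ 1 ∈ F (1 - 1)
          rw [sub_self, h0 0 le_rfl]
          trivial

theorem isCubicFiltration_symPower {M : Set ℂ} {W : VHSData M} {m : M} {τ : ℂ}
    (e : Module.Basis (Fin 2) ℚ (W.Fiber m))
    (h1 : W.F m 1 = Submodule.span ℂ {1 ⊗ₜ e 0 + τ ⊗ₜ e 1}) (h0 : ∀ p ≤ 0, W.F m p = ⊤)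
    (h2 : ∀ p, 2 ≤ p → W.F m p = ⊥) :
    IsCubicFiltration (V := symTensors 3 (W.Fiber m)) (symBasis e) τ ((symPower 3 W).F m) := by
  intro p x
  refine (mem_span_tprod_iff e h1 h0 h2 p _).trans ?_
  simp only [cubeBasis_repr_comparison]
  constructor
  · intro h k hk
    have := h (standardWord k)
    rw [wordWeight_standardWord] at this
    exact this hk
  · exact fun h w => h _

end

/-! ### Flat frames of the third symmetric power. -/

noncomputable section

namespace VHSData

variable {M : Set ℂ} {W : VHSData M}

open Classical in
/-- The section with constant coordinates. -/
def constSection {r : ℕ} {U : Set M} (e : ∀ m : M, m ∈ U → Module.Basis (Fin r) ℚ (W.Fiber m))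
    (a : Fin r → ℚ) (m : M) : W.Fiber m :=
  if hm : m ∈ U then (e m hm).equivFun.symm a else 0

theorem constSection_of_mem {r : ℕ} {U : Set M}
    (e : ∀ m : M, m ∈ U → Module.Basis (Fin r) ℚ (W.Fiber m)) (a : Fin r → ℚ) {m : M} (hm : m ∈ U) :
    constSection e a m = (e m hm).equivFun.symm a := dif_pos hm

theorem repr_constSection {r : ℕ} {U : Set M}
    (e : ∀ m : M, m ∈ U → Module.Basis (Fin r) ℚ (W.Fiber m)) (a : Fin r → ℚ) {m : M} (hm : m ∈ U) :
    ⇑((e m hm).repr (constSection e a m)) = a := by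
  rw [constSection_of_mem e a hm, ← Module.Basis.equivFun_apply, LinearEquiv.apply_symm_apply]

theorem constSection_single {r : ℕ} {U : Set M}
    (e : ∀ m : M, m ∈ U → Module.Basis (Fin r) ℚ (W.Fiber m)) (i : Fin r) (c : ℚ) {m : M}
    (hm : m ∈ U) : constSection e (Pi.single i c) m = c • e m hm i := by
  refine (e m hm).repr.injective (DFunLike.coe_injective ?_)
  rw [repr_constSection e _ hm, map_smul, Module.Basis.repr_self, Finsupp.smul_single, smul_eq_mul,
    mul_one, Finsupp.single_eq_pi_single]

theorem IsFlatFrame.isFlat_constSection {r : ℕ} {U : Set M}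
    {e : ∀ m : M, m ∈ U → Module.Basis (Fin r) ℚ (W.Fiber m)} (he : W.IsFlatFrame U e)
    {U' : Set M} (hU' : IsOpen U') (h : U' ⊆ U) (a : Fin r → ℚ) : W.IsFlat U' (constSection e a) := by
  rw [he U' hU' h]
  refine fun m hm _ => Filter.Eventually.of_forall fun m' hm' => DFunLike.coe_injective ?_
  rw [repr_constSection e a hm, repr_constSection e a hm']

/-- Flatness is a local condition that restricts to smaller sets. -/
def FlatRestricts (W : VHSData M) : Prop :=
  ∀ {U V : Set M} {s : ∀ m, W.Fiber m}, V ⊆ U → W.IsFlat U s → W.IsFlat V s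

theorem IsFlatFrame.eventually_eq {r : ℕ} {U : Set M}
    {e : ∀ m : M, m ∈ U → Module.Basis (Fin r) ℚ (W.Fiber m)} (he : W.IsFlatFrame U e)
    (hU : IsOpen U) (hW : W.FlatRestricts) {U' : Set M} (hU' : IsOpen U') {s : ∀ m, W.Fiber m}
    (hs : W.IsFlat U' s) {m : M} (hm : m ∈ U) (hm' : m ∈ U') :
    ∀ᶠ m' in 𝓝 m, ∀ hm' : m' ∈ U, (e m' hm').repr (s m') = (e m hm).repr (s m) :=
  (he (U' ∩ U) (hU'.inter hU) Set.inter_subset_right s).1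
    (hW Set.inter_subset_left hs) m hm ⟨hm', hm⟩

theorem flatRestricts_symPower : (symPower 3 W).FlatRestricts :=
  fun h hs m hm => hs m (h hm)

/-- The frame of the third symmetric power. -/
def symFrame {U : Set M} (e : ∀ m : M, m ∈ U → Module.Basis (Fin 2) ℚ (W.Fiber m)) (m : M)
    (hm : m ∈ U) : Module.Basis (Fin 4) ℚ ((symPower 3 W).Fiber m) :=
  symBasis (e m hm)

/-- Coordinates of a sum of tensors are polynomials in the coordinates of its factors, hence locally
constant if these are. Conversely, a symmetric tensor expands over the eight words in the frame
vectors. -/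
theorem IsFlatFrame.symPower {U : Set M}
    {e : ∀ m : M, m ∈ U → Module.Basis (Fin 2) ℚ (W.Fiber m)} (he : W.IsFlatFrame U e)
    (hU : IsOpen U) (hW : W.FlatRestricts) :
    (symPower 3 W).IsFlatFrame U (symFrame e) := by
  intro U' hU' hU'U s
  constructor
  · intro hs m hm hmU'
    obtain ⟨V, hV, hmV, k, a, ha, hsum⟩ := hs m hmU'
    have h1 : ∀ᶠ m' in 𝓝 m, ∀ i j, ∀ hm' : m' ∈ U,
        (e m' hm').repr (a i j m') = (e m hm).repr (a i j m) :=
      Filter.eventually_all.2 fun i => Filter.eventually_all.2 fun j =>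
        he.eventually_eq hU hW hV (ha i j) hm hmV
    filter_upwards [h1, hV.mem_nhds hmV] with m' h hm'V hm'
    refine Finsupp.ext fun k => ?_
    have key : ∀ m (hm : m ∈ U), m ∈ V → (symFrame e m hm).repr (s m) k =
        ∑ i, ∏ j, (e m hm).repr (a i j m) (standardWord k j) := fun m hm hmV => by
      conv_lhs => rw [← wordWeight_standardWord k]
      refine (symBasis_repr (e m hm) (s m) _).trans ?_
      rw [hsum m hmV, map_sum, Finset.sum_apply']
      exact Finset.sum_congr rfl fun i _ => cubeBasis_repr_tprod _ _ _
    rw [key m' hm' hm'V, key m hm hmV]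
    simp only [fun i j => h i j hm']
  · intro h m₀ hm₀
    have hm₀U := hU'U hm₀
    obtain ⟨V, hV, hVo, hm₀V⟩ := mem_nhds_iff.1 ((h m₀ hm₀U hm₀).and (hU.mem_nhds hm₀U))
    have hVU : V ⊆ U := fun m hm => (hV hm).2
    set r := (symFrame e m₀ hm₀U).repr (s m₀) with hr
    let E := (Fintype.equivFin (Fin 3 → Fin 2)).symm
    -- Flat sections are sums of pure tensors without scalar coefficients, so the coordinate is
    -- absorbed into the factor with index 0.
    refine ⟨V, hVo, hm₀V, Fintype.card (Fin 3 → Fin 2), fun i j => constSection e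
      (Pi.single (E i j) (if j = 0 then r (wordWeight (E i)) else 1)),
      fun i j => he.isFlat_constSection hVo hVU _, fun m hm => ?_⟩
    refine (coe_eq_sum (e m (hVU hm)) (s m)).trans ?_
    rw [← Equiv.sum_comp E]
    refine Finset.sum_congr rfl fun i _ => ?_
    have h1 : (symBasis (e m (hVU hm))).repr (s m) = r := (hV hm).1 (hVU hm)
    simp only [constSection_single e _ _ (hVU hm)]
    rw [h1, MultilinearMap.map_smul_univ, cubeBasis_apply, Finset.prod_ite_eq']
    simp

end VHSData

end

/-! ### Adapted frames, holomorphy and Griffiths transversality. -/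

noncomputable section

section FiltrationBasis

variable {V : Type} [AddCommGroup V] [Module ℚ V] (b : Module.Basis (Fin 4) ℚ V)

/-- The basis of `ℂ ⊗ V` with coordinates `filtrationCoords`. -/
def filtrationBasis (τ : ℂ) : Module.Basis (Fin 4) ℂ (ℂ ⊗[ℚ] V) :=
  Module.Basis.ofEquivFun ((complexCoords b).trans
    (Matrix.toLin'OfInv (M := cubicRep !![1, 0; τ, 1]) (M' := cubicRep !![1, 0; -τ, 1])
      (by
        rw [← cubicRep_mul, ← cubicRep_one]
        congr 1
        ext i j
        fin_cases i <;> fin_cases j <;> simp)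
      (by
        rw [← cubicRep_mul, ← cubicRep_one]
        congr 1
        ext i j
        fin_cases i <;> fin_cases j <;> simp)))

theorem filtrationBasis_equivFun (τ : ℂ) (x : ℂ ⊗[ℚ] V) :
    (filtrationBasis b τ).equivFun x = filtrationCoords τ (complexCoords b x) := by
  simp [filtrationBasis, Matrix.toLin'OfInv, filtrationCoords]

theorem complexCoords_filtrationBasis (τ : ℂ) (k : Fin 4) :
    complexCoords b (filtrationBasis b τ k) = fun i => cubicRep !![1, 0; τ, 1] i k := by
  rw [filtrationBasis, Module.Basis.coe_ofEquivFun]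
  ext i
  simp [Matrix.toLin'OfInv, Finsupp.single_apply]

variable {b}

theorem IsCubicFiltration.mem_iff_filtrationBasis {τ : ℂ} {F : ℤ → Submodule ℂ (ℂ ⊗[ℚ] V)}
    (hF : IsCubicFiltration b τ F) (p : ℤ) (x : ℂ ⊗[ℚ] V) :
    x ∈ F p ↔ ∀ k : Fin 4, 3 < p + (k : ℤ) → (filtrationBasis b τ).repr x k = 0 := by
  rw [hF, ← filtrationBasis_equivFun]
  rfl

theorem IsCubicFiltration.eq_span {τ : ℂ} {F : ℤ → Submodule ℂ (ℂ ⊗[ℚ] V)}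
    (hF : IsCubicFiltration b τ F) (p : ℤ) :
    F p = Submodule.span ℂ (filtrationBasis b τ '' {k | p + ((k : ℕ) : ℤ) ≤ 3}) := by
  ext x
  rw [hF.mem_iff_filtrationBasis, Module.Basis.mem_span_image]
  constructor
  · intro h k hk
    by_contra hcon
    exact (Finsupp.mem_support_iff.1 hk) (h k (not_le.1 hcon))
  · intro h k hk
    by_contra hcon
    exact absurd (h (Finsupp.mem_support_iff.2 hcon)) (not_le.2 hk)

end FiltrationBasis

/-- The logarithmic derivative of the unipotent change of coordinates lowers the index by one, which
is Griffiths transversality in coordinates. For `k = 0` the index `k - 1` wraps around to 3,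
harmlessly, because of the factor `k`. -/
theorem hasDerivAt_filtrationCoords {τ : ℂ → ℂ} {X : ℂ → Fin 4 → ℂ} {τ' z : ℂ} {X' : Fin 4 → ℂ}
    (hτ : HasDerivAt τ τ' z) (hX : HasDerivAt X X' z) (k : Fin 4) :
    HasDerivAt (fun u => filtrationCoords (τ u) (X u) k)
      (filtrationCoords (τ z) X' k - (k : ℂ) * τ' * filtrationCoords (τ z) (X z) (k - 1)) z := by
  have h := hasDerivAt_pi.1 hX
  have hn := hτ.fun_neg
  unfold filtrationCoords
  simp only [mulVec_fin_four]
  fin_cases k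
  · simp [cubicRep]
    exact h 0
  · simp [cubicRep]
    refine ((hτ.fun_mul (h 0)).fun_neg.fun_add (h 1)).congr_deriv ?_
    ring
  · simp [cubicRep, show (2 : Fin 4) - 1 = 1 from rfl]
    refine ((((hτ.fun_pow 2).fun_mul (h 0)).fun_add ((hτ.const_mul 2).fun_mul (h 1)).fun_neg).fun_add
      (h 2)).congr_deriv ?_
    simp
    ring
  · simp [cubicRep, show (3 : Fin 4) - 1 = 2 from rfl]
    refine ((((hn.fun_pow 3).fun_mul (h 0)).fun_add (((hτ.fun_pow 2).const_mul 3).fun_mul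
      (h 1))).fun_add (((hτ.const_mul 3).fun_mul (h 2)).fun_neg) |>.fun_add (h 3)).congr_deriv ?_
    simp
    ring

namespace VHSData

variable {M : Set ℂ} {W : VHSData M}

/-- A flat frame for which the filtration is the one induced on binary cubics by the line spanned by
`(1, τ)`, for a function `τ` with nowhere vanishing derivative. -/
structure IsCubicFrame (W : VHSData M) (U : Set M)
    (e : ∀ m : M, m ∈ U → Module.Basis (Fin 4) ℚ (W.Fiber m)) (τ : ℂ → ℂ) : Prop where
  isOpen : IsOpen U
  isFlatFrame : W.IsFlatFrame U e
  differentiableAt : ∀ m ∈ U, DifferentiableAt ℂ τ (m : M)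
  deriv_ne_zero : ∀ m ∈ U, deriv τ (m : M) ≠ 0
  im_pos : ∀ m ∈ U, 0 < (τ (m : M)).im
  isCubicFiltration : ∀ m hm, IsCubicFiltration (e m hm) (τ m) (W.F m)

/-- The section with given coordinates. -/
def frameSection {r : ℕ} {U : Set M} (e : ∀ m : M, m ∈ U → Module.Basis (Fin r) ℚ (W.Fiber m))
    (g : Fin r → ℂ → ℂ) (m : M) : ℂ ⊗[ℚ] W.Fiber m :=
  ∑ i, g i m ⊗ₜ[ℚ] constSection e (Pi.single i 1) m

theorem complexCoords_frameSection {r : ℕ} {U : Set M}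
    (e : ∀ m : M, m ∈ U → Module.Basis (Fin r) ℚ (W.Fiber m)) (g : Fin r → ℂ → ℂ) {m : M}
    (hm : m ∈ U) : complexCoords (e m hm) (frameSection e g m) = fun i => g i m := by
  ext i
  rw [frameSection, map_sum, Finset.sum_apply]
  simp only [complexCoords_tmul, repr_constSection e _ hm]
  rw [Finset.sum_eq_single i]
  · simp
  · intro j _ hj
    simp [hj.symm]
  · simp

theorem IsFlatFrame.hasCovariantDeriv {r : ℕ} {U : Set M}
    {e : ∀ m : M, m ∈ U → Module.Basis (Fin r) ℚ (W.Fiber m)} (he : W.IsFlatFrame U e)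
    (hU : IsOpen U) {g : Fin r → ℂ → ℂ} (hg : ∀ i, ∀ m ∈ U, DifferentiableAt ℂ (g i) (m : M)) :
    W.HasCovariantDeriv U (frameSection e g) (frameSection e fun i => deriv (g i)) :=
  fun _ hm => ⟨U, hU, hm, r, g, fun i => constSection e (Pi.single i 1),
    fun _ => he.isFlat_constSection hU subset_rfl _, fun m hm => ⟨fun i => hg i m hm, rfl, rfl⟩⟩

/-- The coordinates of the basis adapted to the filtration. -/
def cubicFrameCoords (τ : ℂ → ℂ) (k i : Fin 4) (z : ℂ) : ℂ := cubicRep !![1, 0; τ z, 1] i k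

theorem differentiableAt_cubicFrameCoords {τ : ℂ → ℂ} {z : ℂ} (hτ : DifferentiableAt ℂ τ z)
    (k i : Fin 4) : DifferentiableAt ℂ (cubicFrameCoords τ k i) z := by
  change DifferentiableAt ℂ (fun z => cubicRep !![1, 0; τ z, 1] i k) z
  fin_cases i <;> fin_cases k <;> simp [cubicRep] <;> fun_prop

namespace IsCubicFrame

variable {U : Set M} {e : ∀ m : M, m ∈ U → Module.Basis (Fin 4) ℚ (W.Fiber m)} {τ : ℂ → ℂ}

theorem frameSection_eq (m : M) (hm : m ∈ U) (k : Fin 4) :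
    frameSection e (cubicFrameCoords τ k) m = filtrationBasis (e m hm) (τ m) k := by
  refine (complexCoords (e m hm)).injective ?_
  rw [complexCoords_frameSection e _ hm, complexCoords_filtrationBasis]
  rfl

theorem hasCovariantDeriv (h : W.IsCubicFrame U e τ) (k : Fin 4) :
    W.HasCovariantDeriv U (frameSection e (cubicFrameCoords τ k))
      (frameSection e fun i => deriv (cubicFrameCoords τ k i)) :=
  h.isFlatFrame.hasCovariantDeriv h.isOpen
    fun i m hm => differentiableAt_cubicFrameCoords (h.differentiableAt m hm) k i

theorem exists_holomorphic (h : W.IsCubicFrame U e τ) (p : ℤ) :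
    ∃ (k : ℕ) (s s' : Fin k → ∀ m, ℂ ⊗[ℚ] W.Fiber m),
      (∀ i, W.HasCovariantDeriv U (s i) (s' i)) ∧
      ∀ m ∈ U, LinearIndependent ℂ (fun i => s i m) ∧
        Submodule.span ℂ (Set.range (fun i => s i m)) = W.F m p := by
  classical
  set K : Set (Fin 4) := {k | p + ((k : ℕ) : ℤ) ≤ 3}
  let E : Fin (Fintype.card K) ≃ K := (Fintype.equivFin K).symm
  refine ⟨Fintype.card K, fun i => frameSection e (cubicFrameCoords τ (E i)), _,
    fun i => h.hasCovariantDeriv (E i), fun m hm => ?_⟩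
  simp only [frameSection_eq m hm]
  constructor
  · exact (filtrationBasis (e m hm) (τ m)).linearIndependent.comp (fun i => (E i : Fin 4))
      (Subtype.val_injective.comp E.injective)
  · rw [(h.isCubicFiltration m hm).eq_span p]
    congr 1
    ext x
    constructor
    · rintro ⟨i, rfl⟩
      exact ⟨E i, (E i).2, rfl⟩
    · rintro ⟨k, hk, rfl⟩
      exact ⟨E.symm ⟨k, hk⟩, by simp⟩

/-- The filtration coordinates of the section that must vanish do so on a neighbourhood, so their
derivatives vanish too. For the coordinates that matter in F^(p−1), the correction term has index `k
- 1` and is itself zero. -/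
theorem transversal (h : W.IsCubicFrame U e τ) (hM : IsOpen M) (hW : W.FlatRestricts) {p : ℤ}
    {U₁ : Set M} {s s' : ∀ m, ℂ ⊗[ℚ] W.Fiber m} (hU₁ : IsOpen U₁) (hs : W.HasCovariantDeriv U₁ s s')
    (hsF : ∀ m ∈ U₁, s m ∈ W.F m p) {m₀ : M} (hm₀ : m₀ ∈ U₁) (hm₀U : m₀ ∈ U) :
    s' m₀ ∈ W.F m₀ (p - 1) := by
  obtain ⟨U₂, hU₂, hm₀U₂, n, f, a, ha, hfa⟩ := hs m₀ hm₀
  set r : Fin n → Fin 4 → ℚ := fun i => (e m₀ hm₀U).repr (a i m₀) with hr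
  have h1 : ∀ᶠ m in 𝓝 m₀, ∀ i, ∀ hm : m ∈ U, (e m hm).repr (a i m) = (e m₀ hm₀U).repr (a i m₀) :=
    Filter.eventually_all.2 fun i =>
      h.isFlatFrame.eventually_eq h.isOpen hW hU₂ (ha i) hm₀U hm₀U₂
  set X : ℂ → Fin 4 → ℂ := fun z j => ∑ i, f i z * r i j with hX
  set X' : Fin 4 → ℂ := fun j => ∑ i, deriv (f i) m₀ * r i j with hX'
  have hXd : HasDerivAt X X' m₀ := by
    refine hasDerivAt_pi.2 fun j => ?_
    exact HasDerivAt.fun_sum fun i _ => ((hfa m₀ hm₀U₂).1 i).hasDerivAt.mul_const _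
  have hc : ∀ m (hm : m ∈ U), m ∈ U₂ → (∀ i, ∀ hm : m ∈ U,
      (e m hm).repr (a i m) = (e m₀ hm₀U).repr (a i m₀)) → complexCoords (e m hm) (s m) = X m := by
    intro m hm hm2 hrep
    rw [(hfa m hm2).2.1]
    ext j
    rw [map_sum, Finset.sum_apply]
    refine Finset.sum_congr rfl fun i _ => ?_
    rw [complexCoords_tmul, hrep i hm]
  have hc' : complexCoords (e m₀ hm₀U) (s' m₀) = X' := by
    rw [(hfa m₀ hm₀U₂).2.2]
    ext j
    rw [map_sum, Finset.sum_apply]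
    refine Finset.sum_congr rfl fun i _ => ?_
    rw [complexCoords_tmul]
  have hev : ∀ᶠ m : M in 𝓝 m₀, ∀ k : Fin 4, 3 < p + (k : ℤ) →
      filtrationCoords (τ m) (X m) k = 0 := by
    filter_upwards [h1, h.isOpen.mem_nhds hm₀U, hU₂.mem_nhds hm₀U₂, hU₁.mem_nhds hm₀] with
      m hrep hmU hmU₂ hmU₁ k hk
    rw [← hc m hmU hmU₂ hrep]
    exact (h.isCubicFiltration m hmU p _).1 (hsF m hmU₁) k hk
  have hevC : ∀ᶠ z in 𝓝 (m₀ : ℂ), ∀ k : Fin 4, 3 < p + (k : ℤ) →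
      filtrationCoords (τ z) (X z) k = 0 := by
    rw [← hM.isOpenEmbedding_subtypeVal.map_nhds_eq]
    exact hev
  rw [h.isCubicFiltration m₀ hm₀U, hc']
  intro k hk
  have hk' : 3 < p + (k : ℤ) := by linarith
  have hd := hasDerivAt_filtrationCoords (h.differentiableAt m₀ hm₀U).hasDerivAt hXd k
  have hd0 : HasDerivAt (fun u => filtrationCoords (τ u) (X u) k) 0 (m₀ : ℂ) :=
    (hasDerivAt_const (m₀ : ℂ) (0 : ℂ)).congr_of_eventuallyEq (hevC.mono fun z hz => hz k hk')
  have := hd.unique hd0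
  by_cases hk0 : k = 0
  · subst hk0
    simpa using this
  · have h3 : filtrationCoords (τ m₀) (X m₀) (k - 1) = 0 := by
      refine hevC.self_of_nhds (k - 1) ?_
      have : ((k - 1 : Fin 4) : ℕ) = (k : ℕ) - 1 := by
        clear * - hk0
        revert k
        decide
      have hpos : 0 < (k : ℕ) := Nat.pos_of_ne_zero fun h => hk0 (Fin.ext h)
      omega
    rwa [h3, mul_zero, sub_zero] at this

end IsCubicFrame

end VHSData

end

/-! ### The invariant form, polarizations and the Calabi-Yau condition. -/

noncomputable section

section InvariantForm

variable {V : Type} [AddCommGroup V] [Module ℚ V] {b : Module.Basis (Fin 4) ℚ V} {c : ℚ}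
  {Q : LinearMap.BilinForm ℚ V} {τ : ℂ} {F : ℤ → Submodule ℂ (ℂ ⊗[ℚ] V)}

/-- `Q` is the multiple with factor `c` of the invariant form on binary cubics. -/
def IsCubicForm (b : Module.Basis (Fin 4) ℚ V) (c : ℚ) (Q : LinearMap.BilinForm ℚ V) : Prop :=
  ∀ x y, Q x y = c * cubicForm (b.repr x) (b.repr y)

/-- The multiple with factor `c` of the invariant form on binary cubics. -/
def cubicBilin (b : Module.Basis (Fin 4) ℚ V) (c : ℚ) : LinearMap.BilinForm ℚ V :=
  LinearMap.mk₂ ℚ (fun x y => c * cubicForm (b.repr x) (b.repr y))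
    (fun x x' y => by rw [map_add]; simp only [cubicForm, Finsupp.add_apply]; ring)
    (fun a x y => by rw [map_smul]; simp only [cubicForm, Finsupp.smul_apply, smul_eq_mul]; ring)
    (fun x y y' => by rw [map_add]; simp only [cubicForm, Finsupp.add_apply]; ring)
    (fun a x y => by rw [map_smul]; simp only [cubicForm, Finsupp.smul_apply, smul_eq_mul]; ring)

theorem isCubicForm_cubicBilin (b : Module.Basis (Fin 4) ℚ V) (c : ℚ) :
    IsCubicForm b c (cubicBilin b c) := fun _ _ => LinearMap.mk₂_apply ..

namespace IsCubicForm

theorem of_repr_eq (hQ : IsCubicForm b c Q) {b' : Module.Basis (Fin 4) ℚ V}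
    {h : Matrix (Fin 2) (Fin 2) ℚ} (hb : ∀ x, ⇑(b.repr x) = (cubicRep h).mulVec (b'.repr x))
    (hh : h.det = 1) : IsCubicForm b' c Q := by
  intro x y
  rw [hQ, hb, hb, cubicForm_cubicRep, hh]
  ring

theorem baseChange (hQ : IsCubicForm b c Q) (x y : ℂ ⊗[ℚ] V) :
    LinearMap.BilinForm.baseChange ℂ Q x y =
      c * cubicForm (complexCoords b x) (complexCoords b y) := by
  induction x with
  | zero => simp [cubicForm]
  | add x x' hx hx' =>
    rw [map_add, LinearMap.add_apply, hx, hx', map_add]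
    simp only [cubicForm, Pi.add_apply]
    ring
  | tmul z v =>
    induction y with
    | zero => simp [cubicForm]
    | add y y' hy hy' =>
      rw [map_add, hy, hy', map_add]
      simp only [cubicForm, Pi.add_apply]
      ring
    | tmul w u =>
      rw [LinearMap.BilinForm.baseChange_tmul, hQ]
      simp only [cubicForm, complexCoords_tmul, Rat.smul_def]
      push_cast
      ring

theorem baseChange_filtrationCoords (hQ : IsCubicForm b c Q) (τ : ℂ) (x y : ℂ ⊗[ℚ] V) :
    LinearMap.BilinForm.baseChange ℂ Q x y =
      c * cubicForm (filtrationCoords τ (complexCoords b x))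
        (filtrationCoords τ (complexCoords b y)) := by
  rw [hQ.baseChange, filtrationCoords, filtrationCoords, cubicForm_cubicRep, Matrix.det_fin_two]
  simp

/-- The factor is the cube of the determinant −2i Im τ of the period matrix. -/
theorem baseChange_hodgeBasis (hQ : IsCubicForm b c Q) (hτ : 0 < τ.im) (x y : ℂ ⊗[ℚ] V) :
    LinearMap.BilinForm.baseChange ℂ Q x y = 8 * c * τ.im ^ 3 * Complex.I *
      cubicForm ((hodgeBasis b hτ).equivFun x) ((hodgeBasis b hτ).equivFun y) := by
  rw [hQ.baseChange, complexCoords_eq b hτ, complexCoords_eq b hτ, cubicForm_cubicRep,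
    Matrix.det_fin_two]
  have : periodMatrix τ 0 0 * periodMatrix τ 1 1 - periodMatrix τ 0 1 * periodMatrix τ 1 0 =
      -2 * τ.im * Complex.I := by
    apply Complex.ext
    · simp [periodMatrix]
    · simp [periodMatrix]
      ring
  rw [this, mul_pow, mul_pow, Complex.I_pow_three]
  ring

theorem antisymm (hQ : IsCubicForm b c Q) (x y : V) : Q x y = (-1) ^ 3 * Q y x := by
  rw [hQ, hQ]
  simp only [cubicForm]
  ring

/-- The filtration coordinates arise from a unipotent change, so the form keeps its shape and pairs
only indices i + j = 3; for each such pair one coordinate vanishes. -/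
theorem orthogonal (hQ : IsCubicForm b c Q) (hF : IsCubicFiltration b τ F) {p : ℤ} {x y : ℂ ⊗[ℚ] V}
    (hx : x ∈ F p) (hy : y ∈ F (3 + 1 - p)) : LinearMap.BilinForm.baseChange ℂ Q x y = 0 := by
  rw [hQ.baseChange_filtrationCoords τ]
  rw [hF] at hx hy
  set X := filtrationCoords τ (complexCoords b x)
  set Y := filtrationCoords τ (complexCoords b y)
  have key : ∀ i j : Fin 4, (i : ℤ) + (j : ℤ) = 3 → X i * Y j = 0 := by
    intro i j hij
    by_cases hi : 3 < p + (i : ℤ)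
    · rw [hx i hi, zero_mul]
    · rw [hy j (by omega), mul_zero]
  have e := key 0 3 rfl
  have e1 := key 1 2 rfl
  have e2 := key 2 1 rfl
  have e3 := key 3 0 rfl
  rw [cubicForm]
  linear_combination (c : ℂ) * (e - 3 * e1 + 3 * e2 - e3)

/-- Pairing with the generator of F³ picks out, up to the factor c, the last filtration coordinate,
whose vanishing defines F¹. -/
theorem mem_one_iff (hQ : IsCubicForm b c Q) (hc : c ≠ 0) (hF : IsCubicFiltration b τ F)
    (x : ℂ ⊗[ℚ] V) :
    x ∈ F 1 ↔ ∀ y ∈ F 3, LinearMap.BilinForm.baseChange ℂ Q y x = 0 := by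
  constructor
  · exact fun hx y hy => hQ.orthogonal hF hy hx
  · intro h
    have h0 := h (filtrationBasis b τ 0) (by
      rw [hF.mem_iff_filtrationBasis]
      intro k hk
      rw [Module.Basis.repr_self, Finsupp.single_eq_of_ne]
      rintro rfl
      exact absurd hk (by norm_num))
    rw [hQ.baseChange_filtrationCoords τ, ← filtrationBasis_equivFun] at h0
    have hc' : (c : ℂ) ≠ 0 := by exact_mod_cast hc
    rw [hF]
    intro k hk
    obtain rfl : k = 3 := by
      apply Fin.ext
      have := k.2
      change (k : ℕ) = 3
      omega
    simpa [cubicForm, hc', Finsupp.single_apply] using h0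

/-- The signs of the powers of i alternate like those of the form, so all four Hodge pieces receive
the same factor −8c(Im τ)³, with weights 1, 3, 3, 1. Positivity is thus equivalent to c < 0. -/
theorem positive_hodgeBasis (hQ : IsCubicForm b c Q) (hτ : 0 < τ.im) (k : Fin 4) (a : ℂ) :
    (-1) ^ (3 * (3 - 1) / 2) * Complex.I ^ (3 - (k : ℤ) - (3 - (3 - (k : ℤ)))) *
      LinearMap.BilinForm.baseChange ℂ Q (a • hodgeBasis b hτ k)
        (complexConj V (a • hodgeBasis b hτ k)) =
      ((-c * (8 * τ.im ^ 3) * (![1, 3, 3, 1] k) * Complex.normSq a : ℝ) : ℂ) := by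
  have hI : Complex.I * Complex.I = -1 := Complex.I_mul_I
  have h3 : (Complex.I : ℂ) ^ (3 : ℤ) = -Complex.I := by
    rw [show (3 : ℤ) = ((3 : ℕ) : ℤ) from rfl, zpow_natCast, Complex.I_pow_three]
  have hm3 : (Complex.I : ℂ) ^ (-3 : ℤ) = Complex.I := by
    rw [zpow_neg, h3, inv_neg, Complex.inv_I, neg_neg]
  have hm1 : (Complex.I : ℂ) ^ (-1 : ℤ) = -Complex.I := by
    rw [zpow_neg_one, Complex.inv_I]
  have ha := Complex.mul_conj a
  rw [hQ.baseChange_hodgeBasis hτ, complexConj_smul, complexConj_hodgeBasis]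
  fin_cases k
  · simp [cubicForm, h3]
    linear_combination (-8 * c * τ.im ^ 3 : ℂ) * (a * (starRingEnd ℂ) a * hI - ha)
  · simp [cubicForm]
    linear_combination (-24 * c * τ.im ^ 3 : ℂ) * (a * (starRingEnd ℂ) a * hI - ha)
  · simp [cubicForm, hm1]
    linear_combination (-24 * c * τ.im ^ 3 : ℂ) * (a * (starRingEnd ℂ) a * hI - ha)
  · simp [cubicForm, hm3]
    linear_combination (-8 * c * τ.im ^ 3 : ℂ) * (a * (starRingEnd ℂ) a * hI - ha)

theorem positive (hQ : IsCubicForm b c Q) (hc : c < 0) (hF : IsCubicFiltration b τ F)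
    (hτ : 0 < τ.im) {p : ℤ} {x : ℂ ⊗[ℚ] V} (hx : x ∈ hodgePiece 3 F p) (hx0 : x ≠ 0) :
    ∃ r : ℝ, 0 < r ∧ (-1) ^ (3 * (3 - 1) / 2) * Complex.I ^ (p - (3 - p)) *
      LinearMap.BilinForm.baseChange ℂ Q x (complexConj V x) = (r : ℂ) := by
  by_cases hp : p < 0 ∨ 3 < p
  · rw [hF.hodgePiece_eq_bot hτ hp] at hx
    exact absurd hx hx0
  obtain ⟨k, rfl⟩ : ∃ k : Fin 4, p = 3 - (k : ℤ) :=
    ⟨⟨(3 - p).toNat, by omega⟩, by simp; omega⟩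
  rw [hF.hodgePiece_eq_span hτ] at hx
  obtain ⟨a, rfl⟩ := Submodule.mem_span_singleton.1 hx
  refine ⟨_, ?_, hQ.positive_hodgeBasis hτ k a⟩
  have ha : 0 < Complex.normSq a := Complex.normSq_pos.2 fun h => hx0 (by rw [h, zero_smul])
  have hc' : (0 : ℝ) < -c := by exact_mod_cast neg_pos.2 hc
  have hk : (0 : ℝ) < ![1, 3, 3, 1] k := by fin_cases k <;> norm_num
  positivity

end IsCubicForm

end InvariantForm

namespace VHSData

variable {M : Set ℂ} {W : VHSData M}

/-- There are frames near every point for which the filtration is induced on binary cubics by a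
nonconstant line. -/
def HasCubicFrames (W : VHSData M) : Prop :=
  ∀ m₀ : M, ∃ (U : Set M) (e : ∀ m : M, m ∈ U → Module.Basis (Fin 4) ℚ (W.Fiber m)) (τ : ℂ → ℂ),
    m₀ ∈ U ∧ W.IsCubicFrame U e τ

namespace HasCubicFrames

theorem exists_isCubicFiltration (h : W.HasCubicFrames) (m : M) :
    ∃ (b : Module.Basis (Fin 4) ℚ (W.Fiber m)) (τ : ℂ), 0 < τ.im ∧
      IsCubicFiltration b τ (W.F m) := by
  obtain ⟨U, e, τ, hm, he⟩ := h m
  exact ⟨e m hm, τ m, he.im_pos m hm, he.isCubicFiltration m hm⟩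

theorem isVHS (h : W.HasCubicFrames) (hM : IsOpen M) (hW : W.FlatRestricts) (hw : W.weight = 3) :
    W.IsVHS where
  isLocalSystem m₀ := by
    obtain ⟨U, e, τ, hm, he⟩ := h m₀
    exact ⟨U, he.isOpen, hm, 4, e, he.isFlatFrame⟩
  isHodgeStructure m := by
    obtain ⟨b, τ, hτ, hF⟩ := h.exists_isCubicFiltration m
    rw [hw]
    exact hF.isHodgeStructure hτ
  holomorphic p m₀ := by
    obtain ⟨U, e, τ, hm, he⟩ := h m₀
    exact ⟨U, he.isOpen, hm, he.exists_holomorphic p⟩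
  transversal p U s s' hU hs hsF m hm := by
    obtain ⟨U', e, τ, hm', he⟩ := h m
    exact he.transversal hM hW hU hs hsF hm hm'

theorem isPolarization (hW : W.FlatRestricts) (hw : W.weight = 3)
    {Q : ∀ m, LinearMap.BilinForm ℚ (W.Fiber m)} {c : ℚ} (hc : c < 0)
    (hQ : ∀ m₀ : M, ∃ (U : Set M) (e : ∀ m : M, m ∈ U → Module.Basis (Fin 4) ℚ (W.Fiber m))
      (τ : ℂ → ℂ), m₀ ∈ U ∧ W.IsCubicFrame U e τ ∧ ∀ m hm, IsCubicForm (e m hm) c (Q m)) :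
    W.IsPolarization Q where
  flat U a b hU ha hb m hm := by
    obtain ⟨U', e, τ, hm', he, hQe⟩ := hQ m
    filter_upwards [he.isFlatFrame.eventually_eq he.isOpen hW hU ha hm' hm,
      he.isFlatFrame.eventually_eq he.isOpen hW hU hb hm' hm, he.isOpen.mem_nhds hm'] with
      m' h1 h2 h3
    rw [hQe m' h3, hQe m hm', h1 h3, h2 h3]
  parity m x y := by
    obtain ⟨U', e, τ, hm', he, hQe⟩ := hQ m
    rw [hw]
    exact (hQe m hm').antisymm x y
  orthogonal m p x hx y hy := by
    obtain ⟨U', e, τ, hm', he, hQe⟩ := hQ m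
    rw [hw] at hy
    exact (hQe m hm').orthogonal (he.isCubicFiltration m hm') hx hy
  positive m p x hx hx0 := by
    obtain ⟨U', e, τ, hm', he, hQe⟩ := hQ m
    rw [hw] at hx ⊢
    exact (hQe m hm').positive hc (he.isCubicFiltration m hm') (he.im_pos m hm') hx hx0

/-- The generator (1, τ, τ², τ³) of F³ has derivative τ'(0, 1, 2τ, 3τ²), and τ' ≠ 0. The other
inclusion is transversality. -/
theorem F_two_eq (h : W.HasCubicFrames) (hM : IsOpen M) (hW : W.FlatRestricts) (m : M) :
    W.F m 2 = Submodule.span ℂ {x | ∃ (U : Set M) (s s' : ∀ m, ℂ ⊗[ℚ] W.Fiber m),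
      IsOpen U ∧ m ∈ U ∧ W.HasCovariantDeriv U s s' ∧ (∀ m' ∈ U, s m' ∈ W.F m' 3) ∧
        (x = s m ∨ x = s' m)} := by
  obtain ⟨U, e, τ, hm, he⟩ := h m
  have hF := he.isCubicFiltration m hm
  have hmem : ∀ (m' : M) (hm' : m' ∈ U),
      frameSection e (cubicFrameCoords τ 0) m' ∈ W.F m' 3 := fun m' hm' => by
    rw [IsCubicFrame.frameSection_eq m' hm', (he.isCubicFiltration m' hm').eq_span]
    exact Submodule.subset_span ⟨0, by simp, rfl⟩
  refine le_antisymm ?_ (Submodule.span_le.2 ?_)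
  · rw [hF.eq_span, Submodule.span_le]
    rintro _ ⟨k, hk, rfl⟩
    have hk1 : k = 0 ∨ k = 1 := by
      have hk : (2 : ℤ) + ((k : ℕ) : ℤ) ≤ 3 := hk
      rcases (show (k : ℕ) = 0 ∨ (k : ℕ) = 1 by omega) with h | h
      · exact Or.inl (Fin.ext h)
      · exact Or.inr (Fin.ext h)
    rcases hk1 with rfl | rfl
    · exact Submodule.subset_span ⟨U, _, _, he.isOpen, hm, he.hasCovariantDeriv 0, hmem,
        Or.inl (IsCubicFrame.frameSection_eq m hm 0).symm⟩
    · have hd := he.deriv_ne_zero m hm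
      have hτ := (he.differentiableAt m hm).hasDerivAt
      have key : frameSection e (fun i => deriv (cubicFrameCoords τ 0 i)) m =
          deriv τ m • filtrationBasis (e m hm) (τ m) 1 := by
        refine (complexCoords (e m hm)).injective ?_
        rw [complexCoords_frameSection e _ hm, map_smul, complexCoords_filtrationBasis]
        ext i
        change deriv (fun z => cubicRep !![1, 0; τ z, 1] i 0) (m : ℂ) = _
        fin_cases i
        · simp [cubicRep]
        · simp [cubicRep]
        · change deriv (fun z => 1 * τ z ^ 2) (m : ℂ) = _
          simp only [one_mul]
          refine (hτ.fun_pow 2).deriv.trans ?_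
          simp [cubicRep]
          ring
        · change deriv (fun z => τ z ^ 3) (m : ℂ) = _
          refine (hτ.fun_pow 3).deriv.trans ?_
          simp [cubicRep]
          ring
      have : filtrationBasis (e m hm) (τ m) 1 =
          (deriv τ m)⁻¹ • frameSection e (fun i => deriv (cubicFrameCoords τ 0 i)) m := by
        rw [key, inv_smul_smul₀ hd]
      rw [this]
      exact Submodule.smul_mem _ _ (Submodule.subset_span ⟨U, _, _, he.isOpen, hm,
        he.hasCovariantDeriv 0, hmem, Or.inr rfl⟩)
  · rintro x ⟨U₁, s, s', hU₁, hm₁, hs, hsF, rfl | rfl⟩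
    · have := hsF m hm₁
      rw [hF] at this
      change s m ∈ W.F m 2
      rw [hF]
      exact fun k hk => this k (by omega)
    · exact he.transversal hM hW hU₁ hs hsF hm₁ hm

theorem isCalabiYauLike (h : W.HasCubicFrames) (hM : IsOpen M) (hW : W.FlatRestricts)
    (hw : W.weight = 3) {Q : ∀ m, LinearMap.BilinForm ℚ (W.Fiber m)} {c : ℚ} (hc : c < 0)
    (hQ : ∀ m₀ : M, ∃ (U : Set M) (e : ∀ m : M, m ∈ U → Module.Basis (Fin 4) ℚ (W.Fiber m))
      (τ : ℂ → ℂ), m₀ ∈ U ∧ W.IsCubicFrame U e τ ∧ ∀ m hm, IsCubicForm (e m hm) c (Q m)) :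
    W.IsCalabiYauLike := by
  refine ⟨hw, h.isVHS hM hW hw, fun m => ?_, h.F_two_eq hM hW, Q,
    isPolarization hW hw hc hQ, fun m x => ?_⟩
  · obtain ⟨b, τ, hτ, hF⟩ := h.exists_isCubicFiltration m
    constructor
    · rw [eq_top_iff]
      intro x _
      rw [hF]
      exact fun k hk => absurd hk (by omega)
    · rw [hF.eq_span, Submodule.span_eq_bot]
      rintro _ ⟨k, hk, rfl⟩
      exact absurd (show (4 : ℤ) + ((k : ℕ) : ℤ) ≤ 3 from hk) (by omega)
  · obtain ⟨U', e, τ, hm', he, hQe⟩ := hQ m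
    exact (hQe m hm').mem_one_iff hc.ne (he.isCubicFiltration m hm') x

theorem finrank_hodgePiece (h : W.HasCubicFrames) (m : M) {p : ℤ} (hp : p ∈ Finset.Icc (0 : ℤ) 3) :
    Module.finrank ℂ (hodgePiece 3 (W.F m) p) = 1 := by
  obtain ⟨b, τ, hτ, hF⟩ := h.exists_isCubicFiltration m
  rw [Finset.mem_Icc] at hp
  obtain ⟨k, rfl⟩ : ∃ k : Fin 4, p = 3 - (k : ℤ) :=
    ⟨⟨(3 - p).toNat, by omega⟩, by simp; omega⟩
  rw [hF.hodgePiece_eq_span hτ]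
  exact finrank_span_singleton ((hodgeBasis b hτ).ne_zero k)

end HasCubicFrames

namespace EllipticStructure

variable (S : W.EllipticStructure)

theorem form_eq {m : M} (e : Module.Basis (Fin 2) ℚ (W.Fiber m)) (x y : W.Fiber m) :
    S.form m x y = (e.repr x 0 * e.repr y 1 - e.repr x 1 * e.repr y 0) * S.form m (e 0) (e 1) := by
  have hanti : S.form m (e 1) (e 0) = -S.form m (e 0) (e 1) := by
    have := S.form_self m (e 0 + e 1)
    simp only [map_add, LinearMap.add_apply, S.form_self] at this
    linear_combination this
  conv_lhs => rw [← e.sum_repr x, ← e.sum_repr y]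
  simp only [Fin.sum_univ_two, map_add, map_smul, LinearMap.add_apply, LinearMap.smul_apply,
    S.form_self, hanti, smul_eq_mul]
  ring

theorem det_toMatrix {m : M} {e e' : Module.Basis (Fin 2) ℚ (W.Fiber m)}
    (he : S.form m (e 0) (e 1) = 1) (he' : S.form m (e' 0) (e' 1) = 1) :
    (e'.toMatrix e).det = 1 := by
  have := S.form_eq e' (e 0) (e 1)
  rw [he, he', mul_one] at this
  rw [Matrix.det_fin_two]
  simp only [Module.Basis.toMatrix_apply]
  linear_combination -this

/-- A symplectic basis of a stalk. -/
theorem exists_basis (m : M) : ∃ e : Module.Basis (Fin 2) ℚ (W.Fiber m),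
    S.form m (e 0) (e 1) = 1 := by
  obtain ⟨U, _, hm, e, τ, h, _⟩ := S.exists_frame m
  exact ⟨e m hm, (h m hm).1⟩

/-- The polarization of the third symmetric power. -/
def symForm (m : M) : LinearMap.BilinForm ℚ ((symPower 3 W).Fiber m) :=
  cubicBilin (V := symTensors 3 (W.Fiber m)) (symBasis (S.exists_basis m).choose) (-1)

/-- Symplectic bases differ by determinant one, so the basis chosen in `symForm` is irrelevant. -/
theorem isCubicForm_symForm {m : M} {e : Module.Basis (Fin 2) ℚ (W.Fiber m)}
    (he : S.form m (e 0) (e 1) = 1) :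
    IsCubicForm (V := symTensors 3 (W.Fiber m)) (symBasis e) (-1) (S.symForm m) :=
  (isCubicForm_cubicBilin (V := symTensors 3 (W.Fiber m)) _ _).of_repr_eq
    (symBasis_repr_change e (S.exists_basis m).choose)
    (S.det_toMatrix he (S.exists_basis m).choose_spec)

theorem flatRestricts (S : W.EllipticStructure) : W.FlatRestricts := fun h hs => S.isFlat_mono h hs

theorem exists_isCubicFrame (m₀ : M) : ∃ (U : Set M)
    (e : ∀ m, m ∈ U → Module.Basis (Fin 2) ℚ (W.Fiber m)) (τ : ℂ → ℂ), m₀ ∈ U ∧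
      W.IsFlatFrame U e ∧ (symPower 3 W).IsCubicFrame U (symFrame e) τ ∧
      ∀ m hm, S.form m (e m hm 0) (e m hm 1) = 1 ∧
        W.F m 1 = Submodule.span ℂ {(1 : ℂ) ⊗ₜ[ℚ] e m hm 0 + τ m ⊗ₜ[ℚ] e m hm 1} := by
  obtain ⟨U, hU, hm₀, e, τ, h, he⟩ := S.exists_frame m₀
  exact ⟨U, e, τ, hm₀, he, ⟨hU, he.symPower hU S.flatRestricts, fun m hm => (h m hm).2.1,
    fun m hm => (h m hm).2.2.1, fun m hm => (h m hm).2.2.2.1, fun m hm =>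
      isCubicFiltration_symPower (e m hm) (h m hm).2.2.2.2 (S.F_nonpos m) (S.F_two_le m)⟩,
    fun m hm => ⟨(h m hm).1, (h m hm).2.2.2.2⟩⟩

include S in
theorem hasCubicFrames : (symPower 3 W).HasCubicFrames := by
  intro m₀
  obtain ⟨U, e, τ, hm₀, -, he, -⟩ := S.exists_isCubicFrame m₀
  exact ⟨U, symFrame e, τ, hm₀, he⟩

include S in
theorem weight_symPower : (symPower 3 W).weight = 3 := by
  change 3 * W.weight = 3
  rw [S.weight_eq]

include S in
theorem isCalabiYauLike (hM : IsOpen M) : (symPower 3 W).IsCalabiYauLike := by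
  refine S.hasCubicFrames.isCalabiYauLike hM flatRestricts_symPower S.weight_symPower
    (Q := S.symForm) (c := -1) (by norm_num) fun m₀ => ?_
  obtain ⟨U, e, τ, hm₀, -, he, h⟩ := S.exists_isCubicFrame m₀
  exact ⟨U, symFrame e, τ, hm₀, he, fun m hm => S.isCubicForm_symForm (h m hm).1⟩

end EllipticStructure

end VHSData

end

/-! ### Transport along frames, a fibre with maximal Hodge group, and the uniqueness of
polarizations. -/

noncomputable section

section Transfer

variable {V V' : Type} [AddCommGroup V] [Module ℚ V] [AddCommGroup V'] [Module ℚ V']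

theorem complexCoords_baseChange {ι : Type} [Fintype ι] [DecidableEq ι] {b : Module.Basis ι ℚ V}
    {b' : Module.Basis ι ℚ V'} (T : V ≃ₗ[ℚ] V') (hT : ∀ k, T (b k) = b' k) (x : ℂ ⊗[ℚ] V) :
    complexCoords b' (T.baseChange ℚ ℂ _ _ x) = complexCoords b x := by
  have hr : ∀ v, b'.repr (T v) = b.repr v := fun v => by
    have : b'.repr (T v) = (b.map T).repr (T v) := by
      congr 2
      ext k
      simp [hT]
    rw [this]
    simp
  induction x with
  | zero => simp
  | add x y hx hy => rw [map_add, map_add, map_add, hx, hy]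
  | tmul z v =>
    ext i
    rw [LinearEquiv.baseChange_tmul, complexCoords_tmul, complexCoords_tmul, hr]

theorem glMatrix_conj {ι : Type} [Fintype ι] [DecidableEq ι] {b : Module.Basis ι ℚ V}
    {b' : Module.Basis ι ℚ V'} (T : V ≃ₗ[ℚ] V') (hT : ∀ k, T (b k) = b' k) (g : GLC V') :
    glMatrix b (((T.baseChange ℚ ℂ _ _).trans g).trans (T.baseChange ℚ ℂ _ _).symm) =
      glMatrix b' g := by
  ext i k
  have h : ∀ (x : ℂ ⊗[ℚ] V),
      (glMatrix b (((T.baseChange ℚ ℂ _ _).trans g).trans (T.baseChange ℚ ℂ _ _).symm)).mulVec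
        (complexCoords b x) = (glMatrix b' g).mulVec (complexCoords b x) := fun x => by
    rw [← complexCoords_apply, ← complexCoords_baseChange T hT, ← complexCoords_baseChange T hT x,
      ← complexCoords_apply]
    simp
  have h1 := congrFun (h ((complexCoords b).symm (Pi.single k 1))) i
  rwa [LinearEquiv.apply_symm_apply, Matrix.mulVec_single_one, Matrix.mulVec_single_one] at h1

theorem conj_mem_cubicGroup_iff {b : Module.Basis (Fin 4) ℚ V} {b' : Module.Basis (Fin 4) ℚ V'}
    (T : V ≃ₗ[ℚ] V') (hT : ∀ k, T (b k) = b' k) (g : GLC V') :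
    ((T.baseChange ℚ ℂ _ _).trans g).trans (T.baseChange ℚ ℂ _ _).symm ∈ cubicGroup b ↔
      g ∈ cubicGroup b' := by
  rw [mem_cubicGroup_iff, mem_cubicGroup_iff, glMatrix_conj T hT]

theorem baseChange_eq_sum {ι : Type} [Fintype ι] [DecidableEq ι] (b : Module.Basis ι ℚ V)
    (Q : LinearMap.BilinForm ℚ V) (x y : ℂ ⊗[ℚ] V) :
    LinearMap.BilinForm.baseChange ℂ Q x y =
      ∑ i, ∑ j, (Q (b i) (b j) : ℂ) * complexCoords b x i * complexCoords b y j := by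
  conv_lhs => rw [← (complexBasis b).sum_repr x, ← (complexBasis b).sum_repr y]
  simp only [map_sum, LinearMap.sum_apply, map_smul, LinearMap.smul_apply, Finset.smul_sum]
  rw [Finset.sum_comm]
  refine Finset.sum_congr rfl fun i _ => ?_
  refine Finset.sum_congr rfl fun j _ => ?_
  have : ∀ k, complexBasis b k = (1 : ℂ) ⊗ₜ[ℚ] b k := fun k => by simp [complexBasis]
  rw [this, this, LinearMap.BilinForm.baseChange_tmul]
  simp only [smul_eq_mul, Rat.smul_def, mul_one]
  change (complexBasis b).repr y j * ((complexBasis b).repr x i * _) =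
    _ * (complexBasis b).repr x i * (complexBasis b).repr y j
  ring

end Transfer

open Polynomial in
theorem coeffs_eq_zero_of_eventually {a b c d e f z₀ : ℂ}
    (h : ∀ᶠ z in 𝓝 z₀, a + b * z + c * z ^ 2 + d * z ^ 3 + e * z ^ 4 + f * z ^ 5 = 0) :
    a = 0 ∧ b = 0 ∧ c = 0 ∧ d = 0 ∧ e = 0 ∧ f = 0 := by
  have hp : C a + C b * X + C c * X ^ 2 + C d * X ^ 3 + C e * X ^ 4 + C f * X ^ 5 =
      (0 : ℂ[X]) := by
    refine Polynomial.eq_zero_of_infinite_isRoot _ ((infinite_of_mem_nhds z₀ h).mono fun z hz => ?_)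
    simpa using hz
  have hc := fun n => congrArg (fun p : ℂ[X] => p.coeff n) hp
  refine ⟨?_, ?_, ?_, ?_, ?_, ?_⟩
  · simpa [coeff_X, coeff_C, coeff_X_pow] using hc 0
  · simpa [coeff_X, coeff_C, coeff_X_pow] using hc 1
  · simpa [coeff_X, coeff_C, coeff_X_pow] using hc 2
  · simpa [coeff_X, coeff_C, coeff_X_pow] using hc 3
  · simpa [coeff_X, coeff_C, coeff_X_pow] using hc 4
  · simpa [coeff_X, coeff_C, coeff_X_pow] using hc 5

namespace VHSData

variable {M : Set ℂ} {W : VHSData M}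

namespace IsCubicFrame

variable {U : Set M} {e : ∀ m : M, m ∈ U → Module.Basis (Fin 4) ℚ (W.Fiber m)} {τ : ℂ → ℂ}

theorem map_nhds_eq (h : W.IsCubicFrame U e τ) (hM : IsOpen M) {m₀ : M} (hm₀ : m₀ ∈ U) :
    Filter.map (fun m : M => τ m) (𝓝 m₀) = 𝓝 (τ m₀) := by
  have hO : IsOpen (Subtype.val '' U) := hM.isOpenEmbedding_subtypeVal.isOpenMap U h.isOpen
  have hd : DifferentiableOn ℂ τ (Subtype.val '' U) := by
    rintro _ ⟨m, hm, rfl⟩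
    exact (h.differentiableAt m hm).differentiableWithinAt
  have ha := hd.analyticAt (hO.mem_nhds ⟨m₀, hm₀, rfl⟩)
  rw [← ha.hasStrictDerivAt.map_nhds_eq (h.deriv_ne_zero m₀ hm₀),
    ← hM.isOpenEmbedding_subtypeVal.map_nhds_eq m₀, Filter.map_map]
  rfl

/-- The translation along the frame is a parallel transport. -/
theorem isTransport (h : W.IsCubicFrame U e τ) {m₀ m : M} (hm₀ : m₀ ∈ U) (hm : m ∈ U)
    (γ : Path m₀ m) (hγ : ∀ t, γ t ∈ U) :
    W.IsTransport γ ((e m₀ hm₀).equiv (e m hm) (Equiv.refl _)) := by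
  intro v
  refine ⟨fun t => ⟨γ t, constSection e ((e m₀ hm₀).equivFun v) (γ t)⟩, ?_, ?_, fun t₀ =>
    ⟨U, constSection e ((e m₀ hm₀).equivFun v), h.isOpen, hγ t₀,
      h.isFlatFrame.isFlat_constSection h.isOpen subset_rfl _, Filter.Eventually.of_forall
        fun _ => rfl⟩⟩
  · change (fun m => (⟨m, constSection e ((e m₀ hm₀).equivFun v) m⟩ : Σ m, W.Fiber m)) (γ 0) = _
    rw [γ.source]
    change (⟨m₀, _⟩ : Σ m, W.Fiber m) = _
    rw [constSection_of_mem e _ hm₀, LinearEquiv.symm_apply_apply]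
  · change (fun m => (⟨m, constSection e ((e m₀ hm₀).equivFun v) m⟩ : Σ m, W.Fiber m)) (γ 1) = _
    rw [γ.target]
    change (⟨m, _⟩ : Σ m, W.Fiber m) = _
    rw [constSection_of_mem e _ hm]
    congr 1
    refine (e m hm).ext_elem fun i => ?_
    simp [Module.Basis.equiv]

/-- Because τ' ≠ 0, τ maps a small disc onto a neighbourhood of its central value, which contains a
number with algebraically independent real and imaginary parts. Inside the disc the frame
transports. -/
theorem exists_transport (h : W.IsCubicFrame U e τ) (hM : IsOpen M) {m₀ : M} (hm₀ : m₀ ∈ U) :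
    ∃ (m : M) (hm : m ∈ U) (γ : Path m₀ m),
      W.IsTransport γ ((e m₀ hm₀).equiv (e m hm) (Equiv.refl _)) ∧
      hodgeGroup 3 (W.F m) = cubicGroup (e m hm) := by
  have hO : IsOpen (Subtype.val '' U) := hM.isOpenEmbedding_subtypeVal.isOpenMap U h.isOpen
  obtain ⟨ε, hε, hball⟩ := Metric.isOpen_iff.1 hO m₀ ⟨m₀, hm₀, rfl⟩
  have hN : {m : M | (m : ℂ) ∈ Metric.ball (m₀ : ℂ) ε} ∈ 𝓝 m₀ :=
    continuous_subtype_val.continuousAt.preimage_mem_nhds (Metric.ball_mem_nhds _ hε)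
  have hI : (fun m : M => τ m) '' {m : M | (m : ℂ) ∈ Metric.ball (m₀ : ℂ) ε} ∈ 𝓝 (τ m₀) := by
    rw [← h.map_nhds_eq hM hm₀]
    exact Filter.image_mem_map hN
  obtain ⟨O, hOsub, hOo, hτO⟩ := mem_nhds_iff.1 hI
  obtain ⟨_, hzO, hai⟩ := exists_algebraicIndependent_re_im hOo ⟨_, hτO⟩
  obtain ⟨m, hm, rfl⟩ := hOsub hzO
  obtain ⟨⟨δ, hδ0, hδ1⟩, hδ⟩ := ((convex_ball (m₀ : ℂ) ε).isPathConnected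
    ⟨_, Metric.mem_ball_self hε⟩).joinedIn _ (Metric.mem_ball_self hε) _ hm
  have hδU : ∀ t, δ t ∈ Subtype.val '' U := fun t => hball (hδ t)
  have hδM : ∀ t, δ t ∈ M := fun t => by
    obtain ⟨x, _, hx⟩ := hδU t
    exact hx ▸ x.2
  let γ : Path m₀ m :=
    ⟨⟨fun t => ⟨δ t, hδM t⟩, δ.continuous.subtype_mk _⟩, Subtype.ext hδ0, Subtype.ext hδ1⟩
  have hγ : ∀ t, γ t ∈ U := fun t => by
    obtain ⟨x, hx, hxt⟩ := hδU t
    exact (Subtype.ext hxt : x = γ t) ▸ hx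
  have hmU : m ∈ U := by
    have := hγ 1
    rwa [γ.target] at this
  exact ⟨m, hmU, γ, h.isTransport hm₀ hmU γ hγ,
    (h.isCubicFiltration m hmU).hodgeGroup_eq (h.im_pos m hmU) hai⟩

/-- Flatness makes the Gram matrix constant near the point. The bilinear relation between the cube
of (1, τ) and the next filtration vector is then a polynomial of degree four in τ that vanishes on
an open set; its coefficients leave only multiples of the invariant form. -/
theorem exists_isCubicForm (h : W.IsCubicFrame U e τ) (hM : IsOpen M) (hw : W.weight = 3)
    {Q : ∀ m, LinearMap.BilinForm ℚ (W.Fiber m)} (hQ : W.IsPolarization Q) {m₀ : M}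
    (hm₀ : m₀ ∈ U) : ∃ c : ℚ, IsCubicForm (e m₀ hm₀) c (Q m₀) := by
  have hconst : ∀ᶠ m in 𝓝 m₀, ∀ i j : Fin 4, ∀ hm : m ∈ U,
      Q m (e m hm i) (e m hm j) = Q m₀ (e m₀ hm₀ i) (e m₀ hm₀ j) := by
    refine Filter.eventually_all.2 fun i => Filter.eventually_all.2 fun j => ?_
    have hflat := fun i : Fin 4 =>
      h.isFlatFrame.isFlat_constSection h.isOpen subset_rfl (Pi.single i 1)
    refine (hQ.flat U _ _ h.isOpen (hflat i) (hflat j) m₀ hm₀).mono fun m hm hmU => ?_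
    rwa [constSection_single e i 1 hmU, constSection_single e j 1 hmU,
      constSection_single e i 1 hm₀, constSection_single e j 1 hm₀, one_smul, one_smul, one_smul,
      one_smul] at hm
  set q : Fin 4 → Fin 4 → ℚ := fun i j => Q m₀ (e m₀ hm₀ i) (e m₀ hm₀ j) with hq
  have hanti : ∀ i j, q i j = -q j i := fun i j => by
    have := hQ.parity m₀ (e m₀ hm₀ i) (e m₀ hm₀ j)
    rw [hw] at this
    simp only [hq]
    linear_combination this
  have hdiag : ∀ i, q i i = 0 := fun i => by linarith [hanti i i]
  have hpoly : ∀ᶠ z in 𝓝 (τ m₀), (q 0 1 : ℂ) + 2 * q 0 2 * z + (3 * q 0 3 + q 1 2) * z ^ 2 +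
      2 * q 1 3 * z ^ 3 + q 2 3 * z ^ 4 + 0 * z ^ 5 = 0 := by
    rw [← h.map_nhds_eq hM hm₀, Filter.eventually_map]
    filter_upwards [hconst, h.isOpen.mem_nhds hm₀] with m hc hm
    have hF := h.isCubicFiltration m hm
    have h0 : filtrationBasis (e m hm) (τ m) 0 ∈ W.F m 3 := by
      rw [hF.eq_span]
      exact Submodule.subset_span ⟨0, by simp, rfl⟩
    have h1 : filtrationBasis (e m hm) (τ m) 1 ∈ W.F m (W.weight + 1 - 3) := by
      rw [hw, hF.eq_span]
      exact Submodule.subset_span ⟨1, by simp, rfl⟩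
    have := hQ.orthogonal m 3 _ h0 _ h1
    rw [baseChange_eq_sum (e m hm), complexCoords_filtrationBasis,
      complexCoords_filtrationBasis] at this
    simp only [hc _ _ hm] at this
    change ∑ i, ∑ j, (q i j : ℂ) * _ * _ = 0 at this
    simp only [Fin.sum_univ_four, hdiag, hanti 1 0, hanti 2 0, hanti 2 1, hanti 3 0, hanti 3 1,
      hanti 3 2] at this
    simp [cubicRep] at this
    linear_combination this
  obtain ⟨h0, h1, h2, h3, h4, -⟩ := coeffs_eq_zero_of_eventually hpoly
  have e01 : q 0 1 = 0 := by exact_mod_cast h0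
  have e02 : q 0 2 = 0 := by
    have : 2 * q 0 2 = 0 := by exact_mod_cast h1
    linarith
  have e12 : q 1 2 = -3 * q 0 3 := by
    have : 3 * q 0 3 + q 1 2 = 0 := by exact_mod_cast h2
    linarith
  have e13 : q 1 3 = 0 := by
    have : 2 * q 1 3 = 0 := by exact_mod_cast h3
    linarith
  have e23 : q 2 3 = 0 := by exact_mod_cast h4
  refine ⟨q 0 3, fun x y => ?_⟩
  conv_lhs => rw [← (e m₀ hm₀).sum_repr x, ← (e m₀ hm₀).sum_repr y]
  simp only [map_sum, LinearMap.sum_apply, map_smul, LinearMap.smul_apply, smul_eq_mul]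
  change ∑ j, _ * ∑ i, _ * q i j = _
  simp only [Fin.sum_univ_four, hdiag, hanti 1 0, hanti 2 0, hanti 2 1, hanti 3 0, hanti 3 1,
    hanti 3 2, e01, e02, e12, e13, e23, cubicForm]
  ring

end IsCubicFrame

end VHSData

end

/-! ### The generic Hodge group at every base point. -/

noncomputable section

namespace VHSData

variable {M : Set ℂ} {W : VHSData M}

namespace EllipticStructure

variable (S : W.EllipticStructure)

/-- A change of symplectic basis acts on the period by a Möbius transformation of determinant one,
which preserves the upper half plane. -/
theorem exists_period {m : M} (b : Module.Basis (Fin 2) ℚ (W.Fiber m))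
    (hb : S.form m (b 0) (b 1) = 1) :
    ∃ τ : ℂ, 0 < τ.im ∧ W.F m 1 = Submodule.span ℂ {(1 : ℂ) ⊗ₜ[ℚ] b 0 + τ ⊗ₜ[ℚ] b 1} := by
  obtain ⟨U, _, hm, e, τ, h, -⟩ := S.exists_frame m
  obtain ⟨he, -, -, hτ, hF⟩ := h m hm
  set p := b.repr (e m hm 0) 0
  set r := b.repr (e m hm 0) 1
  set q := b.repr (e m hm 1) 0
  set s := b.repr (e m hm 1) 1
  have hdet : p * s - r * q = 1 := by
    rw [S.form_eq b, hb, mul_one] at he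
    exact he
  have e0 : e m hm 0 = p • b 0 + r • b 1 := by
    rw [← b.sum_repr (e m hm 0), Fin.sum_univ_two]
  have e1 : e m hm 1 = q • b 0 + s • b 1 := by
    rw [← b.sum_repr (e m hm 1), Fin.sum_univ_two]
  set z := τ m
  have hne : (p : ℂ) + z * q ≠ 0 := by
    intro h0
    have him := congrArg Complex.im h0
    have hre := congrArg Complex.re h0
    simp at him hre
    have hq : q = 0 := by
      rcases him with h | h
      · exact absurd h hτ.ne'
      · exact h
    rw [hq] at hre hdet
    simp at hre
    rw [hre] at hdet
    norm_num at hdet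
  refine ⟨((r : ℂ) + z * s) / (p + z * q), ?_, ?_⟩
  · have hn : 0 < Complex.normSq ((p : ℂ) + z * q) := Complex.normSq_pos.2 hne
    have hdetR : (p : ℝ) * s - r * q = 1 := by exact_mod_cast hdet
    have : (((r : ℂ) + z * s) / (p + z * q)).im = z.im / Complex.normSq ((p : ℂ) + z * q) := by
      rw [Complex.div_im]
      simp
      field_simp
      linear_combination hdetR
    rw [this]
    exact div_pos hτ hn
  · rw [hF, e0, e1]
    have : (1 : ℂ) ⊗ₜ[ℚ] (p • b 0 + r • b 1) + z ⊗ₜ[ℚ] (q • b 0 + s • b 1) =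
        ((p : ℂ) + z * q) • ((1 : ℂ) ⊗ₜ[ℚ] b 0 + (((r : ℂ) + z * s) / (p + z * q)) ⊗ₜ[ℚ] b 1) := by
      rw [smul_add, TensorProduct.smul_tmul', TensorProduct.smul_tmul', smul_eq_mul, smul_eq_mul,
        mul_one, mul_div_cancel₀ _ hne]
      simp only [TensorProduct.tmul_add, TensorProduct.tmul_smul, TensorProduct.add_tmul,
        TensorProduct.smul_tmul', Rat.smul_def, mul_one, mul_comm z]
      abel
    rw [this, Submodule.span_singleton_smul_eq hne.isUnit]

/-- `x` is the family of vectors of the basis of the third symmetric power of the stalk at `m` that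
is given by a symplectic basis. -/
def IsSymplecticFamily (m : M) (x : Fin 4 → Σ m, (symPower 3 W).Fiber m) : Prop :=
  ∃ e : Module.Basis (Fin 2) ℚ (W.Fiber m), S.form m (e 0) (e 1) = 1 ∧
    ∀ k, x k = ⟨m, symBasis e k⟩

theorem isSymplecticFamily_of_repr {m m' : M} {e : Module.Basis (Fin 2) ℚ (W.Fiber m)}
    {e' : Module.Basis (Fin 2) ℚ (W.Fiber m')} (he : S.form m (e 0) (e 1) = 1)
    (he' : S.form m' (e' 0) (e' 1) = 1) {x : Fin 4 → symTensors 3 (W.Fiber m)}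
    {x' : Fin 4 → symTensors 3 (W.Fiber m')}
    (hx : ∀ k, (symBasis e).repr (x k) = (symBasis e').repr (x' k))
    (h : S.IsSymplecticFamily m fun k => ⟨m, x k⟩) :
    S.IsSymplecticFamily m' fun k => ⟨m', x' k⟩ := by
  obtain ⟨b, hb, hxb⟩ := h
  have hxb : ∀ k, x k = symBasis b k := fun k => eq_of_heq (Sigma.mk.inj (hxb k)).2
  refine ⟨b.map (e.equiv e' (Equiv.refl _)), ?_, fun k => ?_⟩
  · have hr : ∀ i, e'.repr (b.map (e.equiv e' (Equiv.refl _)) i) = e.repr (b i) := fun i => by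
      ext j
      simp [Module.Basis.equiv]
    rw [S.form_eq e', hr, hr, he', ← he, ← S.form_eq e, hb]
    exact he.symm
  · have hr : e'.toMatrix (b.map (e.equiv e' (Equiv.refl _))) = e.toMatrix b := by
      ext i j
      simp [Module.Basis.equiv, Module.Basis.toMatrix_apply]
    have : x' k = symBasis (b.map (e.equiv e' (Equiv.refl _))) k := by
      refine (symBasis e').repr.injective (DFunLike.coe_injective ?_)
      rw [← hx, hxb, symBasis_repr_change b e, symBasis_repr_change (b.map _) e', hr,
        Module.Basis.repr_self, Module.Basis.repr_self]
    exact congrArg _ this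

/-- Near any parameter the transported vectors have constant coordinates in a frame coming from
symplectic bases. The set of parameters with the property is therefore clopen in the unit interval.
-/
theorem isSymplecticFamily_transport {m₀ m : M} {γ : Path m₀ m}
    {s : Fin 4 → unitInterval → Σ m, (symPower 3 W).Fiber m}
    (hs : ∀ k, ∀ t₀ : unitInterval, ∃ (U : Set M) (a : ∀ m, (symPower 3 W).Fiber m), IsOpen U ∧
      γ t₀ ∈ U ∧ (symPower 3 W).IsFlat U a ∧ ∀ᶠ t in 𝓝 t₀, s k t = ⟨γ t, a (γ t)⟩)
    (h0 : S.IsSymplecticFamily m₀ fun k => s k 0) : S.IsSymplecticFamily m fun k => s k 1 := by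
  have key : ∀ t₀, ∃ N ∈ 𝓝 t₀, ∀ t ∈ N, ∀ t' ∈ N, S.IsSymplecticFamily (γ t) (fun k => s k t) →
      S.IsSymplecticFamily (γ t') fun k => s k t' := by
    intro t₀
    obtain ⟨U, e, τ, hU, -, he, hform⟩ := S.exists_isCubicFrame (γ t₀)
    choose V a hV htV ha hsa using fun k => hs k t₀
    have h1 : ∀ᶠ t in 𝓝 t₀, ∀ k, ∀ ht : γ t ∈ U, (symBasis (e _ ht)).repr (a k (γ t)) =
        (symBasis (e _ hU)).repr (a k (γ t₀)) :=
      γ.continuous.continuousAt.eventually (Filter.eventually_all.2 fun k =>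
        he.isFlatFrame.eventually_eq he.isOpen flatRestricts_symPower (hV k) (ha k) hU (htV k))
    have h2 : ∀ᶠ t in 𝓝 t₀, γ t ∈ U := γ.continuous.continuousAt.eventually (he.isOpen.mem_nhds hU)
    refine ⟨_, h1.and (h2.and (Filter.eventually_all.2 hsa)), ?_⟩
    rintro t ⟨hr, htU, hst⟩ t' ⟨hr', htU', hst'⟩ h
    simp only [hst] at h
    simp only [hst']
    exact S.isSymplecticFamily_of_repr (hform _ htU).1 (hform _ htU').1
      (fun k => (hr k htU).trans (hr' k htU').symm) h
  have hclopen : IsClopen {t | S.IsSymplecticFamily (γ t) fun k => s k t} := by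
    refine ⟨⟨isOpen_iff_mem_nhds.2 fun t₀ ht₀ => ?_⟩, isOpen_iff_mem_nhds.2 fun t₀ ht₀ => ?_⟩
    · obtain ⟨N, hN, h⟩ := key t₀
      exact Filter.mem_of_superset hN fun t ht hcon => ht₀ (h t ht t₀ (mem_of_mem_nhds hN) hcon)
    · obtain ⟨N, hN, h⟩ := key t₀
      exact Filter.mem_of_superset hN fun t ht => h t₀ (mem_of_mem_nhds hN) t ht ht₀
  have huniv := hclopen.eq_univ ⟨0, show S.IsSymplecticFamily (γ 0) fun k => s k 0 by
    rwa [γ.source]⟩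
  have h1 : S.IsSymplecticFamily (γ 1) fun k => s k 1 := (Set.eq_univ_iff_forall.1 huniv) 1
  rwa [γ.target] at h1

theorem exists_basis_of_isTransport {m₀ m : M} {γ : Path m₀ m}
    {T : (symPower 3 W).Fiber m₀ ≃ₗ[ℚ] (symPower 3 W).Fiber m} (hT : (symPower 3 W).IsTransport γ T)
    {e : Module.Basis (Fin 2) ℚ (W.Fiber m₀)} (he : S.form m₀ (e 0) (e 1) = 1) :
    ∃ e' : Module.Basis (Fin 2) ℚ (W.Fiber m), S.form m (e' 0) (e' 1) = 1 ∧
      ∀ k, T (symBasis e k) = symBasis e' k := by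
  choose s h0 h1 hs using fun k => hT (symBasis e k)
  obtain ⟨e', he', h⟩ := S.isSymplecticFamily_transport hs ⟨e, he, h0⟩
  exact ⟨e', he', fun k => eq_of_heq (Sigma.mk.inj ((h1 k).symm.trans (h k))).2⟩

-- Along any path a symplectic basis stays of that kind, so each transported Hodge group lies in the
-- same `cubicGroup`. A nearby generic fibre attains it, and a maximum is unique.
include S in
theorem isGenericHodgeGroup_iff (hM : IsOpen M) (m₀ : M) :
    ∃ (b : Module.Basis (Fin 4) ℚ ((symPower 3 W).Fiber m₀)) (τ : ℂ), 0 < τ.im ∧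
      IsCubicFiltration b τ ((symPower 3 W).F m₀) ∧
      (∀ G, (symPower 3 W).IsGenericHodgeGroup m₀ G ↔ G = cubicGroup b) ∧
      ∀ Q : (∀ m, LinearMap.BilinForm ℚ ((symPower 3 W).Fiber m)), (symPower 3 W).IsPolarization Q →
        ∃ c : ℚ, IsCubicForm b c (Q m₀) := by
  obtain ⟨U, e, τ, hm₀, -, he, hform⟩ := S.exists_isCubicFrame m₀
  refine ⟨symFrame e m₀ hm₀, τ m₀, he.im_pos m₀ hm₀, he.isCubicFiltration m₀ hm₀, fun G => ?_,
    fun Q hQ => he.exists_isCubicForm hM S.weight_symPower hQ hm₀⟩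
  have hle : ∀ (m : M) (γ : Path m₀ m) (T : (symPower 3 W).Fiber m₀ ≃ₗ[ℚ] (symPower 3 W).Fiber m),
      (symPower 3 W).IsTransport γ T → ∀ g ∈ hodgeGroup (symPower 3 W).weight ((symPower 3 W).F m),
        ((T.baseChange ℚ ℂ _ _).trans g).trans (T.baseChange ℚ ℂ _ _).symm ∈
          cubicGroup (symFrame e m₀ hm₀) := by
    intro m γ T hT g hg
    obtain ⟨e', he', hTe⟩ := S.exists_basis_of_isTransport hT (hform m₀ hm₀).1
    obtain ⟨τ', hτ', hF⟩ := S.exists_period e' he'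
    rw [S.weight_symPower] at hg
    exact (conj_mem_cubicGroup_iff T hTe g).2 ((isCubicFiltration_symPower e' hF (S.F_nonpos m)
      (S.F_two_le m)).hodgeGroup_le hτ' hg)
  obtain ⟨m, hm, γ, hT, hG⟩ := he.exists_transport hM hm₀
  have hTe : ∀ k, (symFrame e m₀ hm₀).equiv (symFrame e m hm) (Equiv.refl _)
      (symFrame e m₀ hm₀ k) = symFrame e m hm k := fun k => by simp
  have hiff : ∀ g, g ∈ hodgeGroup (symPower 3 W).weight ((symPower 3 W).F m) ↔
      ((((symFrame e m₀ hm₀).equiv (symFrame e m hm) (Equiv.refl _)).baseChange ℚ ℂ _ _).trans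
        g).trans (((symFrame e m₀ hm₀).equiv (symFrame e m hm) (Equiv.refl _)).baseChange
          ℚ ℂ _ _).symm ∈ cubicGroup (symFrame e m₀ hm₀) := fun g => by
    rw [conj_mem_cubicGroup_iff _ hTe g, S.weight_symPower, hG]
  constructor
  · rintro ⟨hG1, m', γ', T', hT', hG2⟩
    have hsurj : ∀ {m : M} (T : (symPower 3 W).Fiber m₀ ≃ₗ[ℚ] (symPower 3 W).Fiber m)
        (g : GLC ((symPower 3 W).Fiber m₀)), ∃ g',
          ((T.baseChange ℚ ℂ _ _).trans g').trans (T.baseChange ℚ ℂ _ _).symm = g := fun T g =>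
      ⟨((T.baseChange ℚ ℂ _ _).symm.trans g).trans (T.baseChange ℚ ℂ _ _),
        LinearEquiv.ext fun x => by simp⟩
    ext g
    constructor
    · intro hg
      obtain ⟨g', rfl⟩ := hsurj T' g
      exact hle m' γ' T' hT' g' ((hG2 g').2 hg)
    · intro hg
      obtain ⟨g', rfl⟩ := hsurj ((symFrame e m₀ hm₀).equiv (symFrame e m hm) (Equiv.refl _)) g
      exact hG1 m γ _ hT g' ((hiff g').2 hg)
  · rintro rfl
    exact ⟨hle, m, γ, _, hT, hiff⟩

end EllipticStructure

end VHSData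

end

noncomputable section

/-! ### The Lie algebra of the group of third symmetric powers -/

section MatrixExp

variable {n : Type} [Fintype n] [DecidableEq n] {𝕜 : Type} [RCLike 𝕜]

theorem hasDerivAt_matrix_exp (B : Matrix n n 𝕜) (i j : n) (t : ℝ) :
    HasDerivAt (fun u : ℝ => NormedSpace.exp (u • B) i j) ((B * NormedSpace.exp (t • B)) i j) t := by
  open scoped Matrix.Norms.Operator in
  exact (LinearMap.toContinuousLinearMap (Matrix.entryLinearMap ℝ 𝕜 i j)).hasFDerivAt.comp_hasDerivAt
    t (hasDerivAt_exp_smul_const' (𝕂 := ℝ) B t)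

theorem exp_mul_exp_neg (B : Matrix n n 𝕜) :
    NormedSpace.exp B * NormedSpace.exp (-B) = 1 := by
  rw [← Matrix.exp_add_of_commute _ _ (Commute.refl B).neg_right, add_neg_cancel,
    NormedSpace.exp_zero]

/-- The exponential is characterized by its differential equation. -/
theorem eq_exp_of_hasDerivAt {B : Matrix n n 𝕜} {f : ℝ → Matrix n n 𝕜} (h0 : f 0 = 1)
    (hf : ∀ t i j, HasDerivAt (fun u => f u i j) ((B * f t) i j) t) : f 1 = NormedSpace.exp B := by
  have key : ∀ i j (t : ℝ),
      HasDerivAt (fun u : ℝ => (NormedSpace.exp (u • -B) * f u) i j) 0 t := by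
    intro i j t
    have h : HasDerivAt (fun u : ℝ => ∑ k, NormedSpace.exp (u • -B) i k * f u k j)
        (∑ k, ((-B * NormedSpace.exp (t • -B)) i k * f t k j +
          NormedSpace.exp (t • -B) i k * (B * f t) k j)) t :=
      HasDerivAt.fun_sum fun k _ => (hasDerivAt_matrix_exp (-B) i k t).fun_mul (hf t k j)
    have hc : -B * NormedSpace.exp (t • -B) = NormedSpace.exp (t • -B) * -B :=
      ((Commute.refl (-B)).smul_right t).exp_right
    refine h.congr_deriv ?_
    rw [Finset.sum_add_distrib, ← Matrix.mul_apply, ← Matrix.mul_apply, hc, mul_assoc, neg_mul,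
      mul_neg, Matrix.neg_apply, neg_add_cancel]
  have hconst : NormedSpace.exp (-B) * f 1 = 1 := by
    ext i j
    have := is_const_of_deriv_eq_zero (fun t => (key i j t).differentiableAt)
      (fun t => (key i j t).deriv) 1 0
    simpa [h0] using this
  calc f 1 = NormedSpace.exp B * NormedSpace.exp (-B) * f 1 := by rw [exp_mul_exp_neg, one_mul]
    _ = NormedSpace.exp B := by rw [mul_assoc, hconst, mul_one]

end MatrixExp

section CubicLie

variable {A : Type*} [CommRing A]

/-- The derivative of `cubicRep` at the identity. -/
def cubicLie (X : Matrix (Fin 2) (Fin 2) A) : Matrix (Fin 4) (Fin 4) A :=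
  !![3 * X 0 0, 3 * X 0 1, 0, 0;
     X 1 0, 2 * X 0 0 + X 1 1, 2 * X 0 1, 0;
     0, 2 * X 1 0, X 0 0 + 2 * X 1 1, X 0 1;
     0, 0, 3 * X 1 0, 3 * X 1 1]

/-- The derivative of `cubicRep` at `h` in the direction `k`. -/
def cubicRepDeriv (h k : Matrix (Fin 2) (Fin 2) A) : Matrix (Fin 4) (Fin 4) A :=
  !![3 * h 0 0 ^ 2 * k 0 0, 3 * (2 * h 0 0 * k 0 0 * h 0 1 + h 0 0 ^ 2 * k 0 1),
      3 * (k 0 0 * h 0 1 ^ 2 + h 0 0 * (2 * h 0 1 * k 0 1)), 3 * h 0 1 ^ 2 * k 0 1;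
    2 * h 0 0 * k 0 0 * h 1 0 + h 0 0 ^ 2 * k 1 0,
      2 * h 0 0 * k 0 0 * h 1 1 + h 0 0 ^ 2 * k 1 1 +
        2 * (k 0 0 * h 0 1 * h 1 0 + h 0 0 * k 0 1 * h 1 0 + h 0 0 * h 0 1 * k 1 0),
      2 * h 0 1 * k 0 1 * h 1 0 + h 0 1 ^ 2 * k 1 0 +
        2 * (k 0 0 * h 0 1 * h 1 1 + h 0 0 * k 0 1 * h 1 1 + h 0 0 * h 0 1 * k 1 1),
      2 * h 0 1 * k 0 1 * h 1 1 + h 0 1 ^ 2 * k 1 1;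
    k 0 0 * h 1 0 ^ 2 + h 0 0 * (2 * h 1 0 * k 1 0),
      k 0 1 * h 1 0 ^ 2 + h 0 1 * (2 * h 1 0 * k 1 0) +
        2 * (k 0 0 * h 1 0 * h 1 1 + h 0 0 * k 1 0 * h 1 1 + h 0 0 * h 1 0 * k 1 1),
      k 0 0 * h 1 1 ^ 2 + h 0 0 * (2 * h 1 1 * k 1 1) +
        2 * (k 0 1 * h 1 0 * h 1 1 + h 0 1 * k 1 0 * h 1 1 + h 0 1 * h 1 0 * k 1 1),
      k 0 1 * h 1 1 ^ 2 + h 0 1 * (2 * h 1 1 * k 1 1);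
    3 * h 1 0 ^ 2 * k 1 0, 3 * (2 * h 1 0 * k 1 0 * h 1 1 + h 1 0 ^ 2 * k 1 1),
      3 * (k 1 0 * h 1 1 ^ 2 + h 1 0 * (2 * h 1 1 * k 1 1)), 3 * h 1 1 ^ 2 * k 1 1]

theorem cubicRepDeriv_mul_left (X h : Matrix (Fin 2) (Fin 2) A) :
    cubicRepDeriv h (X * h) = cubicLie X * cubicRep h := by
  ext i j
  fin_cases i <;> fin_cases j <;>
    simp [cubicRepDeriv, cubicLie, cubicRep, Matrix.mul_apply, Fin.sum_univ_succ] <;> ring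

theorem cubicRepDeriv_mul_right (h Y : Matrix (Fin 2) (Fin 2) A) :
    cubicRepDeriv h (h * Y) = cubicRep h * cubicLie Y := by
  ext i j
  fin_cases i <;> fin_cases j <;>
    simp [cubicRepDeriv, cubicLie, cubicRep, Matrix.mul_apply, Fin.sum_univ_succ] <;> ring

theorem cubicLie_mul_cubicRep {X Y h : Matrix (Fin 2) (Fin 2) A} (e : h * Y = X * h) :
    cubicRep h * cubicLie Y = cubicLie X * cubicRep h := by
  rw [← cubicRepDeriv_mul_right, e, cubicRepDeriv_mul_left]

theorem hasDerivAt_cubicRep {f : ℝ → Matrix (Fin 2) (Fin 2) ℂ} {k : Matrix (Fin 2) (Fin 2) ℂ}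
    {t : ℝ} (hf : ∀ i j, HasDerivAt (fun u => f u i j) (k i j) t) (i j : Fin 4) :
    HasDerivAt (fun u => cubicRep (f u) i j) (cubicRepDeriv (f t) k i j) t := by
  have h00 := hf 0 0
  have h01 := hf 0 1
  have h10 := hf 1 0
  have h11 := hf 1 1
  fin_cases i <;> fin_cases j
  · exact (h00.fun_pow 3).congr_deriv (by simp [cubicRepDeriv])
  · exact (((h00.fun_pow 2).const_mul 3).fun_mul h01).congr_deriv (by simp [cubicRepDeriv]; ring)
  · exact ((h00.const_mul 3).fun_mul (h01.fun_pow 2)).congr_deriv (by simp [cubicRepDeriv]; ring)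
  · exact (h01.fun_pow 3).congr_deriv (by simp [cubicRepDeriv])
  · exact ((h00.fun_pow 2).fun_mul h10).congr_deriv (by simp [cubicRepDeriv])
  · exact (((h00.fun_pow 2).fun_mul h11).fun_add
      (((h00.const_mul 2).fun_mul h01).fun_mul h10)).congr_deriv (by simp [cubicRepDeriv]; ring)
  · exact (((h01.fun_pow 2).fun_mul h10).fun_add
      (((h00.const_mul 2).fun_mul h01).fun_mul h11)).congr_deriv (by simp [cubicRepDeriv]; ring)
  · exact ((h01.fun_pow 2).fun_mul h11).congr_deriv (by simp [cubicRepDeriv])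
  · exact (h00.fun_mul (h10.fun_pow 2)).congr_deriv (by simp [cubicRepDeriv])
  · exact ((h01.fun_mul (h10.fun_pow 2)).fun_add
      (((h00.const_mul 2).fun_mul h10).fun_mul h11)).congr_deriv (by simp [cubicRepDeriv]; ring)
  · exact ((h00.fun_mul (h11.fun_pow 2)).fun_add
      (((h01.const_mul 2).fun_mul h10).fun_mul h11)).congr_deriv (by simp [cubicRepDeriv]; ring)
  · exact (h01.fun_mul (h11.fun_pow 2)).congr_deriv (by simp [cubicRepDeriv])
  · exact (h10.fun_pow 3).congr_deriv (by simp [cubicRepDeriv])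
  · exact (((h10.fun_pow 2).const_mul 3).fun_mul h11).congr_deriv (by simp [cubicRepDeriv]; ring)
  · exact ((h10.const_mul 3).fun_mul (h11.fun_pow 2)).congr_deriv (by simp [cubicRepDeriv]; ring)
  · exact (h11.fun_pow 3).congr_deriv (by simp [cubicRepDeriv])

/-- A real matrix as a complex matrix. -/
abbrev complexMatrix (X : Matrix (Fin 2) (Fin 2) ℝ) : Matrix (Fin 2) (Fin 2) ℂ :=
  X.map (algebraMap ℝ ℂ)

/-- Along t ↦ tX both sides solve the same linear differential equation with value 1 at t = 0. -/
theorem cubicRep_exp (X : Matrix (Fin 2) (Fin 2) ℝ) :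
    cubicRep (complexMatrix (NormedSpace.exp X)) =
      NormedSpace.exp (cubicLie (complexMatrix X)) := by
  have h := eq_exp_of_hasDerivAt (B := cubicLie (complexMatrix X))
    (f := fun t : ℝ => cubicRep (complexMatrix (NormedSpace.exp (t • X)))) ?_ ?_
  · simpa using h
  · rw [zero_smul, NormedSpace.exp_zero, complexMatrix,
      Matrix.map_one _ (map_zero _) (map_one _), cubicRep_one]
  · intro t i j
    rw [← cubicRepDeriv_mul_left]
    refine hasDerivAt_cubicRep (fun i j => ?_) i j
    rw [complexMatrix, complexMatrix, ← Matrix.map_mul]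
    exact (hasDerivAt_matrix_exp X i j t).ofReal_comp

/-- The derivative of the determinant along the one-parameter group is trace times determinant. -/
theorem det_exp_of_trace_eq_zero {X : Matrix (Fin 2) (Fin 2) ℝ} (hX : X 0 0 + X 1 1 = 0) :
    (NormedSpace.exp X).det = 1 := by
  have key : ∀ t : ℝ, HasDerivAt (fun u : ℝ => (NormedSpace.exp (u • X)).det) 0 t := fun t => by
    simp only [Matrix.det_fin_two]
    have h := fun i j => hasDerivAt_matrix_exp X i j t
    refine (((h 0 0).fun_mul (h 1 1)).fun_sub ((h 0 1).fun_mul (h 1 0))).congr_deriv ?_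
    simp only [Matrix.mul_apply, Fin.sum_univ_two]
    linear_combination (NormedSpace.exp (t • X) 0 0 * NormedSpace.exp (t • X) 1 1 -
      NormedSpace.exp (t • X) 0 1 * NormedSpace.exp (t • X) 1 0) * hX
  have := is_const_of_deriv_eq_zero (fun t => (key t).differentiableAt) (fun t => (key t).deriv) 1 0
  simpa using this

theorem exp_eq_one_add {N : Matrix (Fin 2) (Fin 2) ℝ} (hN : N * N = 0) :
    NormedSpace.exp N = 1 + N := by
  have h := eq_exp_of_hasDerivAt (B := N) (f := fun t : ℝ => 1 + t • N) (by simp) fun t i j => ?_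
  · simpa using h.symm
  · rw [mul_add, mul_one, Matrix.mul_smul, hN, smul_zero, add_zero]
    simpa using ((hasDerivAt_id t).mul_const (N i j)).const_add ((1 : Matrix (Fin 2) (Fin 2) ℝ) i j)

end CubicLie

end

noncomputable section

open scoped ComplexConjugate

/-! ### The Lie algebra in a basis adapted to the Hodge decomposition -/

/-- A general element of `lieGx`. -/
def lieGxElement (x : ℂ) (t : ℝ) (η : ℂ) : Matrix (Fin 4) (Fin 4) ℂ :=
  !![3 * (t * Complex.I), η, 0, 0; conj η, t * Complex.I, x * η, 0;
     0, conj x * conj η, -(t * Complex.I), η; 0, 0, conj η, -3 * (t * Complex.I)]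

theorem mem_lieGx_iff {x : ℂ} {A : Matrix (Fin 4) (Fin 4) ℂ} :
    A ∈ lieGx x ↔ ∃ (t : ℝ) (η : ℂ), A = lieGxElement x t η := by
  rw [lieGx, Submodule.mem_span_triple]
  have key : ∀ a b c : ℝ,
      a • !![3 * Complex.I, 0, 0, 0; 0, Complex.I, 0, 0; 0, 0, -Complex.I, 0;
        0, 0, 0, -3 * Complex.I] +
      b • !![0, 1, 0, 0; 1, 0, x, 0; 0, conj x, 0, 1; 0, 0, 1, 0] +
      c • !![0, Complex.I, 0, 0; -Complex.I, 0, Complex.I * x, 0;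
        0, -Complex.I * conj x, 0, Complex.I; 0, 0, -Complex.I, 0] =
      lieGxElement x a (b + c * Complex.I) := by
    intro a b c
    ext i j
    fin_cases i <;> fin_cases j <;> simp [lieGxElement] <;> ring
  constructor
  · rintro ⟨a, b, c, rfl⟩
    exact ⟨a, b + c * Complex.I, key a b c⟩
  · rintro ⟨t, η, rfl⟩
    refine ⟨t, η.re, η.im, (key _ _ _).trans ?_⟩
    rw [Complex.re_add_im]

/-- A general traceless matrix that is real for the real structure that exchanges the basis
vectors. -/
def su11Element (t : ℝ) (ξ : ℂ) : Matrix (Fin 2) (Fin 2) ℂ :=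
  !![t * Complex.I, ξ; conj ξ, -(t * Complex.I)]

/-- The diagonal matrix of the scaling factors of a basis adapted to the real structure. -/
def scaleMatrix (α β : ℂ) : Matrix (Fin 4) (Fin 4) ℂ := Matrix.diagonal ![α, β, conj β, conj α]

/-- Comparing entries fixes everything: (0,1) gives η = 3ξβ/α, (1,0) then requires |α|² = 3|β|², and
(1,2) requires x = 2β̄α/(3β²). -/
theorem scaleMatrix_mul_lieGxElement {α β x ξ : ℂ} (hα : α * conj α = 3 * (β * conj β))
    (hβ : β ≠ 0) (hx : x * (3 * β ^ 2) = 2 * conj β * α) (t : ℝ) :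
    scaleMatrix α β * lieGxElement x t (3 * ξ * β / α) =
      cubicLie (su11Element t ξ) * scaleMatrix α β := by
  have hβ' : conj β ≠ 0 := (map_ne_zero _).2 hβ
  have hα0 : α ≠ 0 := by
    rintro rfl
    rw [zero_mul, eq_comm, mul_eq_zero, mul_eq_zero] at hα
    simp [hβ] at hα
  have hα' : conj α ≠ 0 := (map_ne_zero _).2 hα0
  have hx2 : x = 2 * conj β * α / (3 * β ^ 2) := by
    field_simp
    linear_combination hx
  have h2 : conj (2 : ℂ) = 2 := map_ofNat _ 2
  have h3 : conj (3 : ℂ) = 3 := map_ofNat _ 3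
  have hcx : conj x = 2 * β * conj α / (3 * conj β ^ 2) := by
    rw [hx2]
    simp [h2, h3]
  ext i j
  rw [scaleMatrix, Matrix.diagonal_mul, Matrix.mul_diagonal]
  fin_cases i <;> fin_cases j <;> simp [lieGxElement, cubicLie, su11Element, h3]
  · ring
  · field_simp
  · field_simp
    linear_combination -conj ξ * hα
  · ring
  · rw [hx2]
    field_simp
  · rw [hcx]
    field_simp
  · ring
  · field_simp
    linear_combination -ξ * hα
  · field_simp
  · ring

/-- The columns of the period matrix are conjugate to each other. Conjugating with it therefore
turns matrices real for the structure exchanging the basis vectors into real matrices; this and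
`exists_su11Element` identify su(1,1) with sl₂(ℝ). -/
theorem exists_periodMatrix_mul_su11Element {τ : ℂ} (hτ : 0 < τ.im) (t : ℝ) (ξ : ℂ) :
    ∃ X : Matrix (Fin 2) (Fin 2) ℝ, X 0 0 + X 1 1 = 0 ∧
      periodMatrix τ * su11Element t ξ = complexMatrix X * periodMatrix τ := by
  set q : ℝ := (t - ξ.im) / τ.im with hq
  set p : ℝ := ξ.re - q * τ.re with hp
  have hqy : q * τ.im = t - ξ.im := div_mul_cancel₀ _ hτ.ne'
  refine ⟨!![p, q; p * τ.re - t * τ.im + ξ.re * τ.re - ξ.im * τ.im, -p], by simp, ?_⟩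
  ext i j
  fin_cases i <;> fin_cases j <;>
    simp [periodMatrix, su11Element, Matrix.mul_apply, Fin.sum_univ_succ] <;>
    apply Complex.ext <;> simp
  · linear_combination -hp
  · linear_combination -hqy
  · linear_combination -hp
  · linear_combination hqy
  · ring
  · linear_combination -τ.re * hqy + τ.im * hp
  · ring
  · linear_combination τ.re * hqy - τ.im * hp

theorem exists_su11Element {τ : ℂ} (hτ : 0 < τ.im) {X : Matrix (Fin 2) (Fin 2) ℝ}
    (hX : X 0 0 + X 1 1 = 0) :
    ∃ (t : ℝ) (ξ : ℂ), periodMatrix τ * su11Element t ξ = complexMatrix X * periodMatrix τ := by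
  set a : ℝ := X 0 0 + X 0 1 * τ.re with ha
  set c : ℝ := (X 0 0 * τ.re + a * τ.re - X 1 0) / τ.im with hc
  have hcy : c * τ.im = X 0 0 * τ.re + a * τ.re - X 1 0 := div_mul_cancel₀ _ hτ.ne'
  refine ⟨(c + X 0 1 * τ.im) / 2, ⟨a, (c - X 0 1 * τ.im) / 2⟩, ?_⟩
  ext i j
  fin_cases i <;> fin_cases j <;>
    simp [periodMatrix, su11Element, Matrix.mul_apply, Fin.sum_univ_succ] <;>
    apply Complex.ext <;> simp
  · linear_combination ha
  · ring
  · linear_combination ha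
  · ring
  · linear_combination -hcy - τ.re * hX
  · linear_combination -τ.im * ha - τ.im * hX
  · linear_combination -hcy - τ.re * hX
  · linear_combination τ.im * ha + τ.im * hX

end

noncomputable section

open scoped ComplexConjugate

/-! ### Comparison with the groups `G_x` -/

/-- Differentiating at t = 0 the reality of the entries, one invariance relation of the form, and
two cone equations along the twisted cubic gives linear conditions on B. Comparing coefficients of z
leaves exactly the symmetric cubes of real traceless matrices. -/
theorem exists_cubicLie_of_exp {B : Matrix (Fin 4) (Fin 4) ℂ}
    (h : ∀ t : ℝ, ∃ k : Matrix (Fin 2) (Fin 2) ℝ, k.det = 1 ∧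
      NormedSpace.exp (t • B) = cubicRep (complexMatrix k)) :
    ∃ X : Matrix (Fin 2) (Fin 2) ℝ, X 0 0 + X 1 1 = 0 ∧ B = cubicLie (complexMatrix X) := by
  have hd : ∀ i j, HasDerivAt (fun u : ℝ => NormedSpace.exp (u • B) i j) (B i j) 0 := fun i j => by
    simpa using hasDerivAt_matrix_exp B i j 0
  have h0 : NormedSpace.exp ((0 : ℝ) • B) = 1 := by rw [zero_smul, NormedSpace.exp_zero]
  have hreal : ∀ i j, (B i j).im = 0 := fun i j => by
    have h1 : HasDerivAt (fun u : ℝ => (NormedSpace.exp (u • B) i j).im) (B i j).im 0 :=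
      Complex.imCLM.hasFDerivAt.comp_hasDerivAt 0 (hd i j)
    have h2 : (fun u : ℝ => (NormedSpace.exp (u • B) i j).im) = fun _ => 0 := by
      ext u
      obtain ⟨k, -, hk⟩ := h u
      rw [hk, complexMatrix, cubicRep_map]
      simp
    rw [h2] at h1
    exact h1.unique (hasDerivAt_const _ _)
  have hv : ∀ (v : Fin 4 → ℂ) (i : Fin 4),
      HasDerivAt (fun u : ℝ => (NormedSpace.exp (u • B)).mulVec v i) (B.mulVec v i) 0 := fun v i => by
    have : HasDerivAt (fun u : ℝ => ∑ j, NormedSpace.exp (u • B) i j * v j) (∑ j, B i j * v j) 0 :=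
      HasDerivAt.fun_sum fun j _ => (hd i j).mul_const (v j)
    exact this
  have hv0 : ∀ v : Fin 4 → ℂ, (NormedSpace.exp ((0 : ℝ) • B)).mulVec v = v := fun v => by
    rw [h0, Matrix.one_mulVec]
  have hform : B 0 0 + B 3 3 = 0 := by
    have h1 := ((((hd 0 0).fun_mul (hd 3 3)).fun_sub
      (((hd 1 0).const_mul 3).fun_mul (hd 2 3))).fun_add
      (((hd 2 0).const_mul 3).fun_mul (hd 1 3))).fun_sub ((hd 3 0).fun_mul (hd 0 3))
    have h2 : (fun u : ℝ => NormedSpace.exp (u • B) 0 0 * NormedSpace.exp (u • B) 3 3 -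
        3 * NormedSpace.exp (u • B) 1 0 * NormedSpace.exp (u • B) 2 3 +
        3 * NormedSpace.exp (u • B) 2 0 * NormedSpace.exp (u • B) 1 3 -
        NormedSpace.exp (u • B) 3 0 * NormedSpace.exp (u • B) 0 3) = fun _ => 1 := by
      ext u
      obtain ⟨k, hk1, hk⟩ := h u
      have h3 := cubicForm_cubicRep (complexMatrix k) (Pi.single 0 1) (Pi.single 3 1)
      have hdet : (complexMatrix k).det = 1 := by
        rw [complexMatrix, ← RingHom.mapMatrix_apply, ← RingHom.map_det, hk1, map_one]
      rw [← hk, hdet, Matrix.mulVec_single_one, Matrix.mulVec_single_one] at h3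
      simpa [cubicForm] using h3
    rw [h2, h0] at h1
    have := h1.unique (hasDerivAt_const _ _)
    simpa using this
  have hcone : ∀ (z : ℂ) (u : ℝ),
      IsOnCone ((NormedSpace.exp (u • B)).mulVec (veronese 1 z)) := fun z u => by
    obtain ⟨k, -, hk⟩ := h u
    rw [hk, cubicRep_mulVec_veronese]
    exact isOnCone_veronese _ _
  have hc1 : ∀ᶠ z in 𝓝 (0 : ℂ), B 2 0 + (B 2 1 - 2 * B 1 0) * z +
      (B 0 0 + B 2 2 - 2 * B 1 1) * z ^ 2 + (B 0 1 + B 2 3 - 2 * B 1 2) * z ^ 3 +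
      (B 0 2 - 2 * B 1 3) * z ^ 4 + B 0 3 * z ^ 5 = 0 := by
    refine Filter.Eventually.of_forall fun z => ?_
    have h1 := ((hv (veronese 1 z) 0).fun_mul (hv (veronese 1 z) 2)).fun_sub
      ((hv (veronese 1 z) 1).fun_pow 2)
    rw [hv0] at h1
    have := h1.unique ((hasDerivAt_const (0 : ℝ) (0 : ℂ)).congr_of_eventuallyEq
      (Filter.Eventually.of_forall fun u => (hcone z u).1))
    simp only [mulVec_fin_four] at this
    simp [veronese] at this
    linear_combination this
  -- The linearized second equation is divisible by z; the factor is cancelled away from 0, hence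
  -- the base point 1.
  have hc2 : ∀ᶠ z in 𝓝 (1 : ℂ), B 3 0 + (B 3 1 - 2 * B 2 0) * z +
      (B 1 0 + B 3 2 - 2 * B 2 1) * z ^ 2 + (B 1 1 + B 3 3 - 2 * B 2 2) * z ^ 3 +
      (B 1 2 - 2 * B 2 3) * z ^ 4 + B 1 3 * z ^ 5 = 0 := by
    filter_upwards [isOpen_ne.mem_nhds (one_ne_zero : (1 : ℂ) ≠ 0)] with z hz
    have h1 := ((hv (veronese 1 z) 1).fun_mul (hv (veronese 1 z) 3)).fun_sub
      ((hv (veronese 1 z) 2).fun_pow 2)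
    rw [hv0] at h1
    have := h1.unique ((hasDerivAt_const (0 : ℝ) (0 : ℂ)).congr_of_eventuallyEq
      (Filter.Eventually.of_forall fun u => (hcone z u).2.1))
    simp only [mulVec_fin_four] at this
    simp [veronese] at this
    refine mul_left_cancel₀ hz ?_
    linear_combination this
  obtain ⟨a0, a1, a2, a3, a4, a5⟩ := coeffs_eq_zero_of_eventually hc1
  obtain ⟨b0, b1, b2, b3, b4, b5⟩ := coeffs_eq_zero_of_eventually hc2
  have hre : ∀ i j, (((B i j).re : ℝ) : ℂ) = B i j := fun i j =>
    Complex.ext rfl (by simp [hreal i j])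
  refine ⟨!![(B 0 0).re / 3, (B 0 1).re / 3; (B 1 0).re, (B 3 3).re / 3], ?_, ?_⟩
  · have := congrArg Complex.re hform
    simp at this ⊢
    linarith
  · ext i j
    fin_cases i <;> fin_cases j <;> simp [cubicLie, hre]
    · ring
    · ring
    · linear_combination a4 + 2 * b5
    · exact a5
    · linear_combination -(2 * a2 + b3) / 3
    · linear_combination -(2 * a3 + b4) / 3
    · exact b5
    · exact a0
    · linear_combination a1
    · linear_combination -(a2 + 2 * b3) / 3
    · linear_combination -(a3 + 2 * b4) / 3
    · exact b0
    · linear_combination b1 + 2 * a0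
    · linear_combination b2 + 2 * a1
    · ring

open Polynomial in
/-- A polynomial family of group elements that lies in a real algebraic subgroup for real
parameters lies in it for all parameters. -/
theorem IsAlgebraicSubgroup.mem_of_forall_real {V : Type} [AddCommGroup V] [Module ℚ V]
    {ι : Type} [Fintype ι] [DecidableEq ι] (b : Module.Basis ι ℚ V) {H : Subgroup (GLC V)}
    (hH : IsAlgebraicSubgroup ℝ H) {g : ℂ → GLC V} {h : Matrix ι ι ℂ[X]}
    (hg : ∀ z, glMatrix b (g z) = h.map (Polynomial.eval z)) (hreal : ∀ x : ℝ, g x ∈ H) (z : ℂ) :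
    g z ∈ H := by
  obtain ⟨S, hS⟩ := hH
  rw [hS]
  intro P hP
  set p : ℂ[X] := MvPolynomial.aeval (fun vφ : V × Module.Dual ℚ V =>
    ∑ i, ∑ j, C ((vφ.2 (b i) : ℂ) * (b.repr vφ.1 j : ℂ)) * h i j) P with hp
  have heval : ∀ w, p.eval w = MvPolynomial.aeval (matrixCoeff (g w)) P := by
    intro w
    have h1 : p.eval w = ((Polynomial.aeval w).restrictScalars ℝ) p := by
      rw [AlgHom.restrictScalars_apply, Polynomial.coe_aeval_eq_eval]
    rw [h1, hp, ← AlgHom.comp_apply, MvPolynomial.comp_aeval]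
    congr 2
    ext ⟨v, φ⟩
    rw [matrixCoeff_eq_sum b, hg, AlgHom.restrictScalars_apply, Polynomial.coe_aeval_eq_eval]
    simp [Polynomial.eval_finsetSum]
  have hp0 : p = 0 := by
    refine Polynomial.eq_zero_of_infinite_isRoot _
      ((Set.infinite_range_of_injective Complex.ofReal_injective).mono ?_)
    rintro _ ⟨x, rfl⟩
    exact (heval x).trans ((hS _).1 (hreal x) P hP)
  rw [← heval, hp0, eval_zero]

end

noncomputable section

open scoped ComplexConjugate

section NormalizedBasis

variable {V : Type} [AddCommGroup V] [Module ℚ V] {b : Module.Basis (Fin 4) ℚ V} {c : ℚ}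
  {Q : LinearMap.BilinForm ℚ V} {τ : ℂ} {F : ℤ → Submodule ℂ (ℂ ⊗[ℚ] V)}

/-- The Hodge basis is rescaled by positive reals with κα² = 1 and 3κβ² = 1, where κ = −8c(Im τ)³ >
0. -/
theorem IsCubicForm.exists_isNormalizedBasis (hQ : IsCubicForm b c Q) (hc : c < 0)
    (hF : IsCubicFiltration b τ F) (hτ : 0 < τ.im) : ∃ v, IsNormalizedBasis F Q v := by
  have hκ : 0 < -(c : ℝ) * (8 * τ.im ^ 3) := by
    have : (0 : ℝ) < -c := by exact_mod_cast neg_pos.2 hc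
    positivity
  set κ : ℝ := -(c : ℝ) * (8 * τ.im ^ 3) with hκdef
  have hκC : (κ : ℂ) = -c * (8 * τ.im ^ 3) := by
    rw [hκdef]
    push_cast
    ring
  obtain ⟨α, hα, hα1⟩ : ∃ α : ℝ, 0 < α ∧ κ * (α * α) = 1 :=
    ⟨√κ⁻¹, Real.sqrt_pos.2 (inv_pos.2 hκ), by
      rw [Real.mul_self_sqrt (inv_pos.2 hκ).le, mul_inv_cancel₀ hκ.ne']⟩
  obtain ⟨β, hβ, hβ1⟩ : ∃ β : ℝ, 0 < β ∧ 3 * κ * (β * β) = 1 :=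
    ⟨√(3 * κ)⁻¹, Real.sqrt_pos.2 (by positivity), by
      rw [Real.mul_self_sqrt (by positivity), mul_inv_cancel₀ (by positivity)]⟩
  have hα1C : (κ : ℂ) * (α * α) = 1 := by exact_mod_cast hα1
  have hβ1C : 3 * (κ : ℂ) * (β * β) = 1 := by exact_mod_cast hβ1
  rw [hκC] at hα1C hβ1C
  have hd : ∀ k, IsUnit ((![α, β, β, α] : Fin 4 → ℂ) k) := fun k => by
    refine IsUnit.mk0 _ ?_
    fin_cases k <;> simp [hα.ne', hβ.ne']
  have hpiece : ∀ k : Fin 4, hodgeBasis b hτ k ∈ hodgePiece 3 F (3 - (k : ℤ)) := fun k => by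
    rw [hF.hodgePiece_eq_span hτ]
    exact Submodule.mem_span_singleton_self _
  have hI := Complex.I_mul_I
  refine ⟨(hodgeBasis b hτ).isUnitSMul hd, ?_, ?_, ?_, ?_, ?_, ?_⟩ <;>
    simp only [Module.Basis.isUnitSMul_apply]
  · exact Submodule.smul_mem _ _ (hpiece 0)
  · exact Submodule.smul_mem _ _ (hpiece 1)
  · rw [complexConj_smul, complexConj_hodgeBasis]
    simp
  · rw [complexConj_smul, complexConj_hodgeBasis]
    simp
  · rw [hQ.baseChange_hodgeBasis hτ]
    simp [cubicForm, -Complex.coe_smul]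
    linear_combination hα1C + (8 * c * τ.im ^ 3 * α * α : ℂ) * hI
  · rw [hQ.baseChange_hodgeBasis hτ]
    simp [cubicForm, -Complex.coe_smul]
    linear_combination hβ1C + (24 * c * τ.im ^ 3 * β * β : ℂ) * hI

/-- A normalized basis is a rescaling of the basis given by a generator of the line. -/
theorem IsCubicForm.exists_scale (hQ : IsCubicForm b c Q) (hF : IsCubicFiltration b τ F)
    (hτ : 0 < τ.im) {v : Module.Basis (Fin 4) ℂ (ℂ ⊗[ℚ] V)} (hv : IsNormalizedBasis F Q v) :
    ∃ α β : ℂ, β ≠ 0 ∧ α * conj α = 3 * (β * conj β) ∧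
      ∀ k, v k = (![α, β, conj β, conj α] : Fin 4 → ℂ) k • hodgeBasis b hτ k := by
  obtain ⟨h0, h1, h3, h2, hq0, hq1⟩ := hv
  rw [show (3 : ℤ) = 3 - ((0 : Fin 4) : ℤ) from rfl, hF.hodgePiece_eq_span hτ] at h0
  rw [show (2 : ℤ) = 3 - ((1 : Fin 4) : ℤ) from rfl, hF.hodgePiece_eq_span hτ] at h1
  obtain ⟨α, hα⟩ := Submodule.mem_span_singleton.1 h0
  obtain ⟨β, hβ⟩ := Submodule.mem_span_singleton.1 h1
  have h3 : v 3 = conj α • hodgeBasis b hτ 3 := by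
    rw [← h3, ← hα, complexConj_smul, complexConj_hodgeBasis]
    rfl
  have h2 : v 2 = conj β • hodgeBasis b hτ 2 := by
    rw [← h2, ← hβ, complexConj_smul, complexConj_hodgeBasis]
    rfl
  rw [h3, ← hα, hQ.baseChange_hodgeBasis hτ] at hq0
  rw [h2, ← hβ, hQ.baseChange_hodgeBasis hτ] at hq1
  simp [cubicForm] at hq0 hq1
  refine ⟨α, β, ?_, ?_, fun k => ?_⟩
  · rintro rfl
    simp at hq1
  · have hne : (8 * c * τ.im ^ 3 * Complex.I * Complex.I : ℂ) ≠ 0 := by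
      intro h
      refine zero_ne_one (α := ℂ) ?_
      rw [← hq0]
      linear_combination -(α * conj α) * h
    refine mul_left_cancel₀ hne ?_
    linear_combination hq0 - hq1
  · fin_cases k
    · exact hα.symm
    · exact hβ.symm
    · exact h2
    · exact h3

end NormalizedBasis

section GroupGx

variable {V : Type} [AddCommGroup V] [Module ℚ V] {b : Module.Basis (Fin 4) ℚ V} {τ α β x : ℂ}
  {v : Module.Basis (Fin 4) ℂ (ℂ ⊗[ℚ] V)} {T : Matrix (Fin 4) (Fin 4) ℂ}

/-- The scaling part of T carries `lieGx x` to the symmetric cube of su(1,1), and the period matrix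
carries that to the symmetric cube of sl₂(ℝ). -/
theorem mem_lieGx_iff_exists_cubicLie (hτ : 0 < τ.im) (hα : α * conj α = 3 * (β * conj β))
    (hβ : β ≠ 0) (hx : x * (3 * β ^ 2) = 2 * conj β * α)
    (hT : T = cubicRep (periodMatrix τ) * scaleMatrix α β) (hu : IsUnit T)
    {A : Matrix (Fin 4) (Fin 4) ℂ} :
    A ∈ lieGx x ↔ ∃ X : Matrix (Fin 2) (Fin 2) ℝ, X 0 0 + X 1 1 = 0 ∧
      T * A = cubicLie (complexMatrix X) * T := by
  have hα0 : α ≠ 0 := by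
    rintro rfl
    rw [zero_mul, eq_comm, mul_eq_zero, mul_eq_zero] at hα
    simp [hβ] at hα
  have key : ∀ {t ξ} {X : Matrix (Fin 2) (Fin 2) ℝ},
      periodMatrix τ * su11Element t ξ = complexMatrix X * periodMatrix τ →
      T * lieGxElement x t (3 * ξ * β / α) = cubicLie (complexMatrix X) * T := fun {t ξ X} h => by
    rw [hT, mul_assoc, scaleMatrix_mul_lieGxElement hα hβ hx, ← mul_assoc,
      cubicLie_mul_cubicRep h, mul_assoc]
  rw [mem_lieGx_iff]
  constructor
  · rintro ⟨t, η, rfl⟩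
    obtain ⟨X, hX, h⟩ := exists_periodMatrix_mul_su11Element hτ t (η * α / (3 * β))
    refine ⟨X, hX, ?_⟩
    rw [← key h]
    congr 2
    field_simp
  · rintro ⟨X, hX, h⟩
    obtain ⟨t, ξ, h'⟩ := exists_su11Element hτ hX
    exact ⟨t, _, hu.mul_left_cancel (h.trans (key h').symm)⟩

theorem exp_mul_eq_mul_exp {T A B : Matrix (Fin 4) (Fin 4) ℂ} (hu : IsUnit T) (h : T * A = B * T) :
    T * NormedSpace.exp A = NormedSpace.exp B * T := by
  have hdet := (Matrix.isUnit_iff_isUnit_det T).1 hu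
  have : B = T * A * T⁻¹ := by
    rw [h, mul_assoc, Matrix.mul_nonsing_inv _ hdet, mul_one]
  rw [this, Matrix.exp_conj _ _ hu, mul_assoc _ T⁻¹, Matrix.nonsing_inv_mul _ hdet, mul_one]

variable (b v) in
theorem glMatrix_mul_toMatrix (g : GLC V) :
    glMatrix b g * (complexBasis b).toMatrix v =
      (complexBasis b).toMatrix v * LinearMap.toMatrix v v g.toLinearMap := by
  rw [glMatrix, linearMap_toMatrix_mul_basis_toMatrix, basis_toMatrix_mul_linearMap_toMatrix]

variable (b v) in
theorem isUnit_toMatrix : IsUnit ((complexBasis b).toMatrix v) := by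
  have := (complexBasis b).invertibleToMatrix v
  exact isUnit_of_invertible _

theorem toMatrix_eq_exp_iff (hT : T = (complexBasis b).toMatrix v)
    {A : Matrix (Fin 4) (Fin 4) ℂ} {X : Matrix (Fin 2) (Fin 2) ℝ} (hX : X 0 0 + X 1 1 = 0)
    (h : T * A = cubicLie (complexMatrix X) * T) (g : GLC V) :
    LinearMap.toMatrix v v g.toLinearMap = NormedSpace.exp A ↔
      g = cubicHom b (slComplex ⟨NormedSpace.exp X, det_exp_of_trace_eq_zero hX⟩) := by
  have hu : IsUnit T := hT ▸ isUnit_toMatrix b v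
  have he := exp_mul_eq_mul_exp hu h
  have hg := glMatrix_mul_toMatrix b v g
  rw [← hT] at hg
  rw [← (glMatrix_injective b).eq_iff, glMatrix_cubicHom]
  change _ ↔ glMatrix b g = cubicRep (complexMatrix (NormedSpace.exp X))
  rw [cubicRep_exp]
  constructor
  · intro h1
    refine hu.mul_right_cancel ?_
    rw [hg, h1, he]
  · intro h1
    refine hu.mul_left_cancel ?_
    rw [← hg, h1, he]

-- Exponentials of symmetric cubes of traceless matrices lie in the image of `SL₂`. Conversely, real
-- unipotents are such exponentials and depend polynomially on their parameter, so a real algebraic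
-- group containing them contains the complex ones, which generate.
open Polynomial in
theorem groupGx_eq_cubicGroup (hT : T = (complexBasis b).toMatrix v)
    (hlie : ∀ A, A ∈ lieGx x ↔ ∃ X : Matrix (Fin 2) (Fin 2) ℝ, X 0 0 + X 1 1 = 0 ∧
      T * A = cubicLie (complexMatrix X) * T) : groupGx v x = cubicGroup b := by
  have hu : IsUnit T := hT ▸ isUnit_toMatrix b v
  have hdet := (Matrix.isUnit_iff_isUnit_det T).1 hu
  refine le_antisymm (sInf_le ⟨(isAlgebraicSubgroup_cubicGroup b).of_rat, fun A hA g hg => ?_⟩)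
    (le_sInf ?_)
  · obtain ⟨X, hX, h⟩ := (hlie A).1 hA
    rw [(toMatrix_eq_exp_iff hT hX h g).1 hg]
    exact ⟨_, rfl⟩
  · rintro H ⟨hH, hexp⟩
    have hmem : ∀ (X : Matrix (Fin 2) (Fin 2) ℝ) (hX : X 0 0 + X 1 1 = 0),
        cubicHom b (slComplex ⟨NormedSpace.exp X, det_exp_of_trace_eq_zero hX⟩) ∈ H := by
      intro X hX
      have h : T * (T⁻¹ * (cubicLie (complexMatrix X) * T)) = cubicLie (complexMatrix X) * T := by
        rw [← mul_assoc, Matrix.mul_nonsing_inv _ hdet, one_mul]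
      exact hexp _ ((hlie _).2 ⟨X, hX, h⟩) _ ((toMatrix_eq_exp_iff hT hX h _).2 rfl)
    have hupper : ∀ z, cubicHom b (upperUnipotent z) ∈ H := by
      refine hH.mem_of_forall_real b (h := cubicRep !![1, X; 0, 1]) (fun z => ?_) fun y => ?_
      · rw [glMatrix_cubicHom, coe_upperUnipotent, ← Polynomial.coe_evalRingHom, ← cubicRep_map]
        congr 1
        ext i j
        fin_cases i <;> fin_cases j <;> simp
      · have hX : (!![0, y; 0, 0] : Matrix (Fin 2) (Fin 2) ℝ) 0 0 +
          (!![0, y; 0, 0] : Matrix (Fin 2) (Fin 2) ℝ) 1 1 = 0 := by simp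
        convert hmem !![0, y; 0, 0] hX using 2
        have he : NormedSpace.exp (!![0, y; 0, 0] : Matrix (Fin 2) (Fin 2) ℝ) = !![1, y; 0, 1] := by
          rw [exp_eq_one_add]
          · ext i j
            fin_cases i <;> fin_cases j <;> simp
          · ext i j
            fin_cases i <;> fin_cases j <;> simp
        refine Subtype.ext ?_
        change !![1, (y : ℂ); 0, 1] = complexMatrix (NormedSpace.exp !![0, y; 0, 0])
        rw [he]
        ext i j
        fin_cases i <;> fin_cases j <;> simp
    have hlower : ∀ z, cubicHom b (lowerUnipotent z) ∈ H := by
      refine hH.mem_of_forall_real b (h := cubicRep !![1, 0; X, 1]) (fun z => ?_) fun y => ?_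
      · rw [glMatrix_cubicHom, coe_lowerUnipotent, ← Polynomial.coe_evalRingHom, ← cubicRep_map]
        congr 1
        ext i j
        fin_cases i <;> fin_cases j <;> simp
      · have hX : (!![0, 0; y, 0] : Matrix (Fin 2) (Fin 2) ℝ) 0 0 +
          (!![0, 0; y, 0] : Matrix (Fin 2) (Fin 2) ℝ) 1 1 = 0 := by simp
        convert hmem !![0, 0; y, 0] hX using 2
        have he : NormedSpace.exp (!![0, 0; y, 0] : Matrix (Fin 2) (Fin 2) ℝ) = !![1, 0; y, 1] := by
          rw [exp_eq_one_add]
          · ext i j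
            fin_cases i <;> fin_cases j <;> simp
          · ext i j
            fin_cases i <;> fin_cases j <;> simp
        refine Subtype.ext ?_
        change !![1, 0; (y : ℂ), 1] = complexMatrix (NormedSpace.exp !![0, 0; y, 0])
        rw [he]
        ext i j
        fin_cases i <;> fin_cases j <;> simp
    rintro _ ⟨h, rfl⟩
    obtain ⟨p, q, r, s, rfl⟩ := exists_eq_mul_unipotent h
    rw [map_mul, map_mul, map_mul]
    exact H.mul_mem (H.mul_mem (H.mul_mem (hupper _) (hlower _)) (hupper _)) (hlower _)

theorem lieRealPoints_cubicGroup (hT : T = (complexBasis b).toMatrix v)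
    (hlie : ∀ A, A ∈ lieGx x ↔ ∃ X : Matrix (Fin 2) (Fin 2) ℝ, X 0 0 + X 1 1 = 0 ∧
      T * A = cubicLie (complexMatrix X) * T) :
    lieRealPoints v (cubicGroup b) = (lieGx x : Set (Matrix (Fin 4) (Fin 4) ℂ)) := by
  have hu : IsUnit T := hT ▸ isUnit_toMatrix b v
  have hdet := (Matrix.isUnit_iff_isUnit_det T).1 hu
  ext A
  constructor
  · intro hA
    have hB : T * A = T * A * T⁻¹ * T := by
      rw [mul_assoc _ T⁻¹, Matrix.nonsing_inv_mul _ hdet, mul_one]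
    obtain ⟨X, hX, h⟩ := exists_cubicLie_of_exp (B := T * A * T⁻¹) fun t => by
      obtain ⟨g, hg, hgA⟩ := hA t
      obtain ⟨k, rfl⟩ := (mem_realPoints_cubicGroup_iff b).1 hg
      refine ⟨k.1, k.2, ?_⟩
      have h1 : T * (t • A) = (t • (T * A * T⁻¹)) * T := by
        rw [Matrix.mul_smul, Matrix.smul_mul, ← hB]
      have h2 := exp_mul_eq_mul_exp hu h1
      have h3 := glMatrix_mul_toMatrix b v (cubicHom b (slComplex k))
      rw [← hT, hgA, h2, glMatrix_cubicHom] at h3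
      exact (hu.mul_right_cancel h3).symm
    exact (hlie A).2 ⟨X, hX, by rw [← h, ← hB]⟩
  · intro hA t
    obtain ⟨X, hX, h⟩ := (hlie (t • A)).1 (Submodule.smul_mem _ t hA)
    exact ⟨_, (mem_realPoints_cubicGroup_iff b).2 ⟨_, rfl⟩,
      (toMatrix_eq_exp_iff hT hX h _).2 rfl⟩

end GroupGx

theorem IsCubicForm.exists_groupGx {V : Type} [AddCommGroup V] [Module ℚ V]
    {b : Module.Basis (Fin 4) ℚ V} {c : ℚ} {Q : LinearMap.BilinForm ℚ V} {τ : ℂ}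
    {F : ℤ → Submodule ℂ (ℂ ⊗[ℚ] V)} (hQ : IsCubicForm b c Q) (hF : IsCubicFiltration b τ F)
    (hτ : 0 < τ.im) {v : Module.Basis (Fin 4) ℂ (ℂ ⊗[ℚ] V)} (hv : IsNormalizedBasis F Q v) :
    ∃ x : ℂ, ‖x‖ = 2 / √3 ∧ cubicGroup b = groupGx v x ∧
      lieRealPoints v (cubicGroup b) = (lieGx x : Set (Matrix (Fin 4) (Fin 4) ℂ)) := by
  obtain ⟨α, β, hβ, hα, hk⟩ := hQ.exists_scale hF hτ hv
  set T := (complexBasis b).toMatrix v with hT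
  have hT' : T = cubicRep (periodMatrix τ) * scaleMatrix α β := by
    ext i k
    rw [scaleMatrix, Matrix.mul_diagonal, ← complexCoords_hodgeBasis b hτ, hT,
      Module.Basis.toMatrix_apply, hk, map_smul, mul_comm]
    rfl
  have hlie := fun A => mem_lieGx_iff_exists_cubicLie (A := A)
    (x := 2 * conj β * α / (3 * β ^ 2)) hτ hα hβ (by field_simp) hT' (hT ▸ isUnit_toMatrix b v)
  refine ⟨_, ?_, (groupGx_eq_cubicGroup hT hlie).symm, lieRealPoints_cubicGroup hT hlie⟩
  -- With x = 2β̄α/(3β²) this gives |x| = 2√3/3 = 2/√3.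
  have hnorm : ‖α‖ = √3 * ‖β‖ := by
    have h1 := congrArg norm hα
    simp only [norm_mul, RCLike.norm_conj, Complex.norm_ofNat] at h1
    rw [← Real.sqrt_mul_self (norm_nonneg α), h1, Real.sqrt_mul (by norm_num),
      Real.sqrt_mul_self (norm_nonneg β)]
  have hβn : ‖β‖ ≠ 0 := norm_ne_zero_iff.2 hβ
  have h3 : √(3 : ℝ) * √3 = 3 := Real.mul_self_sqrt (by norm_num)
  have h3' : √(3 : ℝ) ≠ 0 := by positivity
  simp only [norm_div, norm_mul, norm_pow, RCLike.norm_conj, Complex.norm_ofNat]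
  rw [hnorm]
  field_simp
  linear_combination h3

end

/-! ### Conclusions for variations of elliptic type. -/

noncomputable section

/-- The third symmetric power of a variation of elliptic type is of third type. -/
theorem VHSData.EllipticStructure.isThirdType {M : Set ℂ} {W : VHSData M}
    (S : W.EllipticStructure) (hM : IsOpen M) : (symPower 3 W).IsThirdType := by
  refine ⟨S.isCalabiYauLike hM, fun m p hp => S.hasCubicFrames.finrank_hodgePiece m hp,
    fun m₀ => ?_⟩
  obtain ⟨b, -, -, -, hG, -⟩ := S.isGenericHodgeGroup_iff hM m₀
  exact ⟨cubicGroup b, (hG _).2 rfl, discreteTopology_centerSet_cubicGroup b,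
    hasDomainUnitDisc_cubicGroup b⟩

/-- The polarization is c times the invariant form, and its positivity on the cube of (1, τ) forces
c < 0, as the construction of a normalized basis requires. -/
theorem VHSData.EllipticStructure.exists_groupGx {M : Set ℂ} {W : VHSData M}
    (S : W.EllipticStructure) (hM : IsOpen M)
    {Q : ∀ m, LinearMap.BilinForm ℚ ((symPower 3 W).Fiber m)} (hQ : (symPower 3 W).IsPolarization Q)
    {m : M} {G : Subgroup (GLC ((symPower 3 W).Fiber m))}
    (hG : (symPower 3 W).IsGenericHodgeGroup m G) :
    (∃ v, IsNormalizedBasis ((symPower 3 W).F m) (Q m) v) ∧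
      ∀ v, IsNormalizedBasis ((symPower 3 W).F m) (Q m) v →
        ∃ x : ℂ, ‖x‖ = 2 / √3 ∧
          G = groupGx v x ∧ lieRealPoints v G = (lieGx x : Set (Matrix (Fin 4) (Fin 4) ℂ)) := by
  obtain ⟨b, τ, hτ, hF, hiff, hform⟩ := S.isGenericHodgeGroup_iff hM m
  obtain ⟨c, hc⟩ := hform Q hQ
  obtain rfl := (hiff G).1 hG
  refine ⟨hc.exists_isNormalizedBasis ?_ hF hτ, fun v hv => hc.exists_groupGx hF hτ hv⟩
  have hmem : hodgeBasis b hτ 0 ∈ hodgePiece 3 ((symPower 3 W).F m) 3 := by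
    rw [show (3 : ℤ) = 3 - ((0 : Fin 4) : ℤ) from rfl, hF.hodgePiece_eq_span hτ]
    exact Submodule.mem_span_singleton_self _
  obtain ⟨r, hr, h⟩ := hQ.positive m 3 (hodgeBasis b hτ 0) (by rwa [S.weight_symPower])
    ((hodgeBasis b hτ).ne_zero 0)
  rw [S.weight_symPower] at h
  have h1 := hc.positive_hodgeBasis hτ 0 1
  rw [one_smul] at h1
  have h2 : r = -(c : ℝ) * (8 * τ.im ^ 3) := by
    have := h.symm.trans h1
    simpa using Complex.ofReal_injective this
  have h3 : 0 < 8 * τ.im ^ 3 := by positivity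
  have h4 : (0 : ℝ) < -c := by
    by_contra hcon
    exact absurd (h2 ▸ hr) (not_lt.2 (mul_nonpos_of_nonpos_of_nonneg (not_lt.1 hcon) h3.le))
  exact neg_pos.1 (by exact_mod_cast h4)

end

theorem mainTheorem10 :
    (VHSData.symPower 3 legendreH1).IsThirdType ∧
    ∀ Q : (∀ m, LinearMap.BilinForm ℚ ((VHSData.symPower 3 legendreH1).Fiber m)),
      (VHSData.symPower 3 legendreH1).IsPolarization Q →
      ∀ (m : legendreBase) (G : Subgroup (GLC ((VHSData.symPower 3 legendreH1).Fiber m))),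
        (VHSData.symPower 3 legendreH1).IsGenericHodgeGroup m G →
        (∃ v, IsNormalizedBasis ((VHSData.symPower 3 legendreH1).F m) (Q m) v) ∧
        ∀ v, IsNormalizedBasis ((VHSData.symPower 3 legendreH1).F m) (Q m) v →
          ∃ x : ℂ, ‖x‖ = 2 / √3 ∧
            G = groupGx v x ∧ lieRealPoints v G = (lieGx x : Set (Matrix (Fin 4) (Fin 4) ℂ)) := by
  have hM : IsOpen legendreBase := isOpen_ne.inter isOpen_ne
  exact ⟨legendreH1EllipticStructure.isThirdType hM, fun Q hQ m G hG =>
    legendreH1EllipticStructure.exists_groupGx hM hQ hG⟩
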